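/- Let $k$ be a field and $Q$ a finite quiver with vertex set $Q_0$, arrow set $Q_1$, tail and head maps $t,h$; paths are composed from left to right. Let $\overline Q$ be the doubled quiver, with a reverse arrow $a^*$ for each $a\in Q_1$ ($a^{**}=a$), and $\epsilon(a)=1$, $\epsilon(a^*)=-1$ for $a\in Q_1$. Fix a total order on $\overline Q_1$ and $q\in(k^\times)^{Q_0}\subset kQ_0$. Let $L_Q=k\overline Q[(1+aa^*)^{-1}]_{a\in\overline Q_1}$, $x_a=1+aa^*$, $\rho=\prod_{a\in\overline Q_1}x_a^{\epsilon(a)}$ (increasing order), $r=\rho-q$, $r'=(q+r)^{-1}-q^{-1}=\rho^{-1}-q^{-1}$ and $\Lambda^q(Q)=L_Q/(r)$. For $W\subseteq Q_0$ let $\Lambda^q(Q,W)=L_Q/(1_{\mathcal B}\,r\,1_{\mathcal B})$, where $\mathcal B=Q_0\setminus W$ and $1_{\mathcal B}=\sum_{i\in\mathcal B}e_i$. Put $B=kQ_0[t,(q+t)^{-1}]$. Assume that $Q$ is connected and contains an unoriented cycle $Q_E$ of length $n\ge 1$ (loops and pairs of arrows joining the same two vertices are allowed), with vertices $v_i$ and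 arrows $c_i$ joining $v_i$ and $v_{i+1}$, $i\in\mathbb Z/n$. Let $W$ be the vertex set of $Q_E$ and $Q'$ the quiver with vertex set $Q_0$ and arrow set $Q_1\setminus (Q_E)_1$. Let $q_E,q'$ be given by $q$, give the doubles of $Q_E$ and $Q'$ the induced orders, and regard $\Lambda^{q_E}(Q_E)$ as a $kQ_0$-algebra by adding a factor $ke_i$ for each vertex $i\notin W$. (1) There is a $kQ_0$-bimodule section $\sigma$ of $L_Q\to\Lambda^q(Q)$ with $\sigma(1)=1$ such that $(L_Q,r,\sigma,B)$ has the strong free product property: $kQ_0[t]\to L_Q$, $t\mapsto r$, extends to an algebra map $\tau:B\to L_Q$, and $$\sigma':\Lambda^q(Q)*_{kQ_0}B\to L_Q,\qquad a_0b_1a_1\cdots b_ma_m\mapsto\sigma(a_0)\tau(b_1)\sigma(a_1)\cdots\tau(b_m)\sigma(a_m)\quad(a_i\in\Lambda^q(Q),\ b_i\in tB)$$ is a well-defined linear isomorphism. (2) $\Lambda^q(Q)$ is linearly the free product $\Lambda^{q_E}(Q_E)*_{kQ_0}\Lambda^{q'}(Q',W)$: there are $kQ_0$-bimodule complements $M$,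 $N$ of $kQ_0$ in $\Lambda^{q_E}(Q_E)$ and in $\Lambda^{q'}(Q',W)$, and a $kQ_0$-bimodule isomorphism $\Psi:\Lambda^{q_E}(Q_E)*_{kQ_0}\Lambda^{q'}(Q',W)\to\Lambda^q(Q)$ with $\Psi(1)=1$ that sends each alternating product of elements of $M$ and $N$ to the product of the images of its factors. (3) $L_Q$ is a free left $kQ_0$-module. (4) Assume moreover the following normalization: $c_i$ goes from $v_i$ to $v_{i+1}$ for all $i$; in the order on $\overline Q_1$ all $c_i$ precede all $c_j^*$, and these precede all other arrows; and $F\subseteq Q'_1$ is the arrow set of a spanning forest of $Q'$ rooted in $W$ with all arrows directed towards the roots. Let $a=\sum_i c_i$, $a^*=\sum_i c_i^*$, $x=1+aa^*$, and $\overline{x_b^{\pm}}=x_b^{\pm1}-1$ for $b\in\overline{Q'}_1$. Then: (a) $\Lambda^{q_E}(Q_E)$ has as a $k$-basis the $e_i$ ($i\in Q_0$) and the set $\mathfrak B$ of all $e_{v}x^ma^{\ell}$ and $e_{v}x^m(a^*)^{\ell}$ with $v\in W$, $m\in\mathbb Z$, $\ell\ge0$, $(m,\ell)\ne(0,0)$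 (the element $e_vx^m$ being listed once). (b) $\Lambda^{q'}(Q',W)$ has as a $k$-basis the $e_i$ ($i\in Q_0$) and the set $\mathfrak B'$ of all nonempty concatenable words in the letters $b,\overline{x_b^+},\overline{x_b^-}$ ($b\in\overline{Q'}_1$) that contain none of the subwords $\overline{x_b^+}\,\overline{x_b^-}$, $\overline{x_b^-}\,\overline{x_b^+}$, $bb^*$, $b\,\overline{x_{b^*}^{\pm}}$ for $b\in\overline{Q'}_1$ and $\overline{x_b^{\pm}}$, $\overline{x_{b^*}^-}$, $\overline{x_{b^*}^+}\,b^*$, $\overline{x_{b^*}^+}\,\overline{x_{b^*}^+}$ for $b\in F$. (c) $L_Q$ has as a $k$-basis the $e_i$ ($i\in Q_0$) and the nonempty concatenable alternating products of elements of $\mathfrak B$, of $\mathfrak B'$ and of $\{e_ir^m,\,e_i(r')^m : i\in Q_0,\ m\ge1\}$ (consecutive factors belong to different ones of the three sets). (d) The words of (c) without powers of $r$ or $r'$ form a $k$-basis of $\Lambda^q(Q)$, and (1) holds for the section $\sigma$ that sends each of these basis elements to the same word in $L_Q$. (e) There is a $kQ_0$-bimodule isomorphism $\Psi:\Lambda^{q_E}(Q_E)*_{kQ_0}\Lambda^{q'}(Q',W)\to\Lambda^q(Q)$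 that sends each word of (d), read in the free product, to the same word in $\Lambda^q(Q)$. All of (a)-(e) hold as well if in $\mathfrak B$ each $x^m$ is replaced by $(x-1)^m$ for $m\ge0$ and by $(x^{-1}-1)^{-m}$ for $m<0$. -/

import Mathlib

noncomputable section

namespace MPA

/-! ### Algebras over a commutative base ring `S`, given by `k`-algebra maps `S → A`

The image of `S` in `A` need not be central, so that `A` is an `S`-bimodule. -/

section SRings

variable {k S A B C : Type*} [Field k] [CommRing S] [Algebra k S]
  [Ring A] [Algebra k A] [Ring B] [Algebra k B] [Ring C] [Algebra k C]

/-- The relation whose ring congruence closure is congruence modulo the two-sided ideal `(r)`. -/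
inductive PrincipalRel (r : A) : A → A → Prop
  | zero : PrincipalRel r r 0

variable (k) in
/-- The quotient `A / (r)` by the two-sided ideal generated by `r`. -/
abbrev Quot1 (r : A) : Type _ := RingQuot (PrincipalRel r)

variable (k) in
/-- The projection `A → A / (r)`. -/
def proj (r : A) : A →ₐ[k] RingQuot (PrincipalRel r) := RingQuot.mkAlgHom k (PrincipalRel r)

/-- The relations on the free algebra on `A ⊔ B` that present the free product `A *_S B`:
both inclusions are `k`-algebra maps, and they agree on `S`. -/
inductive AmalgRel (f : S →ₐ[k] A) (g : S →ₐ[k] B) :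
    FreeAlgebra k (A ⊕ B) → FreeAlgebra k (A ⊕ B) → Prop
  | addl (a a' : A) : AmalgRel f g (FreeAlgebra.ι k (Sum.inl (a + a')))
      (FreeAlgebra.ι k (Sum.inl a) + FreeAlgebra.ι k (Sum.inl a'))
  | mull (a a' : A) : AmalgRel f g (FreeAlgebra.ι k (Sum.inl (a * a')))
      (FreeAlgebra.ι k (Sum.inl a) * FreeAlgebra.ι k (Sum.inl a'))
  | scalarl (c : k) : AmalgRel f g (FreeAlgebra.ι k (Sum.inl (algebraMap k A c)))
      (algebraMap k _ c)
  | addr (b b' : B) : AmalgRel f g (FreeAlgebra.ι k (Sum.inr (b + b')))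
      (FreeAlgebra.ι k (Sum.inr b) + FreeAlgebra.ι k (Sum.inr b'))
  | mulr (b b' : B) : AmalgRel f g (FreeAlgebra.ι k (Sum.inr (b * b')))
      (FreeAlgebra.ι k (Sum.inr b) * FreeAlgebra.ι k (Sum.inr b'))
  | scalarr (c : k) : AmalgRel f g (FreeAlgebra.ι k (Sum.inr (algebraMap k B c)))
      (algebraMap k _ c)
  | amalg (s : S) : AmalgRel f g (FreeAlgebra.ι k (Sum.inl (f s)))
      (FreeAlgebra.ι k (Sum.inr (g s)))

/-- The free product (pushout of `k`-algebras) `A *_S B`. -/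
abbrev FreeProd (f : S →ₐ[k] A) (g : S →ₐ[k] B) : Type _ := RingQuot (AmalgRel f g)

/-- The canonical map `A → A *_S B`. -/
def FreeProd.inl (f : S →ₐ[k] A) (g : S →ₐ[k] B) : A →ₐ[k] FreeProd f g :=
  AlgHom.ofLinearMap
    { toFun := fun a => RingQuot.mkAlgHom k (AmalgRel f g) (FreeAlgebra.ι k (Sum.inl a))
      map_add' := fun a a' => by
        rw [RingQuot.mkAlgHom_rel k (AmalgRel.addl (f := f) (g := g) a a'), map_add]
      map_smul' := fun c a => by
        rw [Algebra.smul_def, RingQuot.mkAlgHom_rel k (AmalgRel.mull (f := f) (g := g) _ a),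
          map_mul, RingQuot.mkAlgHom_rel k (AmalgRel.scalarl (f := f) (g := g) c),
          AlgHom.commutes, ← Algebra.smul_def, RingHom.id_apply] }
    (by
      have h := RingQuot.mkAlgHom_rel k (AmalgRel.scalarl (f := f) (g := g) 1)
      simpa using h)
    (fun a a' => by
      change RingQuot.mkAlgHom k (AmalgRel f g) _ = _
      rw [RingQuot.mkAlgHom_rel k (AmalgRel.mull (f := f) (g := g) a a'), map_mul]
      rfl)

/-- The canonical map `B → A *_S B`. -/
def FreeProd.inr (f : S →ₐ[k] A) (g : S →ₐ[k] B) : B →ₐ[k] FreeProd f g :=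
  AlgHom.ofLinearMap
    { toFun := fun b => RingQuot.mkAlgHom k (AmalgRel f g) (FreeAlgebra.ι k (Sum.inr b))
      map_add' := fun b b' => by
        rw [RingQuot.mkAlgHom_rel k (AmalgRel.addr (f := f) (g := g) b b'), map_add]
      map_smul' := fun c b => by
        rw [Algebra.smul_def, RingQuot.mkAlgHom_rel k (AmalgRel.mulr (f := f) (g := g) _ b),
          map_mul, RingQuot.mkAlgHom_rel k (AmalgRel.scalarr (f := f) (g := g) c),
          AlgHom.commutes, ← Algebra.smul_def, RingHom.id_apply] }
    (by
      have h := RingQuot.mkAlgHom_rel k (AmalgRel.scalarr (f := f) (g := g) 1)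
      simpa using h)
    (fun b b' => by
      change RingQuot.mkAlgHom k (AmalgRel f g) _ = _
      rw [RingQuot.mkAlgHom_rel k (AmalgRel.mulr (f := f) (g := g) b b'), map_mul]
      rfl)

/-- `σ` is an `S`-bimodule section of `A → A / (r)`. It is normalized by `σ 1 = 1` (so `σ` is the
identity on `S`), which is needed for the map `σ'` below to be well defined. -/
structure IsBimoduleSection (ι : S →ₐ[k] A) (r : A) (σ : Quot1 r →ₗ[k] A) : Prop where
  proj_apply : ∀ x, proj k r (σ x) = x
  map_one : σ 1 = 1
  left : ∀ s x, σ (proj k r (ι s) * x) = ι s * σ x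
  right : ∀ s x, σ (x * proj k r (ι s)) = σ x * ι s

/-- The localization `S[t, p⁻¹]` of the polynomial ring `S[t]`. -/
abbrev LocPoly (p : Polynomial S) : Type _ := Localization.Away p

/-- The element `t` of `S[t, p⁻¹]`. -/
def LocPoly.t (p : Polynomial S) : LocPoly p := algebraMap (Polynomial S) _ Polynomial.X

variable (k) in
/-- The structure map `S → S[t, p⁻¹]`. -/
def LocPoly.base (p : Polynomial S) : S →ₐ[k] LocPoly p :=
  (IsScalarTower.toAlgHom k (Polynomial S) (LocPoly p)).comp
    (IsScalarTower.toAlgHom k S (Polynomial S))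

/-- The strong free product property of `(A, r, σ, B)` for `B = S[t, p⁻¹]`: the map `S[t] → A`,
`t ↦ r`, extends to an algebra map `τ : B → A` (which is then unique), and the linear map
`σ' : A/(r) *_S B → A`,
`a₀ b₁ a₁ ⋯ bₙ aₙ ↦ σ(a₀) τ(b₁) σ(a₁) ⋯ τ(bₙ) σ(aₙ)` for `aᵢ ∈ A/(r)`, `bᵢ ∈ tB`,
is a (well-defined) linear isomorphism. The elements `a₀ b₁ a₁ ⋯ bₙ aₙ` span the free product,
so the formula determines `σ'`. -/
def StrongFreeProduct (ι : S →ₐ[k] A) (r : A) (σ : Quot1 r →ₗ[k] A) (p : Polynomial S) : Prop :=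
  IsBimoduleSection ι r σ ∧
  ∃ τ : LocPoly p →ₐ[k] A, (∀ s, τ (LocPoly.base k p s) = ι s) ∧ τ (LocPoly.t p) = r ∧
  ∃ σ' : FreeProd ((proj k r).comp ι) (LocPoly.base k p) ≃ₗ[k] A,
    ∀ (a₀ : Quot1 r) (l : List (LocPoly p × Quot1 r)),
      (∀ x ∈ l, x.1 ∈ Ideal.span {LocPoly.t p}) →
      σ' (FreeProd.inl _ _ a₀ *
          (l.map fun x => FreeProd.inr _ _ x.1 * FreeProd.inl _ _ x.2).prod) =
        σ a₀ * (l.map fun x => τ x.1 * σ x.2).prod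

/-- `C` is linearly the free product `A *_S B`: there are `S`-bimodule complements `M` of `S` in `A`
and `N` of `S` in `B`, and an isomorphism of `S`-bimodules `Ψ : A *_S B → C` with `Ψ 1 = 1` that
sends every alternating product of elements of `M` and `N` to the product in `C` of the images of
its factors. Thus `Ψ` is assembled from the two linear maps `Ψ|_A : A → C` and `Ψ|_B : B → C`. -/
def LinearlyFreeProduct (f : S →ₐ[k] A) (g : S →ₐ[k] B) (ι : S →ₐ[k] C) : Prop :=
  ∃ (M : Submodule k A) (N : Submodule k B) (Ψ : FreeProd f g ≃ₗ[k] C),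
    IsCompl (LinearMap.range f.toLinearMap) M ∧ (∀ s, ∀ m ∈ M, f s * m ∈ M ∧ m * f s ∈ M) ∧
    IsCompl (LinearMap.range g.toLinearMap) N ∧ (∀ s, ∀ n ∈ N, g s * n ∈ N ∧ n * g s ∈ N) ∧
    Ψ 1 = 1 ∧
    (∀ s z, Ψ (FreeProd.inl f g (f s) * z) = ι s * Ψ z ∧
      Ψ (z * FreeProd.inl f g (f s)) = Ψ z * ι s) ∧
    ∀ l : List (A ⊕ B), (∀ a, Sum.inl a ∈ l → a ∈ M) → (∀ b, Sum.inr b ∈ l → b ∈ N) →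
      l.IsChain (fun x y => x.isLeft ≠ y.isLeft) →
      Ψ (l.map (Sum.elim (FreeProd.inl f g) (FreeProd.inr f g))).prod =
        (l.map (Sum.elim (fun a => Ψ (FreeProd.inl f g a))
          (fun b => Ψ (FreeProd.inr f g b)))).prod

end SRings

/-! ### Quivers -/

/-- A quiver with vertex set `V` and arrow set `E`: tail (source) and head (target) maps. -/
structure ArrowQuiver (V E : Type*) where
  tail : E → V
  head : E → V

/-- Arrows of the doubled quiver: `⟨a, true⟩` is `a` and `⟨a, false⟩` is `a*`. -/
@[ext]
structure DArrow (E : Type*) where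
  arrow : E
  pos : Bool

namespace DArrow

variable {E : Type*}

/-- The involution `a ↦ a*`. -/
def star (a : DArrow E) : DArrow E := ⟨a.arrow, !a.pos⟩

/-- The sign `ε`. -/
def sign (a : DArrow E) : ℤ := if a.pos then 1 else -1

/-- Arrows of the double of a subquiver, as arrows of the double of the quiver. -/
def incl {A : Set E} (a : DArrow A) : DArrow E := ⟨a.arrow.1, a.pos⟩

theorem incl_injective {A : Set E} : Function.Injective (incl (A := A)) := by
  rintro ⟨a, b⟩ ⟨a', b'⟩ h
  simp only [incl, DArrow.mk.injEq] at h
  ext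
  · exact h.1
  · exact h.2

instance [Finite E] : Finite (DArrow E) :=
  Finite.of_injective (fun a : DArrow E => (a.arrow, a.pos)) (by
    rintro ⟨a, b⟩ ⟨a', b'⟩ h
    simpa using h)

/-- The induced order on the arrows of the double of a subquiver. -/
instance [LinearOrder (DArrow E)] (A : Set E) : LinearOrder (DArrow A) :=
  LinearOrder.lift' incl incl_injective

/-- All arrows of the doubled quiver, in increasing order. -/
def sorted (E : Type*) [Finite E] [LinearOrder (DArrow E)] : List (DArrow E) :=
  (Set.finite_univ (α := DArrow E)).toFinset.sort

end DArrow

namespace ArrowQuiver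

variable {V E : Type*} (Q : ArrowQuiver V E)

/-- Tail of an arrow of the doubled quiver. -/
def dtail (a : DArrow E) : V := if a.pos then Q.tail a.arrow else Q.head a.arrow

/-- Head of an arrow of the doubled quiver. -/
def dhead (a : DArrow E) : V := if a.pos then Q.head a.arrow else Q.tail a.arrow

/-- The quiver is connected (as an unoriented graph). -/
def Connected : Prop :=
  (SimpleGraph.fromRel fun i j => ∃ a, Q.tail a = i ∧ Q.head a = j).Connected

/-- The subquiver with the same vertices and with arrow set `A`. -/
def restrict (A : Set E) : ArrowQuiver V A := ⟨fun a => Q.tail a, fun a => Q.head a⟩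

/-- An unoriented cycle of length `n` in `Q`: distinct vertices `v i` and distinct arrows `c i`,
where `c i` joins `v i` and `v (i + 1)` in one of the two directions. A loop is a cycle of length
`1`, and two arrows joining the same two vertices form a cycle of length `2`. -/
structure Cycle (n : ℕ) where
  v : ZMod n → V
  c : ZMod n → E
  v_injective : Function.Injective v
  c_injective : Function.Injective c
  joins : ∀ i, (Q.tail (c i) = v i ∧ Q.head (c i) = v (i + 1)) ∨
    (Q.tail (c i) = v (i + 1) ∧ Q.head (c i) = v i)

variable {Q}

/-- The vertices of the cycle. -/
def Cycle.verts {n : ℕ} (z : Q.Cycle n) : Set V := Set.range z.v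

/-- The arrows of the cycle. -/
def Cycle.arrows {n : ℕ} (z : Q.Cycle n) : Set E := Set.range z.c

/-- The `i`-th arrow of the cycle, as an arrow of the subquiver formed by the cycle. -/
def Cycle.arrow {n : ℕ} (z : Q.Cycle n) (i : ZMod n) : z.arrows := ⟨z.c i, i, rfl⟩

/-- The cycle is cyclically oriented: `c i` goes from `v i` to `v (i + 1)`. -/
def Cycle.Oriented {n : ℕ} (z : Q.Cycle n) : Prop :=
  ∀ i, Q.tail (z.c i) = z.v i ∧ Q.head (z.c i) = z.v (i + 1)

/-- The order is adapted to the cycle: the arrows `c i` precede their reverses `(c j)*`, and both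
precede all other arrows of the doubled quiver. -/
def Cycle.Adapted {n : ℕ} [LinearOrder (DArrow E)] (z : Q.Cycle n) : Prop :=
  (∀ i j, (⟨z.c i, true⟩ : DArrow E) < ⟨z.c j, false⟩) ∧
  ∀ a b : DArrow E, a.arrow ∈ z.arrows → b.arrow ∉ z.arrows → a < b

variable (Q)

/-- The arrows in `F` form a spanning forest rooted in `W` and directed towards the roots: no arrow
of `F` leaves a vertex of `W`, exactly one arrow of `F` leaves every other vertex, and following the
arrows of `F` from any vertex leads to `W`. (So `F` is a disjoint union of trees that covers all
vertices, and each tree has exactly one vertex in `W`, its root.) -/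
structure IsRootedForest (W : Set V) (F : Set E) : Prop where
  root : ∀ a ∈ F, Q.tail a ∉ W
  unique : ∀ i, i ∉ W → ∃! a, a ∈ F ∧ Q.tail a = i
  reach : ∀ i, ∃ w ∈ W, Relation.ReflTransGen (fun i j => ∃ a ∈ F, Q.tail a = i ∧ Q.head a = j) i w

end ArrowQuiver

/-! ### The localized path algebra and the multiplicative preprojective algebras -/

/-- Generators of `L_Q`: the idempotents `e_i`, the arrows of the doubled quiver, and the formal
inverses of the elements `g_a = 1 + a a*`. -/
inductive LGen (V E : Type*)
  | vert (i : V) : LGen V E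
  | arr (a : DArrow E) : LGen V E
  | inv (a : DArrow E) : LGen V E

section Algebras

variable (k : Type*) [Field k] {V E : Type*} [Fintype V] (Q : ArrowQuiver V E)

open LGen in
/-- The relations of `L_Q`: those of the path algebra of the doubled quiver (paths are composed from
left to right), and the ones which make `inv a` a two-sided inverse of `1 + a a*`. -/
inductive LRel : FreeAlgebra k (LGen V E) → FreeAlgebra k (LGen V E) → Prop
  | idem (i : V) : LRel (FreeAlgebra.ι k (vert i) * FreeAlgebra.ι k (vert i))
      (FreeAlgebra.ι k (vert i))
  | orth (i j : V) : i ≠ j → LRel (FreeAlgebra.ι k (vert i) * FreeAlgebra.ι k (vert j)) 0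
  | one : LRel (∑ i, FreeAlgebra.ι k (vert i)) 1
  | tail (a : DArrow E) : LRel (FreeAlgebra.ι k (vert (Q.dtail a)) * FreeAlgebra.ι k (arr a))
      (FreeAlgebra.ι k (arr a))
  | head (a : DArrow E) : LRel (FreeAlgebra.ι k (arr a) * FreeAlgebra.ι k (vert (Q.dhead a)))
      (FreeAlgebra.ι k (arr a))
  | mul_inv (a : DArrow E) :
      LRel ((1 + FreeAlgebra.ι k (arr a) * FreeAlgebra.ι k (arr a.star)) *
        FreeAlgebra.ι k (inv a)) 1
  | inv_mul (a : DArrow E) :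
      LRel (FreeAlgebra.ι k (inv a) *
        (1 + FreeAlgebra.ι k (arr a) * FreeAlgebra.ι k (arr a.star))) 1

/-- `L_Q`, the localization of the path algebra of the doubled quiver at all `1 + a a*`. -/
abbrev LAlg : Type _ := RingQuot (LRel k Q)

/-- The class in `L_Q` of a generator. -/
def gen (x : LGen V E) : LAlg k Q := RingQuot.mkAlgHom k (LRel k Q) (FreeAlgebra.ι k x)

/-- The idempotent `e_i` in `L_Q`. -/
def e (i : V) : LAlg k Q := gen k Q (LGen.vert i)

/-- The class in `L_Q` of an arrow of the doubled quiver. -/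
def ar (a : DArrow E) : LAlg k Q := gen k Q (LGen.arr a)

theorem e_mul_self (i : V) : e k Q i * e k Q i = e k Q i := by
  have h := RingQuot.mkAlgHom_rel k (LRel.idem (k := k) (Q := Q) i)
  rwa [map_mul] at h

theorem e_mul_of_ne {i j : V} (hij : i ≠ j) : e k Q i * e k Q j = 0 := by
  have h := RingQuot.mkAlgHom_rel k (LRel.orth (k := k) (Q := Q) i j hij)
  rwa [map_mul, map_zero] at h

theorem sum_e : ∑ i, e k Q i = 1 := by
  have h := RingQuot.mkAlgHom_rel k (LRel.one (k := k) (Q := Q))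
  rwa [map_sum, map_one] at h

/-- The map `kQ₀ → L_Q`, `f ↦ ∑ f i e_i`, where `kQ₀` is the ring of functions `V → k`. -/
def vertexMap : (V → k) →ₐ[k] LAlg k Q :=
  AlgHom.ofLinearMap
    { toFun := fun f => ∑ i, f i • e k Q i
      map_add' := fun f g => by simp [add_smul, Finset.sum_add_distrib]
      map_smul' := fun c f => by simp [mul_smul, Finset.smul_sum] }
    (by simp [sum_e])
    (fun f g => by
      change ∑ i, (f * g) i • e k Q i = (∑ i, f i • e k Q i) * ∑ j, g j • e k Q j
      rw [Finset.sum_mul]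
      refine Finset.sum_congr rfl fun i _ => ?_
      rw [Finset.mul_sum, Finset.sum_eq_single i]
      · rw [smul_mul_smul_comm, e_mul_self, Pi.mul_apply]
      · intro j _ hj
        rw [smul_mul_smul_comm, e_mul_of_ne k Q hj.symm, smul_zero]
      · simp)

/-- The unit `g_a = x_a = 1 + a a*` of `L_Q`. -/
def g (a : DArrow E) : (LAlg k Q)ˣ where
  val := 1 + ar k Q a * ar k Q a.star
  inv := gen k Q (LGen.inv a)
  val_inv := by
    have h := RingQuot.mkAlgHom_rel k (LRel.mul_inv (k := k) (Q := Q) a)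
    rwa [map_mul, map_add, map_mul, map_one] at h
  inv_val := by
    have h := RingQuot.mkAlgHom_rel k (LRel.inv_mul (k := k) (Q := Q) a)
    rwa [map_mul, map_add, map_mul, map_one] at h

variable [Finite E] [LinearOrder (DArrow E)]

/-- `ρ`, the product of all `g_a ^ ε(a)` in increasing order. -/
def rho : (LAlg k Q)ˣ := ((DArrow.sorted E).map fun a => g k Q a ^ a.sign).prod

variable {k} (q : V → kˣ)

/-- The multiplicative preprojective relation `r = ρ - q`. -/
def rel : LAlg k Q := (rho k Q : LAlg k Q) - vertexMap k Q fun i => (q i : k)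

/-- `r' = (q + r)⁻¹ - q⁻¹`; note that `q + r = ρ`. -/
def rel' : LAlg k Q := ((rho k Q)⁻¹ : (LAlg k Q)ˣ) - vertexMap k Q fun i => ((q i)⁻¹ : k)

/-- The multiplicative preprojective algebra `Λ^q(Q)`. -/
abbrev Lam : Type _ := Quot1 (rel Q q)

/-- `r_𝓑 = 1_𝓑 r 1_𝓑`, where `𝓑` is the complement of the set `W` of white vertices. -/
def relBlack (W : Set V) : LAlg k Q :=
  vertexMap k Q (Set.indicator Wᶜ 1) * rel Q q * vertexMap k Q (Set.indicator Wᶜ 1)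

/-- The partial multiplicative preprojective algebra `Λ^q(Q, W)`: the relation is not imposed at the
vertices in `W`. -/
abbrev PLam (W : Set V) : Type _ := Quot1 (relBlack Q q W)

/-- The structure map `kQ₀ → Λ^q(Q)`. -/
def Lam.base : (V → k) →ₐ[k] Lam Q q := (proj k (rel Q q)).comp (vertexMap k Q)

/-- The structure map `kQ₀ → Λ^q(Q, W)`. -/
def PLam.base (W : Set V) : (V → k) →ₐ[k] PLam Q q W :=
  (proj k (relBlack Q q W)).comp (vertexMap k Q)

/-- The polynomial `q + t` in `kQ₀[t]`. -/
def locPt : Polynomial (V → k) := Polynomial.C (fun i => (q i : k)) + Polynomial.X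

variable {Q} {n : ℕ} (z : Q.Cycle n)

/-- `Λ^{q_E}(Q_E)` for the cycle `Q_E`, as an algebra over `kQ₀`: the factor `k e_i` is added for
every vertex `i` off the cycle. These vertices lie on no arrow of `Q_E`, so this is the algebra of
the subquiver with all vertices of `Q` and the arrows of the cycle, with the relation imposed at the
vertices of the cycle only. -/
abbrev CycLam : Type _ := PLam (Q.restrict z.arrows) q z.vertsᶜ

/-- `Λ^{q'}(Q', W)`, where `Q'` is the complement of the cycle (all vertices of `Q`, and the arrows
not on the cycle) and `W` is the set of vertices of the cycle. -/
abbrev ComplLam : Type _ := PLam (Q.restrict z.arrowsᶜ) q z.verts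

/-- The structure map `kQ₀ → Λ^{q_E}(Q_E)`. -/
def CycLam.base : (V → k) →ₐ[k] CycLam q z := PLam.base (Q.restrict z.arrows) q z.vertsᶜ

/-- The structure map `kQ₀ → Λ^{q'}(Q', W)`. -/
def ComplLam.base : (V → k) →ₐ[k] ComplLam q z := PLam.base (Q.restrict z.arrowsᶜ) q z.verts

end Algebras

/-! ### The bases -/

/-- `x ^ m` for `m ≥ 0` and `y ^ (-m)` for `m < 0`. -/
def signedPow {A : Type*} [Monoid A] (x y : A) (m : ℤ) : A :=
  if 0 ≤ m then x ^ m.toNat else y ^ (-m).toNat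

section Words

variable (k : Type*) [Field k] {V E : Type*} [Fintype V] (Q : ArrowQuiver V E)

/-- For a cyclically oriented cycle with vertices `v i` and arrows `c i`, let `a = ∑ c i`,
`a* = ∑ (c i)*`, `x = 1 + a a*`, so that `e_{v i} x = e_{v i} g_{c i}`. If `bar = false` this is
`e_{v i} x ^ m a ^ l` for `l ≥ 0` and `e_{v i} x ^ m (a*) ^ (-l)` for `l < 0`. If `bar = true`, then
`x ^ m` is replaced by `(x - 1) ^ m` for `m ≥ 0` and by `(x⁻¹ - 1) ^ (-m)` for `m < 0`. -/
def cycElt (bar : Bool) {n : ℕ} [NeZero n] (v : ZMod n → V) (c : ZMod n → E)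
    (i : ZMod n) (m l : ℤ) : LAlg k Q :=
  let x : (LAlg k Q)ˣ := g k Q ⟨c i, true⟩
  e k Q (v i) *
    (if bar then signedPow ((x : LAlg k Q) - 1) (((x⁻¹ : (LAlg k Q)ˣ) : LAlg k Q) - 1) m
      else signedPow (x : LAlg k Q) ((x⁻¹ : (LAlg k Q)ˣ) : LAlg k Q) m) *
    signedPow (∑ j, ar k Q ⟨c j, true⟩) (∑ j, ar k Q ⟨c j, false⟩) l

/-- Letters: an arrow `a`, or `x_a - 1` (`s = true`), or `x_a⁻¹ - 1` (`s = false`). -/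
inductive Letter (E : Type*)
  | arr (a : DArrow E) : Letter E
  | bar (a : DArrow E) (s : Bool) : Letter E

namespace Letter

variable {E' : Type*}

/-- Transport of letters along a map of arrows. -/
def map (f : E' → E) : Letter E' → Letter E
  | arr a => arr ⟨f a.arrow, a.pos⟩
  | bar a s => bar ⟨f a.arrow, a.pos⟩ s

variable {k} in
/-- The element of `L_Q` denoted by a letter. -/
def val : Letter E → LAlg k Q
  | arr a => ar k Q a
  | bar a true => (g k Q a : LAlg k Q) - 1
  | bar a false => ((g k Q a)⁻¹ : (LAlg k Q)ˣ) - 1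

/-- The vertex at which a letter starts. -/
def src : Letter E → V
  | arr a => Q.dtail a
  | bar a _ => Q.dtail a

/-- The vertex at which a letter ends. -/
def tgt : Letter E → V
  | arr a => Q.dhead a
  | bar a _ => Q.dtail a

/-- The forbidden letters, for a forest `F`: `x_a - 1`, `x_a⁻¹ - 1` and `x_{a*}⁻¹ - 1`
for `a ∈ F`. -/
inductive Forbidden₁ (F : Set E) : Letter E → Prop
  | bar (a : E) (s : Bool) : a ∈ F → Forbidden₁ F (bar ⟨a, true⟩ s)
  | bar_star (a : E) : a ∈ F → Forbidden₁ F (bar ⟨a, false⟩ false)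

/-- The forbidden subwords of length two: `(x_a - 1)(x_a⁻¹ - 1)`, `(x_a⁻¹ - 1)(x_a - 1)`, `a a*`,
`a (x_{a*} - 1)` and `a (x_{a*}⁻¹ - 1)` for all `a` in the doubled quiver, and `(x_{a*} - 1) a*` and
`(x_{a*} - 1) (x_{a*} - 1)` for `a ∈ F`. -/
inductive Forbidden₂ (F : Set E) : Letter E → Letter E → Prop
  | bar_bar (a : DArrow E) (s : Bool) : Forbidden₂ F (bar a s) (bar a !s)
  | arr_star (a : DArrow E) : Forbidden₂ F (arr a) (arr a.star)
  | arr_bar (a : DArrow E) (s : Bool) : Forbidden₂ F (arr a) (bar a.star s)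
  | forest_arr (a : E) : a ∈ F → Forbidden₂ F (bar ⟨a, false⟩ true) (arr ⟨a, false⟩)
  | forest_sq (a : E) : a ∈ F → Forbidden₂ F (bar ⟨a, false⟩ true) (bar ⟨a, false⟩ true)

end Letter

/-- A nonempty concatenable word in the letters, without forbidden subwords. -/
def IsForestWord (F : Set E) (w : List (Letter E)) : Prop :=
  w ≠ [] ∧ (∀ x ∈ w, ¬ Letter.Forbidden₁ F x) ∧
    w.IsChain fun x y => Letter.tgt Q x = Letter.src Q y ∧ ¬ Letter.Forbidden₂ F x y

variable {Q} {n : ℕ} (z : Q.Cycle n)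

/-- Factors of alternating products: a basis element of the algebra of the cycle, a word in the
letters of the complement of the cycle, or a power `e_i r ^ m` (`m > 0`), `e_i (r') ^ (-m)`
(`m < 0`). -/
inductive Block
  | cyc (i : ZMod n) (m l : ℤ) : Block
  | par (w : List (Letter (z.arrowsᶜ : Set E))) : Block
  | pow (i : V) (m : ℤ) : Block

namespace Block

variable {z}

/-- Which of the three kinds of factors a block is. -/
def kind : Block z → Fin 3
  | cyc _ _ _ => 0
  | par _ => 1
  | pow _ _ => 2

/-- The vertex at which a (valid) block starts. -/
def src : Block z → Option V
  | cyc i _ _ => some (z.v i)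
  | par w => w.head?.map (Letter.src (Q.restrict z.arrowsᶜ))
  | pow i _ => some i

/-- The vertex at which a (valid) block ends. -/
def tgt : Block z → Option V
  | cyc i _ l => some (z.v (i + l))
  | par w => w.getLast?.map (Letter.tgt (Q.restrict z.arrowsᶜ))
  | pow i _ => some i

/-- Blocks that are basis elements of one of the three algebras, other than the idempotents. -/
def Valid (F : Set (z.arrowsᶜ : Set E)) : Block z → Prop
  | cyc _ m l => m ≠ 0 ∨ l ≠ 0
  | par w => IsForestWord (Q.restrict z.arrowsᶜ) F w
  | pow _ m => m ≠ 0

variable {k} [Finite E] [LinearOrder (DArrow E)] [NeZero n]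

/-- The element of `L_Q` denoted by a block. -/
def val (q : V → kˣ) (bar : Bool) : Block z → LAlg k Q
  | cyc i m l => cycElt k Q bar z.v z.c i m l
  | par w => (w.map fun x => (x.map Subtype.val).val Q).prod
  | pow i m => e k Q i * signedPow (rel Q q) (rel' Q q) m

/-- The element of `Λ^{q_E}(Q_E) *_{kQ₀} Λ^{q'}(Q', W)` denoted by a block of one of the first two
kinds (blocks of the third kind are given the value `0`). -/
def freeVal (q : V → kˣ) (bar : Bool) :
    Block z → FreeProd (CycLam.base q z) (ComplLam.base q z)
  | cyc i m l => FreeProd.inl _ _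
      (proj k _ (cycElt k (Q.restrict z.arrows) bar z.v z.arrow i m l))
  | par w => FreeProd.inr _ _
      (proj k _ ((w.map fun x => x.val (Q.restrict z.arrowsᶜ)).prod : LAlg k _))
  | pow _ _ => 0

end Block

/-- Concatenable alternating words: a starting vertex and a (possibly empty) list of valid blocks
beginning there, such that consecutive blocks can be concatenated and are of different kinds. -/
def IsAltWord (F : Set (z.arrowsᶜ : Set E)) (p : V × List (Block z)) : Prop :=
  (∀ b ∈ p.2, b.Valid F) ∧ (∀ b ∈ p.2.head?, b.src = some p.1) ∧
    p.2.IsChain fun b b' => b.tgt = b'.src ∧ b.kind ≠ b'.kind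

/-- Alternating words. -/
abbrev AltWord (F : Set (z.arrowsᶜ : Set E)) : Type _ := {p : V × List (Block z) // IsAltWord z F p}

/-- Alternating words in which no power of `r` or `r'` occurs. -/
abbrev AltWord₀ (F : Set (z.arrowsᶜ : Set E)) : Type _ :=
  {p : V × List (Block z) // IsAltWord z F p ∧ ∀ b ∈ p.2, b.kind ≠ 2}

variable {k z} [Finite E] [LinearOrder (DArrow E)] [NeZero n]

/-- The element of `L_Q` denoted by a word; the empty word at `i` denotes `e_i`. -/
def wordVal (q : V → kˣ) (bar : Bool) (p : V × List (Block z)) : LAlg k Q :=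
  e k Q p.1 * (p.2.map (Block.val q bar)).prod

/-- The element of `Λ^{q_E}(Q_E) *_{kQ₀} Λ^{q'}(Q', W)` denoted by a word. -/
def wordFreeVal (q : V → kˣ) (bar : Bool) (p : V × List (Block z)) :
    FreeProd (CycLam.base q z) (ComplLam.base q z) :=
  FreeProd.inl _ _ (proj k _ (e k (Q.restrict z.arrows) p.1)) *
    (p.2.map (Block.freeVal q bar)).prod

end Words

/-- `L_Q` is free as a left module over `kQ₀`. -/
def LeftFree (k : Type*) [Field k] {V E : Type*} [Fintype V] (Q : ArrowQuiver V E) : Prop :=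
  letI : Module (V → k) (LAlg k Q) := Module.compHom _ (vertexMap k Q).toRingHom
  Module.Free (V → k) (LAlg k Q)

end MPA

end

/-!
# Multiplicative preprojective algebras of quivers that contain a cycle

Everything rests on one fact: the normal words form a basis of `L_Q`, and those without powers of
`r`, `r'` a basis of `Λ^q(Q)`. A normal word is flattened to a sequence of atoms: basis elements of
the algebra of the cycle, letters of the complement, powers of `r` or `r'` (`WordData`). On the
vector space `D.Space k` spanned by the words, every generator of the algebra is given an operator
which satisfies the defining relations and sends the empty word at `i` to the corresponding word.
The operators also correspond, under the evaluation `D.evalBy φ val` of words, to left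
multiplication by the generators (`Eqv`). The first property gives linear independence, the second
spanning: `cyc_bijective`, `letter_bijective`, `lam_bijective`, `lAlg_bijective`.

Three points make such operators possible.

* The letters of the complement act by concatenation and cancellation (`LetterSetup`). A forest
  arrow `b` is the only one whose `1 + b b*` is not a letter: at its tail `i`, outside the cycle,
  the relation `e_i ρ = e_i R`, with `R` the given action of `ρ`, is solved for `1 + b b*`. The
  other factors at `i` only involve letters and forest arrows further away from the roots, so this
  is a recursion along the forest.
* On the cycle, with `x = 1 + a a*` and `y = 1 + a* a`, the relation reads `y = U x`, where the unit
  `U` collects the letters that meet the cycle. `U` is a scalar up to words that start with a letter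
  or a power, so `y` is, with respect to the number of cycle atoms, a triangular perturbation of a
  multiple of `x`. Hence there is an automorphism `Φ` of the space of words with `Φ x = y Φ` that
  fixes the words with leading exponent `0` of `x`, and it corrects the naive actions of `a` and
  `a*` (`CycSetup`).
* `ρ` acts on the powers of `r` and `r'` as multiplication by `T` on `k[T, T⁻¹]` (`powAct`), since
  `(T - q)^m` and `(T⁻¹ - q⁻¹)^m` form a basis (`shiftedBasis`).

For free products the same method shows that the alternating words in the letters of two based
algebras form a basis of the free product (`freeProd_bijective`). Comparing bases yields the linear
isomorphisms (`freeEquiv`); they respect the relevant products because a factor acts on words which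
do not start with its own color by mere concatenation (`linearlyFreeProduct`, `freeEquiv_prod`). For
the strong free product property, the factor `B` is a product of Laurent polynomial rings
(`locEquiv`), in which `tB` has no component along the constants (`locBasis_repr_zero`).

At each vertex there are countably many words, whence the freeness (`free_of_basis`). Finally, an
arbitrary orientation and order is reduced to an adapted one: reversing arrows, or exchanging two
neighbours in the order, is undone by an isomorphism that reverses arrows or conjugates one by a
power of another `1 + a a*` (`rhoEquiv_of_isFlip`), and shortest paths to the cycle provide the
forest (`exists_orientation`).
-/

noncomputable section

open Module

set_option linter.unusedSectionVars false

namespace MPA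

/-! ### Homomorphisms out of the localized path algebra -/

section LAlgBasics

variable {k : Type*} [Field k] {V E : Type*}

theorem DArrow.star_star (a : DArrow E) : a.star.star = a := by
  cases a; simp [DArrow.star]

theorem DArrow.star_ne (a : DArrow E) : a.star ≠ a := by
  cases a; simp [DArrow.star]

theorem ArrowQuiver.dtail_star (Q : ArrowQuiver V E) (a : DArrow E) :
    Q.dtail a.star = Q.dhead a := by
  cases a with | mk a p => cases p <;> simp [dtail, dhead, DArrow.star]

theorem ArrowQuiver.dhead_star (Q : ArrowQuiver V E) (a : DArrow E) :
    Q.dhead a.star = Q.dtail a := by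
  cases a with | mk a p => cases p <;> simp [dtail, dhead, DArrow.star]

variable [Fintype V]

variable (k) in
/-- The data of a homomorphism from `L_Q` to a `k`-algebra `B`: images of the vertices, of the
arrows, and units which are the images of the elements `1 + a a*`. -/
structure QRep (Q : ArrowQuiver V E) (B : Type*) [Ring B] [Algebra k B] where
  vert : V → B
  arr : DArrow E → B
  unit : DArrow E → Bˣ
  idem : CompleteOrthogonalIdempotents vert
  tail : ∀ a, vert (Q.dtail a) * arr a = arr a
  head : ∀ a, arr a * vert (Q.dhead a) = arr a
  unit_eq : ∀ a, (unit a : B) = 1 + arr a * arr a.star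

namespace QRep

variable {Q : ArrowQuiver V E} {B : Type*} [Ring B] [Algebra k B] (ρ : QRep k Q B)

/-- The images of the generators of `L_Q`. -/
def onGen : LGen V E → B
  | .vert i => ρ.vert i
  | .arr a => ρ.arr a
  | .inv a => ((ρ.unit a)⁻¹ : Bˣ)

/-- The homomorphism determined by the data. -/
def toHom : LAlg k Q →ₐ[k] B := RingQuot.liftAlgHom k ⟨FreeAlgebra.lift k ρ.onGen, by
    intro x y h
    induction h with
    | idem i => simpa [onGen] using (ρ.idem.idem i).eq
    | orth i j hij => simpa [onGen] using ρ.idem.ortho hij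
    | one => simpa [onGen] using ρ.idem.complete
    | tail a => simpa [onGen] using ρ.tail a
    | head a => simpa [onGen] using ρ.head a
    | mul_inv a => simp [onGen, ← ρ.unit_eq]
    | inv_mul a => simp [onGen, ← ρ.unit_eq]⟩

@[simp] theorem toHom_e (i : V) : ρ.toHom (e k Q i) = ρ.vert i := by
  simp [toHom, e, gen, onGen]

@[simp] theorem toHom_ar (a : DArrow E) : ρ.toHom (ar k Q a) = ρ.arr a := by
  simp [toHom, ar, gen, onGen]

theorem map_g (a : DArrow E) : Units.map (ρ.toHom : LAlg k Q →* B) (g k Q a) = ρ.unit a := by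
  ext
  simp [g, ρ.unit_eq]

@[simp] theorem toHom_g (a : DArrow E) : ρ.toHom (g k Q a : LAlg k Q) = ρ.unit a :=
  congrArg Units.val (ρ.map_g a)

@[simp] theorem toHom_g_inv (a : DArrow E) :
    ρ.toHom (↑(g k Q a)⁻¹ : LAlg k Q) = ((ρ.unit a)⁻¹ : Bˣ) := by
  rw [← ρ.map_g a, ← map_inv]; rfl

end QRep

variable (k) (Q : ArrowQuiver V E)

theorem e_idem : CompleteOrthogonalIdempotents (e k Q) where
  idem := e_mul_self k Q
  ortho := fun _ _ h => e_mul_of_ne k Q h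
  complete := sum_e k Q

theorem e_mul_ar (a : DArrow E) : e k Q (Q.dtail a) * ar k Q a = ar k Q a := by
  have h := RingQuot.mkAlgHom_rel k (LRel.tail (k := k) (Q := Q) a)
  rwa [map_mul] at h

theorem ar_mul_e (a : DArrow E) : ar k Q a * e k Q (Q.dhead a) = ar k Q a := by
  have h := RingQuot.mkAlgHom_rel k (LRel.head (k := k) (Q := Q) a)
  rwa [map_mul] at h

theorem g_val (a : DArrow E) : (g k Q a : LAlg k Q) = 1 + ar k Q a * ar k Q a.star := rfl

theorem e_mul_ar_of_ne {i : V} {a : DArrow E} (h : i ≠ Q.dtail a) : e k Q i * ar k Q a = 0 := by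
  rw [← e_mul_ar, ← mul_assoc, e_mul_of_ne k Q h, zero_mul]

theorem ar_mul_e_of_ne {i : V} {a : DArrow E} (h : Q.dhead a ≠ i) : ar k Q a * e k Q i = 0 := by
  rw [← ar_mul_e, mul_assoc, e_mul_of_ne k Q h, mul_zero]

/-- `a (1 + a* a) = (1 + a a*) a`. -/
theorem ar_mul_g (a : DArrow E) :
    ar k Q a * (g k Q a.star : LAlg k Q) = (g k Q a : LAlg k Q) * ar k Q a := by
  simp only [g_val, DArrow.star_star]
  noncomm_ring

theorem ar_mul_g_inv (a : DArrow E) :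
    ar k Q a * (↑(g k Q a.star)⁻¹ : LAlg k Q) = (↑(g k Q a)⁻¹ : LAlg k Q) * ar k Q a := by
  rw [Units.mul_inv_eq_iff_eq_mul, mul_assoc, ar_mul_g, Units.inv_mul_cancel_left]

theorem vertexMap_single (i : V) [DecidableEq V] :
    vertexMap k Q (Pi.single i 1) = e k Q i := by
  change ∑ j, (Pi.single i 1 : V → k) j • e k Q j = _
  rw [Finset.sum_eq_single i] <;> simp +contextual

theorem vertexMap_apply (s : V → k) : vertexMap k Q s = ∑ i, s i • e k Q i := rfl

theorem vertexMap_mul_e (s : V → k) (i : V) : vertexMap k Q s * e k Q i = s i • e k Q i := by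
  rw [vertexMap_apply, Finset.sum_mul, Finset.sum_eq_single i]
  · rw [smul_mul_assoc, e_mul_self]
  · intro j _ hj
    rw [smul_mul_assoc, e_mul_of_ne k Q hj, smul_zero]
  · simp

theorem e_mul_vertexMap (s : V → k) (i : V) : e k Q i * vertexMap k Q s = s i • e k Q i := by
  rw [vertexMap_apply, Finset.mul_sum, Finset.sum_eq_single i]
  · rw [mul_smul_comm, e_mul_self]
  · intro j _ hj
    rw [mul_smul_comm, e_mul_of_ne k Q hj.symm, smul_zero]
  · simp

variable {k Q}

theorem LAlg.hom_ext {B : Type*} [Ring B] [Algebra k B] {φ ψ : LAlg k Q →ₐ[k] B}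
    (h1 : ∀ i, φ (e k Q i) = ψ (e k Q i)) (h2 : ∀ a, φ (ar k Q a) = ψ (ar k Q a)) : φ = ψ := by
  apply RingQuot.ringQuot_ext'
  apply FreeAlgebra.hom_ext
  funext x
  have key : ∀ x : LGen V E, φ (gen k Q x) = ψ (gen k Q x) := by
    rintro (i | a | a)
    · exact h1 i
    · exact h2 a
    · have hu : Units.map (φ : LAlg k Q →* B) (g k Q a) = Units.map (ψ : LAlg k Q →* B) (g k Q a) := by
        ext
        simp [g_val, h2]
      have := congrArg (fun u : Bˣ => ((u⁻¹ : Bˣ) : B)) hu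
      rw [← map_inv, ← map_inv] at this
      exact this
  exact key x

end LAlgBasics

/-! ### Units located at a vertex -/

section Located

variable {V B : Type*} [Fintype V] [Ring B] {E : V → B} (hE : CompleteOrthogonalIdempotents E)
include hE

theorem eq_of_idem_mul {x y : B} (h : ∀ i, E i * x = E i * y) : x = y := by
  rw [← one_mul x, ← one_mul y, ← hE.complete, Finset.sum_mul, Finset.sum_mul]
  exact Finset.sum_congr rfl fun i _ => h i

theorem idem_commute_of_located {i : V} {T : B} (h : ∀ j ≠ i, E j * T = E j ∧ T * E j = E j) (j : V) :
    E j * T = T * E j := by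
  by_cases hj : j = i
  · subst hj
    have h1 : E j * T = E j * T * E j := by
      conv_lhs => rw [← mul_one (E j * T), ← hE.complete, Finset.mul_sum]
      refine Finset.sum_eq_single j (fun l _ hl => ?_) (by simp)
      rw [mul_assoc, (h l hl).2, hE.ortho hl.symm]
    have h2 : T * E j = E j * (T * E j) := by
      conv_lhs => rw [← one_mul (T * E j), ← hE.complete, Finset.sum_mul]
      refine Finset.sum_eq_single j (fun l _ hl => ?_) (by simp)
      rw [← mul_assoc, (h l hl).1, hE.ortho hl]
    rw [h1, h2, mul_assoc]
  · rw [(h j hj).1, (h j hj).2]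

omit hE in
variable (E) in
/-- The units which are located at the vertex `i`: they are the identity at all other vertices. -/
def locAt (i : V) : Subgroup Bˣ where
  carrier := {T | ∀ j ≠ i, E j * (T : B) = E j ∧ (T : B) * E j = E j}
  one_mem' := by simp
  mul_mem' := by
    intro a b ha hb j hj
    refine ⟨?_, ?_⟩
    · rw [Units.val_mul, ← mul_assoc, (ha j hj).1, (hb j hj).1]
    · rw [Units.val_mul, mul_assoc, (hb j hj).2, (ha j hj).2]
  inv_mem' := by
    intro a ha j hj
    refine ⟨?_, ?_⟩
    · rw [Units.mul_inv_eq_iff_eq_mul, (ha j hj).1]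
    · rw [Units.inv_mul_eq_iff_eq_mul, (ha j hj).2]

theorem commute_of_mem_locAt {i : V} {T : Bˣ} (h : T ∈ locAt E i) (j : V) :
    Commute (E j) (T : B) :=
  idem_commute_of_located hE h j

/-- The part of a unit at the vertex `i`, completed by the identity at the other vertices. -/
def loc (i : V) (T : Bˣ) (hT : ∀ j, Commute (E j) (T : B)) : Bˣ where
  val := E i * T + (1 - E i)
  inv := E i * (T⁻¹ : Bˣ) + (1 - E i)
  val_inv := by
    have h1 := (hT i).eq
    have h3 : E i * E i = E i := hE.idem i
    have h4 : E i * (T : B) * (E i * (T⁻¹ : Bˣ)) = E i := by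
      rw [h1, mul_assoc, ← mul_assoc (E i), h3, ← mul_assoc, ← h1, mul_assoc, Units.mul_inv, mul_one]
    have h5 : E i * (T : B) * E i = E i * T := by rw [mul_assoc, ← h1, ← mul_assoc, h3]
    rw [add_mul, mul_add, mul_add, h4]
    simp only [mul_sub, sub_mul, one_mul, mul_one, ← mul_assoc, h3, h5]
    abel
  inv_val := by
    have h1 := (hT i).units_inv_right.eq
    have h3 : E i * E i = E i := hE.idem i
    have h4 : E i * ((T⁻¹ : Bˣ) : B) * (E i * T) = E i := by
      rw [h1, mul_assoc, ← mul_assoc (E i), h3, ← mul_assoc, ← h1, mul_assoc, Units.inv_mul, mul_one]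
    have h5 : E i * ((T⁻¹ : Bˣ) : B) * E i = E i * (T⁻¹ : Bˣ) := by
      rw [mul_assoc, ← h1, ← mul_assoc, h3]
    rw [add_mul, mul_add, mul_add, h4]
    simp only [mul_sub, sub_mul, one_mul, mul_one, ← mul_assoc, h3, h5]
    abel

theorem loc_val (i : V) (T : Bˣ) (hT : ∀ j, Commute (E j) (T : B)) :
    (loc hE i T hT : B) = E i * T + (1 - E i) := rfl

theorem idem_mul_loc (i : V) (T : Bˣ) (hT : ∀ j, Commute (E j) (T : B)) :
    E i * (loc hE i T hT : B) = E i * T := by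
  have h3 : E i * E i = E i := hE.idem i
  rw [loc_val, mul_add, ← mul_assoc, h3, mul_sub, h3]; simp

theorem loc_mem (i : V) (T : Bˣ) (hT : ∀ j, Commute (E j) (T : B)) : loc hE i T hT ∈ locAt E i := by
  intro j hj
  rw [loc_val]
  refine ⟨?_, ?_⟩
  · rw [mul_add, ← mul_assoc, hE.ortho hj, mul_sub, hE.ortho hj]; simp
  · rw [add_mul, (hT i).eq, mul_assoc, hE.ortho hj.symm, sub_mul, hE.ortho hj.symm]; simp

theorem eq_loc {i : V} {T : Bˣ} (hT : ∀ j, Commute (E j) (T : B)) {T' : Bˣ} (h : T' ∈ locAt E i)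
    (h' : E i * (T' : B) = E i * T) : T' = loc hE i T hT := by
  ext
  apply eq_of_idem_mul hE
  intro j
  by_cases hj : j = i
  · subst hj; rw [h', idem_mul_loc]
  · rw [(h j hj).1, (loc_mem hE i T hT j hj).1]

variable {D : Type*} (tl : D → V) (G : D → Bˣ) (hG : ∀ d, G d ∈ locAt E (tl d)) (s : D → ℤ)

omit [Fintype V] hE in
theorem commute_prod {T : List Bˣ} (hT : ∀ t ∈ T, ∀ j, Commute (E j) (t : B)) (j : V) :
    Commute (E j) ((T.prod : Bˣ) : B) := by
  induction T with
  | nil => simp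
  | cons a T ih =>
    rw [List.prod_cons, Units.val_mul]
    exact (hT a (by simp) j).mul_right (ih fun t ht => hT t (by simp [ht]))

include hG

theorem commute_map_prod (l : List D) (j : V) :
    Commute (E j) (((l.map fun d => G d ^ s d).prod : Bˣ) : B) := by
  apply commute_prod
  intro t ht j
  obtain ⟨d, _, rfl⟩ := List.mem_map.1 ht
  exact commute_of_mem_locAt hE (Subgroup.zpow_mem _ (hG d) _) j

omit [Fintype V] hE in
theorem filter_prod_mem [DecidableEq V] (i : V) (l : List D) :
    ((l.filter fun d => tl d = i).map fun d => G d ^ s d).prod ∈ locAt E i := by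
  apply Subgroup.list_prod_mem
  intro t ht
  obtain ⟨d, hd, rfl⟩ := List.mem_map.1 ht
  have := (List.mem_filter.1 hd).2
  simp only [decide_eq_true_eq] at this
  subst this
  exact Subgroup.zpow_mem _ (hG d) _

theorem idem_mul_filter_prod [DecidableEq V] (i : V) (l : List D) :
    E i * (((l.filter fun d => tl d = i).map fun d => G d ^ s d).prod : Bˣ) =
      E i * ((l.map fun d => G d ^ s d).prod : Bˣ) := by
  induction l with
  | nil => simp
  | cons d l ih =>
    by_cases hd : tl d = i
    · rw [List.filter_cons_of_pos (by simpa using hd)]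
      simp only [List.map_cons, List.prod_cons, Units.val_mul]
      have hc := commute_of_mem_locAt hE (Subgroup.zpow_mem _ (hG d) (s d)) i
      rw [← mul_assoc, hc.eq, mul_assoc, ih, ← mul_assoc, ← hc.eq, mul_assoc]
    · rw [List.filter_cons_of_neg (by simpa using hd), ih]
      simp only [List.map_cons, List.prod_cons, Units.val_mul]
      rw [← mul_assoc, (Subgroup.zpow_mem _ (hG d) (s d) i (Ne.symm hd)).1]

end Located

/-! ### The module of normal words -/

/-- The factors of flat normal words: a basis element `e_i x^m a^l` of the algebra of the cycle,
a letter of the complement of the cycle, or a power of `r` or `r'` at a vertex. -/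
inductive Atom (n : ℕ) (V E : Type*)
  | cyc (i : ZMod n) (m l : ℤ) : Atom n V E
  | letter (x : Letter E) : Atom n V E
  | pow (i : V) (m : ℤ) : Atom n V E

/-- Sequences of atoms. -/
abbrev Atoms (n : ℕ) (V E : Type*) := List (Atom n V E)

/-- The data on which the notion of a flat normal word depends: the quiver of the letters, the
vertices of the cycle, the forest, and the set of kinds of atoms (`0`, `1`, `2` for the three
constructors of `Atom`) which are allowed. -/
structure WordData (n : ℕ) (V E : Type*) where
  quiver : ArrowQuiver V E
  cyc : ZMod n → V
  forest : Set E
  kinds : Set (Fin 3)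

namespace WordData

variable {n : ℕ} {V E : Type*} (D : WordData n V E)

/-- The vertex at which an atom starts. -/
def src : Atom n V E → V
  | .cyc i _ _ => D.cyc i
  | .letter x => x.src D.quiver
  | .pow i _ => i

/-- The vertex at which an atom ends. -/
def tgt : Atom n V E → V
  | .cyc i _ l => D.cyc (i + l)
  | .letter x => x.tgt D.quiver
  | .pow i _ => i

/-- The atoms which may occur in normal words. -/
def Good : Atom n V E → Prop
  | .cyc _ m l => 0 ∈ D.kinds ∧ (m ≠ 0 ∨ l ≠ 0)
  | .letter x => 1 ∈ D.kinds ∧ ¬ Letter.Forbidden₁ D.forest x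
  | .pow _ m => 2 ∈ D.kinds ∧ m ≠ 0

/-- The pairs of atoms which may be adjacent in normal words, if they can be concatenated. -/
def Ok : Atom n V E → Atom n V E → Prop
  | .letter x, .letter y => ¬ Letter.Forbidden₂ D.forest x y
  | .cyc _ _ _, .cyc _ _ _ => False
  | .pow _ _, .pow _ _ => False
  | _, _ => True

/-- Normal words which start at a given vertex. -/
def IsWord : V → Atoms n V E → Prop
  | _, [] => True
  | v, x :: w => D.Good x ∧ D.src x = v ∧ (∀ y ∈ w.head?, D.Ok x y) ∧ IsWord (D.tgt x) w

/-- Does the word start with an atom of the cycle? -/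
def StartsCyc : Atoms n V E → Prop
  | .cyc _ _ _ :: _ => True
  | _ => False

/-- Does the word start with a power of `r` or `r'`? -/
def StartsPow : Atoms n V E → Prop
  | .pow _ _ :: _ => True
  | _ => False

/-- The number of atoms of the cycle in a word. -/
def cnt : Atoms n V E → ℕ
  | [] => 0
  | .cyc _ _ _ :: w => cnt w + 1
  | _ :: w => cnt w

variable (k : Type*) [Field k]

/-- The vector space with basis the normal words. -/
def Space : Type _ := {p : V × Atoms n V E // D.IsWord p.1 p.2} →₀ k

instance : AddCommGroup (D.Space k) := inferInstanceAs (AddCommGroup (_ →₀ k))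

instance : Module k (D.Space k) := inferInstanceAs (Module k (_ →₀ k))

/-- The basis of the module formed by the normal words. -/
def wordBasis : Basis {p : V × Atoms n V E // D.IsWord p.1 p.2} k (D.Space k) :=
  ⟨LinearEquiv.refl k _⟩

/-- The linear operators on the space of normal words. -/
abbrev Op := End k (D.Space k)

open Classical in
/-- The basis vector of a normal word; it is `0` for sequences of atoms which are not normal. -/
def wd (v : V) (w : Atoms n V E) : D.Space k :=
  if h : D.IsWord v w then D.wordBasis k ⟨(v, w), h⟩ else 0

variable {k D}

theorem wd_of_not {v : V} {w : Atoms n V E} (h : ¬ D.IsWord v w) : D.wd k v w = 0 := dif_neg h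

theorem wd_of {v : V} {w : Atoms n V E} (h : D.IsWord v w) :
    D.wd k v w = D.wordBasis k ⟨(v, w), h⟩ := dif_pos h

variable {N : Type*} [AddCommGroup N] [Module k N]

variable (D) in
/-- The linear map with given values on words. -/
def lin (f : V → Atoms n V E → N) : D.Space k →ₗ[k] N :=
  (D.wordBasis k).constr k fun p => f p.1.1 p.1.2

theorem lin_wd (f : V → Atoms n V E → N) {v : V} {w : Atoms n V E}
    (h : D.IsWord v w) : D.lin f (D.wd k v w) = f v w := by
  rw [lin, wd_of h, Basis.constr_basis]

theorem lin_wd' (f : V → Atoms n V E → N) {v : V} {w : Atoms n V E}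
    (h : ¬ D.IsWord v w → f v w = 0) : D.lin f (D.wd k v w) = f v w := by
  by_cases hw : D.IsWord v w
  · exact lin_wd f hw
  · rw [wd_of_not hw, h hw, map_zero]

theorem space_ext {f g : D.Space k →ₗ[k] N}
    (h : ∀ v w, D.IsWord v w → f (D.wd k v w) = g (D.wd k v w)) : f = g := by
  refine (D.wordBasis k).ext ?_
  rintro ⟨⟨v, w⟩, hw⟩
  have := h v w hw
  rwa [wd_of hw] at this

theorem space_induction {P : D.Space k → Prop} (x : D.Space k)
    (hmk : ∀ v w, D.IsWord v w → P (D.wd k v w)) (hadd : ∀ x y, P x → P y → P (x + y))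
    (hsmul : ∀ (c : k) x, P x → P (c • x)) (h0 : P 0) : P x := by
  rw [← (D.wordBasis k).linearCombination_repr x, Finsupp.linearCombination_apply]
  refine Finset.sum_induction _ P hadd h0 fun a _ => hsmul _ _ ?_
  have := hmk a.1.1 a.1.2 a.2
  rwa [wd_of a.2] at this

theorem lin_mem {f : V → Atoms n V E → N} {S : Submodule k N}
    (h : ∀ v w, D.IsWord v w → f v w ∈ S) (x : D.Space k) : D.lin f x ∈ S := by
  refine space_induction (P := fun x => D.lin f x ∈ S) x (fun v w hw => ?_)
    (fun x y hx hy => ?_) (fun c x hx => ?_) ?_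
  · rw [lin_wd f hw]; exact h v w hw
  · rw [map_add]; exact S.add_mem hx hy
  · rw [map_smul]; exact S.smul_mem c hx
  · rw [map_zero]; exact S.zero_mem

/-! The two gradings of the module: by the starting vertex and by the number of cycle atoms. -/

open Classical in
variable (D k) in
/-- The projection to the words which start at `i`. -/
def vproj (i : V) : D.Op k := D.lin fun v w => if v = i then D.wd k v w else 0

open Classical in
variable (D k) in
/-- The projection to the words with `c` atoms of the cycle. -/
def cproj (c : ℕ) : D.Op k := D.lin fun v w => if cnt w = c then D.wd k v w else 0

theorem vproj_wd_self (v : V) (w : Atoms n V E) : D.vproj k v (D.wd k v w) = D.wd k v w := by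
  rw [vproj, lin_wd' _ fun h => by simp [wd_of_not h]]; simp

theorem vproj_wd_of_ne {v i : V} (h : v ≠ i) (w : Atoms n V E) :
    D.vproj k i (D.wd k v w) = 0 := by
  rw [vproj, lin_wd' _ fun h => by simp [wd_of_not h]]; simp [h]

theorem cproj_wd_self (v : V) (w : Atoms n V E) :
    D.cproj k (cnt w) (D.wd k v w) = D.wd k v w := by
  rw [cproj, lin_wd' _ fun h => by simp [wd_of_not h]]; simp

theorem cproj_wd_of_ne {v : V} {c : ℕ} {w : Atoms n V E} (h : cnt w ≠ c) :
    D.cproj k c (D.wd k v w) = 0 := by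
  rw [cproj, lin_wd' _ fun h => by simp [wd_of_not h]]; simp [h]

theorem vproj_idem [Fintype V] : CompleteOrthogonalIdempotents (D.vproj k) where
  idem i := by
    apply space_ext
    intro v w _
    by_cases h : v = i
    · subst h; simp [vproj_wd_self]
    · simp [vproj_wd_of_ne h]
  ortho i j hij := by
    apply space_ext
    intro v w _
    by_cases h : v = j
    · subst h; simp [vproj_wd_self, vproj_wd_of_ne hij.symm]
    · simp [vproj_wd_of_ne h]
  complete := by
    apply space_ext
    intro v w _
    rw [LinearMap.sum_apply, Finset.sum_eq_single v]
    · simp [vproj_wd_self]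
    · intro i _ hi; exact vproj_wd_of_ne hi.symm w
    · simp

variable (D k) in
/-- The vectors which are homogeneous for both gradings. -/
def piece (v : V) (c : ℕ) : Submodule k (D.Space k) :=
  LinearMap.eqLocus (D.vproj k v) LinearMap.id ⊓ LinearMap.eqLocus (D.cproj k c) LinearMap.id

theorem wd_mem_piece (v : V) (w : Atoms n V E) : D.wd k v w ∈ D.piece k v (cnt w) :=
  ⟨vproj_wd_self v w, cproj_wd_self v w⟩

theorem vproj_of_mem_of_ne {v i : V} {c : ℕ} {x : D.Space k} (h : x ∈ D.piece k v c)
    (hi : v ≠ i) : D.vproj k i x = 0 := by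
  classical
  rw [show x = D.vproj k v x from h.1.symm]
  have : D.vproj k i * D.vproj k v = 0 := by
    apply space_ext
    intro u w _
    by_cases h : u = v
    · subst h; simp [vproj_wd_self, vproj_wd_of_ne hi]
    · simp [vproj_wd_of_ne h]
  exact LinearMap.congr_fun this x

theorem cproj_of_mem_of_ne {v : V} {c d : ℕ} {x : D.Space k} (h : x ∈ D.piece k v c)
    (hi : c ≠ d) : D.cproj k d x = 0 := by
  rw [show x = D.cproj k c x from h.2.symm]
  have : D.cproj k d * D.cproj k c = 0 := by
    apply space_ext
    intro u w _
    by_cases h : cnt w = c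
    · subst h; simp [cproj_wd_self, cproj_wd_of_ne hi]
    · simp [cproj_wd_of_ne h]
  exact LinearMap.congr_fun this x

variable (D k) in
/-- The span of the words with a given property. -/
def wspan (P : V → Atoms n V E → Prop) : Submodule k (D.Space k) :=
  Submodule.span k {x | ∃ v w, D.IsWord v w ∧ P v w ∧ x = D.wd k v w}

theorem wd_mem_wspan {P : V → Atoms n V E → Prop} {v : V} {w : Atoms n V E}
    (h : D.IsWord v w → P v w) : D.wd k v w ∈ D.wspan k P := by
  by_cases hw : D.IsWord v w
  · exact Submodule.subset_span ⟨v, w, hw, h hw, rfl⟩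
  · rw [wd_of_not hw]; exact Submodule.zero_mem _

theorem wspan_induction {P : V → Atoms n V E → Prop} {S : Submodule k (D.Space k)}
    (h : ∀ v w, D.IsWord v w → P v w → D.wd k v w ∈ S) : D.wspan k P ≤ S := by
  apply Submodule.span_le.2
  rintro _ ⟨v, w, hw, hP, rfl⟩
  exact h v w hw hP

theorem wspan_mono {P P' : V → Atoms n V E → Prop} (h : ∀ v w, P v w → P' v w) :
    D.wspan k P ≤ D.wspan k P' :=
  wspan_induction fun v w _ hP => wd_mem_wspan fun _ => h v w hP

theorem piece_le_wspan (v : V) (c : ℕ) :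
    D.piece k v c ≤ D.wspan k fun u w => u = v ∧ cnt w = c := by
  intro x hx
  have hx' : x = D.vproj k v (D.cproj k c x) := by rw [hx.2]; exact hx.1.symm
  rw [hx']
  refine space_induction (P := fun x => D.vproj k v (D.cproj k c x) ∈ _) x (fun u w _ => ?_)
    (fun x y hx hy => ?_) (fun c x hx => ?_) ?_
  · by_cases h : cnt w = c
    · subst h
      rw [cproj_wd_self]
      by_cases hu : u = v
      · subst hu; rw [vproj_wd_self]; exact wd_mem_wspan fun _ => ⟨rfl, rfl⟩
      · rw [vproj_wd_of_ne hu]; exact Submodule.zero_mem _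
    · rw [cproj_wd_of_ne h, map_zero]; exact Submodule.zero_mem _
  · rw [map_add, map_add]; exact Submodule.add_mem _ hx hy
  · rw [map_smul, map_smul]; exact Submodule.smul_mem _ _ hx
  · rw [map_zero, map_zero]; exact Submodule.zero_mem _

/-- An operator which maps the words starting at `t` to words starting at `s`, kills the other
words, and preserves the number of cycle atoms. -/
structure Shift (s t : V) (T : D.Op k) : Prop where
  mem : ∀ w, D.IsWord t w → T (D.wd k t w) ∈ D.piece k s (cnt w)
  zero : ∀ v w, v ≠ t → D.IsWord v w → T (D.wd k v w) = 0

namespace Shift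

variable {s t : V} {T : D.Op k} (h : Shift s t T)
include h

theorem vproj_mul : D.vproj k s * T = T := by
  apply space_ext
  intro v w hw
  by_cases hv : v = t
  · subst hv; exact (h.mem w hw).1
  · rw [End.mul_apply, h.zero v w hv hw, map_zero]

theorem mul_vproj : T * D.vproj k t = T := by
  apply space_ext
  intro v w hw
  rw [End.mul_apply]
  by_cases hv : v = t
  · subst hv; rw [vproj_wd_self]
  · rw [vproj_wd_of_ne hv, map_zero, h.zero v w hv hw]

theorem vproj_mul_of_ne {i : V} (hi : i ≠ s) : D.vproj k i * T = 0 := by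
  apply space_ext
  intro v w hw
  rw [End.mul_apply]
  by_cases hv : v = t
  · subst hv; exact vproj_of_mem_of_ne (h.mem w hw) hi.symm
  · rw [h.zero v w hv hw, map_zero]; rfl

theorem mul_vproj_of_ne {i : V} (hi : i ≠ t) : T * D.vproj k i = 0 := by
  apply space_ext
  intro v w hw
  rw [End.mul_apply]
  by_cases hv : v = i
  · subst hv; rw [vproj_wd_self, h.zero v w hi hw]; rfl
  · rw [vproj_wd_of_ne hv, map_zero]; rfl

theorem cproj_commute (c : ℕ) : Commute (D.cproj k c) T := by
  apply space_ext
  intro v w hw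
  rw [End.mul_apply, End.mul_apply]
  by_cases hv : v = t
  · subst hv
    by_cases hc : cnt w = c
    · subst hc; rw [cproj_wd_self, (h.mem w hw).2]; rfl
    · rw [cproj_wd_of_ne hc, map_zero, cproj_of_mem_of_ne (h.mem w hw) hc]
  · rw [h.zero v w hv hw, map_zero]
    by_cases hc : cnt w = c
    · subst hc; rw [cproj_wd_self, h.zero v w hv hw]
    · rw [cproj_wd_of_ne hc, map_zero]

theorem mem_piece {c : ℕ} {x : D.Space k} (hx : x ∈ D.piece k t c) : T x ∈ D.piece k s c := by
  refine ⟨LinearMap.congr_fun h.vproj_mul x, ?_⟩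
  have := LinearMap.congr_fun (h.cproj_commute c).eq x
  rw [End.mul_apply, End.mul_apply, hx.2] at this
  exact this

end Shift

/-- Operators which are compatible with both gradings. -/
structure Graded (T : D.Op k) : Prop where
  vert : ∀ v, Commute (D.vproj k v) T
  count : ∀ c, Commute (D.cproj k c) T

namespace Graded

variable {T T' : D.Op k}

theorem mem_piece (h : Graded T) {v : V} {c : ℕ} {x : D.Space k} (hx : x ∈ D.piece k v c) :
    T x ∈ D.piece k v c := by
  constructor
  · have := LinearMap.congr_fun (h.vert v).eq x
    rw [End.mul_apply, End.mul_apply, hx.1] at this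
    exact this
  · have := LinearMap.congr_fun (h.count c).eq x
    rw [End.mul_apply, End.mul_apply, hx.2] at this
    exact this

theorem one : Graded (1 : D.Op k) := ⟨fun _ => Commute.one_right _, fun _ => Commute.one_right _⟩

theorem mul (h : Graded T) (h' : Graded T') : Graded (T * T') :=
  ⟨fun v => (h.vert v).mul_right (h'.vert v), fun c => (h.count c).mul_right (h'.count c)⟩

theorem add (h : Graded T) (h' : Graded T') : Graded (T + T') :=
  ⟨fun v => (h.vert v).add_right (h'.vert v), fun c => (h.count c).add_right (h'.count c)⟩

theorem sub (h : Graded T) (h' : Graded T') : Graded (T - T') :=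
  ⟨fun v => (h.vert v).sub_right (h'.vert v), fun c => (h.count c).sub_right (h'.count c)⟩

theorem inv {T : (D.Op k)ˣ} (h : Graded (T : D.Op k)) :
    Graded (↑T⁻¹ : D.Op k) :=
  ⟨fun v => (h.vert v).units_inv_right, fun c => (h.count c).units_inv_right⟩

theorem of_mem (h : ∀ v w, D.IsWord v w → T (D.wd k v w) ∈ D.piece k v (cnt w)) : Graded T := by
  constructor
  · intro i
    apply space_ext
    intro v w hw
    rw [End.mul_apply, End.mul_apply]
    by_cases hv : v = i
    · subst hv; rw [vproj_wd_self]; exact (h v w hw).1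
    · rw [vproj_wd_of_ne hv, map_zero, vproj_of_mem_of_ne (h v w hw) hv]
  · intro c
    apply space_ext
    intro v w hw
    rw [End.mul_apply, End.mul_apply]
    by_cases hc : cnt w = c
    · subst hc; rw [cproj_wd_self]; exact (h v w hw).2
    · rw [cproj_wd_of_ne hc, map_zero, cproj_of_mem_of_ne (h v w hw) hc]

theorem vproj (i : V) : Graded (D.vproj k i) := of_mem fun v w _ => by
    by_cases hv : v = i
    · subst hv; rw [vproj_wd_self]; exact wd_mem_piece v w
    · rw [vproj_wd_of_ne hv]; exact Submodule.zero_mem _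

end Graded

variable (D k) in
/-- The graded units. -/
def gradedUnits : Subgroup (D.Op k)ˣ where
  carrier := {T | Graded (T : D.Op k)}
  one_mem' := Graded.one
  mul_mem' := fun h h' => Graded.mul h h'
  inv_mem' := fun h => Graded.inv h

/-! Evaluation of words in an algebra. -/

section Eval

variable {B : Type*} [Ring B] [Algebra k B]

variable (D) in
/-- The linear map from words to an algebra, given by elements for the vertices and the atoms. -/
def eval (eB : V → B) (val : Atom n V E → B) : D.Space k →ₗ[k] B :=
  D.lin fun v w => eB v * (w.map val).prod

theorem eval_wd {eB : V → B} {val : Atom n V E → B} {v : V} {w : Atoms n V E}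
    (h : D.IsWord v w) : D.eval (k := k) eB val (D.wd k v w) = eB v * (w.map val).prod :=
  lin_wd _ h

/-- The operator `T` corresponds to left multiplication by `b`. -/
def Eqv (Θ : D.Space k →ₗ[k] B) (T : D.Op k) (b : B) : Prop := ∀ x, Θ (T x) = b * Θ x

namespace Eqv

variable {Θ : D.Space k →ₗ[k] B} {T T' : D.Op k} {b b' : B}

theorem one : Eqv Θ 1 1 := fun x => by simp

theorem mul (h : Eqv Θ T b) (h' : Eqv Θ T' b') : Eqv Θ (T * T') (b * b') := fun x => by
  rw [End.mul_apply, h, h', mul_assoc]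

theorem add (h : Eqv Θ T b) (h' : Eqv Θ T' b') : Eqv Θ (T + T') (b + b') := fun x => by
  rw [LinearMap.add_apply, map_add, h, h', add_mul]

theorem sub (h : Eqv Θ T b) (h' : Eqv Θ T' b') : Eqv Θ (T - T') (b - b') := fun x => by
  rw [LinearMap.sub_apply, map_sub, h, h', sub_mul]

theorem smul (h : Eqv Θ T b) (c : k) : Eqv Θ (c • T) (c • b) := fun x => by
  rw [LinearMap.smul_apply, map_smul, h, smul_mul_assoc]

theorem of_words (h : ∀ v w, D.IsWord v w → Θ (T (D.wd k v w)) = b * Θ (D.wd k v w)) :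
    Eqv Θ T b := by
  intro x
  refine space_induction (P := fun x => Θ (T x) = b * Θ x) x h (fun x y hx hy => ?_) (fun c x hx => ?_) ?_
  · rw [map_add, map_add, hx, hy, map_add, mul_add]
  · rw [map_smul, map_smul, hx, map_smul, mul_smul_comm]
  · simp

theorem inv {T : (D.Op k)ˣ} {b : Bˣ} (h : Eqv Θ (T : D.Op k) (b : B)) :
    Eqv Θ (↑T⁻¹ : D.Op k) ((b⁻¹ : Bˣ) : B) := by
  intro x
  rw [Units.eq_inv_mul_iff_mul_eq, ← h, ← End.mul_apply, Units.mul_inv, End.one_apply]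

variable (Θ) in
/-- The pairs of units which correspond to each other. -/
def units : Subgroup ((D.Op k)ˣ × Bˣ) where
  carrier := {p | Eqv Θ (p.1 : D.Op k) (p.2 : B)}
  one_mem' := Eqv.one
  mul_mem' := fun h h' => Eqv.mul h h'
  inv_mem' := fun h => Eqv.inv h

theorem list_prod {ι : Type*} (l : List ι) (f : ι → (D.Op k)ˣ) (g : ι → Bˣ)
    (s : ι → ℤ) (h : ∀ i ∈ l, Eqv Θ (f i : D.Op k) (g i : B)) :
    Eqv Θ ((l.map fun i => f i ^ s i).prod : (D.Op k)ˣ).val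
      ((l.map fun i => g i ^ s i).prod : Bˣ).val := by
  have : (((l.map fun i => f i ^ s i).prod, (l.map fun i => g i ^ s i).prod) :
      (D.Op k)ˣ × Bˣ) ∈ units Θ := by
    induction l with
    | nil => exact (units Θ).one_mem
    | cons a l ih =>
      exact (units Θ).mul_mem (x := (f a ^ s a, g a ^ s a))
        ((units Θ).zpow_mem (x := (f a, g a)) (h a (by simp)) (s a)) (ih fun i hi => h i (by simp [hi]))
  exact this

end Eqv

end Eval

end WordData

/-! ### Bases of the ring of Laurent polynomials -/

section Laurent

open LaurentPolynomial

theorem signedPow_zero {A : Type*} [Monoid A] (x y : A) : signedPow x y 0 = 1 := by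
  simp [signedPow]

theorem signedPow_nat {A : Type*} [Monoid A] (x y : A) (m : ℕ) : signedPow x y (m : ℤ) = x ^ m := by
  simp [signedPow]

theorem signedPow_neg {A : Type*} [Monoid A] (x y : A) (m : ℕ) : signedPow x y (-(m : ℤ)) = y ^ m := by
  cases m with
  | zero => simp [signedPow]
  | succ m =>
    have : ¬ (0 : ℤ) ≤ -((m + 1 : ℕ) : ℤ) := by omega
    rw [signedPow, if_neg this, neg_neg, Int.toNat_natCast]

theorem signedPow_add_one {A : Type*} [Monoid A] (x y : A) {m : ℤ} (h : 0 ≤ m) :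
    signedPow x y (m + 1) = x * signedPow x y m := by
  lift m to ℕ using h
  rw [signedPow_nat, ← pow_succ', ← signedPow_nat x y, Nat.cast_succ]

theorem signedPow_sub_one {A : Type*} [Monoid A] (x y : A) {m : ℤ} (h : m ≤ 0) :
    signedPow x y (m - 1) = y * signedPow x y m := by
  obtain ⟨m, rfl⟩ : ∃ l : ℕ, m = -l := ⟨(-m).toNat, by omega⟩
  rw [signedPow_neg, ← pow_succ', ← signedPow_neg x y]
  congr 1
  push_cast
  ring

theorem map_signedPow {A B F : Type*} [Monoid A] [Monoid B] [FunLike F A B] [MonoidHomClass F A B]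
    (f : F) (x y : A) (m : ℤ) : f (signedPow x y m) = signedPow (f x) (f y) m := by
  unfold signedPow
  split_ifs <;> simp

variable {k A : Type*} [Field k] [Ring A] [Algebra k A]

variable (k) in
/-- Evaluation of Laurent polynomials at a unit of a (not necessarily commutative) algebra. -/
def laurentEval (u : Aˣ) : k[T;T⁻¹] →ₐ[k] A :=
  AddMonoidAlgebra.lift k A ℤ ((Units.coeHom A).comp (zpowersHom Aˣ u))

theorem laurentEval_T (u : Aˣ) (m : ℤ) : laurentEval k u (T m) = ((u ^ m : Aˣ) : A) := by
  have := AddMonoidAlgebra.lift_single (R := k) (A := A) ((Units.coeHom A).comp (zpowersHom Aˣ u)) m (1 : k)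
  rw [one_smul] at this
  exact this

variable (k) in
/-- The basis of the Laurent polynomials formed by the powers of the variable. -/
def laurentBasis : Basis ℤ k k[T;T⁻¹] := AddMonoidAlgebra.basis ℤ k

theorem laurentBasis_apply (m : ℤ) : laurentBasis k m = T m := by
  rfl

/-- `T ^ m ↦ (T + δ) ^ m` and `T ^ (-m) ↦ (T⁻¹ + δ') ^ m` for `m ≥ 0`. -/
def laurentShift (δ δ' : k) : k[T;T⁻¹] →ₗ[k] k[T;T⁻¹] :=
  (laurentBasis k).constr k fun m => signedPow (T 1 + C δ) (T (-1) + C δ') m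

theorem laurentShift_T (δ δ' : k) (m : ℤ) :
    laurentShift δ δ' (T m) = signedPow (T 1 + C δ) (T (-1) + C δ') m := by
  rw [laurentShift, ← laurentBasis_apply m, Basis.constr_basis]

theorem laurentShift_aeval_pos (δ δ' : k) (f : Polynomial k) :
    laurentShift δ δ' (Polynomial.aeval (T 1) f) = Polynomial.aeval (T 1 + C δ : k[T;T⁻¹]) f := by
  induction f using Polynomial.induction_on' with
  | add f g hf hg => rw [map_add, map_add, hf, hg, map_add]
  | monomial m c =>
    rw [← mul_one c, ← smul_eq_mul, ← Polynomial.smul_monomial, map_smul, map_smul, map_smul]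
    simp only [Polynomial.monomial_one_right_eq_X_pow, map_pow, Polynomial.aeval_X, T_pow, mul_one]
    rw [laurentShift_T, signedPow_nat]

theorem laurentShift_aeval_neg (δ δ' : k) (f : Polynomial k) :
    laurentShift δ δ' (Polynomial.aeval (T (-1)) f) =
      Polynomial.aeval (T (-1) + C δ' : k[T;T⁻¹]) f := by
  induction f using Polynomial.induction_on' with
  | add f g hf hg => rw [map_add, map_add, hf, hg, map_add]
  | monomial m c =>
    rw [← mul_one c, ← smul_eq_mul, ← Polynomial.smul_monomial, map_smul, map_smul, map_smul]
    simp only [Polynomial.monomial_one_right_eq_X_pow, map_pow, Polynomial.aeval_X, T_pow]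
    rw [mul_neg_one, laurentShift_T, signedPow_neg]

theorem laurentShift_comp (δ δ' : k) :
    laurentShift δ δ' ∘ₗ laurentShift (-δ) (-δ') = LinearMap.id := by
  apply (laurentBasis k).ext
  intro m
  rw [laurentBasis_apply, LinearMap.comp_apply, laurentShift_T, LinearMap.id_apply]
  obtain ⟨m, rfl | rfl⟩ := m.eq_nat_or_neg
  · have := laurentShift_aeval_pos δ δ' ((Polynomial.X - Polynomial.C δ) ^ m)
    simp only [map_pow, map_sub, Polynomial.aeval_X, Polynomial.aeval_C, ← C_eq_algebraMap,
      add_sub_cancel_right, T_pow, mul_one] at this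
    rw [signedPow_nat, map_neg, ← sub_eq_add_neg, this]
  · have := laurentShift_aeval_neg δ δ' ((Polynomial.X - Polynomial.C δ') ^ m)
    simp only [map_pow, map_sub, Polynomial.aeval_X, Polynomial.aeval_C, ← C_eq_algebraMap,
      add_sub_cancel_right, T_pow, mul_neg_one] at this
    rw [signedPow_neg, map_neg, ← sub_eq_add_neg, this]

/-- The basis of the Laurent polynomials formed by the powers of `T - δ` and of `T⁻¹ - δ'`. -/
def shiftedBasis (δ δ' : k) : Basis ℤ k k[T;T⁻¹] :=
  (laurentBasis k).map (LinearEquiv.ofLinearMap (laurentShift (-δ) (-δ')) (laurentShift δ δ')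
    (by simpa using laurentShift_comp (-δ) (-δ')) (laurentShift_comp δ δ'))

theorem shiftedBasis_apply (δ δ' : k) (m : ℤ) :
    shiftedBasis δ δ' m = signedPow (T 1 - C δ) (T (-1) - C δ') m := by
  simp [shiftedBasis, laurentBasis_apply, laurentShift_T, sub_eq_add_neg]

theorem shiftedBasis_zero (δ δ' : k) : shiftedBasis δ δ' 0 = 1 := by
  rw [shiftedBasis_apply, signedPow_zero]

theorem laurentEval_shiftedBasis (u : Aˣ) (δ δ' : k) (m : ℤ) :
    laurentEval k u (shiftedBasis δ δ' m) =
      signedPow ((u : A) - algebraMap k A δ) (((u⁻¹ : Aˣ) : A) - algebraMap k A δ') m := by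
  rw [shiftedBasis_apply, map_signedPow]
  have hc (c : k) : laurentEval k u (C c) = algebraMap k A c := by
    rw [C_eq_algebraMap, AlgHom.commutes]
  rw [map_sub, map_sub, hc, hc, laurentEval_T, laurentEval_T, zpow_one, zpow_neg_one]

end Laurent

/-! ### The action of the letters on normal words -/

namespace WordData

open Classical

variable {n : ℕ} {V E : Type*} {D : WordData n V E} {k : Type*} [Field k]

/-- The atom given by an arrow. -/
abbrev aL (d : DArrow E) : Atom n V E := .letter (.arr d)

/-- The atom `x_d - 1` or `x_d⁻¹ - 1`. -/
abbrev bL (d : DArrow E) (s : Bool) : Atom n V E := .letter (.bar d s)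

theorem IsWord.tail {v : V} {x : Atom n V E} {w : Atoms n V E} (h : D.IsWord v (x :: w)) :
    D.IsWord (D.tgt x) w := h.2.2.2

theorem IsWord.ok {v : V} {x : Atom n V E} {w : Atoms n V E} (h : D.IsWord v (x :: w)) :
    ∀ y ∈ w.head?, D.Ok x y := h.2.2.1

theorem IsWord.good {v : V} {x : Atom n V E} {w : Atoms n V E} (h : D.IsWord v (x :: w)) :
    D.Good x := h.1

theorem IsWord.src {v : V} {x : Atom n V E} {w : Atoms n V E} (h : D.IsWord v (x :: w)) :
    D.src x = v := h.2.1

theorem IsWord.good_head {v : V} {w : Atoms n V E} (h : D.IsWord v w) :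
    ∀ x ∈ w.head?, D.Good x := by
  cases w with
  | nil => simp
  | cons x w => simpa using h.good

theorem cons_or (x : Atom n V E) (w : Atoms n V E) :
    (∃ w', w = x :: w') ∨ ∀ y ∈ w.head?, y ≠ x := by
  cases w with
  | nil => simp
  | cons y w => by_cases h : y = x <;> simp [h]

/-! The operators `x_d - 1` and `x_d⁻¹ - 1` for an arrow `d` outside the forest. -/

variable (D k) in
/-- The product of `x_d^{±1} - 1` with a normal word. -/
def barFun (d : DArrow E) (s : Bool) (v : V) : Atoms n V E → D.Space k
  | [] => if v = D.quiver.dtail d then D.wd k v [bL d s] else 0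
  | x :: w => if v = D.quiver.dtail d then
      (if x = bL d !s then -barFun d s v w - D.wd k v (x :: w) else D.wd k v (bL d s :: x :: w))
      else 0

variable (D k) in
/-- The operator of left multiplication by `x_d - 1` or `x_d⁻¹ - 1`. -/
def bar (d : DArrow E) (s : Bool) : D.Op k := D.lin (D.barFun k d s)

theorem bar_wd_of_ne {d : DArrow E} {s : Bool} {v : V} {w : Atoms n V E}
    (hv : v ≠ D.quiver.dtail d) : D.bar k d s (D.wd k v w) = 0 := by
  have : D.barFun k d s v w = 0 := by cases w <;> simp [barFun, hv]
  rw [bar, lin_wd' _ fun _ => this, this]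

theorem bar_wd_of {d : DArrow E} {s : Bool} {w : Atoms n V E}
    (hw : D.IsWord (D.quiver.dtail d) w) (h : ∀ y ∈ w.head?, y ≠ bL d !s) :
    D.bar k d s (D.wd k (D.quiver.dtail d) w) = D.wd k (D.quiver.dtail d) (bL d s :: w) := by
  rw [bar, lin_wd _ hw]
  cases w with
  | nil => simp [barFun]
  | cons x w => simp only [barFun, if_true]; rw [if_neg (by simpa using h)]

theorem bar_wd_cancel {d : DArrow E} {s : Bool} {w : Atoms n V E}
    (hw : D.IsWord (D.quiver.dtail d) (bL d (!s) :: w)) :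
    D.bar k d s (D.wd k (D.quiver.dtail d) (bL d (!s) :: w)) =
      -D.bar k d s (D.wd k (D.quiver.dtail d) w) -
        D.wd k (D.quiver.dtail d) (bL d (!s) :: w) := by
  have hw' : D.IsWord (D.quiver.dtail d) w := hw.tail
  rw [bar, lin_wd _ hw, lin_wd _ hw']
  simp [barFun]

variable (D) in
/-- Induction on the number of leading letters `x_d^{±1} - 1` of a word. -/
theorem bar_induction (d : DArrow E) (s : Bool) {P : Atoms n V E → Prop}
    (h : ∀ w, D.IsWord (D.quiver.dtail d) w → (∀ y ∈ w.head?, y ≠ bL d !s) → P w)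
    (hc : ∀ w, D.IsWord (D.quiver.dtail d) (bL d (!s) :: w) → D.IsWord (D.quiver.dtail d) w →
      P w → P (bL d (!s) :: w)) : ∀ w, D.IsWord (D.quiver.dtail d) w → P w
  | [], hw => h _ hw (by simp)
  | x :: w, hw => by
    by_cases hx : x = bL d !s
    · subst hx; exact hc w hw hw.tail (bar_induction d s h hc w hw.tail)
    · exact h _ hw (by simpa using hx)

section NonForest

variable (h1 : 1 ∈ D.kinds) {d : DArrow E} (hd : d.arrow ∉ D.forest)
include h1 hd

theorem isWord_bar {s : Bool} {w : Atoms n V E}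
    (hw : D.IsWord (D.quiver.dtail d) w) (h : ∀ y ∈ w.head?, y ≠ bL d !s) :
    D.IsWord (D.quiver.dtail d) (bL d s :: w) := by
  refine ⟨⟨h1, ?_⟩, rfl, fun y hy => ?_, hw⟩
  · intro hf
    cases hf with
    | bar _ _ hf => exact hd hf
    | bar_star _ hf => exact hd hf
  · have := h y hy
    cases y with
    | cyc => trivial
    | pow => trivial
    | letter y =>
      intro hf
      cases hf with
      | bar_bar => exact this rfl
      | forest_arr _ hf => exact hd hf
      | forest_sq _ hf => exact hd hf

omit hd in
theorem isWord_arr {w : Atoms n V E} (hw : D.IsWord (D.quiver.dhead d) w)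
    (h : ∀ y ∈ w.head?, y ≠ aL d.star ∧ ∀ s, y ≠ bL d.star s) :
    D.IsWord (D.quiver.dtail d) (aL d :: w) := by
  refine ⟨⟨h1, ?_⟩, rfl, fun y hy => ?_, hw⟩
  · intro hf; cases hf
  · have := h y hy
    cases y with
    | cyc => trivial
    | pow => trivial
    | letter y =>
      intro hf
      cases hf with
      | arr_star => exact this.1 rfl
      | arr_bar _ s => exact this.2 s rfl

omit h1 hd in
theorem bar_head {s : Bool} {v : V} {w : Atoms n V E} (hw : D.IsWord v (bL d s :: w)) :
    ∀ y ∈ w.head?, y ≠ bL d !s := by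
  rintro y hy rfl
  exact hw.ok _ hy (.bar_bar d s)

theorem bar_mul_bar (s : Bool) :
    D.bar k d s * D.bar k d (!s) = -D.bar k d s - D.bar k d !s := by
  apply space_ext
  intro v w
  simp only [End.mul_apply, LinearMap.sub_apply, LinearMap.neg_apply]
  by_cases hv : v = D.quiver.dtail d
  swap
  · intro _; simp [bar_wd_of_ne hv]
  subst hv
  revert w
  refine bar_induction D d (!s) (fun w hw h => ?_) fun w hw hw' ih => ?_
  · rw [bar_wd_of (s := !s) hw h, bar_wd_cancel (isWord_bar h1 hd hw h)]
  · have hc := bar_wd_cancel (k := k) hw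
    rw [Bool.not_not] at hc hw ⊢
    rw [hc, map_sub, map_neg, ih, bar_wd_of (s := s) hw' (bar_head hw)]
    abel

omit h1 hd in
theorem bar_mem_wspan (s : Bool) (x : D.Space k) :
    D.bar k d s x ∈ D.wspan k fun _ w => ¬ StartsCyc w := by
  have key : ∀ v w, D.IsWord v w → D.bar k d s (D.wd k v w) ∈ D.wspan k fun _ w => ¬ StartsCyc w := by
    intro v w hw
    by_cases hv : v = D.quiver.dtail d
    swap
    · rw [bar_wd_of_ne hv]; exact Submodule.zero_mem _
    subst hv
    revert w
    refine bar_induction D d s (fun w hw h => ?_) fun w hw _ ih => ?_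
    · rw [bar_wd_of hw h]
      exact wd_mem_wspan fun _ h => h
    · rw [bar_wd_cancel hw]
      exact Submodule.sub_mem _ (Submodule.neg_mem _ ih) (wd_mem_wspan fun _ h => h)
  refine space_induction (P := fun x => D.bar k d s x ∈ _) x key (fun x y hx hy => ?_)
    (fun c x hx => ?_) ?_
  · rw [map_add]; exact Submodule.add_mem _ hx hy
  · rw [map_smul]; exact Submodule.smul_mem _ _ hx
  · rw [map_zero]; exact Submodule.zero_mem _

omit h1 hd in
theorem bar_shift (s : Bool) : Shift (D.quiver.dtail d) (D.quiver.dtail d) (D.bar k d s) := by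
  refine ⟨bar_induction D d s (fun w hw h => ?_) fun w hw _ ih => ?_, fun v w hv _ => bar_wd_of_ne hv⟩
  · rw [bar_wd_of hw h]
    exact wd_mem_piece _ _
  · rw [bar_wd_cancel hw]
    exact Submodule.sub_mem _ (Submodule.neg_mem _ ih) (wd_mem_piece _ _)

variable (k) in
/-- The operator `x_d`. -/
def gN : (D.Op k)ˣ where
  val := 1 + D.bar k d true
  inv := 1 + D.bar k d false
  val_inv := by
    have h := bar_mul_bar (k := k) h1 hd true
    simp only [Bool.not_true] at h
    rw [mul_add, add_mul, add_mul, h, mul_one, mul_one, one_mul]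
    abel
  inv_val := by
    have h := bar_mul_bar (k := k) h1 hd false
    simp only [Bool.not_false] at h
    rw [mul_add, add_mul, add_mul, h, mul_one, mul_one, one_mul]
    abel

end NonForest

/-! The operators of the arrows outside the forest. -/

variable (D k) in
/-- The product of an arrow outside the forest with a normal word. -/
def arFun (d : DArrow E) (v : V) : Atoms n V E → D.Space k
  | [] => if v = D.quiver.dhead d then D.wd k (D.quiver.dtail d) [aL d] else 0
  | x :: w => if v = D.quiver.dhead d then
      (if x = aL d.star then D.bar k d true (D.wd k (D.quiver.dtail d) w)
      else if x = bL d.star true then D.bar k d true (arFun d v w)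
      else if x = bL d.star false then D.bar k d false (arFun d v w)
      else D.wd k (D.quiver.dtail d) (aL d :: x :: w))
      else 0

variable (D k) in
/-- The operator of left multiplication by an arrow outside the forest. -/
def arN (d : DArrow E) : D.Op k := D.lin (D.arFun k d)

theorem arN_wd_of_ne {d : DArrow E} {v : V} {w : Atoms n V E}
    (hv : v ≠ D.quiver.dhead d) : D.arN k d (D.wd k v w) = 0 := by
  have : D.arFun k d v w = 0 := by cases w <;> simp [arFun, hv]
  rw [arN, lin_wd' _ fun _ => this, this]

theorem arN_wd_of {d : DArrow E} {w : Atoms n V E} (hw : D.IsWord (D.quiver.dhead d) w)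
    (h : ∀ y ∈ w.head?, y ≠ aL d.star ∧ ∀ s, y ≠ bL d.star s) :
    D.arN k d (D.wd k (D.quiver.dhead d) w) = D.wd k (D.quiver.dtail d) (aL d :: w) := by
  rw [arN, lin_wd _ hw]
  cases w with
  | nil => simp [arFun]
  | cons x w =>
    have := h x (by simp)
    simp only [arFun, if_true]
    rw [if_neg this.1, if_neg (this.2 _), if_neg (this.2 _)]

theorem arN_wd_star {d : DArrow E} {w : Atoms n V E}
    (hw : D.IsWord (D.quiver.dhead d) (aL d.star :: w)) :
    D.arN k d (D.wd k (D.quiver.dhead d) (aL d.star :: w)) =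
      D.bar k d true (D.wd k (D.quiver.dtail d) w) := by
  rw [arN, lin_wd _ hw]
  simp [arFun]

theorem IsWord.tail_star {v : V} {d : DArrow E} {s : Bool} {w : Atoms n V E}
    (h : D.IsWord v (bL d.star s :: w)) : D.IsWord (D.quiver.dhead d) w :=
  D.quiver.dtail_star d ▸ h.tail

theorem arN_wd_bar {d : DArrow E} {s : Bool} {w : Atoms n V E}
    (hw : D.IsWord (D.quiver.dhead d) (bL d.star s :: w)) :
    D.arN k d (D.wd k (D.quiver.dhead d) (bL d.star s :: w)) =
      D.bar k d s (D.arN k d (D.wd k (D.quiver.dhead d) w)) := by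
  rw [arN, lin_wd _ hw, lin_wd _ hw.tail_star]
  cases s <;> simp [arFun]

/-- The three ways in which an arrow outside the forest meets the start of a word. -/
theorem arN_induction {d : DArrow E} {P : Atoms n V E → Prop}
    (h : ∀ w, D.IsWord (D.quiver.dhead d) w →
      (∀ y ∈ w.head?, y ≠ aL d.star ∧ ∀ s, y ≠ bL d.star s) → P w)
    (hs : ∀ w, D.IsWord (D.quiver.dhead d) (aL d.star :: w) → P (aL d.star :: w))
    (hb : ∀ s w, D.IsWord (D.quiver.dhead d) (bL d.star s :: w) → P w → P (bL d.star s :: w)) :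
    ∀ w, D.IsWord (D.quiver.dhead d) w → P w
  | [], hw => h _ hw (by simp)
  | x :: w, hw => by
    by_cases hx : x = aL d.star
    · subst hx; exact hs w hw
    by_cases hx' : ∃ s, x = bL d.star s
    · obtain ⟨s, rfl⟩ := hx'
      exact hb s w hw (arN_induction h hs hb w hw.tail_star)
    · exact h _ hw (by
        simp only [List.head?_cons, Option.mem_some_iff, forall_eq']
        exact ⟨hx, fun s hs => hx' ⟨s, hs⟩⟩)

section NonForest

variable (h1 : 1 ∈ D.kinds) {d : DArrow E} (hd : d.arrow ∉ D.forest)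
include h1 hd

theorem arN_mul_bar (s : Bool) : D.arN k d * D.bar k d.star s = D.bar k d s * D.arN k d := by
  apply space_ext
  intro v w
  simp only [End.mul_apply]
  have hds : d.star.arrow ∉ D.forest := hd
  have hst := D.quiver.dtail_star d
  by_cases hv : v = D.quiver.dhead d
  swap
  · intro _; simp [bar_wd_of_ne (D := D) (k := k) (d := d.star) (hst ▸ hv), arN_wd_of_ne hv]
  subst hv
  rw [← hst]
  revert w
  refine bar_induction D d.star s (fun w hw hh => ?_) fun w hw hw' ih => ?_
  · have hb' := isWord_bar h1 hds hw hh
    rw [bar_wd_of hw hh, hst, arN_wd_bar (hst ▸ hb')]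
  · rw [bar_wd_cancel hw, map_sub, map_neg, ih, hst, arN_wd_bar (hst ▸ hw)]
    have := LinearMap.congr_fun (bar_mul_bar (k := k) h1 hd s)
      (D.arN k d (D.wd k (D.quiver.dhead d) w))
    simp only [End.mul_apply, LinearMap.sub_apply, LinearMap.neg_apply] at this
    rw [this]

theorem arN_mul_arN : D.arN k d * D.arN k d.star = D.bar k d true := by
  apply space_ext
  intro v w
  simp only [End.mul_apply]
  have hds : d.star.arrow ∉ D.forest := hd
  have hst := D.quiver.dtail_star d
  have hst' := D.quiver.dhead_star d
  by_cases hv : v = D.quiver.dtail d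
  swap
  · intro _
    rw [arN_wd_of_ne (d := d.star) (hst' ▸ hv), bar_wd_of_ne hv, map_zero]
  subst hv
  induction w with
  | nil =>
    intro hw
    have h := arN_wd_of (k := k) (d := d.star) (w := []) (by rwa [hst']) (by simp)
    have h' := isWord_arr h1 (w := []) (by rwa [hst']) (by simp)
    rw [hst, hst'] at h; rw [hst] at h'
    rw [h, arN_wd_star h']
  | cons x w ih =>
    intro hw
    by_cases hx : x = aL d
    · subst hx
      have h := arN_wd_star (k := k) (d := d.star) (w := w)
        (by rw [DArrow.star_star, hst']; exact hw)
      rw [DArrow.star_star, hst, hst'] at h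
      have hw' : D.IsWord (D.quiver.dhead d) w := hw.tail
      have hh : ∀ y ∈ w.head?, y ≠ aL d.star ∧ ∀ s, y ≠ bL d.star s := by
        intro y hy
        refine ⟨?_, fun s => ?_⟩
        · rintro rfl; exact hw.ok _ hy (.arr_star d)
        · rintro rfl; exact hw.ok _ hy (.arr_bar d s)
      have hm := LinearMap.congr_fun (arN_mul_bar (k := k) h1 hd true)
        (D.wd k (D.quiver.dhead d) w)
      simp only [End.mul_apply] at hm
      rw [h, hm, arN_wd_of hw' hh]
    by_cases hx' : ∃ s, x = bL d s
    · obtain ⟨s, rfl⟩ := hx'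
      have hw' : D.IsWord (D.quiver.dtail d) w := hw.tail
      have h := arN_wd_bar (k := k) (d := d.star) (s := s) (w := w)
        (by rw [DArrow.star_star, hst']; exact hw)
      rw [DArrow.star_star, hst'] at h
      have hm := LinearMap.congr_fun (arN_mul_bar (k := k) h1 hd s)
        (D.arN k d.star (D.wd k (D.quiver.dtail d) w))
      simp only [End.mul_apply] at hm
      have hb := bar_wd_of (k := k) hw' (bar_head hw)
      rw [h, hm, ih hw', ← hb]
      have hcomm : D.bar k d s * D.bar k d true = D.bar k d true * D.bar k d s := by
        cases s with
        | true => rfl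
        | false =>
          have e1 := bar_mul_bar (k := k) h1 hd true
          have e2 := bar_mul_bar (k := k) h1 hd false
          simp only [Bool.not_true, Bool.not_false] at e1 e2
          rw [e1, e2]; abel
      exact LinearMap.congr_fun hcomm _
    · have hh : ∀ y ∈ (x :: w).head?, y ≠ aL d.star.star ∧ ∀ s, y ≠ bL d.star.star s := by
        rw [DArrow.star_star]
        simp only [List.head?_cons, Option.mem_some_iff, forall_eq']
        exact ⟨hx, fun s hs => hx' ⟨s, hs⟩⟩
      have h := arN_wd_of (k := k) (d := d.star) (w := x :: w) (by rwa [hst']) hh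
      have h' := isWord_arr h1 (w := x :: w) (by rwa [hst']) hh
      rw [hst, hst'] at h; rw [hst] at h'
      rw [h, arN_wd_star h']

omit h1 hd in
theorem arN_shift : Shift (D.quiver.dtail d) (D.quiver.dhead d) (D.arN k d) := by
  refine ⟨arN_induction (fun w hw h => ?_) (fun w hw => ?_) fun s w hw ih => ?_,
    fun v w hv _ => arN_wd_of_ne hv⟩
  · rw [arN_wd_of hw h]
    exact wd_mem_piece _ _
  · rw [arN_wd_star hw]
    exact (bar_shift true).mem_piece (wd_mem_piece _ _)
  · rw [arN_wd_bar hw]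
    exact (bar_shift s).mem_piece ih

end NonForest

/-! The operators of the arrows of the forest, for a given operator `U` in the role of `x_b`. -/

variable (D k) in
/-- The product of the reverse of an arrow of the forest with a normal word. -/
def arFs (b : E) : D.Op k := D.lin fun v w =>
  if v = D.quiver.tail b then
    match w with
    | [] => D.wd k (D.quiver.head b) [aL ⟨b, false⟩]
    | x :: w => if x = aL ⟨b, true⟩ then D.wd k (D.quiver.head b) (bL ⟨b, false⟩ true :: w)
      else D.wd k (D.quiver.head b) (aL ⟨b, false⟩ :: x :: w)
  else 0

variable (D k) in
/-- The product of an arrow `b` of the forest with a normal word, where `x_b = 1 + b b*` is to be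
the operator `U`. -/
def arFo (b : E) (U : D.Op k) : D.Op k := D.lin fun v w =>
  if v = D.quiver.head b then
    match w with
    | [] => D.wd k (D.quiver.tail b) [aL ⟨b, true⟩]
    | x :: w => if x = aL ⟨b, false⟩ then (U - 1) (D.wd k (D.quiver.tail b) w)
      else if x = bL ⟨b, false⟩ true then (U - 1) (D.wd k (D.quiver.tail b) (aL ⟨b, true⟩ :: w))
      else D.wd k (D.quiver.tail b) (aL ⟨b, true⟩ :: x :: w)
  else 0

section Forest

variable {b : E} {U : D.Op k}

theorem arFs_wd_of_ne {v : V} {w : Atoms n V E} (hw : D.IsWord v w)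
    (hv : v ≠ D.quiver.tail b) : D.arFs k b (D.wd k v w) = 0 := by
  rw [arFs, lin_wd _ hw, if_neg hv]

theorem arFo_wd_of_ne {v : V} {w : Atoms n V E} (hw : D.IsWord v w)
    (hv : v ≠ D.quiver.head b) : D.arFo k b U (D.wd k v w) = 0 := by
  rw [arFo, lin_wd _ hw, if_neg hv]

theorem arFs_wd_of {w : Atoms n V E} (hw : D.IsWord (D.quiver.tail b) w)
    (h : ∀ y ∈ w.head?, y ≠ aL ⟨b, true⟩) :
    D.arFs k b (D.wd k (D.quiver.tail b) w) = D.wd k (D.quiver.head b) (aL ⟨b, false⟩ :: w) := by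
  rw [arFs, lin_wd _ hw, if_pos rfl]
  cases w with
  | nil => rfl
  | cons x w => exact if_neg (h x (by simp))

theorem arFs_wd_arr {w : Atoms n V E} (hw : D.IsWord (D.quiver.tail b) (aL ⟨b, true⟩ :: w)) :
    D.arFs k b (D.wd k (D.quiver.tail b) (aL ⟨b, true⟩ :: w)) =
      D.wd k (D.quiver.head b) (bL ⟨b, false⟩ true :: w) := by
  rw [arFs, lin_wd _ hw, if_pos rfl]
  exact if_pos rfl

theorem arFo_wd_of {w : Atoms n V E} (hw : D.IsWord (D.quiver.head b) w)
    (h : ∀ y ∈ w.head?, y ≠ aL ⟨b, false⟩ ∧ y ≠ bL ⟨b, false⟩ true) :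
    D.arFo k b U (D.wd k (D.quiver.head b) w) = D.wd k (D.quiver.tail b) (aL ⟨b, true⟩ :: w) := by
  rw [arFo, lin_wd _ hw, if_pos rfl]
  cases w with
  | nil => rfl
  | cons x w => exact (if_neg (h x (by simp)).1).trans (if_neg (h x (by simp)).2)

theorem arFo_wd_star {w : Atoms n V E} (hw : D.IsWord (D.quiver.head b) (aL ⟨b, false⟩ :: w)) :
    D.arFo k b U (D.wd k (D.quiver.head b) (aL ⟨b, false⟩ :: w)) =
      (U - 1) (D.wd k (D.quiver.tail b) w) := by
  rw [arFo, lin_wd _ hw, if_pos rfl]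
  exact if_pos rfl

theorem arFo_wd_bar {w : Atoms n V E} (hw : D.IsWord (D.quiver.head b) (bL ⟨b, false⟩ true :: w)) :
    D.arFo k b U (D.wd k (D.quiver.head b) (bL ⟨b, false⟩ true :: w)) =
      (U - 1) (D.wd k (D.quiver.tail b) (aL ⟨b, true⟩ :: w)) := by
  rw [arFo, lin_wd _ hw, if_pos rfl]
  exact (if_neg (by simp)).trans (if_pos rfl)

theorem arFs_shift : Shift (D.quiver.head b) (D.quiver.tail b) (D.arFs k b) := by
  refine ⟨fun w hw => ?_, fun v w hv hw => arFs_wd_of_ne hw hv⟩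
  rcases cons_or (aL ⟨b, true⟩) w with ⟨w', rfl⟩ | h
  · rw [arFs_wd_arr hw]; exact wd_mem_piece _ _
  · rw [arFs_wd_of hw h]; exact wd_mem_piece _ _

theorem arFs_mem_wspan (x : D.Space k) :
    D.arFs k b x ∈ D.wspan k fun _ w => ¬ StartsCyc w := by
  apply lin_mem
  intro v w hw
  split_ifs with h
  · rcases w with _ | ⟨x, w⟩
    · exact wd_mem_wspan fun _ h => h
    · simp only
      split_ifs
      · exact wd_mem_wspan fun _ h => h
      · exact wd_mem_wspan fun _ h => h
  · exact Submodule.zero_mem _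

theorem arFo_shift (hU : Graded U) : Shift (D.quiver.tail b) (D.quiver.head b) (D.arFo k b U) := by
  refine ⟨fun w hw => ?_, fun v w hv hw => arFo_wd_of_ne hw hv⟩
  have hU1 : Graded (U - 1) := hU.sub Graded.one
  rcases cons_or (aL ⟨b, false⟩) w with ⟨w', rfl⟩ | h
  · rw [arFo_wd_star hw]; exact hU1.mem_piece (wd_mem_piece _ _)
  rcases cons_or (bL ⟨b, false⟩ true) w with ⟨w', rfl⟩ | h'
  · rw [arFo_wd_bar hw]; exact hU1.mem_piece (wd_mem_piece _ _)
  · rw [arFo_wd_of hw fun y hy => ⟨h y hy, h' y hy⟩]; exact wd_mem_piece _ _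

theorem isWord_forest_bar (h1 : 1 ∈ D.kinds) {v : V} {w : Atoms n V E}
    (hw : D.IsWord v (aL ⟨b, true⟩ :: w)) :
    D.IsWord (D.quiver.head b) (bL ⟨b, false⟩ true :: w) := by
  refine ⟨⟨h1, fun hf => by cases hf⟩, rfl, fun y hy => ?_, hw.tail⟩
  have hok := hw.ok y hy
  cases y with
  | cyc => trivial
  | pow => trivial
  | letter y =>
    intro hf
    cases hf with
    | bar_bar => exact hok (.arr_bar ⟨b, true⟩ _)
    | forest_arr => exact hok (.arr_star ⟨b, true⟩)
    | forest_sq => exact hok (.arr_bar ⟨b, true⟩ _)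

theorem isWord_forest_star (h1 : 1 ∈ D.kinds) (hb : b ∈ D.forest) {w : Atoms n V E}
    (hw : D.IsWord (D.quiver.tail b) w) (h : ∀ y ∈ w.head?, y ≠ aL ⟨b, true⟩) :
    D.IsWord (D.quiver.head b) (aL ⟨b, false⟩ :: w) := by
  refine ⟨⟨h1, fun hf => by cases hf⟩, rfl, fun y hy => ?_, hw⟩
  have hg := hw.good_head y hy
  have hn := h y hy
  cases y with
  | cyc => trivial
  | pow => trivial
  | letter y =>
    intro hf
    cases hf with
    | arr_star => exact hn rfl
    | arr_bar _ s => exact hg.2 (Letter.Forbidden₁.bar b s hb)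

/-- The defining property of the operator of an arrow of the forest: `b b* = U - 1`. -/
theorem arFo_mul_arFs (h1 : 1 ∈ D.kinds) (hb : b ∈ D.forest) :
    D.arFo k b U * D.arFs k b = (U - 1) * D.vproj k (D.quiver.tail b) := by
  apply space_ext
  intro v w hw
  simp only [End.mul_apply]
  by_cases hv : v = D.quiver.tail b
  swap
  · rw [arFs_wd_of_ne hw hv, vproj_wd_of_ne hv, map_zero, map_zero]
  subst hv
  rw [vproj_wd_self]
  rcases cons_or (aL ⟨b, true⟩) w with ⟨w', rfl⟩ | h
  · rw [arFs_wd_arr hw, arFo_wd_bar (isWord_forest_bar h1 hw)]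
  · rw [arFs_wd_of hw h, arFo_wd_star (isWord_forest_star h1 hb hw h)]

end Forest

end WordData

namespace WordData

open Classical

/-! ### The forest: solving the preprojective relation outside the roots -/

section Aux

theorem exists_wellFounded_fix {α β : Type*} [Inhabited β] {r : α → α → Prop} (wf : WellFounded r)
    (Φ : α → (α → β) → β) (h : ∀ i U U', (∀ j, r j i → U j = U' j) → Φ i U = Φ i U') :
    ∃ U : α → β, ∀ i, U i = Φ i U := by
  let F : ∀ i, (∀ j, r j i → β) → β := fun i rec => Φ i fun j => if hj : r j i then rec j hj else default
  refine ⟨wf.fix F, fun i => ?_⟩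
  rw [wf.fix_eq]
  apply h
  intro j hj
  simp [hj]

variable {V E : Type*} [Finite V] {Q : ArrowQuiver V E} {W : Set V} {F : Set E}

/-- In a finite rooted forest, the relation "`j` is a child of `i`" is well-founded. -/
theorem wellFounded_child (hF : Q.IsRootedForest W F) :
    WellFounded fun j i => ∃ a ∈ F, Q.tail a = j ∧ Q.head a = i := by
  set step : V → V → Prop := fun i j => ∃ a ∈ F, Q.tail a = i ∧ Q.head a = j with hstep
  have hdet : ∀ {i j j'}, step i j → step i j' → j = j' := by
    rintro i j j' ⟨a, ha, rfl, rfl⟩ ⟨a', ha', ht, rfl⟩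
    have := (hF.unique (Q.tail a) (hF.root a ha)).unique ⟨ha, rfl⟩ ⟨ha', ht⟩
    rw [this]
  have hcyc : ∀ {i x}, Relation.ReflTransGen step i x → Relation.TransGen step i i →
      Relation.TransGen step x x := by
    intro i x hx hi
    induction hx with
    | refl => exact hi
    | tail _ hxy ih =>
      obtain ⟨y', h1, h2⟩ := Relation.TransGen.head'_iff.1 ih
      rw [hdet hxy h1]
      exact Relation.TransGen.tail' h2 h1
  have hirr : ∀ i, ¬ Relation.TransGen step i i := by
    intro i hi
    obtain ⟨w, hw, hr⟩ := hF.reach i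
    obtain ⟨y, ⟨a, ha, hta, _⟩, _⟩ := Relation.TransGen.head'_iff.1 (hcyc hr hi)
    exact hF.root a ha (hta ▸ hw)
  have : Std.Irrefl (Relation.TransGen step) := ⟨hirr⟩
  have hwf : WellFounded (Relation.TransGen step) := Finite.wellFounded_of_trans_of_irrefl _
  exact Subrelation.wf (fun h => Relation.TransGen.single h) hwf

end Aux

variable {n : ℕ} {V E : Type*} [Fintype V] {D : WordData n V E} {k : Type*} [Field k]

theorem Shift.mul {s t u : V} {T T' : D.Op k} (h : Shift s t T)
    (h' : Shift t u T') : Shift s u (T * T') :=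
  ⟨fun w hw => h.mem_piece (h'.mem w hw), fun v w hv hw => by
    rw [End.mul_apply, h'.zero v w hv hw, map_zero]⟩

theorem Shift.mem_locAt {i : V} {A : D.Op k} (h : Shift i i A)
    {T : (D.Op k)ˣ} (hT : (T : D.Op k) = 1 + A) :
    T ∈ locAt (D.vproj k) i := by
  intro j hj
  rw [hT, mul_add, add_mul, h.vproj_mul_of_ne hj, h.mul_vproj_of_ne hj]
  simp

theorem Shift.graded {i : V} {A : D.Op k} (h : Shift i i A) : Graded A := ⟨fun v => by
    by_cases hv : v = i
    · subst hv
      change _ * _ = _ * _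
      rw [h.vproj_mul, h.mul_vproj]
    · change _ * _ = _ * _
      rw [h.vproj_mul_of_ne hv, h.mul_vproj_of_ne hv], h.cproj_commute⟩

/-- The operator of an arrow, for given operators `U i` in the role of `x_b` for the arrow `b` of
the forest which leaves the vertex `i`. -/
def arU (U : V → (D.Op k)ˣ) (d : DArrow E) : D.Op k := if d.arrow ∈ D.forest then
    (if d.pos then D.arFo k d.arrow (U (D.quiver.tail d.arrow)) else D.arFs k d.arrow)
  else D.arN k d

/-- The operator of `x_d`, for given operators `U i`. -/
def gU (U : V → (D.Op k)ˣ) (d : DArrow E) : (D.Op k)ˣ :=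
  if h : IsUnit (1 + arU U d * arU U d.star) then h.unit else 1

variable {U : V → (D.Op k)ˣ}

theorem arU_forest_pos {b : E} (hb : b ∈ D.forest) :
    arU U ⟨b, true⟩ = D.arFo k b (U (D.quiver.tail b)) := by simp [arU, hb]

theorem arU_forest_neg {b : E} (hb : b ∈ D.forest) : arU U ⟨b, false⟩ = D.arFs k b := by
  simp [arU, hb]

theorem arU_nonforest {d : DArrow E} (hd : d.arrow ∉ D.forest) : arU U d = D.arN k d := by
  simp [arU, hd]

variable (D k) in
/-- The units located at the vertex `i` which are compatible with the gradings. -/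
def goodUnits (i : V) : Subgroup (D.Op k)ˣ := locAt (D.vproj k) i ⊓ D.gradedUnits k

/-- The operator `U i` is as required, if an arrow is in the forest, or its reverse is, where `i`
is the tail of the arrow of the forest. -/
def GoodAt (U : V → (D.Op k)ˣ) (d : DArrow E) : Prop :=
  d.arrow ∈ D.forest → U (D.quiver.tail d.arrow) ∈ D.goodUnits k (D.quiver.tail d.arrow)

theorem arU_shift (d : DArrow E) (hU : GoodAt U d) :
    Shift (D.quiver.dtail d) (D.quiver.dhead d) (arU U d) := by
  obtain ⟨b, p⟩ := d
  by_cases hb : b ∈ D.forest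
  · cases p
    · rw [arU_forest_neg hb]; exact arFs_shift
    · rw [arU_forest_pos hb]; exact arFo_shift (hU hb).2
  · rw [arU_nonforest hb]; exact arN_shift

theorem one_add_forest {b : E} {T : (D.Op k)ˣ} (h1 : 1 ∈ D.kinds)
    (hb : b ∈ D.forest) (hT : T ∈ D.goodUnits k (D.quiver.tail b)) :
    1 + D.arFo k b T * D.arFs k b = T := by
  rw [arFo_mul_arFs h1 hb]
  have hc := commute_of_mem_locAt vproj_idem hT.1 (D.quiver.tail b)
  have hi : D.vproj k (D.quiver.tail b) * D.vproj k (D.quiver.tail b) = D.vproj k (D.quiver.tail b) :=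
    vproj_idem.idem _
  apply eq_of_idem_mul (vproj_idem (D := D) (k := k))
  intro j
  rw [sub_mul, ← hc.eq, one_mul, mul_add, mul_one, mul_sub, ← mul_assoc]
  by_cases hj : j = D.quiver.tail b
  · subst hj
    rw [hi]; abel
  · rw [vproj_idem.ortho hj, (hT.1 j hj).1]; simp

theorem isUnit_gU (h1 : 1 ∈ D.kinds) (d : DArrow E) (hU : GoodAt U d) :
    IsUnit (1 + arU U d * arU U d.star) := by
  obtain ⟨b, p⟩ := d
  by_cases hb : b ∈ D.forest
  · specialize hU hb
    simp only at hU
    set T := U (D.quiver.tail b) with hTdef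
    have hT := one_add_forest h1 hb hU
    cases p
    · simp only [DArrow.star, Bool.not_false]
      rw [arU_forest_neg hb, arU_forest_pos hb]
      set o := D.arFo k b (U (D.quiver.tail b))
      set s := D.arFs k b
      have hos : o * s = (T : D.Op k) - 1 := by rw [← hT]; simp [o, s]
      -- the inverse of `1 + b* b` is `1 - b* (1 + b b*)⁻¹ b`
      have hT1 := T.mul_inv
      have hT2 := T.inv_mul
      set t : D.Op k := ↑T⁻¹
      refine ⟨⟨1 + s * o, 1 - s * t * o, ?_, ?_⟩, rfl⟩
      · have : (1 + s * o) * (1 - s * t * o) = 1 + s * o - s * (t + (o * s) * t) * o := by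
          noncomm_ring
        rw [this, hos, sub_mul, hT1, one_mul, add_sub_cancel]
        noncomm_ring
      · have : (1 - s * t * o) * (1 + s * o) = 1 + s * o - s * (t + t * (o * s)) * o := by
          noncomm_ring
        rw [this, hos, mul_sub, hT2, mul_one, add_sub_cancel]
        noncomm_ring
    · simp only [DArrow.star, Bool.not_true]
      rw [arU_forest_neg hb, arU_forest_pos hb, hT]
      exact T.isUnit
  · have hb' : (⟨b, p⟩ : DArrow E).star.arrow ∉ D.forest := hb
    rw [arU_nonforest hb, arU_nonforest hb', arN_mul_arN h1 hb]
    exact (gN k h1 hb).isUnit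

theorem gU_val (h1 : 1 ∈ D.kinds) (d : DArrow E) (hU : GoodAt U d) :
    (gU U d : D.Op k) = 1 + arU U d * arU U d.star := by
  rw [gU, dif_pos (isUnit_gU h1 d hU)]
  rfl

theorem gU_forest (h1 : 1 ∈ D.kinds) {b : E} (hb : b ∈ D.forest)
    (hU : U (D.quiver.tail b) ∈ D.goodUnits k (D.quiver.tail b)) :
    gU U ⟨b, true⟩ = U (D.quiver.tail b) := by
  ext1
  rw [gU_val h1 _ fun _ => hU]
  simp only [DArrow.star, Bool.not_true]
  rw [arU_forest_neg hb, arU_forest_pos hb, one_add_forest h1 hb hU]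

theorem gU_mem (h1 : 1 ∈ D.kinds) (d : DArrow E) (hU : GoodAt U d) :
    gU U d ∈ D.goodUnits k (D.quiver.dtail d) := by
  have hs : Shift (D.quiver.dtail d) (D.quiver.dtail d) (arU U d * arU U d.star) := by
    have h2 := arU_shift (U := U) d.star hU
    rw [D.quiver.dtail_star, D.quiver.dhead_star] at h2
    exact (arU_shift d hU).mul h2
  refine ⟨hs.mem_locAt (gU_val h1 d hU), ?_⟩
  change Graded (gU U d : D.Op k)
  rw [gU_val h1 d hU]
  exact Graded.one.add hs.graded

theorem gU_sub_one_mem (h1 : 1 ∈ D.kinds) (d : DArrow E) (hU : GoodAt U d)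
    (hd : d.arrow ∈ D.forest → d.pos = false) (x : D.Space k) :
    (gU U d : D.Op k) x - x ∈ D.wspan k fun _ w => ¬ StartsCyc w := by
  rw [gU_val h1 d hU, LinearMap.add_apply, End.one_apply, add_sub_cancel_left, End.mul_apply]
  obtain ⟨b, p⟩ := d
  by_cases hb : b ∈ D.forest
  · obtain rfl : p = false := hd hb
    rw [arU_forest_neg hb]
    exact arFs_mem_wspan _
  · have hb' : (⟨b, p⟩ : DArrow E).star.arrow ∉ D.forest := hb
    have := LinearMap.congr_fun (arN_mul_arN (k := k) h1 (d := ⟨b, p⟩) hb) x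
    rw [End.mul_apply] at this
    rw [arU_nonforest hb, arU_nonforest hb', this]
    exact bar_mem_wspan _ _

variable (D k) in
/-- The situation in which the letters act on normal words: the forest is rooted in `W`, the
arrows of the doubled quiver are listed in some order, and `R` is an operator in the role of `ρ`
(used outside `W` only). -/
structure LetterSetup where
  W : Set V
  one_mem : 1 ∈ D.kinds
  forest : D.quiver.IsRootedForest W D.forest
  list : List (DArrow E)
  nodup : list.Nodup
  mem_list : ∀ d, d ∈ list
  R : (D.Op k)ˣ
  hR : R ∈ D.gradedUnits k

/-- The product of the units `G d`, with exponents given by the signs, over the arrows `d` in a list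
which start at the vertex `i`. -/
def tailProd (Q : ArrowQuiver V E) {B : Type*} [Group B] (G : DArrow E → B) (i : V)
    (l : List (DArrow E)) : B :=
  ((l.filter fun d => Q.dtail d = i).map fun d => G d ^ d.sign).prod

namespace LetterSetup

variable (S : D.LetterSetup k)

/-- The arrows before the positive arrow `b`. -/
def before (b : E) : List (DArrow E) := S.list.takeWhile fun d => d ≠ ⟨b, true⟩

/-- The arrows after the positive arrow `b`. -/
def after (b : E) : List (DArrow E) := (S.list.dropWhile fun d => d ≠ ⟨b, true⟩).tail

theorem list_eq (b : E) : S.list = S.before b ++ ⟨b, true⟩ :: S.after b := by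
  have h := List.takeWhile_append_dropWhile (p := fun d => decide (d ≠ (⟨b, true⟩ : DArrow E)))
    (l := S.list)
  have hne : S.list.dropWhile (fun d => decide (d ≠ (⟨b, true⟩ : DArrow E))) ≠ [] := by
    intro h0
    have := List.dropWhile_eq_nil_iff.1 h0 _ (S.mem_list ⟨b, true⟩)
    simp at this
  have hhead := List.head_dropWhile_not (fun d => decide (d ≠ (⟨b, true⟩ : DArrow E))) hne
  simp only [ne_eq, decide_not, Bool.not_eq_eq_eq_not, Bool.not_false, decide_eq_true_eq] at hhead
  conv_lhs => rw [← h]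
  rw [before, after]
  congr 1
  rw [← List.cons_head_tail hne]
  simp only [ne_eq, decide_not, List.tail_cons]
  rw [hhead]

theorem ne_of_mem_before {b : E} {d : DArrow E} (h : d ∈ S.before b ∨ d ∈ S.after b) :
    d ≠ ⟨b, true⟩ := by
  have hn := S.nodup
  rw [S.list_eq b, List.nodup_append] at hn
  rintro rfl
  rcases h with h | h
  · exact hn.2.2 _ h _ (by simp) rfl
  · exact (List.nodup_cons.1 hn.2.1).1 h

theorem tailProd_list {B : Type*} [Group B] (G : DArrow E → B) (b : E) :
    tailProd D.quiver G (D.quiver.tail b) S.list =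
      tailProd D.quiver G (D.quiver.tail b) (S.before b) * G ⟨b, true⟩ *
        tailProd D.quiver G (D.quiver.tail b) (S.after b) := by
  have : D.quiver.dtail ⟨b, true⟩ = D.quiver.tail b := by simp [ArrowQuiver.dtail]
  rw [S.list_eq b]
  simp [tailProd, this, DArrow.sign, mul_assoc]

theorem vproj_commute_R (j : V) : Commute (D.vproj k j) (S.R : D.Op k) := S.hR.vert j

/-- The recursive formula for `U i`, which makes the product of all `x_d^{±1}` with tail `i` equal to
`R` at `i`. -/
def step (i : V) (U : V → (D.Op k)ˣ) : (D.Op k)ˣ := if h : ∃ b ∈ D.forest, D.quiver.tail b = i then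
    (tailProd D.quiver (gU U) i (S.before h.choose))⁻¹ *
      loc vproj_idem i S.R S.vproj_commute_R * (tailProd D.quiver (gU U) i (S.after h.choose))⁻¹
  else 1

theorem exists_forest {i : V} (hi : i ∉ S.W) : ∃ b ∈ D.forest, D.quiver.tail b = i :=
  (S.forest.unique i hi).exists

include S in
theorem forest_unique {b b' : E} (hb : b ∈ D.forest) (hb' : b' ∈ D.forest)
    (h : D.quiver.tail b = D.quiver.tail b') : b = b' :=
  (S.forest.unique _ (S.forest.root b' hb')).unique ⟨hb, h⟩ ⟨hb', rfl⟩

theorem step_eq (U : V → (D.Op k)ˣ) {b : E} (hb : b ∈ D.forest) :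
    S.step (D.quiver.tail b) U = (tailProd D.quiver (gU U) (D.quiver.tail b) (S.before b))⁻¹ *
        loc vproj_idem (D.quiver.tail b) S.R S.vproj_commute_R *
        (tailProd D.quiver (gU U) (D.quiver.tail b) (S.after b))⁻¹ := by
  have h : ∃ b' ∈ D.forest, D.quiver.tail b' = D.quiver.tail b := ⟨b, hb, rfl⟩
  rw [step, dif_pos h, S.forest_unique h.choose_spec.1 hb h.choose_spec.2]

/-- The arrows of the forest, or their reverses, which occur in the formula for `U i` come from the
children of `i`. -/
theorem child_of_mem {b : E} (hb : b ∈ D.forest) {d : DArrow E}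
    (hd : d ∈ S.before b ∨ d ∈ S.after b) (ht : D.quiver.dtail d = D.quiver.tail b)
    (hf : d.arrow ∈ D.forest) : d.pos = false ∧ D.quiver.head d.arrow = D.quiver.tail b := by
  obtain ⟨a, p⟩ := d
  cases p
  · exact ⟨rfl, by simpa [ArrowQuiver.dtail] using ht⟩
  · exfalso
    have : a = b := S.forest_unique hf hb (by simpa [ArrowQuiver.dtail] using ht)
    exact S.ne_of_mem_before hd (by rw [this])

theorem exists_units : ∃ U : V → (D.Op k)ˣ, ∀ i, U i = S.step i U := by
  apply exists_wellFounded_fix (wellFounded_child S.forest)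
  intro i U U' h
  unfold step
  split_ifs with hi
  · obtain ⟨hb, ht⟩ := hi.choose_spec
    set b := hi.choose
    have key : ∀ l : List (DArrow E), (∀ d ∈ l, d ∈ S.before b ∨ d ∈ S.after b) →
        tailProd D.quiver (gU U) i l = tailProd D.quiver (gU U') i l := by
      intro l hl
      unfold tailProd
      congr 1
      apply List.map_congr_left
      intro d hd
      obtain ⟨hd, hdt⟩ := List.mem_filter.1 hd
      simp only [decide_eq_true_eq] at hdt
      have harU : ∀ d' : DArrow E, d'.arrow = d.arrow → arU U d' = arU U' d' := by
        rintro ⟨a, p⟩ rfl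
        unfold arU
        split_ifs with h1 h2
        · obtain ⟨-, hc⟩ := S.child_of_mem hb (hl d hd) (hdt.trans ht.symm) h1
          rw [h _ ⟨_, h1, rfl, hc.trans ht⟩]
        · rfl
        · rfl
      unfold gU
      simp only [harU d rfl, harU d.star rfl]
    rw [key _ fun d hd => Or.inl hd, key _ fun d hd => Or.inr hd]
  · rfl

/-- The operators of the elements `x_b`, for the arrows `b` of the forest, indexed by their tails. -/
def solve : V → (D.Op k)ˣ := S.exists_units.choose

theorem solve_eq (i : V) : S.solve i = S.step i S.solve := S.exists_units.choose_spec i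

/-- The operator of an arrow. -/
def ar (d : DArrow E) : D.Op k := arU S.solve d

/-- The operator of `x_d`. -/
def g (d : DArrow E) : (D.Op k)ˣ := gU S.solve d

theorem tailProd_mem {i : V} {G : DArrow E → (D.Op k)ˣ} {l : List (DArrow E)}
    (h : ∀ d ∈ l, D.quiver.dtail d = i → G d ∈ D.goodUnits k i) :
    tailProd D.quiver G i l ∈ D.goodUnits k i := by
  apply Subgroup.list_prod_mem
  intro t ht
  obtain ⟨d, hd, rfl⟩ := List.mem_map.1 ht
  obtain ⟨hd, hdt⟩ := List.mem_filter.1 hd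
  simp only [decide_eq_true_eq] at hdt
  exact Subgroup.zpow_mem _ (h d hd hdt) _

theorem loc_mem_goodUnits (i : V) {T : (D.Op k)ˣ} (hT : T ∈ D.gradedUnits k) :
    loc vproj_idem i T hT.vert ∈ D.goodUnits k i := by
  refine ⟨loc_mem vproj_idem i T _, ?_⟩
  change Graded (loc vproj_idem i T hT.vert : D.Op k)
  rw [loc_val]
  exact ((Graded.vproj i).mul hT).add (Graded.one.sub (Graded.vproj i))

theorem solve_mem (i : V) : S.solve i ∈ D.goodUnits k i := by
  induction i using (wellFounded_child S.forest).induction with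
  | _ i ih =>
  by_cases hi : ∃ b ∈ D.forest, D.quiver.tail b = i
  · obtain ⟨b, hb, rfl⟩ := hi
    have key : ∀ d : DArrow E, d ∈ S.before b ∨ d ∈ S.after b →
        D.quiver.dtail d = D.quiver.tail b → gU S.solve d ∈ D.goodUnits k (D.quiver.tail b) := by
      intro d hd hdt
      rw [← hdt]
      exact gU_mem S.one_mem d fun hf => ih _ ⟨_, hf, rfl, (S.child_of_mem hb hd hdt hf).2⟩
    rw [S.solve_eq, S.step_eq S.solve hb]
    exact Subgroup.mul_mem _ (Subgroup.mul_mem _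
      (Subgroup.inv_mem _ (tailProd_mem fun d hd => key d (Or.inl hd)))
      (loc_mem_goodUnits _ S.hR)) (Subgroup.inv_mem _ (tailProd_mem fun d hd => key d (Or.inr hd)))
  · rw [S.solve_eq, step, dif_neg hi]
    exact Subgroup.one_mem _

theorem ar_shift (d : DArrow E) : Shift (D.quiver.dtail d) (D.quiver.dhead d) (S.ar d) :=
  arU_shift d fun _ => S.solve_mem _

theorem g_val (d : DArrow E) :
    (S.g d : D.Op k) = 1 + S.ar d * S.ar d.star :=
  gU_val S.one_mem d fun _ => S.solve_mem _

theorem g_mem (d : DArrow E) : S.g d ∈ D.goodUnits k (D.quiver.dtail d) :=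
  gU_mem S.one_mem d fun _ => S.solve_mem _

theorem g_sub_one_mem (d : DArrow E) (hd : D.quiver.dtail d ∈ S.W) (x : D.Space k) :
    (S.g d : D.Op k) x - x ∈ D.wspan k fun _ w => ¬ StartsCyc w := by
  refine gU_sub_one_mem S.one_mem d (fun _ => S.solve_mem _) (fun hf => ?_) x
  obtain ⟨a, p⟩ := d
  cases p
  · rfl
  · exact absurd (by simpa [ArrowQuiver.dtail] using hd) (S.forest.root a hf)

/-- The operator of the product `ρ'` of all `x_d^{±1}`. -/
def rho : (D.Op k)ˣ := (S.list.map fun d => S.g d ^ d.sign).prod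

theorem rho_graded : S.rho ∈ D.gradedUnits k := by
  apply Subgroup.list_prod_mem
  intro t ht
  obtain ⟨d, _, rfl⟩ := List.mem_map.1 ht
  exact Subgroup.zpow_mem _ (S.g_mem d).2 _

/-- Outside `W`, the product of all `x_d^{±1}` acts as `R`. -/
theorem vproj_mul_rho {i : V} (hi : i ∉ S.W) :
    D.vproj k i * (S.rho : D.Op k) = D.vproj k i * S.R := by
  obtain ⟨b, hb, rfl⟩ := S.exists_forest hi
  have h := idem_mul_filter_prod vproj_idem D.quiver.dtail S.g (fun d => (S.g_mem d).1) DArrow.sign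
    (D.quiver.tail b) S.list
  have h2 : tailProd D.quiver S.g (D.quiver.tail b) S.list =
      loc vproj_idem (D.quiver.tail b) S.R S.vproj_commute_R := by
    rw [S.tailProd_list, show S.g ⟨b, true⟩ = S.solve (D.quiver.tail b) from
      gU_forest S.one_mem hb (S.solve_mem _), S.solve_eq, S.step_eq S.solve hb]
    change _ * (_ * _ * _) * _ = _
    rw [show gU S.solve = S.g from rfl]
    group
  rw [rho, ← h, ← idem_mul_loc vproj_idem _ S.R S.vproj_commute_R, ← h2]
  rfl

end LetterSetup

end WordData

/-! ### Letters in the localized path algebra -/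

section LetterVal

variable {k : Type*} [Field k] {V E : Type*} [Fintype V] {Q : ArrowQuiver V E}

theorem g_mem_locAt (d : DArrow E) : g k Q d ∈ locAt (e k Q) (Q.dtail d) := by
  intro j hj
  have h2 : ar k Q d.star * e k Q j = 0 := ar_mul_e_of_ne k Q (by rw [Q.dhead_star]; exact hj.symm)
  rw [g_val, mul_add, add_mul, ← mul_assoc, e_mul_ar_of_ne k Q hj, mul_assoc, h2]
  simp

theorem val_bar_true (d : DArrow E) :
    (Letter.bar d true).val (k := k) Q = ar k Q d * ar k Q d.star := by
  simp [Letter.val, g_val]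

theorem e_mul_val (x : Letter E) : e k Q (x.src Q) * x.val (k := k) Q = x.val Q := by
  rcases x with d | ⟨d, _ | _⟩
  · exact e_mul_ar k Q d
  · simp only [Letter.src, Letter.val]
    have h : e k Q (Q.dtail d) * (g k Q d - 1) = g k Q d - 1 := by
      rw [g_val, add_sub_cancel_left, ← mul_assoc, e_mul_ar]
    have h2 : (↑(g k Q d)⁻¹ : LAlg k Q) - 1 =
        (1 - (g k Q d : LAlg k Q)) * ((g k Q d)⁻¹ : (LAlg k Q)ˣ) := by
      rw [sub_mul, Units.mul_inv, one_mul]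
    have h3 : e k Q (Q.dtail d) * (1 - (g k Q d : LAlg k Q)) = 1 - g k Q d := by
      rw [← neg_sub (g k Q d : LAlg k Q) 1]
      exact (mul_neg _ _).trans (congrArg Neg.neg h)
    rw [h2, ← mul_assoc, h3]
  · simp only [Letter.src, Letter.val]
    rw [g_val, add_sub_cancel_left, ← mul_assoc, e_mul_ar]

theorem val_mul_e (x : Letter E) : x.val (k := k) Q * e k Q (x.tgt Q) = x.val Q := by
  rcases x with d | ⟨d, _ | _⟩
  · exact ar_mul_e k Q d
  · simp only [Letter.tgt, Letter.val]
    have h : ((g k Q d : LAlg k Q) - 1) * e k Q (Q.dtail d) = g k Q d - 1 := by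
      rw [g_val, add_sub_cancel_left, mul_assoc, ← Q.dhead_star, ar_mul_e]
    have h2 : (↑(g k Q d)⁻¹ : LAlg k Q) - 1 =
        ((g k Q d)⁻¹ : (LAlg k Q)ˣ) * (1 - (g k Q d : LAlg k Q)) := by
      rw [mul_sub, Units.inv_mul, mul_one]
    have h3 : (1 - (g k Q d : LAlg k Q)) * e k Q (Q.dtail d) = 1 - g k Q d := by
      rw [← neg_sub (g k Q d : LAlg k Q) 1]
      exact (neg_mul _ _).trans (congrArg Neg.neg h)
    rw [h2, mul_assoc, h3]
  · simp only [Letter.tgt, Letter.val]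
    rw [g_val, add_sub_cancel_left, mul_assoc, ← Q.dhead_star, ar_mul_e]

theorem val_bar_mul_bar (d : DArrow E) (s : Bool) :
    (Letter.bar d s).val (k := k) Q * (Letter.bar d !s).val Q =
      -(Letter.bar d s).val Q - (Letter.bar d !s).val Q := by
  cases s
  · simp only [Letter.val, Bool.not_false]
    rw [sub_mul, mul_sub, Units.inv_mul, mul_one, one_mul]; abel
  · simp only [Letter.val, Bool.not_true]
    rw [sub_mul, mul_sub, Units.mul_inv, mul_one, one_mul]; abel

theorem ar_mul_val_bar (d : DArrow E) (s : Bool) :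
    ar k Q d * (Letter.bar d.star s).val Q = (Letter.bar d s).val Q * ar k Q d := by
  cases s
  · simp only [Letter.val]
    rw [mul_sub, ar_mul_g_inv, sub_mul, mul_one, one_mul]
  · simp only [Letter.val]
    rw [mul_sub, ar_mul_g, sub_mul, mul_one, one_mul]

end LetterVal

namespace WordData

open Classical

variable {n : ℕ} {V E : Type*} [Fintype V] {D : WordData n V E} {k : Type*} [Field k]
  {B : Type*} [Ring B] [Algebra k B]

/-! ### Compatibility of the action of the letters with evaluation -/

variable (D) in
/-- The evaluation of words given by a homomorphism from the localized path algebra of the letters,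
and by the values of the other atoms. -/
abbrev evalBy (φ : LAlg k D.quiver →ₐ[k] B) (val : Atom n V E → B) : D.Space k →ₗ[k] B :=
  D.eval (fun v => φ (e k D.quiver v)) val

variable {φ : LAlg k D.quiver →ₐ[k] B} {val : Atom n V E → B}

theorem eqv_vproj (i : V) : Eqv (D.evalBy φ val) (D.vproj k i) (φ (e k D.quiver i)) := by
  apply Eqv.of_words
  intro v w hw
  by_cases hv : v = i
  · subst hv
    rw [vproj_wd_self, eval_wd hw, ← mul_assoc, ← map_mul, e_mul_self]
  · rw [vproj_wd_of_ne hv, eval_wd hw, ← mul_assoc, ← map_mul,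
      e_mul_of_ne k _ (Ne.symm hv), map_zero, map_zero, zero_mul]

theorem e_mul_evalBy {v : V} {w : Atoms n V E} :
    φ (e k D.quiver v) * D.evalBy φ val (D.wd k v w) = D.evalBy φ val (D.wd k v w) := by
  rw [← eqv_vproj, vproj_wd_self]

theorem mul_evalBy_of_ne {a : LAlg k D.quiver} {t v : V} (ha : a * e k D.quiver t = a) (hv : v ≠ t)
    {w : Atoms n V E} : φ a * D.evalBy φ val (D.wd k v w) = 0 := by
  rw [← e_mul_evalBy, ← mul_assoc, ← ha, ← map_mul, mul_assoc, e_mul_of_ne k _ hv.symm, mul_zero,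
    map_zero, zero_mul]

variable (hval : ∀ x, val (.letter x) = φ (x.val D.quiver))
include hval

theorem evalBy_letter {v : V} {x : Letter E} {w : Atoms n V E} (hw : D.IsWord v (.letter x :: w)) :
    D.evalBy φ val (D.wd k v (.letter x :: w)) =
      φ (x.val D.quiver) * D.evalBy φ val (D.wd k (x.tgt D.quiver) w) := by
  have hs : x.src D.quiver = v := hw.src
  have hw' : D.IsWord (x.tgt D.quiver) w := hw.tail
  rw [eval_wd hw, eval_wd hw', List.map_cons, List.prod_cons, hval, ← mul_assoc, ← mul_assoc,
    ← map_mul, ← map_mul, ← hs, e_mul_val]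
  congr 2
  exact (val_mul_e x).symm

theorem eqv_bar (h1 : 1 ∈ D.kinds) {d : DArrow E} (hd : d.arrow ∉ D.forest) (s : Bool) :
    Eqv (D.evalBy φ val) (D.bar k d s) (φ ((Letter.bar d s).val D.quiver)) := by
  apply Eqv.of_words
  intro v w
  by_cases hv : v = D.quiver.dtail d
  swap
  · intro _
    rw [bar_wd_of_ne hv, map_zero, mul_evalBy_of_ne (val_mul_e (Letter.bar d s)) hv]
  subst hv
  revert w
  refine bar_induction D d s (fun w hw h => ?_) fun w hw hw' ih => ?_
  · rw [bar_wd_of hw h, evalBy_letter hval (isWord_bar h1 hd hw h)]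
    rfl
  · rw [bar_wd_cancel hw, map_sub, map_neg, ih, evalBy_letter hval hw, ← mul_assoc, ← map_mul,
      val_bar_mul_bar, map_sub, map_neg, sub_mul, neg_mul]
    rfl

theorem eqv_arN (h1 : 1 ∈ D.kinds) {d : DArrow E} (hd : d.arrow ∉ D.forest) :
    Eqv (D.evalBy φ val) (D.arN k d) (φ (ar k D.quiver d)) := by
  apply Eqv.of_words
  intro v w
  by_cases hv : v = D.quiver.dhead d
  swap
  · intro _
    rw [arN_wd_of_ne hv, map_zero, mul_evalBy_of_ne (ar_mul_e k _ d) hv]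
  subst hv
  have hst := D.quiver.dtail_star d
  have hst' := D.quiver.dhead_star d
  revert w
  refine arN_induction (fun w hw h => ?_) (fun w hw => ?_) fun s w hw ih => ?_
  · rw [arN_wd_of hw h, evalBy_letter hval (isWord_arr h1 hw h)]
    rfl
  · rw [arN_wd_star hw, eqv_bar hval h1 hd, evalBy_letter hval hw, val_bar_true, map_mul, mul_assoc]
    simp only [Letter.val, Letter.tgt, hst']
  · rw [arN_wd_bar hw, eqv_bar hval h1 hd, ih, evalBy_letter hval hw, ← mul_assoc, ← mul_assoc,
      ← map_mul, ← map_mul, ar_mul_val_bar]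
    simp only [Letter.tgt, hst]

theorem eqv_arFs (h1 : 1 ∈ D.kinds) {b : E} (hb : b ∈ D.forest) :
    Eqv (D.evalBy φ val) (D.arFs k b) (φ (ar k D.quiver ⟨b, false⟩)) := by
  apply Eqv.of_words
  intro v w hw
  by_cases hv : v = D.quiver.tail b
  swap
  · rw [arFs_wd_of_ne hw hv, map_zero, mul_evalBy_of_ne (ar_mul_e k _ ⟨b, false⟩) hv]
  subst hv
  rcases cons_or (aL ⟨b, true⟩) w with ⟨w', rfl⟩ | h
  · rw [arFs_wd_arr hw, evalBy_letter hval hw, evalBy_letter hval (isWord_forest_bar h1 hw),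
      val_bar_true, ← mul_assoc, ← map_mul]
    rfl
  · rw [arFs_wd_of hw h, evalBy_letter hval (isWord_forest_star h1 hb hw h)]
    rfl

omit hval in
theorem isWord_forest_arr (h1 : 1 ∈ D.kinds) {b : E} (hb : b ∈ D.forest)
    {w : Atoms n V E} (hw : D.IsWord (D.quiver.head b) w)
    (h : ∀ y ∈ w.head?, y ≠ aL ⟨b, false⟩ ∧ y ≠ bL ⟨b, false⟩ true) :
    D.IsWord (D.quiver.tail b) (aL ⟨b, true⟩ :: w) := by
  refine isWord_arr (d := ⟨b, true⟩) h1 hw fun y hy => ⟨(h y hy).1, ?_⟩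
  rintro (_ | _) rfl
  · exact (hw.good_head _ hy).2 (.bar_star b hb)
  · exact (h _ hy).2 rfl

omit hval in
theorem isWord_forest_arr_of_bar (h1 : 1 ∈ D.kinds) {b : E} (hb : b ∈ D.forest) {v : V}
    {w : Atoms n V E} (hw : D.IsWord v (bL ⟨b, false⟩ true :: w)) :
    (∀ y ∈ w.head?, y ≠ aL ⟨b, false⟩ ∧ y ≠ bL ⟨b, false⟩ true) ∧
      D.IsWord (D.quiver.tail b) (aL ⟨b, true⟩ :: w) := by
  refine (and_iff_left_of_imp (isWord_forest_arr h1 hb hw.tail)).2 fun y hy => ⟨?_, ?_⟩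
  · rintro rfl; exact hw.ok _ hy (.forest_arr b hb)
  · rintro rfl; exact hw.ok _ hy (.forest_sq b hb)

theorem eqv_arFo (h1 : 1 ∈ D.kinds) {b : E} (hb : b ∈ D.forest) {U : D.Op k}
    (hU : Eqv (D.evalBy φ val) U (φ (g k D.quiver ⟨b, true⟩))) :
    Eqv (D.evalBy φ val) (D.arFo k b U) (φ (ar k D.quiver ⟨b, true⟩)) := by
  have hU1 : Eqv (D.evalBy φ val) (U - 1)
      (φ (ar k D.quiver ⟨b, true⟩ * ar k D.quiver ⟨b, false⟩)) := by
    have := hU.sub Eqv.one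
    rwa [← map_one φ, ← map_sub, MPA.g_val, add_sub_cancel_left] at this
  apply Eqv.of_words
  intro v w hw
  by_cases hv : v = D.quiver.head b
  swap
  · rw [arFo_wd_of_ne hw hv, map_zero, mul_evalBy_of_ne (ar_mul_e k _ ⟨b, true⟩) hv]
  subst hv
  rcases cons_or (aL ⟨b, false⟩) w with ⟨w', rfl⟩ | h
  · rw [arFo_wd_star hw, hU1, evalBy_letter hval hw, map_mul, mul_assoc]
    rfl
  rcases cons_or (bL ⟨b, false⟩ true) w with ⟨w', rfl⟩ | h'
  · rw [arFo_wd_bar hw, hU1, evalBy_letter hval hw,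
      evalBy_letter hval (isWord_forest_arr_of_bar h1 hb hw).2, val_bar_true]
    simp only [← mul_assoc, ← map_mul, Letter.val]
    rfl
  · have hh := fun y hy => And.intro (h y hy) (h' y hy)
    rw [arFo_wd_of hw hh, evalBy_letter hval (isWord_forest_arr h1 hb hw hh)]
    rfl

namespace LetterSetup

variable (S : D.LetterSetup k)

omit hval in
theorem ar_neg {b : E} (hb : b ∈ D.forest) : S.ar ⟨b, false⟩ = D.arFs k b := arU_forest_neg hb

omit hval in
theorem ar_pos {b : E} (hb : b ∈ D.forest) :
    S.ar ⟨b, true⟩ = D.arFo k b (S.solve (D.quiver.tail b)) := arU_forest_pos hb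

omit hval in
theorem ar_nonforest {d : DArrow E} (hd : d.arrow ∉ D.forest) : S.ar d = D.arN k d :=
  arU_nonforest hd

omit hval in
variable (k) in
/-- The product of all `x_d^{±1}` in the localized path algebra. -/
def rhoL (L : List (DArrow E)) (Q : ArrowQuiver V E) : (LAlg k Q)ˣ :=
  (L.map fun d => MPA.g k Q d ^ d.sign).prod

variable (hR : ∀ i ∉ S.W, Eqv (D.evalBy φ val) (D.vproj k i * S.R)
  (φ (e k D.quiver i * rhoL k S.list D.quiver)))

omit hval in
theorem eqv_tailProd {G : DArrow E → (D.Op k)ˣ} {l : List (DArrow E)} {i : V}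
    (h : ∀ d ∈ l, D.quiver.dtail d = i →
      Eqv (D.evalBy φ val) (G d : D.Op k) (φ (MPA.g k D.quiver d))) :
    Eqv (D.evalBy φ val) (tailProd D.quiver G i l : (D.Op k)ˣ).val
      (Units.map (φ : LAlg k D.quiver →* B) (tailProd D.quiver (MPA.g k D.quiver) i l) : B) := by
  have := Eqv.list_prod (Θ := D.evalBy φ val) (l.filter fun d => D.quiver.dtail d = i) G
    (fun d => Units.map (φ : LAlg k D.quiver →* B) (MPA.g k D.quiver d)) DArrow.sign (by
      intro d hd
      obtain ⟨hd, hdt⟩ := List.mem_filter.1 hd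
      simp only [decide_eq_true_eq] at hdt
      exact h d hd hdt)
  unfold tailProd
  rw [map_list_prod, List.map_map]
  simpa [Function.comp_def, map_zpow] using this

omit hval in
theorem g_eq_loc (b : E) (hc : ∀ j, Commute (e k D.quiver j) (rhoL k S.list D.quiver : LAlg k D.quiver)) :
    MPA.g k D.quiver ⟨b, true⟩ =
      (tailProd D.quiver (MPA.g k D.quiver) (D.quiver.tail b) (S.before b))⁻¹ *
        loc (e_idem k D.quiver) (D.quiver.tail b) (rhoL k S.list D.quiver) hc *
        (tailProd D.quiver (MPA.g k D.quiver) (D.quiver.tail b) (S.after b))⁻¹ := by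
  have h : tailProd D.quiver (MPA.g k D.quiver) (D.quiver.tail b) S.list =
      loc (e_idem k D.quiver) (D.quiver.tail b) (rhoL k S.list D.quiver) hc := by
    apply eq_loc
    · exact filter_prod_mem D.quiver.dtail _ g_mem_locAt DArrow.sign _ _
    · exact idem_mul_filter_prod (e_idem k D.quiver) D.quiver.dtail _ g_mem_locAt DArrow.sign _ _
  rw [← h, S.tailProd_list]
  group

omit hval in
theorem rhoL_commute (L : List (DArrow E)) (Q : ArrowQuiver V E) (j : V) :
    Commute (e k Q j) (rhoL k L Q : LAlg k Q) :=
  commute_map_prod (e_idem k Q) Q.dtail _ g_mem_locAt DArrow.sign _ _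

theorem eqv_ar_of (d : DArrow E) (h : d.arrow ∈ D.forest →
    Eqv (D.evalBy φ val) (S.solve (D.quiver.tail d.arrow) : D.Op k)
      (φ (MPA.g k D.quiver ⟨d.arrow, true⟩))) :
    Eqv (D.evalBy φ val) (S.ar d) (φ (MPA.ar k D.quiver d)) := by
  by_cases hf : d.arrow ∈ D.forest
  · obtain ⟨a, _ | _⟩ := d
    · rw [S.ar_neg hf]
      exact eqv_arFs hval S.one_mem hf
    · rw [S.ar_pos hf]
      exact eqv_arFo hval S.one_mem hf (h hf)
  · rw [S.ar_nonforest hf]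
    exact eqv_arN hval S.one_mem hf

theorem eqv_g_of (d : DArrow E) (h : d.arrow ∈ D.forest →
    Eqv (D.evalBy φ val) (S.solve (D.quiver.tail d.arrow) : D.Op k)
      (φ (MPA.g k D.quiver ⟨d.arrow, true⟩))) :
    Eqv (D.evalBy φ val) (S.g d : D.Op k) (φ (MPA.g k D.quiver d)) := by
  rw [S.g_val, MPA.g_val, map_add, map_one, map_mul]
  exact Eqv.one.add ((S.eqv_ar_of hval d h).mul (S.eqv_ar_of hval d.star h))

include hR

theorem eqv_solve (i : V) : ∀ b ∈ D.forest, D.quiver.tail b = i →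
    Eqv (D.evalBy φ val) (S.solve i : D.Op k) (φ (MPA.g k D.quiver ⟨b, true⟩)) := by
  induction i using (wellFounded_child S.forest).induction with
  | _ i ih =>
  rintro b hb rfl
  have key : ∀ d : DArrow E, d ∈ S.before b ∨ d ∈ S.after b → D.quiver.dtail d = D.quiver.tail b →
      Eqv (D.evalBy φ val) (S.g d : D.Op k) (φ (MPA.g k D.quiver d)) := fun d hd hdt =>
    S.eqv_g_of hval d fun hf => ih _ ⟨_, hf, rfl, (S.child_of_mem hb hd hdt hf).2⟩ _ hf rfl
  have hi : D.quiver.tail b ∉ S.W := S.forest.root b hb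
  have h1 := (eqv_tailProd (i := D.quiver.tail b) fun d hd => key d (Or.inl hd)).inv
  have h2 := (eqv_tailProd (i := D.quiver.tail b) fun d hd => key d (Or.inr hd)).inv
  have h3 : Eqv (D.evalBy φ val)
      (loc vproj_idem (D.quiver.tail b) S.R S.vproj_commute_R : D.Op k)
      (φ (loc (e_idem k D.quiver) (D.quiver.tail b) (rhoL k S.list D.quiver)
        (rhoL_commute _ _) : LAlg k D.quiver)) := by
    rw [loc_val, loc_val, map_add, map_sub, map_one]
    exact (hR _ hi).add (Eqv.one.sub (eqv_vproj _))
  have h4 := (h1.mul h3).mul h2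
  rw [S.solve_eq, S.step_eq _ hb, S.g_eq_loc b (rhoL_commute _ _)]
  refine cast (congrArg (Eqv _ _) ?_) h4
  rw [← map_inv, ← map_inv]
  simp

theorem eqv_ar (d : DArrow E) : Eqv (D.evalBy φ val) (S.ar d) (φ (MPA.ar k D.quiver d)) :=
  S.eqv_ar_of hval d fun hf => S.eqv_solve hval hR _ _ hf rfl

theorem eqv_g (d : DArrow E) :
    Eqv (D.evalBy φ val) (S.g d : D.Op k) (φ (MPA.g k D.quiver d)) :=
  S.eqv_g_of hval d fun hf => S.eqv_solve hval hR _ _ hf rfl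

theorem eqv_rho :
    Eqv (D.evalBy φ val) (S.rho : D.Op k) (φ (rhoL k S.list D.quiver)) := by
  have := Eqv.list_prod (Θ := D.evalBy φ val) S.list S.g
    (fun d => Units.map (φ : LAlg k D.quiver →* B) (MPA.g k D.quiver d)) DArrow.sign
    fun d _ => S.eqv_g hval hR d
  refine cast (congrArg (Eqv _ _) ?_) this
  change _ = ((Units.map (φ : LAlg k D.quiver →* B) (rhoL k S.list D.quiver) : Bˣ) : B)
  rw [rhoL, map_list_prod, List.map_map]
  simp [Function.comp_def, map_zpow]

end LetterSetup

/-! ### Letters act on words by concatenation -/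

namespace LetterSetup

omit hval

variable (S : D.LetterSetup k)

/-- The operator of a letter. -/
def op : Letter E → D.Op k
  | .arr d => S.ar d
  | .bar d true => (S.g d : D.Op k) - 1
  | .bar d false => ((S.g d)⁻¹ : (D.Op k)ˣ) - 1

theorem g_nonforest {d : DArrow E} (hd : d.arrow ∉ D.forest) : S.g d = gN k S.one_mem hd := by
  ext1
  have hd' : d.star.arrow ∉ D.forest := hd
  rw [S.g_val, S.ar_nonforest hd, S.ar_nonforest hd', arN_mul_arN S.one_mem hd]
  rfl

theorem op_wd {v : V} {x : Letter E} {w : Atoms n V E} (hw : D.IsWord v (.letter x :: w)) :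
    S.op x (D.wd k (x.tgt D.quiver) w) = D.wd k v (.letter x :: w) := by
  have hs : x.src D.quiver = v := hw.src
  subst hs
  have hg := hw.good.2
  have hok := hw.ok
  have hw' := hw.tail
  rcases x with d | ⟨d, s⟩
  · change S.ar d _ = _
    by_cases hf : d.arrow ∈ D.forest
    · obtain ⟨b, _ | _⟩ := d
      · rw [S.ar_neg hf]
        refine arFs_wd_of hw' ?_
        rintro y hy rfl
        exact hok _ hy (.arr_star ⟨b, false⟩)
      · rw [S.ar_pos hf]
        refine arFo_wd_of hw' fun y hy => ⟨?_, ?_⟩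
        · rintro rfl
          exact hok _ hy (.arr_star ⟨b, true⟩)
        · rintro rfl
          exact hok _ hy (.arr_bar ⟨b, true⟩ true)
    · rw [S.ar_nonforest hf]
      refine arN_wd_of hw' fun y hy => ⟨?_, fun s => ?_⟩
      · rintro rfl
        exact hok _ hy (.arr_star d)
      · rintro rfl
        exact hok _ hy (.arr_bar d s)
  · by_cases hf : d.arrow ∈ D.forest
    · obtain ⟨b, _ | _⟩ := d
      · cases s
        · exact absurd (.bar_star b hf) hg
        · change (S.g ⟨b, false⟩ - 1 : D.Op k) _ = _
          obtain ⟨h, ha⟩ := isWord_forest_arr_of_bar S.one_mem hf hw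
          rw [S.g_val, add_sub_cancel_left, End.mul_apply, S.ar_neg hf,
            show S.ar (DArrow.star ⟨b, false⟩) = _ from S.ar_pos hf]
          exact (congrArg _ (arFo_wd_of hw' h)).trans (arFs_wd_arr ha)
      · exact absurd (.bar b s hf) hg
    · have : S.op (.bar d s) = D.bar k d s := by
        cases s
        · change (↑(S.g d)⁻¹ : D.Op k) - 1 = _
          rw [S.g_nonforest hf]
          exact add_sub_cancel_left _ _
        · change (S.g d : D.Op k) - 1 = _
          rw [S.g_nonforest hf]
          exact add_sub_cancel_left _ _
      rw [this]
      exact bar_wd_of hw' (bar_head hw)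

end LetterSetup

end WordData

open LaurentPolynomial in
theorem commute_laurentEval {k A : Type*} [Field k] [Ring A] [Algebra k A] {u : Aˣ} {b : A}
    (h : Commute b u) (f : k[T;T⁻¹]) : Commute b (laurentEval k u f) := by
  induction f using LaurentPolynomial.induction_on' with
  | add f g hf hg => rw [map_add]; exact hf.add_right hg
  | C_mul_T m c =>
    rw [map_mul, C_eq_algebraMap, AlgHom.commutes, laurentEval_T]
    exact Commute.mul_right (Algebra.commutes c _).symm (h.units_zpow_right m)

namespace WordData

open LaurentPolynomial

variable {n : ℕ} {V E : Type*} [Fintype V] {D : WordData n V E} {k : Type*} [Field k]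

/-! ### The action of `ρ` on words -/

/-- The exponent of the leading power of `r` or `r'`, or `0` if there is none. -/
def powHead : Atoms n V E → ℤ
  | .pow _ m :: _ => m
  | _ => 0

/-- The word without its leading power of `r` or `r'`. -/
def powTail : Atoms n V E → Atoms n V E
  | .pow _ _ :: w => w
  | w => w

/-- Prepend a power of `r` or `r'` with a possibly vanishing exponent. -/
def mkPow (v : V) (m : ℤ) (g : Atoms n V E) : Atoms n V E := if m = 0 then g else .pow v m :: g

theorem mkPow_zero (v : V) (g : Atoms n V E) : mkPow v 0 g = g := if_pos rfl

theorem mkPow_of_ne (v : V) {m : ℤ} (h : m ≠ 0) (g : Atoms n V E) :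
    mkPow v m g = .pow v m :: g := if_neg h

theorem powHead_of_not {g : Atoms n V E} (hg : ¬ StartsPow g) : powHead g = 0 := by
  rcases g with _ | ⟨_ | _ | _, _⟩ <;> first | rfl | exact absurd trivial hg

theorem powTail_of_not {g : Atoms n V E} (hg : ¬ StartsPow g) : powTail g = g := by
  rcases g with _ | ⟨_ | _ | _, _⟩ <;> first | rfl | exact absurd trivial hg

theorem powHead_mkPow (v : V) (m : ℤ) {g : Atoms n V E} (hg : ¬ StartsPow g) :
    powHead (mkPow v m g) = m := by
  by_cases h : m = 0
  · subst h; rw [mkPow_zero, powHead_of_not hg]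
  · rw [mkPow_of_ne v h]; rfl

theorem powTail_mkPow (v : V) (m : ℤ) {g : Atoms n V E} (hg : ¬ StartsPow g) :
    powTail (mkPow v m g) = g := by
  by_cases h : m = 0
  · subst h; rw [mkPow_zero, powTail_of_not hg]
  · rw [mkPow_of_ne v h]; rfl

theorem cnt_mkPow (v : V) (m : ℤ) (g : Atoms n V E) : cnt (mkPow v m g) = cnt g := by
  unfold mkPow; split_ifs <;> rfl

theorem isWord_pow (h2 : 2 ∈ D.kinds) {v : V} {m : ℤ} (hm : m ≠ 0) {g : Atoms n V E}
    (hw : D.IsWord v g) (hg : ¬ StartsPow g) : D.IsWord v (.pow v m :: g) := by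
  refine ⟨⟨h2, hm⟩, rfl, fun y hy => ?_, hw⟩
  rcases g with _ | ⟨_ | _ | _, _⟩
  · simp at hy
  all_goals
    simp only [List.head?_cons, Option.mem_some_iff] at hy
    subst hy
  · trivial
  · trivial
  · exact absurd trivial hg

theorem isWord_mkPow (h2 : 2 ∈ D.kinds) {v : V} (m : ℤ) {g : Atoms n V E}
    (hw : D.IsWord v g) (hg : ¬ StartsPow g) : D.IsWord v (mkPow v m g) := by
  by_cases h : m = 0
  · subst h; rwa [mkPow_zero]
  · rw [mkPow_of_ne v h]; exact isWord_pow h2 h hw hg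

/-- A normal word is a power of `r` or `r'` followed by a normal word without leading power. -/
theorem powTail_spec {v : V} {w : Atoms n V E} (hw : D.IsWord v w) :
    D.IsWord v (powTail w) ∧ ¬ StartsPow (powTail w) ∧ mkPow v (powHead w) (powTail w) = w := by
  by_cases h : StartsPow w
  · rcases w with _ | ⟨_ | _ | ⟨i, m⟩, w⟩
    · exact h.elim
    · exact h.elim
    · exact h.elim
    · obtain rfl : i = v := hw.src
      refine ⟨hw.tail, fun h' => ?_, mkPow_of_ne i hw.good.2 w⟩
      rcases w with _ | ⟨_ | _ | _, w⟩
      · exact h'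
      · exact h'
      · exact h'
      · exact hw.ok _ rfl
  · rw [powTail_of_not h, powHead_of_not h, mkPow_zero]
    exact ⟨hw, h, rfl⟩

variable (D) in
/-- The words which differ from `g` by a leading power of `r` or `r'`, as a copy of the Laurent
polynomials in `ρ`. -/
def powFibre (q : V → kˣ) (v : V) (g : Atoms n V E) : k[T;T⁻¹] →ₗ[k] D.Space k :=
  (shiftedBasis (q v : k) ((q v)⁻¹ : k)).constr k fun m => D.wd k v (mkPow v m g)

theorem powFibre_basis (q : V → kˣ) (v : V) (g : Atoms n V E) (m : ℤ) :
    D.powFibre q v g (shiftedBasis (q v : k) ((q v)⁻¹ : k) m) = D.wd k v (mkPow v m g) :=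
  Basis.constr_basis _ _ _ _

theorem powFibre_one (q : V → kˣ) (v : V) (g : Atoms n V E) :
    D.powFibre q v g 1 = D.wd k v g := by
  rw [← shiftedBasis_zero (q v : k) ((q v)⁻¹ : k), powFibre_basis, mkPow_zero]

theorem powFibre_mem (q : V → kˣ) (v : V) (g : Atoms n V E) (f : k[T;T⁻¹]) :
    D.powFibre q v g f ∈ D.piece k v (cnt g) := by
  rw [← (shiftedBasis (q v : k) ((q v)⁻¹ : k)).linearCombination_repr f,
    Finsupp.linearCombination_apply, Finsupp.sum, map_sum]
  refine Submodule.sum_mem _ fun m _ => ?_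
  rw [map_smul, powFibre_basis]
  refine Submodule.smul_mem _ _ ?_
  rw [← cnt_mkPow v m g]
  exact wd_mem_piece _ _

variable (D) in
/-- The action of Laurent polynomials in `ρ` on words, as linear maps. -/
def powActLin (q : V → kˣ) (f : k[T;T⁻¹]) : D.Op k := D.lin fun v w => D.powFibre q v (powTail w)
    (f * shiftedBasis (q v : k) ((q v)⁻¹ : k) (powHead w))

theorem powActLin_fibre (h2 : 2 ∈ D.kinds) (q : V → kˣ) (f h : k[T;T⁻¹]) {v : V}
    {g : Atoms n V E} (hw : D.IsWord v g) (hg : ¬ StartsPow g) :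
    D.powActLin q f (D.powFibre q v g h) = D.powFibre q v g (f * h) := by
  have : D.powActLin q f ∘ₗ D.powFibre q v g = D.powFibre q v g ∘ₗ LinearMap.mulLeft k f := by
    apply (shiftedBasis (q v : k) ((q v)⁻¹ : k)).ext
    intro m
    rw [LinearMap.comp_apply, powFibre_basis, powActLin, lin_wd _ (isWord_mkPow h2 m hw hg),
      powHead_mkPow v m hg, powTail_mkPow v m hg]
    rfl
  exact LinearMap.congr_fun this h

theorem eq_powFibre (q : V → kˣ) {v : V} {w : Atoms n V E} (hw : D.IsWord v w) :
    D.wd k v w = D.powFibre q v (powTail w) (shiftedBasis (q v : k) ((q v)⁻¹ : k) (powHead w)) := by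
  rw [powFibre_basis, (powTail_spec hw).2.2]

variable (D) in
/-- The action of the ring of Laurent polynomials in `ρ` on words. -/
def powAct (h2 : 2 ∈ D.kinds) (q : V → kˣ) : k[T;T⁻¹] →ₐ[k] D.Op k := AlgHom.ofLinearMap
    { toFun := D.powActLin q
      map_add' := fun f f' => by
        apply space_ext
        intro v w hw
        simp only [powActLin, LinearMap.add_apply]
        rw [lin_wd _ hw, lin_wd _ hw, lin_wd _ hw, add_mul, map_add]
      map_smul' := fun c f => by
        apply space_ext
        intro v w hw
        simp only [powActLin, LinearMap.smul_apply, RingHom.id_apply]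
        rw [lin_wd _ hw, lin_wd _ hw, smul_mul_assoc, map_smul] }
    (by
      apply space_ext
      intro v w hw
      change D.powActLin q 1 _ = _
      rw [powActLin, lin_wd _ hw, one_mul, powFibre_basis, (powTail_spec hw).2.2]
      rfl)
    (fun f f' => by
      apply space_ext
      intro v w hw
      change D.powActLin q _ _ = D.powActLin q f (D.powActLin q f' _)
      obtain ⟨h, hg, _⟩ := powTail_spec hw
      rw [eq_powFibre q hw, powActLin_fibre h2 q _ _ h hg, powActLin_fibre h2 q _ _ h hg,
        powActLin_fibre h2 q _ _ h hg, mul_assoc])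

theorem powAct_fibre (h2 : 2 ∈ D.kinds) (q : V → kˣ) (f h : k[T;T⁻¹]) {v : V}
    {g : Atoms n V E} (hw : D.IsWord v g) (hg : ¬ StartsPow g) :
    D.powAct h2 q f (D.powFibre q v g h) = D.powFibre q v g (f * h) :=
  powActLin_fibre h2 q f h hw hg

theorem powAct_graded (h2 : 2 ∈ D.kinds) (q : V → kˣ) (f : k[T;T⁻¹]) :
    Graded (D.powAct h2 q f) := by
  apply Graded.of_mem
  intro v w hw
  obtain ⟨h, hg, hm⟩ := powTail_spec hw
  have hc : cnt w = cnt (powTail w) := by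
    rw [← cnt_mkPow v (powHead w) (powTail w), hm]
  rw [hc, eq_powFibre q hw, powAct_fibre h2 q _ _ h hg]
  exact powFibre_mem q v _ _

/-- The unit `T` of the ring of Laurent polynomials. -/
def laurentUnit (k : Type*) [Field k] : (k[T;T⁻¹])ˣ where
  val := T 1
  inv := T (-1)
  val_inv := by rw [← T_add]; simp
  inv_val := by rw [← T_add]; simp

/-- An operator in the role of `ρ`: it acts as `q` up to powers of `r`. -/
structure IsRho (D : WordData n V E) (q : V → kˣ) (R : (D.Op k)ˣ) : Prop where
  graded : R ∈ D.gradedUnits k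
  inv_sub : ∀ v w, D.IsWord v w → ¬ StartsPow w → (↑R⁻¹ : D.Op k) (D.wd k v w) -
      ((q v)⁻¹ : k) • D.wd k v w ∈ D.wspan k fun _ w => ¬ StartsCyc w

variable (D) in
/-- The action of `ρ` if powers of `r` are allowed in words. -/
def powRho (h2 : 2 ∈ D.kinds) (q : V → kˣ) : (D.Op k)ˣ :=
  Units.map (D.powAct h2 q : k[T;T⁻¹] →* D.Op k) (laurentUnit k)

theorem powRho_isRho (h2 : 2 ∈ D.kinds) (q : V → kˣ) : D.IsRho q (D.powRho h2 q) where
  graded := powAct_graded h2 q _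
  inv_sub v w hw hp := by
    have h1 : (↑(D.powRho h2 q)⁻¹ : D.Op k) = D.powAct h2 q (T (-1)) := rfl
    have h3 : (T (-1) : k[T;T⁻¹]) =
        shiftedBasis (q v : k) ((q v)⁻¹ : k) (-1) + ((q v)⁻¹ : k) • (1 : k[T;T⁻¹]) := by
      rw [shiftedBasis_apply, show (-1 : ℤ) = -((1 : ℕ) : ℤ) from rfl, signedPow_neg, pow_one,
        Algebra.smul_def, mul_one, C_eq_algebraMap]
      simp
    rw [h1, ← powFibre_one q v w, powAct_fibre h2 q _ _ hw hp, mul_one, h3, map_add, map_smul,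
      add_sub_cancel_right, powFibre_basis, mkPow_of_ne v (by norm_num)]
    exact wd_mem_wspan fun _ h => h

variable (D) in
/-- The diagonal action of functions on the vertices. -/
def diag (s : V → k) : D.Op k := ∑ i, s i • D.vproj k i

theorem diag_wd (s : V → k) (v : V) (w : Atoms n V E) :
    D.diag s (D.wd k v w) = s v • D.wd k v w := by
  rw [diag, LinearMap.sum_apply, Finset.sum_eq_single v]
  · rw [LinearMap.smul_apply, vproj_wd_self]
  · intro i _ hi
    rw [LinearMap.smul_apply, vproj_wd_of_ne hi.symm, smul_zero]
  · simp

variable (D) in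
/-- The action of `q`. -/
def diagRho (q : V → kˣ) : (D.Op k)ˣ where
  val := D.diag fun i => (q i : k)
  inv := D.diag fun i => ((q i)⁻¹ : k)
  val_inv := by
    apply space_ext
    intro v w _
    rw [End.mul_apply, diag_wd, map_smul, diag_wd, smul_smul]
    simp
  inv_val := by
    apply space_ext
    intro v w _
    rw [End.mul_apply, diag_wd, map_smul, diag_wd, smul_smul]
    simp

theorem diagRho_isRho (q : V → kˣ) : D.IsRho q (D.diagRho q) where
  graded := Graded.of_mem fun v w _ => by
    change D.diag _ _ ∈ _
    rw [diag_wd]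
    exact Submodule.smul_mem _ _ (wd_mem_piece v w)
  inv_sub v w _ _ := by
    change D.diag _ _ - _ ∈ _
    rw [diag_wd, sub_self]
    exact Submodule.zero_mem _

theorem vproj_mul_diag (s : V → k) (i : V) : D.vproj k i * D.diag s = s i • D.vproj k i := by
  apply space_ext
  intro v w _
  rw [End.mul_apply, diag_wd, map_smul, LinearMap.smul_apply]
  by_cases h : v = i
  · rw [h]
  · rw [vproj_wd_of_ne h, smul_zero, smul_zero]

theorem vproj_mul_powAct (h2 : 2 ∈ D.kinds) (q : V → kˣ) {v : V} {m : ℤ} {w : Atoms n V E}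
    (hw : D.IsWord v (.pow v m :: w)) :
    D.powAct h2 q (shiftedBasis (q v : k) ((q v)⁻¹ : k) m) (D.wd k v w) =
      D.wd k v (.pow v m :: w) := by
  have hp : ¬ StartsPow w := (powTail_spec hw).2.1
  rw [← powFibre_one q v w, powAct_fibre h2 q _ _ (show D.IsWord v w from hw.tail) hp, mul_one, powFibre_basis,
    mkPow_of_ne v hw.good.2]

section Eqv

variable {B : Type*} [Ring B] [Algebra k B] {φ : LAlg k D.quiver →ₐ[k] B} {val : Atom n V E → B}

theorem eqv_diagRho {q : V → kˣ} {u : Bˣ}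
    (hu : ∀ i, φ (e k D.quiver i) * u = (q i : k) • φ (e k D.quiver i))
    (hc : ∀ i, Commute (φ (e k D.quiver i)) u) :
    Eqv (D.evalBy φ val) (D.diagRho q : D.Op k) (u : B) := by
  apply Eqv.of_words
  intro v w _
  change D.evalBy φ val (D.diag _ _) = _
  rw [diag_wd, map_smul, ← e_mul_evalBy, ← mul_assoc, ← (hc v).eq, hu, smul_mul_assoc]

theorem eqv_powRho (h2 : 2 ∈ D.kinds) {q : V → kˣ} {u : Bˣ}
    (hc : ∀ i, Commute (φ (e k D.quiver i)) u)
    (hpow : ∀ i m, val (.pow i m) =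
      φ (e k D.quiver i) * laurentEval k u (shiftedBasis (q i : k) ((q i)⁻¹ : k) m)) :
    Eqv (D.evalBy φ val) (D.powRho h2 q : D.Op k) (u : B) := by
  have key : ∀ v g, D.IsWord v g → ¬ StartsPow g → ∀ f, D.evalBy φ val (D.powFibre q v g f) =
        laurentEval k u f * D.evalBy φ val (D.wd k v g) := by
    intro v g hw hg f
    have hcL := commute_laurentEval (k := k) (hc v)
    have : D.evalBy φ val ∘ₗ D.powFibre q v g =
        LinearMap.mulRight k (D.evalBy φ val (D.wd k v g)) ∘ₗ (laurentEval k u).toLinearMap := by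
      apply (shiftedBasis (q v : k) ((q v)⁻¹ : k)).ext
      intro m
      rw [LinearMap.comp_apply, powFibre_basis]
      change _ = laurentEval k u _ * D.evalBy φ val (D.wd k v g)
      by_cases hm : m = 0
      · rw [hm, mkPow_zero, shiftedBasis_zero, map_one, one_mul]
      · rw [mkPow_of_ne v hm, eval_wd (isWord_pow h2 hm hw hg), List.map_cons, List.prod_cons, hpow,
          eval_wd hw, (hcL _).eq, mul_assoc, ← mul_assoc, (hcL _).eq, mul_assoc]
        congr 1
        rw [← mul_assoc, ← map_mul, e_mul_self]
    exact LinearMap.congr_fun this f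
  apply Eqv.of_words
  intro v w hw
  obtain ⟨h, hg, _⟩ := powTail_spec hw
  rw [eq_powFibre q hw]
  change D.evalBy φ val (D.powAct h2 q (T 1) _) = _
  rw [powAct_fibre h2 q _ _ h hg, key _ _ h hg, key _ _ h hg, map_mul, laurentEval_T, zpow_one,
    mul_assoc]

end Eqv

end WordData

/-! ### The action of the cycle on words -/

open LaurentPolynomial

theorem exists_int_seq {α : Type*} (φ : ℤ → α ≃ α) (a : α) :
    ∃ s : ℤ → α, s 0 = a ∧ ∀ m, s (m + 1) = φ m (s m) := by
  let up : ℕ → α := fun n => Nat.rec a (fun n x => φ n x) n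
  let down : ℕ → α := fun n => Nat.rec a (fun n x => (φ (-(n + 1 : ℕ))).symm x) n
  refine ⟨fun m => match m with
    | Int.ofNat n => up n
    | Int.negSucc n => down (n + 1), rfl, fun m => ?_⟩
  match m with
  | Int.ofNat n => rfl
  | Int.negSucc 0 => exact ((φ (-1)).apply_symm_apply a).symm
  | Int.negSucc (n + 1) => exact ((φ (-(n + 2 : ℕ))).apply_symm_apply (down (n + 1))).symm

variable {k : Type*} [Field k]

theorem laurent_hom_ext {N : Type*} [AddCommGroup N] [Module k N] {f g : k[T;T⁻¹] →ₗ[k] N}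
    (h : ∀ m, f (T m) = g (T m)) : f = g :=
  (laurentBasis k).ext fun m => by rw [laurentBasis_apply]; exact h m

/-- A recursion for the values at the powers of `T`, in both directions from `ψ 1`. -/
theorem exists_laurent_solution {N : Type*} [AddCommGroup N] [Module k N] (X : (End k N)ˣ)
    (c : kˣ) (p : N) (h : k[T;T⁻¹] →ₗ[k] N) :
    ∃ ψ : k[T;T⁻¹] →ₗ[k] N, ψ 1 = p ∧
      ∀ f, (c : k) • ψ (T 1 * f) + h (T 1 * f) = (X : End k N) (ψ f) := by
  obtain ⟨s, h0, hs⟩ := exists_int_seq (α := N) (fun m =>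
    { toFun := fun x => ((c⁻¹ : kˣ) : k) • ((X : End k N) x - h (T (m + 1)))
      invFun := fun y => (↑X⁻¹ : End k N) ((c : k) • y + h (T (m + 1)))
      left_inv := fun x => by
        simp only [smul_smul, Units.mul_inv, one_smul, sub_add_cancel]
        rw [← End.mul_apply, Units.inv_mul, End.one_apply]
      right_inv := fun y => by
        simp only []
        rw [← End.mul_apply, Units.mul_inv, End.one_apply, add_sub_cancel_right,
          smul_smul, Units.inv_mul, one_smul] }) p
  have hb : ∀ m, (laurentBasis k).constr k s (T m) = s m := fun m => by
    rw [← laurentBasis_apply m, Basis.constr_basis]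
  refine ⟨(laurentBasis k).constr k s, by rw [← T_zero, hb, h0], fun f => ?_⟩
  have : (c : k) • ((laurentBasis k).constr k s ∘ₗ LinearMap.mulLeft k (T 1)) +
      h ∘ₗ LinearMap.mulLeft k (T 1) = (X : End k N) ∘ₗ (laurentBasis k).constr k s := by
    apply laurent_hom_ext
    intro m
    simp only [LinearMap.add_apply, LinearMap.smul_apply, LinearMap.comp_apply,
      LinearMap.mulLeft_apply]
    rw [← T_add, hb, hb, add_comm 1 m, hs]
    simp [smul_smul]
  exact LinearMap.congr_fun this f

namespace WordData

variable {n : ℕ} {V E : Type*} [Fintype V] {D : WordData n V E}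

/-- The exponent `m` of the leading atom `e_i x^m a^l` of a word, or `0` if there is none. -/
def cycM : Atoms n V E → ℤ
  | .cyc _ m _ :: _ => m
  | _ => 0

/-- The exponent `l` of the leading atom `e_i x^m a^l` of a word, or `0` if there is none. -/
def cycL : Atoms n V E → ℤ
  | .cyc _ _ l :: _ => l
  | _ => 0

/-- The word without its leading atom of the cycle. -/
def cycTail : Atoms n V E → Atoms n V E
  | .cyc _ _ _ :: w => w
  | w => w

/-- Prepend an atom of the cycle with possibly vanishing exponents. -/
def mkCyc (i : ZMod n) (m l : ℤ) (g : Atoms n V E) : Atoms n V E :=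
  if m = 0 ∧ l = 0 then g else .cyc i m l :: g

theorem mkCyc_zero (i : ZMod n) (g : Atoms n V E) : mkCyc i 0 0 g = g := if_pos ⟨rfl, rfl⟩

theorem mkCyc_of (i : ZMod n) {m l : ℤ} (h : m ≠ 0 ∨ l ≠ 0) (g : Atoms n V E) :
    mkCyc i m l g = .cyc i m l :: g := if_neg (by tauto)

theorem cyc_of_not {g : Atoms n V E} (hg : ¬ StartsCyc g) :
    cycM g = 0 ∧ cycL g = 0 ∧ cycTail g = g := by
  rcases g with _ | ⟨_ | _ | _, _⟩ <;> first | exact ⟨rfl, rfl, rfl⟩ | exact absurd trivial hg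

theorem cyc_mkCyc (i : ZMod n) (m l : ℤ) {g : Atoms n V E} (hg : ¬ StartsCyc g) :
    cycM (mkCyc i m l g) = m ∧ cycL (mkCyc i m l g) = l ∧ cycTail (mkCyc i m l g) = g := by
  by_cases h : m = 0 ∧ l = 0
  · obtain ⟨rfl, rfl⟩ := h
    rw [mkCyc_zero]; exact cyc_of_not hg
  · rw [mkCyc_of i (by tauto)]; exact ⟨rfl, rfl, rfl⟩

theorem isWord_cyc (h0 : 0 ∈ D.kinds) {i : ZMod n} {m l : ℤ} (hm : m ≠ 0 ∨ l ≠ 0)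
    {g : Atoms n V E} (hw : D.IsWord (D.cyc (i + l)) g) (hg : ¬ StartsCyc g) :
    D.IsWord (D.cyc i) (.cyc i m l :: g) := by
  refine ⟨⟨h0, hm⟩, rfl, fun y hy => ?_, hw⟩
  rcases g with _ | ⟨_ | _ | _, _⟩
  · simp at hy
  all_goals
    simp only [List.head?_cons, Option.mem_some_iff] at hy
    subst hy
  · exact absurd trivial hg
  · trivial
  · trivial

theorem isWord_mkCyc (h0 : 0 ∈ D.kinds) {i : ZMod n} (m : ℤ) {l : ℤ}
    {g : Atoms n V E} (hw : D.IsWord (D.cyc (i + l)) g) (hg : ¬ StartsCyc g) :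
    D.IsWord (D.cyc i) (mkCyc i m l g) := by
  by_cases h : m = 0 ∧ l = 0
  · obtain ⟨rfl, rfl⟩ := h
    rw [mkCyc_zero]; simpa using hw
  · rw [mkCyc_of i (by tauto)]; exact isWord_cyc h0 (by tauto) hw hg

/-- A normal word which starts on the cycle is an atom of the cycle followed by a normal word
without leading atom of the cycle. -/
theorem cycTail_spec (inj : Function.Injective D.cyc) {i : ZMod n} {w : Atoms n V E}
    (hw : D.IsWord (D.cyc i) w) :
    D.IsWord (D.cyc (i + cycL w)) (cycTail w) ∧ ¬ StartsCyc (cycTail w) ∧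
      mkCyc i (cycM w) (cycL w) (cycTail w) = w := by
  by_cases h : StartsCyc w
  · rcases w with _ | ⟨⟨j, m, l⟩ | _ | _, w⟩
    · exact h.elim
    · obtain rfl : j = i := inj hw.src
      refine ⟨hw.tail, fun h' => ?_, mkCyc_of j hw.good.2 w⟩
      rcases w with _ | ⟨_ | _ | _, w⟩
      · exact h'
      · exact hw.ok _ rfl
      · exact h'
      · exact h'
    · exact h.elim
    · exact h.elim
  · obtain ⟨h1, h2, h3⟩ := cyc_of_not h
    rw [h1, h2, h3, mkCyc_zero]
    exact ⟨by simpa using hw, h, rfl⟩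

theorem not_startsCyc {v : V} {w : Atoms n V E} (hv : ∀ i, D.cyc i ≠ v) (hw : D.IsWord v w) :
    ¬ StartsCyc w := by
  rcases w with _ | ⟨⟨j, _, _⟩ | _ | _, w⟩
  · exact id
  · exact absurd hw.src (hv j)
  · exact id
  · exact id

variable (D) in
/-- The situation in which the cycle acts on normal words. The parameter `δ` is `0` or `1`,
according to whether powers of `x` or of `x - 1` are used, and `U` is the operator for which
`1 + a* a` is `U` times `1 + a a*`. -/
structure CycSetup (k : Type*) [Field k] where
  zero_mem : 0 ∈ D.kinds
  inj : Function.Injective D.cyc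
  δ : k
  c : ZMod n → kˣ
  U : (D.Op k)ˣ
  U_mem : U ∈ D.gradedUnits k
  U_off : ∀ v w, (∀ i, D.cyc i ≠ v) → D.IsWord v w → (U : D.Op k) (D.wd k v w) = D.wd k v w
  U_sub : ∀ i w, D.IsWord (D.cyc i) w → StartsCyc w →
    (U : D.Op k) (D.wd k (D.cyc i) w) - (c i : k) • D.wd k (D.cyc i) w ∈
      D.wspan k fun _ w => ¬ StartsCyc w

namespace CycSetup

variable (C : D.CycSetup k)

/-- The basis of the Laurent polynomials in `x` which is used in words. -/
def basis : Basis ℤ k k[T;T⁻¹] := shiftedBasis C.δ C.δ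

theorem basis_zero : C.basis 0 = 1 := shiftedBasis_zero _ _

/-- The words `e_i x^m a^l g` for fixed `i`, `l` and `g`, as a copy of the Laurent polynomials
in `x`. -/
def fib (i : ZMod n) (l : ℤ) (g : Atoms n V E) : k[T;T⁻¹] →ₗ[k] D.Space k :=
  C.basis.constr k fun m => D.wd k (D.cyc i) (mkCyc i m l g)

theorem fib_basis (i : ZMod n) (l : ℤ) (g : Atoms n V E) (m : ℤ) :
    C.fib i l g (C.basis m) = D.wd k (D.cyc i) (mkCyc i m l g) :=
  Basis.constr_basis _ _ _ _

theorem fib_one (i : ZMod n) (l : ℤ) (g : Atoms n V E) :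
    C.fib i l g 1 = D.wd k (D.cyc i) (mkCyc i 0 l g) := by
  rw [← C.basis_zero, fib_basis]

theorem eq_fib {i : ZMod n} {w : Atoms n V E} (hw : D.IsWord (D.cyc i) w) :
    D.wd k (D.cyc i) w = C.fib i (cycL w) (cycTail w) (C.basis (cycM w)) := by
  rw [fib_basis, (cycTail_spec C.inj hw).2.2]

theorem eq_fib_zero (i : ZMod n) (w : Atoms n V E) :
    D.wd k (D.cyc i) w = C.fib i 0 w 1 := by
  rw [fib_one, mkCyc_zero]

theorem fib_vproj (i : ZMod n) (l : ℤ) (g : Atoms n V E) (f : k[T;T⁻¹]) :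
    D.vproj k (D.cyc i) (C.fib i l g f) = C.fib i l g f := by
  have : D.vproj k (D.cyc i) ∘ₗ C.fib i l g = C.fib i l g := by
    apply C.basis.ext
    intro m
    rw [LinearMap.comp_apply, fib_basis, vproj_wd_self]
  exact LinearMap.congr_fun this f

theorem vproj_fib_of_ne {i : ZMod n} {v : V} (h : D.cyc i ≠ v) (l : ℤ) (g : Atoms n V E)
    (f : k[T;T⁻¹]) : D.vproj k v (C.fib i l g f) = 0 := by
  rw [← C.fib_vproj, ← End.mul_apply, vproj_idem.ortho (Ne.symm h)]; rfl

section Lin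

variable {N : Type*} [AddCommGroup N] [Module k N]

open Classical in
/-- The linear map on words which is given by a function on words which start off the cycle, and by
linear maps on the spaces of words `e_i x^m a^l g`. -/
def cycLin (f : V → Atoms n V E → N)
    (F : ZMod n → ℤ → Atoms n V E → k[T;T⁻¹] →ₗ[k] N) : D.Space k →ₗ[k] N :=
  D.lin fun v w =>
    if h : ∃ i, D.cyc i = v then F h.choose (cycL w) (cycTail w) (C.basis (cycM w)) else f v w

variable (f : V → Atoms n V E → N) (F : ZMod n → ℤ → Atoms n V E → k[T;T⁻¹] →ₗ[k] N)

theorem cycLin_off {v : V} {w : Atoms n V E} (hv : ∀ i, D.cyc i ≠ v) (hw : D.IsWord v w) :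
    C.cycLin f F (D.wd k v w) = f v w := by
  rw [cycLin, lin_wd _ hw, dif_neg (by push Not; exact hv)]

theorem cycLin_fib {i : ZMod n} {l : ℤ} {g : Atoms n V E}
    (hw : D.IsWord (D.cyc (i + l)) g) (hg : ¬ StartsCyc g) (p : k[T;T⁻¹]) :
    C.cycLin f F (C.fib i l g p) = F i l g p := by
  have : C.cycLin f F ∘ₗ C.fib i l g = F i l g := by
    apply C.basis.ext
    intro m
    have h : ∃ j, D.cyc j = D.cyc i := ⟨i, rfl⟩
    obtain ⟨h1, h2, h3⟩ := cyc_mkCyc i m l hg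
    rw [LinearMap.comp_apply, fib_basis, cycLin, lin_wd _ (isWord_mkCyc C.zero_mem m hw hg),
      dif_pos h, h1, h2, h3, C.inj h.choose_spec]
  exact LinearMap.congr_fun this p

include C in
theorem cyc_ext {f g : D.Space k →ₗ[k] N}
    (hoff : ∀ v w, (∀ i, D.cyc i ≠ v) → D.IsWord v w → f (D.wd k v w) = g (D.wd k v w))
    (hfib : ∀ i (l : ℤ) w, D.IsWord (D.cyc (i + l)) w → ¬ StartsCyc w → ∀ p,
      f (C.fib i l w p) = g (C.fib i l w p)) : f = g := by
  apply space_ext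
  intro v w hw
  by_cases hv : ∃ i, D.cyc i = v
  · obtain ⟨i, rfl⟩ := hv
    obtain ⟨h1, h2, _⟩ := cycTail_spec C.inj hw
    rw [C.eq_fib hw]
    exact hfib _ _ _ h1 h2 _
  · push Not at hv
    exact hoff v w hv hw

end Lin

/-- Multiplication by a Laurent polynomial on words which start on the cycle. -/
def mulOp (p : k[T;T⁻¹]) : D.Op k :=
  C.cycLin (fun v w => D.wd k v w) fun i l g => C.fib i l g ∘ₗ LinearMap.mulLeft k p

theorem mulOp_fib {i : ZMod n} {l : ℤ} {g : Atoms n V E}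
    (hw : D.IsWord (D.cyc (i + l)) g) (hg : ¬ StartsCyc g) (p f : k[T;T⁻¹]) :
    C.mulOp p (C.fib i l g f) = C.fib i l g (p * f) := C.cycLin_fib _ _ hw hg f

theorem mulOp_off (p : k[T;T⁻¹]) {v : V} {w : Atoms n V E} (hv : ∀ i, D.cyc i ≠ v)
    (hw : D.IsWord v w) : C.mulOp p (D.wd k v w) = D.wd k v w := C.cycLin_off _ _ hv hw

theorem mulOp_mul {p q : k[T;T⁻¹]} (h : p * q = 1) : C.mulOp p * C.mulOp q = 1 := C.cyc_ext
    (fun v w hv hw => by rw [End.mul_apply, C.mulOp_off _ hv hw, C.mulOp_off _ hv hw]; rfl)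
    (fun i l g hw hg f => by
      rw [End.mul_apply, C.mulOp_fib hw hg, C.mulOp_fib hw hg, ← mul_assoc, h, one_mul]; rfl)

/-- The operator of `x`. -/
def X : (D.Op k)ˣ where
  val := C.mulOp (T 1)
  inv := C.mulOp (T (-1))
  val_inv := C.mulOp_mul (by rw [← T_add]; rfl)
  inv_val := C.mulOp_mul (by rw [← T_add]; rfl)

theorem X_fib {i : ZMod n} {l : ℤ} {g : Atoms n V E}
    (hw : D.IsWord (D.cyc (i + l)) g) (hg : ¬ StartsCyc g) (f : k[T;T⁻¹]) :
    (C.X : D.Op k) (C.fib i l g f) = C.fib i l g (T 1 * f) :=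
  C.mulOp_fib hw hg _ f

theorem X_off {v : V} {w : Atoms n V E} (hv : ∀ i, D.cyc i ≠ v)
    (hw : D.IsWord v w) : (C.X : D.Op k) (D.wd k v w) = D.wd k v w :=
  C.mulOp_off _ hv hw

/-- An operator preserves the starting vertex, if it fixes words which start off the cycle, and
preserves the starting vertex of the others. -/
theorem vproj_commute {T : D.Op k}
    (hoff : ∀ v w, (∀ i, D.cyc i ≠ v) → D.IsWord v w → T (D.wd k v w) = D.wd k v w)
    (hfib : ∀ i (l : ℤ) w, D.IsWord (D.cyc (i + l)) w → ¬ StartsCyc w → ∀ p,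
      D.vproj k (D.cyc i) (T (C.fib i l w p)) = T (C.fib i l w p)) (v : V) :
    Commute (D.vproj k v) T := by
  apply C.cyc_ext
  · intro u w hu hw
    rw [End.mul_apply, End.mul_apply, hoff u w hu hw]
    by_cases h : u = v
    · subst h; rw [vproj_wd_self, hoff u w hu hw]
    · rw [vproj_wd_of_ne h, map_zero]
  · intro i l g hw hg p
    rw [End.mul_apply, End.mul_apply]
    by_cases h : D.cyc i = v
    · subst h; rw [fib_vproj, hfib i l g hw hg]
    · rw [C.vproj_fib_of_ne h, map_zero, ← hfib i l g hw hg, ← End.mul_apply,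
        vproj_idem.ortho (Ne.symm h)]
      rfl

theorem vproj_commute_X (v : V) : Commute (D.vproj k v) (C.X : D.Op k) :=
  C.vproj_commute (fun _ _ => C.X_off)
    (fun i l g hw hg p => by rw [C.X_fib hw hg, fib_vproj]) v

theorem X_zpow_fib {i : ZMod n} {l : ℤ} {g : Atoms n V E}
    (hw : D.IsWord (D.cyc (i + l)) g) (hg : ¬ StartsCyc g) (m : ℤ) (f : k[T;T⁻¹]) :
    (↑(C.X ^ m) : D.Op k) (C.fib i l g f) = C.fib i l g (T m * f) := by
  induction m using Int.induction_on with
  | zero => simp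
  | succ m ih =>
    rw [add_comm, zpow_add, zpow_one, Units.val_mul, End.mul_apply, ih, C.X_fib hw hg, T_add,
      mul_assoc]
  | pred m ih =>
    rw [sub_eq_add_neg, add_comm, zpow_add, zpow_neg_one, Units.val_mul, End.mul_apply, ih]
    exact (C.mulOp_fib hw hg _ _).trans (by rw [T_add, mul_assoc])

/-- The operator of `y = 1 + a* a`. -/
def Y : (D.Op k)ˣ := C.U * C.X

theorem vproj_commute_Y (v : V) : Commute (D.vproj k v) (C.Y : D.Op k) :=
  (C.U_mem.vert v).mul_right (C.vproj_commute_X v)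

theorem Y_off {v : V} {w : Atoms n V E} (hv : ∀ i, D.cyc i ≠ v)
    (hw : D.IsWord v w) : (C.Y : D.Op k) (D.wd k v w) = D.wd k v w := by
  change (C.U : D.Op k) ((C.X : D.Op k) _) = _
  rw [C.X_off hv hw, C.U_off v w hv hw]

/-- The isomorphism which carries the multiplication by `x` to the multiplication by `y`, as a
linear map. -/
def Φ : D.Op k := C.cycLin (fun v w => D.wd k v w) fun i l g =>
    (LinearMap.applyₗ (D.wd k (D.cyc i) (mkCyc i 0 l g))) ∘ₗ (laurentEval k C.Y).toLinearMap

theorem Φ_off {v : V} {w : Atoms n V E} (hv : ∀ i, D.cyc i ≠ v)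
    (hw : D.IsWord v w) : C.Φ (D.wd k v w) = D.wd k v w := C.cycLin_off _ _ hv hw

theorem Φ_fib {i : ZMod n} {l : ℤ} {g : Atoms n V E}
    (hw : D.IsWord (D.cyc (i + l)) g) (hg : ¬ StartsCyc g) (f : k[T;T⁻¹]) :
    C.Φ (C.fib i l g f) = laurentEval k C.Y f (D.wd k (D.cyc i) (mkCyc i 0 l g)) :=
  C.cycLin_fib _ _ hw hg f

theorem Φ_fib_one {i : ZMod n} {l : ℤ} {g : Atoms n V E}
    (hw : D.IsWord (D.cyc (i + l)) g) (hg : ¬ StartsCyc g) :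
    C.Φ (C.fib i l g 1) = C.fib i l g 1 := by
  rw [Φ_fib C hw hg, map_one, fib_one, End.one_apply]

theorem Φ_mul_X : C.Φ * (C.X : D.Op k) = C.Y * C.Φ := by
  apply C.cyc_ext
  · intro v w hv hw
    rw [End.mul_apply, End.mul_apply, C.X_off hv hw, C.Φ_off hv hw, C.Y_off hv hw]
  · intro i l g hw hg p
    rw [End.mul_apply, End.mul_apply, C.X_fib hw hg, C.Φ_fib hw hg, C.Φ_fib hw hg,
      map_mul, laurentEval_T, zpow_one, End.mul_apply]

theorem vproj_commute_Φ (v : V) : Commute (D.vproj k v) C.Φ :=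
  C.vproj_commute (fun _ _ => C.Φ_off) (fun i l g hw hg p => by
    rw [C.Φ_fib hw hg, ← End.mul_apply, (commute_laurentEval (C.vproj_commute_Y _) p).eq,
      End.mul_apply, vproj_wd_self]) v

/-- The deviation of `U` from the scalar `c i`. -/
def dev (i : ZMod n) : D.Op k := C.U - (C.c i : k) • 1

theorem dev_apply (i : ZMod n) (x : D.Space k) :
    C.dev i x = (C.U : D.Op k) x - (C.c i : k) • x := rfl

/-- On words `e_i x^m a^l g`, the deviation of `U` from a scalar yields words which do not start
with an atom of the cycle, or have fewer such atoms. -/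
theorem dev_fib_mem {i : ZMod n} {l : ℤ} {g : Atoms n V E}
    (hw : D.IsWord (D.cyc (i + l)) g) (hg : ¬ StartsCyc g) (f : k[T;T⁻¹]) :
    C.dev i (C.fib i l g f) ∈ D.wspan k fun _ w => StartsCyc w → cnt w ≤ cnt g := by
  rw [← C.basis.linearCombination_repr f, Finsupp.linearCombination_apply, Finsupp.sum, map_sum,
    map_sum]
  refine Submodule.sum_mem _ fun m _ => ?_
  rw [map_smul, map_smul, fib_basis]
  refine Submodule.smul_mem _ _ ?_
  by_cases h : m = 0 ∧ l = 0
  · obtain ⟨rfl, rfl⟩ := h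
    rw [mkCyc_zero, dev_apply]
    have hp : (C.U : D.Op k) (D.wd k (D.cyc i) g) -
        (C.c i : k) • D.wd k (D.cyc i) g ∈ D.piece k (D.cyc i) (cnt g) :=
      Submodule.sub_mem _ (C.U_mem.mem_piece (wd_mem_piece _ _))
        (Submodule.smul_mem _ _ (wd_mem_piece _ _))
    exact wspan_mono (fun _ w h _ => h.2.le) (piece_le_wspan _ _ hp)
  · have hw' := isWord_mkCyc C.zero_mem m hw hg
    rw [mkCyc_of i (by tauto)] at hw' ⊢
    rw [dev_apply]
    exact wspan_mono (fun _ w h h' => absurd h' h) (C.U_sub i _ hw' trivial)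

theorem Y_fib {i : ZMod n} {l : ℤ} {g : Atoms n V E}
    (hw : D.IsWord (D.cyc (i + l)) g) (hg : ¬ StartsCyc g) (f : k[T;T⁻¹]) :
    (C.Y : D.Op k) (C.fib i l g f) =
      (C.c i : k) • C.fib i l g (T 1 * f) + C.dev i (C.fib i l g (T 1 * f)) := by
  change (C.U : D.Op k) ((C.X : D.Op k) _) = _
  rw [C.X_fib hw hg, dev_apply]
  abel

/-- By induction on the number of cycle atoms: the range is stable under `Y` and contains the words
`e_i a^l g`. -/
theorem wd_mem_range_Φ {v : V} {w : Atoms n V E} (hw : D.IsWord v w) :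
    D.wd k v w ∈ LinearMap.range C.Φ := by
  induction hN : cnt w using Nat.strong_induction_on generalizing v w with
  | _ N ih =>
  by_cases hv : ∃ i, D.cyc i = v
  swap
  · push Not at hv
    exact ⟨_, C.Φ_off hv hw⟩
  obtain ⟨i, rfl⟩ := hv
  have hbase : ∀ v w, D.IsWord v w → ¬ StartsCyc w → D.wd k v w ∈ LinearMap.range C.Φ := by
    intro v w hw h
    by_cases hv : ∃ i, D.cyc i = v
    · obtain ⟨i, rfl⟩ := hv
      rw [C.eq_fib_zero]
      exact ⟨_, C.Φ_fib_one (by simpa using hw) h⟩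
    · push Not at hv
      exact ⟨_, C.Φ_off hv hw⟩
  by_cases h : StartsCyc w
  swap
  · exact hbase _ _ hw h
  obtain ⟨h1, h2, _⟩ := cycTail_spec C.inj hw
  have hcnt : cnt (cycTail w) < N := by
    rcases w with _ | ⟨_ | _ | _, w⟩ <;> first | exact h.elim | exact hN ▸ Nat.lt_succ_self _
  rw [C.eq_fib hw]
  set g := cycTail w
  set l := cycL w
  have hdev : ∀ f, C.dev i (C.fib i l g f) ∈ LinearMap.range C.Φ := fun f => by
    refine wspan_induction ?_ (C.dev_fib_mem h1 h2 f)
    intro v w hw hP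
    by_cases h : StartsCyc w
    · exact ih _ ((hP h).trans_lt hcnt) hw rfl
    · exact hbase v w hw h
  have hup : ∀ f, C.fib i l g f ∈ LinearMap.range C.Φ →
      C.fib i l g (T 1 * f) ∈ LinearMap.range C.Φ := by
    rintro f ⟨x, hx⟩
    have h3 : (C.Y : D.Op k) (C.fib i l g f) ∈ LinearMap.range C.Φ := ⟨(C.X : D.Op k) x, by
        rw [← hx, ← End.mul_apply, Φ_mul_X, End.mul_apply]⟩
    rw [C.Y_fib h1 h2] at h3
    have h4 := Submodule.sub_mem _ h3 (hdev (T 1 * f))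
    rw [add_sub_cancel_right] at h4
    have h5 := Submodule.smul_mem _ ((C.c i : k)⁻¹) h4
    rwa [smul_smul, inv_mul_cancel₀ (C.c i).ne_zero, one_smul] at h5
  have hdown : ∀ f, C.fib i l g (T 1 * f) ∈ LinearMap.range C.Φ →
      C.fib i l g f ∈ LinearMap.range C.Φ := by
    intro f hf
    have h3 := Submodule.add_mem _ (Submodule.smul_mem _ (C.c i : k) hf) (hdev (T 1 * f))
    rw [← C.Y_fib h1 h2] at h3
    obtain ⟨x, hx⟩ := h3
    refine ⟨(↑C.X⁻¹ : D.Op k) x, ?_⟩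
    have h6 : ↑C.Y⁻¹ * C.Φ = C.Φ * ↑C.X⁻¹ := by
      rw [Units.inv_mul_eq_iff_eq_mul, ← mul_assoc, ← Φ_mul_X, mul_assoc, Units.mul_inv, mul_one]
    rw [← End.mul_apply, ← h6, End.mul_apply, hx, ← End.mul_apply, Units.inv_mul, End.one_apply]
  have hall : ∀ m : ℤ, C.fib i l g (T m) ∈ LinearMap.range C.Φ := by
    intro m
    induction m using Int.induction_on with
    | zero => rw [T_zero]; exact ⟨_, C.Φ_fib_one h1 h2⟩
    | succ m ih => rw [add_comm, T_add]; exact hup _ ih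
    | pred m ih => exact hdown _ (by rw [← T_add]; simpa using ih)
  generalize C.basis (cycM w) = f
  induction f using LaurentPolynomial.induction_on' with
  | add f g hf hg => rw [map_add]; exact Submodule.add_mem _ hf hg
  | C_mul_T m c =>
    rw [← smul_eq_C_mul, map_smul]
    exact Submodule.smul_mem _ _ (hall m)

theorem Φ_surjective : Function.Surjective C.Φ := by
  rw [← LinearMap.range_eq_top, eq_top_iff]
  intro x _
  refine space_induction (P := fun x => x ∈ LinearMap.range C.Φ) x
    (fun v w hw => C.wd_mem_range_Φ hw) (fun x y => Submodule.add_mem _)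
    (fun c x => Submodule.smul_mem _ c) (Submodule.zero_mem _)

/-- The linear map on words which is given by linear maps on the spaces of words `e_i x^m a^l g`,
and fixes all words which do not start with an atom of the cycle. -/
def glue (F : ZMod n × ℤ × Atoms n V E → k[T;T⁻¹] →ₗ[k] D.Space k) :
    D.Op k :=
  D.lin fun v w => match w with
    | .cyc i m l :: g => F (i, l, g) (C.basis m)
    | w => D.wd k v w

theorem glue_of_not (F : ZMod n × ℤ × Atoms n V E → k[T;T⁻¹] →ₗ[k] D.Space k) {v : V}
    {w : Atoms n V E} (hw : D.IsWord v w) (h : ¬ StartsCyc w) :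
    C.glue F (D.wd k v w) = D.wd k v w := by
  rw [glue, lin_wd _ hw]
  rcases w with _ | ⟨_ | _ | _, _⟩ <;> first | rfl | exact absurd trivial h

/-- The inverse of `Φ` is constructed by recursion on the number of atoms of the cycle. -/
theorem exists_retraction : ∃ Ψ : D.Op k,
    (∀ v w, D.IsWord v w → ¬ StartsCyc w → Ψ (D.wd k v w) = D.wd k v w) ∧
    (∀ i (l : ℤ) g, D.IsWord (D.cyc (i + l)) g → ¬ StartsCyc g → Ψ (C.fib i l g 1) = C.fib i l g 1 ∧
      ∀ f, Ψ ((C.Y : D.Op k) (C.fib i l g f)) = (C.X : D.Op k) (Ψ (C.fib i l g f))) := by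
  classical
  choose sol hsol using fun (i : ZMod n) (p : D.Space k) (h : k[T;T⁻¹] →ₗ[k] D.Space k) =>
    exists_laurent_solution C.X (C.c i) p h
  have wf : WellFounded fun a b : ZMod n × ℤ × Atoms n V E => cnt a.2.2 < cnt b.2.2 :=
    InvImage.wf (fun a : ZMod n × ℤ × Atoms n V E => cnt a.2.2) wellFounded_lt
  obtain ⟨F, hF⟩ := exists_wellFounded_fix wf
    (fun a (F : _ → k[T;T⁻¹] →ₗ[k] D.Space k) =>
      if D.IsWord (D.cyc (a.1 + a.2.1)) a.2.2 ∧ ¬ StartsCyc a.2.2 then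
        sol a.1 (C.fib a.1 a.2.1 a.2.2 1) (C.glue F ∘ₗ C.dev a.1 ∘ₗ C.fib a.1 a.2.1 a.2.2)
      else 0) (by
    rintro ⟨i, l, g⟩ F F' hFF
    split_ifs with h
    · congr 1
      refine LinearMap.ext fun f => ?_
      have hmem := C.dev_fib_mem h.1 h.2 f
      have hle : D.wspan k (fun _ w => StartsCyc w → cnt w ≤ cnt g) ≤
          LinearMap.eqLocus (C.glue F) (C.glue F') := by
        refine wspan_induction fun v w hw hP => ?_
        change C.glue F (D.wd k v w) = C.glue F' (D.wd k v w)
        by_cases hc : StartsCyc w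
        · rcases w with _ | ⟨⟨j, m, l'⟩ | _ | _, w⟩
          · exact hc.elim
          · rw [glue, glue, lin_wd _ hw, lin_wd _ hw]
            have := hFF (j, l', w) (Nat.lt_of_succ_le (hP hc))
            simp only [this]
          · exact hc.elim
          · exact hc.elim
        · rw [C.glue_of_not F hw hc, C.glue_of_not F' hw hc]
      exact hle hmem
    · rfl)
  refine ⟨C.glue F, fun v w => C.glue_of_not F, fun i l g hw hg => ?_⟩
  have hFa := hF (i, l, g)
  rw [if_pos ⟨hw, hg⟩] at hFa
  obtain ⟨h1, h2⟩ := hsol i (C.fib i l g 1) (C.glue F ∘ₗ C.dev i ∘ₗ C.fib i l g)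
  rw [← hFa] at h1 h2
  have hfib : ∀ f, C.glue F (C.fib i l g f) = F (i, l, g) f := by
    intro f
    have : C.glue F ∘ₗ C.fib i l g = F (i, l, g) := by
      apply C.basis.ext
      intro m
      rw [LinearMap.comp_apply, fib_basis]
      have hw' := isWord_mkCyc C.zero_mem m hw hg
      by_cases h : m = 0 ∧ l = 0
      · obtain ⟨rfl, rfl⟩ := h
        rw [mkCyc_zero] at hw' ⊢
        rw [C.glue_of_not F hw' hg, C.basis_zero, h1, fib_one, mkCyc_zero]
      · rw [mkCyc_of i (by tauto)] at hw' ⊢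
        rw [glue, lin_wd _ hw']
    exact LinearMap.congr_fun this f
  refine ⟨by rw [hfib, h1], fun f => ?_⟩
  rw [C.Y_fib hw hg, map_add, map_smul, hfib, hfib, ← h2]
  rfl

theorem Φ_injective : Function.Injective C.Φ := by
  obtain ⟨Ψ, h1, h2⟩ := C.exists_retraction
  suffices h : Ψ * C.Φ = 1 from Function.LeftInverse.injective (g := Ψ) fun x =>
    LinearMap.congr_fun h x
  -- `Ψ` intertwines the actions of `Y` and `X`
  have hΨY : Ψ * (C.Y : D.Op k) = C.X * Ψ := by
    apply C.cyc_ext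
    · intro v w hv hw
      rw [End.mul_apply, End.mul_apply, C.Y_off hv hw, h1 v w hw (not_startsCyc hv hw),
        C.X_off hv hw]
    · intro i l g hw hg p
      exact (h2 i l g hw hg).2 p
  have hz : ∀ m : ℤ, Ψ * ↑(C.Y ^ m) = ↑(C.X ^ m) * Ψ := fun m =>
    (SemiconjBy.units_zpow_right (show SemiconjBy Ψ (C.Y : D.Op k) C.X from hΨY)
      m).eq
  apply C.cyc_ext
  · intro v w hv hw
    rw [End.mul_apply, C.Φ_off hv hw, h1 v w hw (not_startsCyc hv hw)]; rfl
  · intro i l g hw hg p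
    have : (Ψ * C.Φ) ∘ₗ C.fib i l g = C.fib i l g := by
      apply laurent_hom_ext
      intro m
      rw [LinearMap.comp_apply, End.mul_apply, C.Φ_fib hw hg, laurentEval_T,
        ← End.mul_apply, hz, End.mul_apply, ← fib_one, (h2 i l g hw hg).1,
        C.X_zpow_fib hw hg, mul_one]
    exact LinearMap.congr_fun this p

/-- `Φ` as a unit. -/
def Φu : (D.Op k)ˣ := LinearMap.GeneralLinearGroup.ofLinearEquiv
    (LinearEquiv.ofBijective C.Φ ⟨C.Φ_injective, C.Φ_surjective⟩)

theorem Φu_val : (C.Φu : D.Op k) = C.Φ := rfl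

end CycSetup

end WordData

namespace WordData

variable {k : Type*} [Field k] {n : ℕ} {V E : Type*} [Fintype V] {D : WordData n V E}

namespace CycSetup

variable (C : D.CycSetup k)

/-! ### The operators of the arrows of the cycle -/

variable (k) in
/-- The factor in `a · a^l = κ a^(l+1)`, where negative powers of `a` are powers of `a*`. -/
def κ (l : ℤ) : k[T;T⁻¹] := if 0 ≤ l then 1 else T 1 - 1

variable (k) in
/-- The factor in `a* · a^l = κ' a^(l-1)`, where negative powers of `a` are powers of `a*`. -/
def κ' (l : ℤ) : k[T;T⁻¹] := if l ≤ 0 then 1 else T 1 - 1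

theorem κ_mul_κ' (l : ℤ) : κ k (l - 1) * κ' k l = T 1 - 1 := by
  unfold κ κ'
  split_ifs <;> first | omega | simp

theorem κ'_mul_κ (l : ℤ) : κ' k (l + 1) * κ k l = T 1 - 1 := by
  unfold κ κ'
  split_ifs <;> first | omega | simp

/-- Left multiplication by `a`, conjugated by `Φ` on one side. -/
def α₀ : D.Op k :=
  C.cycLin (fun _ _ => 0) fun i l g => C.fib (i - 1) (l + 1) g ∘ₗ LinearMap.mulLeft k (κ k l)

/-- Left multiplication by `a*`, conjugated by `Φ` on one side. -/
def α₀' : D.Op k :=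
  C.cycLin (fun _ _ => 0) fun i l g => C.fib (i + 1) (l - 1) g ∘ₗ LinearMap.mulLeft k (κ' k l)

theorem α₀_fib {i : ZMod n} {l : ℤ} {g : Atoms n V E}
    (hw : D.IsWord (D.cyc (i + l)) g) (hg : ¬ StartsCyc g) (f : k[T;T⁻¹]) :
    C.α₀ (C.fib i l g f) = C.fib (i - 1) (l + 1) g (κ k l * f) := C.cycLin_fib _ _ hw hg f

theorem α₀'_fib {i : ZMod n} {l : ℤ} {g : Atoms n V E}
    (hw : D.IsWord (D.cyc (i + l)) g) (hg : ¬ StartsCyc g) (f : k[T;T⁻¹]) :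
    C.α₀' (C.fib i l g f) = C.fib (i + 1) (l - 1) g (κ' k l * f) := C.cycLin_fib _ _ hw hg f

theorem α₀_off {v : V} {w : Atoms n V E} (hv : ∀ i, D.cyc i ≠ v)
    (hw : D.IsWord v w) : C.α₀ (D.wd k v w) = 0 := C.cycLin_off _ _ hv hw

theorem α₀'_off {v : V} {w : Atoms n V E} (hv : ∀ i, D.cyc i ≠ v)
    (hw : D.IsWord v w) : C.α₀' (D.wd k v w) = 0 := C.cycLin_off _ _ hv hw

theorem isWord_up {i : ZMod n} {l : ℤ} {g : Atoms n V E}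
    (hw : D.IsWord (D.cyc (i + l)) g) : D.IsWord (D.cyc (i - 1 + (l + 1 : ℤ))) g := by
  have : (i - 1 + (l + 1 : ℤ) : ZMod n) = i + l := by push_cast; ring
  rwa [this]

theorem isWord_down {i : ZMod n} {l : ℤ} {g : Atoms n V E}
    (hw : D.IsWord (D.cyc (i + l)) g) : D.IsWord (D.cyc (i + 1 + (l - 1 : ℤ))) g := by
  have : (i + 1 + (l - 1 : ℤ) : ZMod n) = i + l := by push_cast; ring
  rwa [this]

theorem α₀_mul_α₀' : C.α₀ * C.α₀' = C.X - 1 := by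
  apply C.cyc_ext
  · intro v w hv hw
    rw [End.mul_apply, C.α₀'_off hv hw, map_zero, LinearMap.sub_apply, C.X_off hv hw]
    exact (sub_self _).symm
  · intro i l g hw hg f
    rw [End.mul_apply, C.α₀'_fib hw hg, C.α₀_fib (isWord_down hw) hg, ← mul_assoc, κ_mul_κ',
      LinearMap.sub_apply, C.X_fib hw hg, add_sub_cancel_right, sub_add_cancel, sub_mul, one_mul,
      map_sub]
    rfl

theorem α₀'_mul_α₀ : C.α₀' * C.α₀ = C.X - 1 := by
  apply C.cyc_ext
  · intro v w hv hw
    rw [End.mul_apply, C.α₀_off hv hw, map_zero, LinearMap.sub_apply, C.X_off hv hw]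
    exact (sub_self _).symm
  · intro i l g hw hg f
    rw [End.mul_apply, C.α₀_fib hw hg, C.α₀'_fib (isWord_up hw) hg, ← mul_assoc, κ'_mul_κ,
      LinearMap.sub_apply, C.X_fib hw hg, add_sub_cancel_right, sub_add_cancel, sub_mul, one_mul,
      map_sub]
    rfl

theorem vproj_mul_α₀ (i : ZMod n) : D.vproj k (D.cyc i) * C.α₀ = C.α₀ * D.vproj k (D.cyc (i + 1)) := by
  apply C.cyc_ext
  · intro v w hv hw
    rw [End.mul_apply, End.mul_apply, C.α₀_off hv hw, map_zero,
      vproj_wd_of_ne (hv _).symm, map_zero]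
  · intro j l g hw hg f
    rw [End.mul_apply, End.mul_apply, C.α₀_fib hw hg]
    by_cases h : j = i + 1
    · subst h
      rw [fib_vproj, C.α₀_fib hw hg, add_sub_cancel_right, fib_vproj]
    · rw [C.vproj_fib_of_ne (fun h' => h (C.inj h')), map_zero, C.vproj_fib_of_ne]
      intro h'
      exact h (by rw [← C.inj h', sub_add_cancel])

theorem vproj_mul_α₀' (i : ZMod n) :
    D.vproj k (D.cyc (i + 1)) * C.α₀' = C.α₀' * D.vproj k (D.cyc i) := by
  apply C.cyc_ext
  · intro v w hv hw
    rw [End.mul_apply, End.mul_apply, C.α₀'_off hv hw, map_zero,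
      vproj_wd_of_ne (hv _).symm, map_zero]
  · intro j l g hw hg f
    rw [End.mul_apply, End.mul_apply, C.α₀'_fib hw hg]
    by_cases h : j = i
    · subst h
      rw [fib_vproj, fib_vproj, C.α₀'_fib hw hg]
    · rw [C.vproj_fib_of_ne (fun h' => h (C.inj h')), map_zero, C.vproj_fib_of_ne]
      intro h'
      exact h (add_right_cancel (C.inj h'))

/-- The operator of `a`. -/
def α : D.Op k := C.α₀ * ↑C.Φu⁻¹

/-- The operator of `a*`. -/
def α' : D.Op k := C.Φ * C.α₀'

theorem α_mul_α' : C.α * C.α' = C.X - 1 := by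
  rw [α, α', mul_assoc, ← mul_assoc _ C.Φ, ← C.Φu_val, Units.inv_mul, one_mul, α₀_mul_α₀']

theorem α'_mul_α : C.α' * C.α = C.Y - 1 := by
  rw [α, α', mul_assoc, ← mul_assoc C.α₀', α₀'_mul_α₀, ← mul_assoc, mul_sub, Φ_mul_X, mul_one,
    ← C.Φu_val, sub_mul, mul_assoc, Units.mul_inv, mul_one]

theorem vproj_mul_α (i : ZMod n) : D.vproj k (D.cyc i) * C.α = C.α * D.vproj k (D.cyc (i + 1)) := by
  have h : Commute (D.vproj k (D.cyc (i + 1))) (C.Φu : D.Op k) := C.vproj_commute_Φ _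
  rw [α, ← mul_assoc, vproj_mul_α₀, mul_assoc, h.units_inv_right.eq, mul_assoc]

theorem vproj_mul_α' (i : ZMod n) :
    D.vproj k (D.cyc (i + 1)) * C.α' = C.α' * D.vproj k (D.cyc i) := by
  rw [α', ← mul_assoc, (C.vproj_commute_Φ _).eq, mul_assoc, vproj_mul_α₀', mul_assoc]

theorem Φu_inv_fib_one {i : ZMod n} {l : ℤ} {g : Atoms n V E}
    (hw : D.IsWord (D.cyc (i + l)) g) (hg : ¬ StartsCyc g) :
    (↑C.Φu⁻¹ : D.Op k) (C.fib i l g 1) = C.fib i l g 1 := by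
  conv_lhs => rw [← C.Φ_fib_one hw hg, ← C.Φu_val, ← End.mul_apply, Units.inv_mul]
  rfl

theorem α_pow_fib {l : ℕ} : ∀ {i : ZMod n} {g : Atoms n V E},
    D.IsWord (D.cyc (i + (l : ℤ))) g → ¬ StartsCyc g →
      (C.α ^ l) (C.fib (i + (l : ℤ)) 0 g 1) = C.fib i l g 1 := by
  induction l with
  | zero => intro i g _ _; simp
  | succ l ih =>
    intro i g hw hg
    have hw' : D.IsWord (D.cyc (i + 1 + ((l : ℕ) : ℤ))) g := by
      have : (i + 1 + ((l : ℕ) : ℤ) : ZMod n) = i + ((l + 1 : ℕ) : ℤ) := by push_cast; ring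
      rwa [this]
    have := ih hw' hg
    rw [show (i + ((l + 1 : ℕ) : ℤ) : ZMod n) = i + 1 + ((l : ℕ) : ℤ) by push_cast; ring, pow_succ',
      End.mul_apply, this, α, End.mul_apply, C.Φu_inv_fib_one hw' hg,
      C.α₀_fib hw' hg, add_sub_cancel_right, κ, if_pos (by omega), one_mul]
    rfl

theorem α'_pow_fib {l : ℕ} : ∀ {i : ZMod n} {g : Atoms n V E},
    D.IsWord (D.cyc (i + (-l : ℤ))) g → ¬ StartsCyc g →
      (C.α' ^ l) (C.fib (i + (-l : ℤ)) 0 g 1) = C.fib i (-l) g 1 := by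
  induction l with
  | zero => intro i g _ _; simp
  | succ l ih =>
    intro i g hw hg
    have he : (i - 1 + (-(l : ℕ) : ℤ) : ZMod n) = i + (-(l + 1 : ℕ) : ℤ) := by push_cast; ring
    have hw' : D.IsWord (D.cyc (i - 1 + (-(l : ℕ) : ℤ))) g := by rwa [he]
    have := ih hw' hg
    have hl : (-(l : ℤ) - 1) = (-(l + 1 : ℕ) : ℤ) := by push_cast; ring
    rw [← he, pow_succ', End.mul_apply, this, α', End.mul_apply, C.α₀'_fib hw' hg, κ',
      if_pos (by omega), one_mul, sub_add_cancel, hl, C.Φ_fib_one ?_ hg]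
    exact hw

theorem signedPow_fib {i : ZMod n} {l : ℤ} {g : Atoms n V E}
    (hw : D.IsWord (D.cyc (i + l)) g) (hg : ¬ StartsCyc g) :
    signedPow C.α C.α' l (D.wd k (D.cyc (i + l)) g) = C.fib i l g 1 := by
  rw [C.eq_fib_zero]
  obtain ⟨l, rfl | rfl⟩ := l.eq_nat_or_neg
  · rw [signedPow_nat]; exact C.α_pow_fib hw hg
  · rw [signedPow_neg]; exact C.α'_pow_fib hw hg

theorem laurentEval_X_fib {i : ZMod n} {l : ℤ} {g : Atoms n V E}
    (hw : D.IsWord (D.cyc (i + l)) g) (hg : ¬ StartsCyc g) (f h : k[T;T⁻¹]) :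
    laurentEval k C.X f (C.fib i l g h) = C.fib i l g (f * h) := by
  induction f using LaurentPolynomial.induction_on' with
  | add f g hf hg => rw [map_add, LinearMap.add_apply, hf, hg, add_mul, map_add]
  | C_mul_T m c =>
    rw [← smul_eq_C_mul, map_smul, LinearMap.smul_apply, laurentEval_T, C.X_zpow_fib hw hg,
      smul_mul_assoc, map_smul]

/-- The operators of the cycle act on words by concatenation. -/
theorem op_wd {i : ZMod n} {m l : ℤ} {g : Atoms n V E} (hw : D.IsWord (D.cyc i) (.cyc i m l :: g)) :
    laurentEval k C.X (C.basis m) (signedPow C.α C.α' l (D.wd k (D.cyc (i + l)) g)) =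
      D.wd k (D.cyc i) (.cyc i m l :: g) := by
  have h1 : D.IsWord (D.cyc (i + l)) g := hw.tail
  have h2 : ¬ StartsCyc g := (cycTail_spec C.inj hw).2.1
  rw [C.signedPow_fib h1 h2, C.laurentEval_X_fib h1 h2, mul_one, C.fib_basis, mkCyc_of i hw.good.2]

end CycSetup

section Eqv

variable {B : Type*} [Ring B] [Algebra k B]

/-- Elements of an algebra in the roles of `a`, `a*`, `x` and `y`, and which give the values of the
atoms of the cycle. -/
structure CycVals (C : D.CycSetup k) (φ : LAlg k D.quiver →ₐ[k] B) (val : Atom n V E → B) where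
  a : B
  a' : B
  x : Bˣ
  y : Bˣ
  a_mul_a' : a * a' = x - 1
  a'_mul_a : a' * a = y - 1
  e_mul_a : ∀ i, φ (e k D.quiver (D.cyc i)) * a = a * φ (e k D.quiver (D.cyc (i + 1)))
  e_mul_a' : ∀ i, φ (e k D.quiver (D.cyc (i + 1))) * a' = a' * φ (e k D.quiver (D.cyc i))
  off_a : ∀ v, (∀ i, D.cyc i ≠ v) → φ (e k D.quiver v) * a = 0
  off_a' : ∀ v, (∀ i, D.cyc i ≠ v) → a' * φ (e k D.quiver v) = 0
  a_off : ∀ v, (∀ i, D.cyc i ≠ v) → a * φ (e k D.quiver v) = 0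
  val_cyc : ∀ i m l, val (.cyc i m l) =
    φ (e k D.quiver (D.cyc i)) * laurentEval k x (C.basis m) * signedPow a a' l
  u : B
  eqv_U : Eqv (D.evalBy φ val) (C.U : D.Op k) u
  y_eq : y = u * x

namespace CycVals

variable {C : D.CycSetup k} {φ : LAlg k D.quiver →ₐ[k] B} {val : Atom n V E → B}
  (c : CycVals C φ val)

include c

theorem a_mul_y : c.a * c.y = c.x * c.a := by
  rw [eq_add_of_sub_eq c.a_mul_a'.symm, eq_add_of_sub_eq c.a'_mul_a.symm, mul_add, add_mul, mul_assoc,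
    mul_one, one_mul]

theorem a'_mul_x : c.a' * c.x = c.y * c.a' := by
  rw [eq_add_of_sub_eq c.a_mul_a'.symm, eq_add_of_sub_eq c.a'_mul_a.symm, mul_add, add_mul, mul_assoc,
    mul_one, one_mul]

theorem commute_x (v : V) : Commute (φ (e k D.quiver v)) (c.x : B) := by
  have h1 := c.a_mul_a'
  rw [eq_sub_iff_add_eq] at h1
  rw [← h1]
  refine Commute.add_right ?_ (Commute.one_right _)
  change _ * _ = _ * _
  by_cases hv : ∃ i, D.cyc i = v
  · obtain ⟨i, rfl⟩ := hv
    rw [← mul_assoc, c.e_mul_a, mul_assoc, c.e_mul_a', mul_assoc]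
  · push Not at hv
    rw [← mul_assoc, c.off_a v hv, mul_assoc, c.off_a' v hv, zero_mul, mul_zero]

omit c in
theorem laurentEval_semiconj {a : B} {x y : Bˣ} (h : a * y = x * a) (f : k[T;T⁻¹]) :
    a * laurentEval k y f = laurentEval k x f * a := by
  induction f using LaurentPolynomial.induction_on' with
  | add f g hf hg => rw [map_add, map_add, mul_add, add_mul, hf, hg]
  | C_mul_T m r =>
    rw [← smul_eq_C_mul, map_smul, map_smul, laurentEval_T, laurentEval_T, mul_smul_comm,
      smul_mul_assoc]
    congr 1
    exact (SemiconjBy.units_zpow_right (show SemiconjBy a (y : B) x from h) m).eq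

omit c in
theorem _root_.MPA.idem_mul_signedPow {E : ZMod n → B} {a a' : B}
    (ha : ∀ i, E i * a = a * E (i + 1)) (ha' : ∀ i, E (i + 1) * a' = a' * E i) (i : ZMod n) (l : ℤ) :
    E i * signedPow a a' l = signedPow a a' l * E (i + l) := by
  obtain ⟨l, rfl | rfl⟩ := l.eq_nat_or_neg
  · rw [signedPow_nat]
    induction l with
    | zero => simp
    | succ l ih =>
      rw [pow_succ, ← mul_assoc, ih, mul_assoc, ha, mul_assoc]
      push_cast
      rw [add_assoc]
  · rw [signedPow_neg]
    induction l with
    | zero => simp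
    | succ l ih =>
      have := ha' (i + (-(l + 1 : ℕ) : ℤ))
      rw [show (i + (-(l + 1 : ℕ) : ℤ) + 1 : ZMod n) = i + (-(l : ℕ) : ℤ) by push_cast; ring] at this
      rw [pow_succ, ← mul_assoc, ih, mul_assoc, this, mul_assoc]

theorem e_mul_signedPow (i : ZMod n) (l : ℤ) :
    φ (e k D.quiver (D.cyc i)) * signedPow c.a c.a' l =
      signedPow c.a c.a' l * φ (e k D.quiver (D.cyc (i + l))) :=
  idem_mul_signedPow (E := fun i => φ (e k D.quiver (D.cyc i))) c.e_mul_a c.e_mul_a' i l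

theorem a_mul_signedPow (l : ℤ) :
    c.a * signedPow c.a c.a' l = laurentEval k c.x (CycSetup.κ k l) * signedPow c.a c.a' (l + 1) := by
  rw [CycSetup.κ]
  split_ifs with h
  · rw [map_one, one_mul, signedPow_add_one _ _ h]
  · have := signedPow_sub_one c.a c.a' (m := l + 1) (by omega)
    rw [add_sub_cancel_right] at this
    rw [this, ← mul_assoc, c.a_mul_a', map_sub, map_one, laurentEval_T, zpow_one]

theorem a'_mul_signedPow (l : ℤ) :
    c.a' * signedPow c.a c.a' l =
      laurentEval k c.y (CycSetup.κ' k l) * signedPow c.a c.a' (l - 1) := by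
  rw [CycSetup.κ']
  split_ifs with h
  · rw [map_one, one_mul, signedPow_sub_one _ _ h]
  · have := signedPow_add_one c.a c.a' (m := l - 1) (by omega)
    rw [sub_add_cancel] at this
    rw [this, ← mul_assoc, c.a'_mul_a, map_sub, map_one, laurentEval_T, zpow_one]

theorem eval_fib {i : ZMod n} {l : ℤ} {g : Atoms n V E}
    (hw : D.IsWord (D.cyc (i + l)) g) (hg : ¬ StartsCyc g) (f : k[T;T⁻¹]) :
    D.evalBy φ val (C.fib i l g f) =
      laurentEval k c.x f * signedPow c.a c.a' l * D.evalBy φ val (D.wd k (D.cyc (i + l)) g) := by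
  have hc := fun f => (commute_laurentEval (k := k) (c.commute_x (D.cyc i)) f).eq
  have : D.evalBy φ val ∘ₗ C.fib i l g =
      LinearMap.mulRight k (signedPow c.a c.a' l * D.evalBy φ val (D.wd k (D.cyc (i + l)) g)) ∘ₗ
        (laurentEval k c.x).toLinearMap := by
    apply C.basis.ext
    intro m
    rw [LinearMap.comp_apply, CycSetup.fib_basis]
    change _ = laurentEval k c.x (C.basis m) *
      (signedPow c.a c.a' l * D.evalBy φ val (D.wd k (D.cyc (i + l)) g))
    by_cases h : m = 0 ∧ l = 0
    · obtain ⟨rfl, rfl⟩ := h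
      rw [mkCyc_zero, C.basis_zero, map_one, signedPow_zero, one_mul, one_mul, Int.cast_zero,
        add_zero]
    · rw [mkCyc_of i (by tauto), eval_wd (isWord_cyc C.zero_mem (by tauto) hw hg), List.map_cons,
        List.prod_cons, c.val_cyc, eval_wd hw, ← mul_assoc (signedPow _ _ _), ← c.e_mul_signedPow]
      simp only [← mul_assoc]
      rw [← map_mul, e_mul_self, hc]
  rw [mul_assoc]
  exact LinearMap.congr_fun this f

theorem eqv_X : Eqv (D.evalBy φ val) (C.X : D.Op k) (c.x : B) := by
  have : D.evalBy φ val ∘ₗ (C.X : D.Op k) = LinearMap.mulLeft k (c.x : B) ∘ₗ D.evalBy φ val := by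
    apply C.cyc_ext
    · intro v w hv hw
      rw [LinearMap.comp_apply, C.X_off hv hw]
      change _ = (c.x : B) * _
      have h1 := c.a_mul_a'
      rw [eq_sub_iff_add_eq] at h1
      rw [← e_mul_evalBy, ← h1, add_mul, ← mul_assoc (_ * _), mul_assoc c.a, c.off_a' v hv, mul_zero,
        zero_mul, zero_add, one_mul]
    · intro i l g hw hg f
      rw [LinearMap.comp_apply, C.X_fib hw hg, c.eval_fib hw hg, map_mul, laurentEval_T, zpow_one]
      change _ = (c.x : B) * D.evalBy φ val (C.fib i l g f)
      rw [c.eval_fib hw hg]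
      simp only [mul_assoc]
  exact fun x => LinearMap.congr_fun this x

theorem eqvY : Eqv (D.evalBy φ val) (C.Y : D.Op k) (c.y : B) := by
  rw [c.y_eq]; exact c.eqv_U.mul c.eqv_X

theorem eval_Φ_fib {i : ZMod n} {l : ℤ} {g : Atoms n V E}
    (hw : D.IsWord (D.cyc (i + l)) g) (hg : ¬ StartsCyc g) (f : k[T;T⁻¹]) :
    D.evalBy φ val (C.Φ (C.fib i l g f)) =
      laurentEval k c.y f * signedPow c.a c.a' l * D.evalBy φ val (D.wd k (D.cyc (i + l)) g) := by
  have hY : ∀ f, Eqv (D.evalBy φ val) (laurentEval k C.Y f) (laurentEval k c.y f) := by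
    intro f
    induction f using LaurentPolynomial.induction_on' with
    | add f g hf hg => rw [map_add, map_add]; exact hf.add hg
    | C_mul_T m r =>
      rw [← smul_eq_C_mul, map_smul, map_smul, laurentEval_T, laurentEval_T]
      refine Eqv.smul ?_ r
      exact (Eqv.units (D.evalBy φ val)).zpow_mem (x := (C.Y, c.y)) c.eqvY m
  rw [C.Φ_fib hw hg, hY, ← C.fib_one, c.eval_fib hw hg, map_one, one_mul, mul_assoc]

theorem eqv_α : Eqv (D.evalBy φ val) C.α c.a := by
  have : D.evalBy φ val ∘ₗ C.α₀ = LinearMap.mulLeft k c.a ∘ₗ D.evalBy φ val ∘ₗ C.Φ := by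
    apply C.cyc_ext
    · intro v w hv hw
      rw [LinearMap.comp_apply, C.α₀_off hv hw, map_zero]
      change 0 = c.a * D.evalBy φ val (C.Φ _)
      rw [C.Φ_off hv hw, ← e_mul_evalBy, ← mul_assoc, c.a_off v hv, zero_mul]
    · intro i l g hw hg f
      rw [LinearMap.comp_apply, C.α₀_fib hw hg, c.eval_fib (CycSetup.isWord_up hw) hg]
      change _ = c.a * D.evalBy φ val (C.Φ _)
      rw [c.eval_Φ_fib hw hg, ← mul_assoc, ← mul_assoc, laurentEval_semiconj c.a_mul_y,
        mul_assoc _ c.a, c.a_mul_signedPow,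
        show (i - 1 + (l + 1 : ℤ) : ZMod n) = i + l by push_cast; ring, map_mul, ← mul_assoc,
        ← map_mul, ← map_mul, mul_comm f]
  intro x
  have h := LinearMap.congr_fun this ((↑C.Φu⁻¹ : D.Op k) x)
  refine h.trans ?_
  change c.a * D.evalBy φ val ((C.Φu : D.Op k) _) = _
  rw [← End.mul_apply, Units.mul_inv, End.one_apply]

theorem eqv_α' : Eqv (D.evalBy φ val) C.α' c.a' := by
  have : D.evalBy φ val ∘ₗ C.Φ ∘ₗ C.α₀' = LinearMap.mulLeft k c.a' ∘ₗ D.evalBy φ val := by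
    apply C.cyc_ext
    · intro v w hv hw
      rw [LinearMap.comp_apply, LinearMap.comp_apply, C.α₀'_off hv hw, map_zero, map_zero]
      change 0 = c.a' * D.evalBy φ val _
      rw [← e_mul_evalBy, ← mul_assoc, c.off_a' v hv, zero_mul]
    · intro i l g hw hg f
      rw [LinearMap.comp_apply, LinearMap.comp_apply, C.α₀'_fib hw hg,
        c.eval_Φ_fib (CycSetup.isWord_down hw) hg]
      change _ = c.a' * D.evalBy φ val _
      rw [c.eval_fib hw hg, ← mul_assoc, ← mul_assoc, laurentEval_semiconj c.a'_mul_x,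
        mul_assoc _ c.a', c.a'_mul_signedPow,
        show (i + 1 + (l - 1 : ℤ) : ZMod n) = i + l by push_cast; ring, map_mul, ← mul_assoc,
        ← map_mul, ← map_mul, mul_comm f]
  exact fun x => LinearMap.congr_fun this x

end CycVals

end Eqv

end WordData

theorem idem_mul_pow {A : Type*} [Monoid A] {e x y : A} (h : e * x = e * y) (hy : Commute e y)
    (m : ℕ) : e * x ^ m = e * y ^ m := by
  induction m with
  | zero => simp
  | succ m ih =>
    rw [pow_succ', pow_succ', ← mul_assoc, h, hy.eq, mul_assoc, ih, ← mul_assoc, ← hy.eq, mul_assoc]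

section Induction

variable {k : Type*} [Field k] {V E : Type*} [Fintype V] {Q : ArrowQuiver V E}

/-! ### Generators of the localized path algebra, subquivers -/

theorem LAlg.eq_top {S : Subalgebra k (LAlg k Q)} (h : ∀ x, gen k Q x ∈ S) : S = ⊤ := by
  rw [eq_top_iff]
  rintro x -
  obtain ⟨y, rfl⟩ := RingQuot.mkAlgHom_surjective k (LRel k Q) x
  have : (⊤ : Subalgebra k (FreeAlgebra k (LGen V E))) ≤
      S.comap (RingQuot.mkAlgHom k (LRel k Q)) := by
    rw [← FreeAlgebra.adjoin_range_ι, Algebra.adjoin_le_iff]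
    rintro _ ⟨x, rfl⟩
    exact h x
  exact this (Algebra.mem_top (x := y))

variable {B : Type*} [Ring B] [Algebra k B]

/-- The representation of a quiver which is given on the arrows in `A` and on the other arrows. -/
def QRep.union {A : Set E} (r : QRep k (Q.restrict A) B) (r' : QRep k (Q.restrict Aᶜ) B)
    (h : r.vert = r'.vert) : QRep k Q B := by
  classical
  exact
  { vert := r.vert
    arr := fun a => if ha : a.arrow ∈ A then r.arr ⟨⟨a.arrow, ha⟩, a.pos⟩
      else r'.arr ⟨⟨a.arrow, ha⟩, a.pos⟩
    unit := fun a => if ha : a.arrow ∈ A then r.unit ⟨⟨a.arrow, ha⟩, a.pos⟩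
      else r'.unit ⟨⟨a.arrow, ha⟩, a.pos⟩
    idem := r.idem
    tail := fun a => by
      by_cases ha : a.arrow ∈ A
      · simp only [dif_pos ha]; exact r.tail ⟨⟨a.arrow, ha⟩, a.pos⟩
      · simp only [dif_neg ha]; rw [h]; exact r'.tail ⟨⟨a.arrow, ha⟩, a.pos⟩
    head := fun a => by
      by_cases ha : a.arrow ∈ A
      · simp only [dif_pos ha]; exact r.head ⟨⟨a.arrow, ha⟩, a.pos⟩
      · simp only [dif_neg ha]; rw [h]; exact r'.head ⟨⟨a.arrow, ha⟩, a.pos⟩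
    unit_eq := fun a => by
      by_cases ha : a.arrow ∈ A
      · have ha' : a.star.arrow ∈ A := ha
        simp only [dif_pos ha, dif_pos ha']; exact r.unit_eq ⟨⟨a.arrow, ha⟩, a.pos⟩
      · have ha' : a.star.arrow ∉ A := ha
        simp only [dif_neg ha, dif_neg ha']; exact r'.unit_eq ⟨⟨a.arrow, ha⟩, a.pos⟩ }

variable (k Q) in
/-- The inclusion of the localized path algebra of a subquiver. -/
def incl (A : Set E) : LAlg k (Q.restrict A) →ₐ[k] LAlg k Q := QRep.toHom
    { vert := e k Q
      arr := fun a => ar k Q a.incl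
      unit := fun a => g k Q a.incl
      idem := e_idem k Q
      tail := fun a => e_mul_ar k Q a.incl
      head := fun a => ar_mul_e k Q a.incl
      unit_eq := fun _ => rfl }

@[simp] theorem incl_e (A : Set E) (i : V) : incl k Q A (e k _ i) = e k Q i := QRep.toHom_e _ i

@[simp] theorem incl_ar (A : Set E) (a : DArrow A) : incl k Q A (ar k _ a) = ar k Q a.incl :=
  QRep.toHom_ar _ a

theorem incl_g (A : Set E) (a : DArrow A) :
    Units.map (incl k Q A : LAlg k (Q.restrict A) →* LAlg k Q) (g k _ a) = g k Q a.incl :=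
  QRep.map_g _ a

theorem QRep.union_incl {A : Set E} (r : QRep k (Q.restrict A) B) (r' : QRep k (Q.restrict Aᶜ) B)
    (h : r.vert = r'.vert) : (r.union r' h).toHom.comp (incl k Q A) = r.toHom := by
  apply LAlg.hom_ext
  · intro i
    simp [QRep.union]
  · rintro ⟨⟨a, ha⟩, p⟩
    simp [QRep.union, DArrow.incl, ha]

theorem QRep.union_incl_compl {A : Set E} (r : QRep k (Q.restrict A) B)
    (r' : QRep k (Q.restrict Aᶜ) B) (h : r.vert = r'.vert) :
    (r.union r' h).toHom.comp (incl k Q Aᶜ) = r'.toHom := by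
  apply LAlg.hom_ext
  · intro i
    simp [QRep.union, h]
  · rintro ⟨⟨a, ha⟩, p⟩
    have ha' : a ∉ A := ha
    simp [QRep.union, DArrow.incl, ha']

end Induction

/-! ### Lists of arrows -/

section Sorting

variable {E : Type*} [Finite E] [LinearOrder (DArrow E)]

theorem mem_sorted (d : DArrow E) : d ∈ DArrow.sorted E := by
  simp [DArrow.sorted]

theorem sorted_nodup : (DArrow.sorted E).Nodup := Finset.sort_nodup _ _

theorem sorted_pairwise : (DArrow.sorted E).Pairwise (· < ·) := (Finset.sortedLT_sort _).pairwise

theorem eq_of_pairwise_lt {α : Type*} [LinearOrder α] {l l' : List α} (h : l.Pairwise (· < ·))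
    (h' : l'.Pairwise (· < ·)) (hm : ∀ a, a ∈ l ↔ a ∈ l') : l = l' :=
  List.Perm.eq_of_pairwise (fun _ _ _ _ h1 h2 => absurd (h1.trans h2) (lt_irrefl _)) h h'
    ((List.perm_ext_iff_of_nodup (h.imp ne_of_lt) (h'.imp ne_of_lt)).2 hm)

theorem map_incl_sorted (A : Set E) [DecidablePred (· ∈ A)] :
    (DArrow.sorted A).map DArrow.incl = (DArrow.sorted E).filter fun d => d.arrow ∈ A := by
  apply eq_of_pairwise_lt
  · exact List.pairwise_map.2 sorted_pairwise
  · exact sorted_pairwise.filter _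
  · rintro ⟨a, p⟩
    simp only [List.mem_map, List.mem_filter, mem_sorted, true_and, decide_eq_true_eq]
    constructor
    · rintro ⟨⟨⟨a', ha'⟩, p'⟩, h⟩
      simp only [DArrow.incl, DArrow.mk.injEq] at h
      rw [← h.1]; exact ha'
    · intro h
      exact ⟨⟨⟨a, h⟩, p⟩, rfl⟩

/-- If the arrows in `A` come before all others, then the sorted list of arrows is composed from
the sorted lists for `A` and for the complement. -/
theorem sorted_eq_append (A : Set E) (h : ∀ a b : DArrow E, a.arrow ∈ A → b.arrow ∉ A → a < b) :
    DArrow.sorted E = (DArrow.sorted A).map DArrow.incl ++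
      (DArrow.sorted (Aᶜ : Set E)).map DArrow.incl := by
  classical
  rw [map_incl_sorted, map_incl_sorted]
  apply eq_of_pairwise_lt sorted_pairwise
  · refine List.pairwise_append.2 ⟨sorted_pairwise.filter _, sorted_pairwise.filter _, ?_⟩
    intro a ha b hb
    exact h a b (by simpa using (List.mem_filter.1 ha).2) (by simpa using (List.mem_filter.1 hb).2)
  · intro d
    simp only [mem_sorted, List.mem_append, List.mem_filter, true_and, decide_eq_true_eq, true_iff]
    exact Classical.em _

variable {k : Type*} [Field k] {V : Type*} [Fintype V] {Q : ArrowQuiver V E}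

theorem rho_eq_incl_mul_incl (A : Set E) (h : ∀ a b : DArrow E, a.arrow ∈ A → b.arrow ∉ A → a < b) :
    rho k Q = Units.map (incl k Q A : LAlg k (Q.restrict A) →* LAlg k Q) (rho k (Q.restrict A)) *
      Units.map (incl k Q Aᶜ : LAlg k (Q.restrict Aᶜ) →* LAlg k Q) (rho k (Q.restrict Aᶜ)) := by
  rw [rho, sorted_eq_append A h, List.map_append, List.prod_append, rho, rho, map_list_prod,
    map_list_prod, List.map_map, List.map_map, List.map_map, List.map_map]
  congr 2 <;>
  · apply List.map_congr_left
    intro a _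
    simp only [Function.comp_apply, map_zpow, incl_g]
    rfl

end Sorting

/-! ### The elements `a`, `a*`, `x` and `y` of the algebra of a cycle -/

/-- The arrows `c i` form an oriented cycle with vertices `v i`. -/
structure IsCyc {V E : Type*} (Q : ArrowQuiver V E) {n : ℕ} (v : ZMod n → V) (c : ZMod n → E) :
    Prop where
  inj : Function.Injective v
  tail : ∀ i, Q.tail (c i) = v i
  head : ∀ i, Q.head (c i) = v (i + 1)

section CycleElements

variable {k : Type*} [Field k] {V E : Type*} [Fintype V] {Q : ArrowQuiver V E}
  {n : ℕ} [NeZero n] {v : ZMod n → V} {c : ZMod n → E}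

variable (k Q c) in
/-- The sum `a` of the arrows of the cycle. -/
def cycA : LAlg k Q := ∑ j, ar k Q ⟨c j, true⟩

variable (k Q c) in
/-- The sum `a*` of the reversed arrows of the cycle. -/
def cycA' : LAlg k Q := ∑ j, ar k Q ⟨c j, false⟩

namespace IsCyc

variable (h : IsCyc Q v c)
include h

theorem dtail_true (i : ZMod n) : Q.dtail ⟨c i, true⟩ = v i := h.tail i
theorem dhead_true (i : ZMod n) : Q.dhead ⟨c i, true⟩ = v (i + 1) := h.head i
theorem dtail_false (i : ZMod n) : Q.dtail ⟨c i, false⟩ = v (i + 1) := h.head i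
theorem dhead_false (i : ZMod n) : Q.dhead ⟨c i, false⟩ = v i := h.tail i

theorem e_mul_a (i : ZMod n) : e k Q (v i) * cycA k Q c = ar k Q ⟨c i, true⟩ := by
  rw [cycA, Finset.mul_sum, Finset.sum_eq_single i]
  · rw [← h.dtail_true, e_mul_ar]
  · intro j _ hj
    exact e_mul_ar_of_ne k Q fun h' => hj (h.inj (by rw [h', h.dtail_true])).symm
  · simp

theorem a_mul_e (i : ZMod n) : cycA k Q c * e k Q (v (i + 1)) = ar k Q ⟨c i, true⟩ := by
  rw [cycA, Finset.sum_mul, Finset.sum_eq_single i]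
  · rw [← h.dhead_true, ar_mul_e]
  · intro j _ hj
    refine ar_mul_e_of_ne k Q fun h' => hj ?_
    rw [h.dhead_true] at h'
    exact add_right_cancel (h.inj h')
  · simp

theorem e_mul_a' (i : ZMod n) : e k Q (v (i + 1)) * cycA' k Q c = ar k Q ⟨c i, false⟩ := by
  rw [cycA', Finset.mul_sum, Finset.sum_eq_single i]
  · rw [← h.dtail_false, e_mul_ar]
  · intro j _ hj
    refine e_mul_ar_of_ne k Q fun h' => hj ?_
    rw [h.dtail_false] at h'
    exact (add_right_cancel (h.inj h')).symm
  · simp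

theorem a'_mul_e (i : ZMod n) : cycA' k Q c * e k Q (v i) = ar k Q ⟨c i, false⟩ := by
  rw [cycA', Finset.sum_mul, Finset.sum_eq_single i]
  · rw [← h.dhead_false, ar_mul_e]
  · intro j _ hj
    refine ar_mul_e_of_ne k Q fun h' => hj ?_
    rw [h.dhead_false] at h'
    exact h.inj h'
  · simp

theorem off_a {u : V} (hu : ∀ i, v i ≠ u) : e k Q u * cycA k Q c = 0 := by
  rw [cycA, Finset.mul_sum]
  exact Finset.sum_eq_zero fun j _ => e_mul_ar_of_ne k Q (by rw [h.dtail_true]; exact (hu j).symm)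

theorem a_off {u : V} (hu : ∀ i, v i ≠ u) : cycA k Q c * e k Q u = 0 := by
  rw [cycA, Finset.sum_mul]
  exact Finset.sum_eq_zero fun j _ => ar_mul_e_of_ne k Q (by rw [h.dhead_true]; exact hu _)

theorem off_a' {u : V} (hu : ∀ i, v i ≠ u) : e k Q u * cycA' k Q c = 0 := by
  rw [cycA', Finset.mul_sum]
  exact Finset.sum_eq_zero fun j _ => e_mul_ar_of_ne k Q (by rw [h.dtail_false]; exact (hu _).symm)

theorem a'_off {u : V} (hu : ∀ i, v i ≠ u) : cycA' k Q c * e k Q u = 0 := by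
  rw [cycA', Finset.sum_mul]
  exact Finset.sum_eq_zero fun j _ => ar_mul_e_of_ne k Q (by rw [h.dhead_false]; exact hu _)

omit h in
variable (k Q c) in
/-- The unit `x`, which is `g_{c i}` at `v i`. -/
def _root_.MPA.cycX : (LAlg k Q)ˣ :=
  ((Finset.univ : Finset (ZMod n)).toList.map fun i => g k Q ⟨c i, true⟩ ^ (1 : ℤ)).prod

omit h in
variable (k Q c) in
/-- The unit `y`, which is `g_{(c i)*}` at `v (i + 1)`. -/
def _root_.MPA.cycY : (LAlg k Q)ˣ :=
  ((Finset.univ : Finset (ZMod n)).toList.map fun i => g k Q ⟨c i, false⟩ ^ (1 : ℤ)).prod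

omit h in
theorem filter_univ {p : ZMod n → Prop} [DecidablePred p] {i : ZMod n} (hp : ∀ j, p j ↔ j = i) :
    ((Finset.univ : Finset (ZMod n)).toList.filter fun j => p j) = [i] := by
  rw [← List.perm_singleton]
  refine (List.perm_ext_iff_of_nodup ((Finset.nodup_toList _).filter _) (List.nodup_singleton i)).2 ?_
  intro j
  simp [hp]

omit h in
theorem e_mul_prod (p : Bool) {u : V} {i : ZMod n} (hp : ∀ j, Q.dtail ⟨c j, p⟩ = u ↔ j = i) :
    e k Q u * ((((Finset.univ : Finset (ZMod n)).toList.map fun i => g k Q ⟨c i, p⟩ ^ (1 : ℤ)).prod :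
      (LAlg k Q)ˣ) : LAlg k Q) = e k Q u * g k Q ⟨c i, p⟩ := by
  classical
  rw [← idem_mul_filter_prod (e_idem k Q) (fun j => Q.dtail ⟨c j, p⟩)
    (fun j => g k Q ⟨c j, p⟩) (fun j => g_mem_locAt _) (fun _ => 1) u, filter_univ hp]
  simp

omit h in
theorem e_mul_prod_off (p : Bool) {u : V} (hp : ∀ j, Q.dtail ⟨c j, p⟩ ≠ u) :
    e k Q u * ((((Finset.univ : Finset (ZMod n)).toList.map fun i => g k Q ⟨c i, p⟩ ^ (1 : ℤ)).prod :
      (LAlg k Q)ˣ) : LAlg k Q) = e k Q u := by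
  classical
  rw [← idem_mul_filter_prod (e_idem k Q) (fun j => Q.dtail ⟨c j, p⟩)
    (fun j => g k Q ⟨c j, p⟩) (fun j => g_mem_locAt _) (fun _ => 1) u, List.filter_eq_nil_iff.2]
  · simp
  · simpa using hp

theorem e_mul_x (i : ZMod n) :
    e k Q (v i) * (cycX k Q c : LAlg k Q) = e k Q (v i) * (g k Q ⟨c i, true⟩ : LAlg k Q) :=
  e_mul_prod true fun j => by rw [h.dtail_true, h.inj.eq_iff]

theorem e_mul_y (i : ZMod n) :
    e k Q (v (i + 1)) * (cycY k Q c : LAlg k Q) =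
      e k Q (v (i + 1)) * (g k Q ⟨c i, false⟩ : LAlg k Q) :=
  e_mul_prod false fun j => by rw [h.dtail_false, h.inj.eq_iff, add_left_inj]

theorem off_x {u : V} (hu : ∀ i, v i ≠ u) : e k Q u * (cycX k Q c : LAlg k Q) = e k Q u :=
  e_mul_prod_off true fun j => by rw [h.dtail_true]; exact hu j

theorem off_y {u : V} (hu : ∀ i, v i ≠ u) : e k Q u * (cycY k Q c : LAlg k Q) = e k Q u :=
  e_mul_prod_off false fun j => by rw [h.dtail_false]; exact hu _

omit h in
theorem e_mul_inv_eq {i : V} {x : (LAlg k Q)ˣ} {d : DArrow E}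
    (hx : e k Q i * (x : LAlg k Q) = e k Q i * (g k Q d : LAlg k Q)) :
    e k Q i * (↑x⁻¹ : LAlg k Q) = e k Q i * (↑(g k Q d)⁻¹ : LAlg k Q) := by
  have hg := commute_of_mem_locAt (e_idem k Q) (g_mem_locAt (k := k) (Q := Q) d) i
  rw [Units.mul_inv_eq_iff_eq_mul, hg.units_inv_right.eq, mul_assoc, hx, hg.eq,
    Units.inv_mul_cancel_left]

omit h in
theorem commute_x (u : V) : Commute (e k Q u) (cycX k Q c : LAlg k Q) :=
  commute_map_prod (e_idem k Q) (fun j => Q.dtail ⟨c j, true⟩) _ (fun _ => g_mem_locAt _) _ _ _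

theorem a_mul_a' : cycA k Q c * cycA' k Q c = cycX k Q c - 1 := by
  rw [eq_sub_iff_add_eq]
  apply eq_of_idem_mul (e_idem k Q)
  intro u
  by_cases hu : ∃ i, v i = u
  · obtain ⟨i, rfl⟩ := hu
    rw [h.e_mul_x, g_val, mul_add, mul_add, ← mul_assoc, h.e_mul_a, ← mul_assoc,
      show e k Q (v i) * ar k Q ⟨c i, true⟩ = ar k Q ⟨c i, true⟩ by rw [← h.dtail_true, e_mul_ar]]
    nth_rw 1 [← ar_mul_e k Q ⟨c i, true⟩]
    rw [mul_assoc, h.dhead_true, h.e_mul_a', add_comm]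
    rfl
  · push Not at hu
    rw [h.off_x hu, mul_add, ← mul_assoc, h.off_a hu, zero_mul, zero_add, mul_one]

theorem a'_mul_a : cycA' k Q c * cycA k Q c = cycY k Q c - 1 := by
  rw [eq_sub_iff_add_eq]
  apply eq_of_idem_mul (e_idem k Q)
  intro u
  by_cases hu : ∃ i, v i = u
  · obtain ⟨i, rfl⟩ := hu
    obtain ⟨i, rfl⟩ : ∃ j, j + 1 = i := ⟨i - 1, sub_add_cancel _ _⟩
    rw [h.e_mul_y, g_val, mul_add, mul_add, ← mul_assoc, h.e_mul_a', ← mul_assoc,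
      show e k Q (v (i + 1)) * ar k Q ⟨c i, false⟩ = ar k Q ⟨c i, false⟩ by
        rw [← h.dtail_false, e_mul_ar]]
    nth_rw 1 [← ar_mul_e k Q ⟨c i, false⟩]
    rw [mul_assoc, h.dhead_false, h.e_mul_a, add_comm]
    rfl
  · push Not at hu
    rw [h.off_y hu, mul_add, ← mul_assoc, h.off_a' hu, zero_mul, zero_add, mul_one]

theorem e_mul_a_comm (i : ZMod n) :
    e k Q (v i) * cycA k Q c = cycA k Q c * e k Q (v (i + 1)) := by rw [h.e_mul_a, h.a_mul_e]

theorem e_mul_a'_comm (i : ZMod n) :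
    e k Q (v (i + 1)) * cycA' k Q c = cycA' k Q c * e k Q (v i) := by rw [h.e_mul_a', h.a'_mul_e]

theorem e_mul_rho_off [Finite E] [LinearOrder (DArrow E)] (hc : Function.Surjective c) {u : V}
    (hu : ∀ i, v i ≠ u) : e k Q u * (rho k Q : LAlg k Q) = e k Q u := by
  classical
  rw [rho, ← idem_mul_filter_prod (e_idem k Q) Q.dtail (g k Q) g_mem_locAt DArrow.sign u,
    List.filter_eq_nil_iff.2]
  · simp
  · rintro ⟨a, p⟩ _
    obtain ⟨j, rfl⟩ := hc a
    cases p
    · simpa [h.dtail_false] using hu _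
    · simpa [h.dtail_true] using hu _

/-- If the arrows `c i` are all arrows, and precede their reverses, then `ρ = x y⁻¹`. -/
theorem rho_eq [Finite E] [LinearOrder (DArrow E)] (hc : Function.Surjective c)
    (hlt : ∀ i j, (⟨c i, true⟩ : DArrow E) < ⟨c j, false⟩) :
    rho k Q = cycX k Q c * (cycY k Q c)⁻¹ := by
  classical
  ext1
  apply eq_of_idem_mul (e_idem k Q)
  intro u
  rw [Units.val_mul, ← mul_assoc]
  by_cases hu : ∃ i, v i = u
  · obtain ⟨i, rfl⟩ := hu
    obtain ⟨i, rfl⟩ : ∃ j, j + 1 = i := ⟨i - 1, sub_add_cancel _ _⟩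
    have hl : ((DArrow.sorted E).filter fun d => Q.dtail d = v (i + 1)) =
        [⟨c (i + 1), true⟩, ⟨c i, false⟩] := by
      apply eq_of_pairwise_lt (sorted_pairwise.filter _)
      · simpa using hlt (i + 1) i
      · rintro ⟨a, p⟩
        obtain ⟨j, rfl⟩ := hc a
        have hcc : ∀ {j j'}, c j = c j' ↔ j = j' := fun {j j'} =>
          ⟨fun h' => h.inj (by rw [← h.tail, h', h.tail]), fun h' => by rw [h']⟩
        cases p
        · simp [mem_sorted, h.dtail_false, h.inj.eq_iff, hcc]
        · simp [mem_sorted, h.dtail_true, h.inj.eq_iff, hcc]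
    rw [rho, ← idem_mul_filter_prod (e_idem k Q) Q.dtail (g k Q) g_mem_locAt DArrow.sign, hl,
      h.e_mul_x]
    have hgc := commute_of_mem_locAt (e_idem k Q) (g_mem_locAt (k := k) (Q := Q) ⟨c (i + 1), true⟩)
      (v (i + 1))
    rw [hgc.eq, mul_assoc, e_mul_inv_eq (h.e_mul_y i), ← mul_assoc, ← hgc.eq]
    simp [DArrow.sign, mul_assoc]
  · push Not at hu
    rw [h.e_mul_rho_off hc hu, h.off_x hu, eq_comm, Units.mul_inv_eq_iff_eq_mul, h.off_y hu]

/-- The elements of the basis of the algebra of the cycle in terms of the unit `x`. -/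
theorem cycElt_eq (bar : Bool) (i : ZMod n) (m l : ℤ) :
    cycElt k Q bar v c i m l = e k Q (v i) *
      laurentEval k (cycX k Q c) (shiftedBasis (if bar then 1 else 0) (if bar then 1 else 0) m) *
        signedPow (cycA k Q c) (cycA' k Q c) l := by
  have hloc : ∀ f : k[T;T⁻¹], e k Q (v i) * laurentEval k (cycX k Q c) f =
      e k Q (v i) * laurentEval k (g k Q ⟨c i, true⟩) f := by
    have hg := commute_of_mem_locAt (e_idem k Q) (g_mem_locAt (k := k) (Q := Q) ⟨c i, true⟩) (v i)
    intro f
    induction f using LaurentPolynomial.induction_on' with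
    | add f f' hf hf' => rw [map_add, map_add, mul_add, mul_add, hf, hf']
    | C_mul_T m r =>
      rw [← smul_eq_C_mul, map_smul, map_smul, laurentEval_T, laurentEval_T, mul_smul_comm,
        mul_smul_comm]
      congr 1
      obtain ⟨m, rfl | rfl⟩ := m.eq_nat_or_neg
      · simpa using idem_mul_pow (h.e_mul_x i) hg m
      · have := idem_mul_pow (e_mul_inv_eq (h.e_mul_x i)) hg.units_inv_right m
        rw [zpow_neg, zpow_natCast, zpow_neg, zpow_natCast, ← inv_pow, ← inv_pow]
        simpa using this
  rw [hloc, laurentEval_shiftedBasis]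
  unfold cycElt
  cases bar <;> simp [cycA, cycA']

end IsCyc

theorem incl_cycElt (A : Set E) (c : ZMod n → A) (bar : Bool) (i : ZMod n) (m l : ℤ) :
    incl k Q A (cycElt k (Q.restrict A) bar v c i m l) =
      cycElt k Q bar v (fun i => (c i : E)) i m l := by
  have h1 : incl k Q A (g k (Q.restrict A) ⟨c i, true⟩ : LAlg k (Q.restrict A)) =
      g k Q ⟨c i, true⟩ := congrArg Units.val (incl_g A ⟨c i, true⟩)
  have h2 : incl k Q A (↑(g k (Q.restrict A) ⟨c i, true⟩)⁻¹ : LAlg k (Q.restrict A)) =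
      (↑(g k Q ⟨c i, true⟩)⁻¹ : LAlg k Q) := by
    have := congrArg (fun u : (LAlg k Q)ˣ => (↑u⁻¹ : LAlg k Q))
      (incl_g (k := k) (Q := Q) A ⟨c i, true⟩)
    rw [← map_inv] at this
    exact this
  unfold cycElt
  cases bar <;> simp [map_signedPow, h1, h2, DArrow.incl]

end CycleElements

namespace WordData

variable {k : Type*} [Field k] {n : ℕ} {V E : Type*} [Fintype V] {D : WordData n V E}

/-! ### Representations on words -/

/-- The representation on words of the quiver of the letters. -/
def LetterSetup.rep (S : D.LetterSetup k) : QRep k D.quiver (D.Op k) where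
  vert := D.vproj k
  arr := S.ar
  unit := S.g
  idem := vproj_idem
  tail d := (S.ar_shift d).vproj_mul
  head d := (S.ar_shift d).mul_vproj
  unit_eq := S.g_val

theorem LetterSetup.rep_rhoL (S : D.LetterSetup k) :
    Units.map (S.rep.toHom : LAlg k D.quiver →* D.Op k)
      (rhoL k S.list D.quiver) = S.rho := by
  rw [rhoL, map_list_prod, List.map_map, rho]
  congr 1
  apply List.map_congr_left
  intro d _
  simp only [Function.comp_apply, map_zpow, QRep.map_g]
  rfl

theorem LetterSetup.rep_val (S : D.LetterSetup k) (x : Letter E) :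
    S.rep.toHom (x.val D.quiver) = S.op x := by
  rcases x with d | ⟨d, _ | _⟩
  · exact QRep.toHom_ar _ d
  · simp only [Letter.val, op, map_sub, map_one, QRep.toHom_g_inv]; rfl
  · simp only [Letter.val, op, map_sub, map_one, QRep.toHom_g]; rfl

namespace CycSetup

variable (C : D.CycSetup k) {E₁ : Type*} {Q₁ : ArrowQuiver V E₁} [NeZero n] {c : ZMod n → E₁}

theorem off_α {v : V} (hv : ∀ i, D.cyc i ≠ v) : D.vproj k v * C.α = 0 := by
  have : D.vproj k v * C.α₀ = 0 := by
    apply C.cyc_ext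
    · intro u w hu hw
      rw [End.mul_apply, C.α₀_off hu hw, map_zero]; rfl
    · intro i l g hw hg f
      rw [End.mul_apply, C.α₀_fib hw hg, C.vproj_fib_of_ne (hv _)]; rfl
  rw [α, ← mul_assoc, this, zero_mul]

theorem off_α' {v : V} (hv : ∀ i, D.cyc i ≠ v) : D.vproj k v * C.α' = 0 := by
  have : D.vproj k v * C.α₀' = 0 := by
    apply C.cyc_ext
    · intro u w hu hw
      rw [End.mul_apply, C.α₀'_off hu hw, map_zero]; rfl
    · intro i l g hw hg f
      rw [End.mul_apply, C.α₀'_fib hw hg, C.vproj_fib_of_ne (hv _)]; rfl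
  rw [α', ← mul_assoc, (C.vproj_commute_Φ v).eq, mul_assoc, this, mul_zero]

/-- The unit `1 + a a*` for an arrow `a` of the cycle. -/
def unitX (i : ZMod n) : (D.Op k)ˣ := loc vproj_idem (D.cyc i) C.X fun v => C.vproj_commute_X v

/-- The unit `1 + a* a` for an arrow `a` of the cycle. -/
def unitY (i : ZMod n) : (D.Op k)ˣ :=
  loc vproj_idem (D.cyc (i + 1)) C.Y fun v => C.vproj_commute_Y v

theorem unitX_val (i : ZMod n) : (C.unitX i : D.Op k) =
    1 + D.vproj k (D.cyc i) * C.α * (D.vproj k (D.cyc (i + 1)) * C.α') := by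
  have hi : D.vproj k (D.cyc i) * D.vproj k (D.cyc i) = D.vproj k (D.cyc i) := vproj_idem.idem _
  rw [unitX, loc_val, C.vproj_mul_α', C.vproj_mul_α, mul_assoc, ← mul_assoc _ C.α',
    C.vproj_mul_α', mul_assoc, hi, ← mul_assoc, α_mul_α', (C.vproj_commute_X _).eq, sub_mul, one_mul]
  abel

theorem unitY_val (i : ZMod n) : (C.unitY i : D.Op k) =
    1 + D.vproj k (D.cyc (i + 1)) * C.α' * (D.vproj k (D.cyc i) * C.α) := by
  have hi : D.vproj k (D.cyc (i + 1)) * D.vproj k (D.cyc (i + 1)) = D.vproj k (D.cyc (i + 1)) :=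
    vproj_idem.idem _
  rw [unitY, loc_val, C.vproj_mul_α, C.vproj_mul_α', mul_assoc, ← mul_assoc _ C.α,
    C.vproj_mul_α, mul_assoc, hi, ← mul_assoc, α'_mul_α, (C.vproj_commute_Y _).eq, sub_mul, one_mul]
  abel

/-- The representation on words of a quiver whose arrows form the cycle. -/
def rep (h : IsCyc Q₁ D.cyc c) (hc : Function.Bijective c) :
    QRep k Q₁ (D.Op k) where
  vert := D.vproj k
  arr a := if a.pos then D.vproj k (D.cyc ((Equiv.ofBijective c hc).symm a.arrow)) * C.α
    else D.vproj k (D.cyc ((Equiv.ofBijective c hc).symm a.arrow + 1)) * C.α'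
  unit a := if a.pos then C.unitX ((Equiv.ofBijective c hc).symm a.arrow)
    else C.unitY ((Equiv.ofBijective c hc).symm a.arrow)
  idem := vproj_idem
  tail a := by
    obtain ⟨a, p⟩ := a
    obtain ⟨i, rfl⟩ := (Equiv.ofBijective c hc).surjective a
    rw [Equiv.symm_apply_apply]
    cases p
    · rw [Equiv.ofBijective_apply, h.dtail_false, if_neg (by simp), ← mul_assoc, vproj_idem.idem]
    · rw [Equiv.ofBijective_apply, h.dtail_true, if_pos rfl, ← mul_assoc, vproj_idem.idem]
  head a := by
    obtain ⟨a, p⟩ := a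
    obtain ⟨i, rfl⟩ := (Equiv.ofBijective c hc).surjective a
    rw [Equiv.symm_apply_apply]
    cases p
    · rw [Equiv.ofBijective_apply, h.dhead_false, if_neg (by simp), vproj_mul_α', mul_assoc,
        vproj_idem.idem]
    · rw [Equiv.ofBijective_apply, h.dhead_true, if_pos rfl, vproj_mul_α, mul_assoc,
        vproj_idem.idem]
  unit_eq a := by
    obtain ⟨a, p⟩ := a
    cases p
    · simpa [DArrow.star] using C.unitY_val _
    · simpa [DArrow.star] using C.unitX_val _

section

variable (h : IsCyc Q₁ D.cyc c) (hc : Function.Bijective c)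

theorem rep_arr_true (i : ZMod n) : (C.rep h hc).arr ⟨c i, true⟩ = D.vproj k (D.cyc i) * C.α := by
  have : (Equiv.ofBijective c hc).symm (c i) = i := Equiv.ofBijective_symm_apply_apply c hc i
  simp [rep, this]

theorem rep_arr_false (i : ZMod n) :
    (C.rep h hc).arr ⟨c i, false⟩ = D.vproj k (D.cyc (i + 1)) * C.α' := by
  have : (Equiv.ofBijective c hc).symm (c i) = i := Equiv.ofBijective_symm_apply_apply c hc i
  simp [rep, this]

theorem rep_a : (C.rep h hc).toHom (cycA k Q₁ c) = C.α := by
  apply eq_of_idem_mul (vproj_idem (D := D) (k := k))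
  intro u
  have he : D.vproj k u = (C.rep h hc).toHom (e k Q₁ u) := (QRep.toHom_e (C.rep h hc) u).symm
  rw [he, ← map_mul]
  by_cases hu : ∃ i, D.cyc i = u
  · obtain ⟨i, rfl⟩ := hu
    rw [h.e_mul_a, QRep.toHom_ar, rep_arr_true, ← he]
  · push Not at hu
    rw [h.off_a hu, map_zero, ← he, C.off_α hu]

theorem rep_a' : (C.rep h hc).toHom (cycA' k Q₁ c) = C.α' := by
  apply eq_of_idem_mul (vproj_idem (D := D) (k := k))
  intro u
  have he : D.vproj k u = (C.rep h hc).toHom (e k Q₁ u) := (QRep.toHom_e (C.rep h hc) u).symm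
  rw [he, ← map_mul]
  by_cases hu : ∃ i, D.cyc i = u
  · obtain ⟨i, rfl⟩ := hu
    obtain ⟨i, rfl⟩ : ∃ j, j + 1 = i := ⟨i - 1, sub_add_cancel _ _⟩
    rw [h.e_mul_a', QRep.toHom_ar, rep_arr_false, ← he]
  · push Not at hu
    rw [h.off_a' hu, map_zero, ← he, C.off_α' hu]

theorem rep_x : Units.map ((C.rep h hc).toHom : LAlg k Q₁ →* D.Op k) (cycX k Q₁ c) = C.X := by
  ext1
  have := congrArg (C.rep h hc).toHom (h.a_mul_a' (k := k))
  rw [map_mul, map_sub, map_one, rep_a, rep_a', α_mul_α'] at this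
  exact (sub_left_injective this).symm

theorem rep_y : Units.map ((C.rep h hc).toHom : LAlg k Q₁ →* D.Op k) (cycY k Q₁ c) = C.Y := by
  ext1
  have := congrArg (C.rep h hc).toHom (h.a'_mul_a (k := k))
  rw [map_mul, map_sub, map_one, rep_a, rep_a', α'_mul_α] at this
  exact (sub_left_injective this).symm

end

end CycSetup

section NormalForm

variable {B : Type*} [Ring B] [Algebra k B] {E₁ : Type*} {Q₁ : ArrowQuiver V E₁}
  {φ : LAlg k D.quiver →ₐ[k] B} {val : Atom n V E → B}

theorem eqv_toHom {r : QRep k Q₁ (D.Op k)} (hr : r.vert = D.vproj k)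
    {π : LAlg k Q₁ →ₐ[k] B} (hφ : ∀ v, φ (e k D.quiver v) = π (e k Q₁ v))
    (harr : ∀ d, Eqv (D.evalBy φ val) (r.arr d) (π (ar k Q₁ d))) (a : LAlg k Q₁) :
    Eqv (D.evalBy φ val) (r.toHom a) (π a) := by
  let S : Subalgebra k (LAlg k Q₁) :=
    { carrier := {a | Eqv (D.evalBy φ val) (r.toHom a) (π a)}
      mul_mem' := fun {a b} ha hb => by
        change Eqv _ _ _
        rw [map_mul, map_mul]; exact Eqv.mul ha hb
      add_mem' := fun {a b} ha hb => by
        change Eqv _ _ _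
        rw [map_add, map_add]; exact Eqv.add ha hb
      algebraMap_mem' := fun c => by
        change Eqv _ _ _
        rw [Algebra.algebraMap_eq_smul_one, map_smul, map_smul, map_one, map_one]
        exact Eqv.one.smul c }
  have hS : S = ⊤ := by
    apply LAlg.eq_top
    have har : ∀ d, ar k Q₁ d ∈ S := fun d => by
      change Eqv _ _ _
      rw [QRep.toHom_ar]; exact harr d
    rintro (v | d | d)
    · change Eqv _ (r.toHom (e k Q₁ v)) (π (e k Q₁ v))
      rw [QRep.toHom_e, hr, ← hφ]
      exact eqv_vproj v
    · exact har d
    · have hg : Eqv (D.evalBy φ val) (r.unit d : D.Op k)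
          ((Units.map (π : LAlg k Q₁ →* B) (MPA.g k Q₁ d) : Bˣ) : B) := by
        have h1 : ((Units.map (π : LAlg k Q₁ →* B) (MPA.g k Q₁ d) : Bˣ) : B) =
            1 + π (ar k Q₁ d) * π (ar k Q₁ d.star) := by
          rw [← map_one π, ← map_mul, ← map_add]; rfl
        rw [h1, r.unit_eq]
        exact Eqv.one.add ((harr d).mul (harr d.star))
      have h2 := hg.inv
      rw [← QRep.toHom_g_inv, ← map_inv] at h2
      exact h2
  have : a ∈ S := hS ▸ Algebra.mem_top
  exact this

/-- If an algebra acts on normal words such that the atoms act by concatenation and evaluation is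
equivariant, then the normal words form a basis of the algebra. -/
theorem eval_bijective {r : QRep k Q₁ (D.Op k)} (hr : r.vert = D.vproj k)
    {π : LAlg k Q₁ →ₐ[k] B} (hπ : Function.Surjective π) {σ : B →ₐ[k] D.Op k}
    (hσ : σ.comp π = r.toHom) (hφ : ∀ v, φ (e k D.quiver v) = π (e k Q₁ v))
    (harr : ∀ d, Eqv (D.evalBy φ val) (r.arr d) (π (ar k Q₁ d)))
    (hloc : ∀ x, D.Good x → val x * φ (e k D.quiver (D.tgt x)) = val x)
    (hop : ∀ v x w, D.IsWord v (x :: w) → σ (val x) (D.wd k (D.tgt x) w) = D.wd k v (x :: w)) :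
    Function.Bijective (D.evalBy φ val) := by
  set u : D.Space k := ∑ v, D.wd k v [] with hu
  have hone : D.evalBy φ val u = 1 := by
    rw [hu, map_sum, ← map_one φ, ← sum_e, map_sum]
    refine Finset.sum_congr rfl fun v _ => ?_
    rw [eval_wd (show D.IsWord v [] from trivial)]
    simp
  have hσe : ∀ v, σ (φ (e k D.quiver v)) = D.vproj k v := fun v => by
    rw [hφ]
    exact (AlgHom.congr_fun hσ _).trans (by rw [QRep.toHom_e, hr])
  constructor
  · have key : ∀ w v, D.IsWord v w → D.vproj k v (σ (w.map val).prod u) = D.wd k v w := by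
      intro w
      induction w with
      | nil =>
        intro v _
        rw [List.map_nil, List.prod_nil, map_one, End.one_apply, hu, map_sum,
          Finset.sum_eq_single v]
        · exact vproj_wd_self v []
        · intro i _ hi; exact vproj_wd_of_ne hi []
        · simp
      | cons x w ih =>
        intro v hw
        rw [List.map_cons, List.prod_cons, ← hloc x hw.good, mul_assoc, map_mul,
          End.mul_apply, map_mul, hσe, End.mul_apply, ih _ hw.tail, hop v x w hw,
          vproj_wd_self]
    have hinv : ∀ x, σ (D.evalBy φ val x) u = x := by
      have : (LinearMap.applyₗ u ∘ₗ σ.toLinearMap) ∘ₗ D.evalBy φ val = LinearMap.id := by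
        apply space_ext
        intro v w hw
        rw [LinearMap.comp_apply, eval_wd hw]
        change σ (_ * _) u = _
        rw [map_mul, hσe, End.mul_apply, key w v hw]
        rfl
      exact fun x => LinearMap.congr_fun this x
    exact Function.LeftInverse.injective (g := fun b => σ b u) hinv
  · intro b
    obtain ⟨a, rfl⟩ := hπ b
    exact ⟨r.toHom a u, by rw [eqv_toHom hr hφ harr, hone, mul_one]⟩

/-- The basis of normal words. -/
theorem exists_basis_of_bijective (h : Function.Bijective (D.evalBy φ val)) :
    ∃ b : Basis {p : V × Atoms n V E // D.IsWord p.1 p.2} k B,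
      ∀ p, b p = φ (e k D.quiver p.1.1) * (p.1.2.map val).prod := by
  refine ⟨(D.wordBasis k).map (LinearEquiv.ofBijective (D.evalBy φ val) h), ?_⟩
  rintro ⟨⟨v, w⟩, hw⟩
  have h1 := eval_wd (k := k) (eB := fun v => φ (e k D.quiver v)) (val := val) hw
  rw [wd_of hw] at h1
  exact (Basis.map_apply _ _ _).trans h1

end NormalForm

end WordData

/-! ### The normal words form bases of the algebras -/

section Laurent

variable {k A B : Type*} [Field k] [Ring A] [Algebra k A] [Ring B] [Algebra k B]

theorem map_laurentEval (f : A →ₐ[k] B) (u : Aˣ) (p : k[T;T⁻¹]) :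
    f (laurentEval k u p) = laurentEval k (Units.map (f : A →* B) u) p := by
  induction p using LaurentPolynomial.induction_on' with
  | add p p' h h' => rw [map_add, map_add, h, h', map_add]
  | C_mul_T m c =>
    rw [← smul_eq_C_mul, map_smul, map_smul, map_smul, laurentEval_T, laurentEval_T, ← map_zpow]
    rfl

theorem laurentEval_laurentUnit (p : k[T;T⁻¹]) :
    laurentEval k (WordData.laurentUnit k) p = p := by
  have hT : ∀ m : ℕ, (↑(WordData.laurentUnit k ^ m) : k[T;T⁻¹]) = T m := fun m => by
    rw [Units.val_pow_eq_pow_val]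
    change T 1 ^ m = _
    rw [T_pow, mul_one]
  have hT' : ∀ m : ℕ, (↑((WordData.laurentUnit k)⁻¹ ^ m) : k[T;T⁻¹]) = T (-m) :=
    fun m => by
      rw [Units.val_pow_eq_pow_val]
      change T (-1) ^ m = _
      rw [T_pow, mul_neg_one]
  induction p using LaurentPolynomial.induction_on' with
  | add p p' h h' => rw [map_add, h, h']
  | C_mul_T m c =>
    rw [← smul_eq_C_mul, map_smul, laurentEval_T]
    obtain ⟨m, rfl | rfl⟩ := m.eq_nat_or_neg
    · rw [zpow_natCast, hT]
    · rw [zpow_neg, zpow_natCast, ← inv_pow, hT']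

end Laurent

section Lift

variable {k A B : Type*} [Field k] [Ring A] [Algebra k A] [Ring B] [Algebra k B] {r : A}

theorem proj_surjective : Function.Surjective (proj k r) := RingQuot.mkAlgHom_surjective k _

theorem proj_self : proj k r r = 0 := by
  have := RingQuot.mkAlgHom_rel k (PrincipalRel.zero (r := r))
  rwa [map_zero] at this

variable (k) in
/-- The homomorphism on `A / (r)` induced by a homomorphism which kills `r`. -/
def quotLift (f : A →ₐ[k] B) (hf : f r = 0) : Quot1 r →ₐ[k] B :=
  RingQuot.liftAlgHom k ⟨f, by rintro _ _ ⟨⟩; rw [hf, map_zero]⟩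

theorem quotLift_proj (f : A →ₐ[k] B) (hf : f r = 0) (a : A) :
    quotLift k f hf (proj k r a) = f a := by
  simp [quotLift, proj]

theorem quotLift_comp (f : A →ₐ[k] B) (hf : f r = 0) : (quotLift k f hf).comp (proj k r) = f :=
  AlgHom.ext fun a => quotLift_proj f hf a

end Lift

section Relations

variable {k : Type*} [Field k] {V E : Type*} [Fintype V] [Finite E] [LinearOrder (DArrow E)]
  {Q : ArrowQuiver V E} {q : V → kˣ} {B : Type*} [Ring B] [Algebra k B]

theorem e_commute_rho (i : V) : Commute (e k Q i) (rho k Q : LAlg k Q) :=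
  commute_map_prod (e_idem k Q) Q.dtail _ g_mem_locAt DArrow.sign _ _

theorem e_commute_vertexMap (i : V) (s : V → k) : Commute (e k Q i) (vertexMap k Q s) := by
  change _ * _ = _ * _
  rw [e_mul_vertexMap, vertexMap_mul_e]

theorem e_mul_rel (i : V) :
    e k Q i * rel Q q = e k Q i * (rho k Q : LAlg k Q) - (q i : k) • e k Q i := by
  rw [rel, mul_sub, e_mul_vertexMap]

theorem e_commute_rel (i : V) : Commute (e k Q i) (rel Q q) :=
  (e_commute_rho i).sub_right (e_commute_vertexMap i _)

theorem e_mul_relBlack (W : Set V) (i : V) :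
    e k Q i * relBlack Q q W = (by classical exact if i ∈ W then 0 else e k Q i * rel Q q) := by
  classical
  rw [relBlack, ← mul_assoc, ← mul_assoc, e_mul_vertexMap]
  by_cases hi : i ∈ W
  · simp [hi]
  · rw [Set.indicator_of_mem (show i ∈ Wᶜ from hi), Pi.one_apply, one_smul, if_neg hi,
      (e_commute_rel i).eq, mul_assoc, e_mul_vertexMap, Set.indicator_of_mem (show i ∈ Wᶜ from hi),
      Pi.one_apply, one_smul]

theorem map_relBlack_eq_zero (f : LAlg k Q →ₐ[k] B) (W : Set V) :
    f (relBlack Q q W) = 0 ↔ ∀ i ∉ W, f (e k Q i * rho k Q) = (q i : k) • f (e k Q i) := by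
  constructor
  · intro h i hi
    have h1 := congrArg f (e_mul_relBlack (q := q) (Q := Q) W i)
    rw [map_mul, h, mul_zero, if_neg hi, e_mul_rel, map_sub, map_smul] at h1
    exact (sub_eq_zero.1 h1.symm)
  · intro h
    rw [← one_mul (relBlack Q q W), ← sum_e, Finset.sum_mul, map_sum]
    refine Finset.sum_eq_zero fun i _ => ?_
    rw [e_mul_relBlack]
    split_ifs with hi
    · exact map_zero _
    · rw [e_mul_rel, map_sub, map_smul, h i hi, sub_self]

/-- Powers of `r` and `r'` at a vertex in terms of `ρ`. -/
theorem e_mul_signedPow_rel (i : V) (m : ℤ) :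
    e k Q i * signedPow (rel Q q) (rel' Q q) m = e k Q i *
      laurentEval k (rho k Q) (shiftedBasis (q i : k) ((q i)⁻¹ : k) m) := by
  rw [laurentEval_shiftedBasis]
  obtain ⟨m, rfl | rfl⟩ := m.eq_nat_or_neg
  · rw [signedPow_nat, signedPow_nat]
    apply idem_mul_pow
    · rw [e_mul_rel, mul_sub, ← Algebra.commutes, ← Algebra.smul_def]
    · exact (e_commute_rho i).sub_right (Algebra.commutes _ _).symm
  · rw [signedPow_neg, signedPow_neg]
    apply idem_mul_pow
    · rw [rel', mul_sub, mul_sub, e_mul_vertexMap, ← Algebra.commutes, ← Algebra.smul_def]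
    · exact (e_commute_rho i).units_inv_right.sub_right (Algebra.commutes _ _).symm

end Relations

namespace ArrowQuiver.Cycle

variable {V E : Type*} {Q : ArrowQuiver V E} {n : ℕ} {z : Q.Cycle n}

theorem isCyc (h : z.Oriented) : IsCyc (Q.restrict z.arrows) z.v z.arrow :=
  ⟨z.v_injective, fun i => (h i).1, fun i => (h i).2⟩

theorem arrow_bijective (z : Q.Cycle n) : Function.Bijective z.arrow := by
  constructor
  · intro i j h
    exact z.c_injective (congrArg Subtype.val h)
  · rintro ⟨_, i, rfl⟩
    exact ⟨i, rfl⟩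

theorem mem_verts {v : V} : v ∈ z.verts ↔ ∃ i, z.v i = v := Iff.rfl

/-- The data for normal words with given allowed kinds of atoms. -/
abbrev wordData (z : Q.Cycle n) (F : Set (z.arrowsᶜ : Set E)) (K : Set (Fin 3)) :
    WordData n V (z.arrowsᶜ : Set E) := ⟨Q.restrict z.arrowsᶜ, z.v, F, K⟩

/-- The data for normal words in the atoms of the cycle only. -/
abbrev cycData (z : Q.Cycle n) : WordData n V Empty := ⟨⟨Empty.elim, Empty.elim⟩, z.v, ∅, {0}⟩

end ArrowQuiver.Cycle

open WordData

section Bases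

variable {k : Type*} [Field k] {V E : Type*} [Fintype V] [Finite E] [LinearOrder (DArrow E)]
  {Q : ArrowQuiver V E} {q : V → kˣ} {n : ℕ} [NeZero n] {z : Q.Cycle n}

/-- The letters act on words, in the sorted order. -/
def letterSetup {D : WordData n V E} {W : Set V} (hF : D.quiver.IsRootedForest W D.forest)
    (h1 : 1 ∈ D.kinds) {R : (D.Op k)ˣ} (hR : D.IsRho q R) : D.LetterSetup k where
  W := W
  one_mem := h1
  forest := hF
  list := DArrow.sorted _
  nodup := sorted_nodup
  mem_list := mem_sorted
  R := R
  hR := hR.graded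

variable (q) in
/-- The values of letters in a partial multiplicative preprojective algebra. -/
def letterVal (Q : ArrowQuiver V E) (W : Set V) : Atom n V E → PLam Q q W
  | .letter x => proj k (relBlack Q q W) (x.val Q)
  | _ => 0

/-- The words in the letters form a basis of the algebra of the complement of the cycle. -/
theorem letter_bijective {D : WordData n V E} {W : Set V}
    (hF : D.quiver.IsRootedForest W D.forest) (hK : D.kinds = {1}) :
    Function.Bijective (D.evalBy (proj k (relBlack D.quiver q W)) (letterVal q D.quiver W)) := by
  set π := proj k (relBlack D.quiver q W) with hπ
  have h1 : 1 ∈ D.kinds := by rw [hK]; rfl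
  let S := letterSetup hF h1 (diagRho_isRho (D := D) q)
  have hrel : ∀ i ∉ W, π (e k D.quiver i * rho k D.quiver) = (q i : k) • π (e k D.quiver i) :=
    (map_relBlack_eq_zero π W).1 proj_self
  have h0 : S.rep.toHom (relBlack D.quiver q W) = 0 := by
    rw [map_relBlack_eq_zero]
    intro i hi
    have h1 : S.rep.toHom (rho k D.quiver : LAlg k D.quiver) =
        (S.rho : D.Op k) := congrArg Units.val S.rep_rhoL
    have h2 : S.rep.toHom (e k D.quiver i) = D.vproj k i := QRep.toHom_e S.rep i
    rw [map_mul, h1, h2, S.vproj_mul_rho (i := i) hi]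
    exact vproj_mul_diag _ i
  refine eval_bijective (r := S.rep) rfl proj_surjective (σ := quotLift k S.rep.toHom h0)
    (quotLift_comp _ _) (fun v => rfl) (fun d => ?_) ?_ ?_
  · refine S.eqv_ar (fun x => rfl) (fun i hi => ?_) d
    have h1 := (eqv_vproj (D := D) (φ := π) (val := letterVal q D.quiver W) i).smul (q i : k)
    have h2 : π (e k D.quiver i * LetterSetup.rhoL k S.list D.quiver) =
        (q i : k) • π (e k D.quiver i) := hrel i hi
    rw [h2]
    rwa [← vproj_mul_diag (fun i => (q i : k))] at h1
  · rintro (_ | x | _) hx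
    · simp [letterVal]
    · change π _ * π _ = π _
      rw [← map_mul]
      congr 1
      exact val_mul_e x
    · simp [letterVal]
  · rintro v (_ | x | _) w hw
    · have := hw.good.1
      simp [hK] at this
    · have : quotLift k S.rep.toHom h0 (letterVal (n := n) q D.quiver W (.letter x)) = S.op x :=
        (quotLift_proj _ _ _).trans (S.rep_val x)
      rw [this]
      exact S.op_wd hw
    · have := hw.good.1
      simp [hK] at this

end Bases

namespace WordData

variable {k : Type*} [Field k] {V E E₁ : Type*} [Fintype V] {n : ℕ} [NeZero n]
  {D : WordData n V E} {B : Type*} [Ring B] [Algebra k B] {Q₁ : ArrowQuiver V E₁}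
  {c : ZMod n → E₁} {φ : LAlg k D.quiver →ₐ[k] B} {val : Atom n V E → B}

/-- The number `1` or `0`, according to whether `x` is replaced by `x - 1` in words. -/
def shiftOf (k : Type*) [Field k] (bar : Bool) : k := if bar then 1 else 0

/-- The values of the atoms of the cycle, from a homomorphism. -/
def CycVals.ofHom {C : D.CycSetup k} (h : IsCyc Q₁ D.cyc c) (ψ : LAlg k Q₁ →ₐ[k] B)
    (hψ : ∀ v, φ (e k D.quiver v) = ψ (e k Q₁ v)) {u : B}
    (hu : Eqv (D.evalBy φ val) (C.U : D.Op k) u)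
    (hy : ψ (cycY k Q₁ c) = u * ψ (cycX k Q₁ c)) {bar : Bool} (hδ : C.δ = shiftOf k bar)
    (hval : ∀ i m l, val (.cyc i m l) = ψ (cycElt k Q₁ bar D.cyc c i m l)) : CycVals C φ val where
  a := ψ (cycA k Q₁ c)
  a' := ψ (cycA' k Q₁ c)
  x := Units.map (ψ : LAlg k Q₁ →* B) (cycX k Q₁ c)
  y := Units.map (ψ : LAlg k Q₁ →* B) (cycY k Q₁ c)
  a_mul_a' := by rw [← map_mul, h.a_mul_a', map_sub, map_one]; rfl
  a'_mul_a := by rw [← map_mul, h.a'_mul_a, map_sub, map_one]; rfl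
  e_mul_a i := by rw [hψ, hψ, ← map_mul, ← map_mul, h.e_mul_a_comm]
  e_mul_a' i := by rw [hψ, hψ, ← map_mul, ← map_mul, h.e_mul_a'_comm]
  off_a v hv := by rw [hψ, ← map_mul, h.off_a hv, map_zero]
  off_a' v hv := by rw [hψ, ← map_mul, h.a'_off hv, map_zero]
  a_off v hv := by rw [hψ, ← map_mul, h.a_off hv, map_zero]
  val_cyc i m l := by
    rw [hval, h.cycElt_eq, map_mul, map_mul, hψ, map_laurentEval, map_signedPow, CycSetup.basis, hδ]
    rfl
  u := u
  eqv_U := hu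
  y_eq := hy

theorem CycSetup.eqv_rep {C : D.CycSetup k} (cv : CycVals C φ val) (h : IsCyc Q₁ D.cyc c)
    (hc : Function.Bijective c) (ψ : LAlg k Q₁ →ₐ[k] B)
    (hψ : ∀ v, φ (e k D.quiver v) = ψ (e k Q₁ v)) (ha : cv.a = ψ (cycA k Q₁ c))
    (ha' : cv.a' = ψ (cycA' k Q₁ c)) (d : DArrow E₁) :
    Eqv (D.evalBy φ val) ((C.rep h hc).arr d) (ψ (MPA.ar k Q₁ d)) := by
  obtain ⟨e, p⟩ := d
  obtain ⟨i, rfl⟩ := hc.surjective e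
  cases p
  · rw [C.rep_arr_false h hc, ← h.e_mul_a', map_mul, ← hψ, ← ha']
    exact (eqv_vproj _).mul cv.eqv_α'
  · rw [C.rep_arr_true h hc, ← h.e_mul_a, map_mul, ← hψ, ← ha]
    exact (eqv_vproj _).mul cv.eqv_α

theorem CycSetup.rep_cycElt (C : D.CycSetup k) (h : IsCyc Q₁ D.cyc c)
    (hc : Function.Bijective c) {bar : Bool} (hδ : C.δ = shiftOf k bar) {v : V} {i : ZMod n} {m l : ℤ}
    {w : Atoms n V E} (hw : D.IsWord v (.cyc i m l :: w)) :
    (C.rep h hc).toHom (cycElt k Q₁ bar D.cyc c i m l) (D.wd k (D.cyc (i + l)) w) =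
      D.wd k v (.cyc i m l :: w) := by
  obtain rfl : D.cyc i = v := hw.src
  rw [h.cycElt_eq, map_mul, map_mul, map_laurentEval, map_signedPow, C.rep_a, C.rep_a', C.rep_x,
    QRep.toHom_e, End.mul_apply, End.mul_apply]
  have := C.op_wd hw
  rw [CycSetup.basis, hδ, shiftOf] at this
  rw [this]
  exact vproj_wd_self _ _

theorem CycVals.val_mul_e {C : D.CycSetup k} (cv : CycVals C φ val) (i : ZMod n) (m l : ℤ) :
    val (.cyc i m l) * φ (e k D.quiver (D.cyc (i + l))) = val (.cyc i m l) := by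
  rw [cv.val_cyc, mul_assoc, ← cv.e_mul_signedPow, ← mul_assoc, mul_assoc (φ _),
    ← (commute_laurentEval (k := k) (cv.commute_x (D.cyc i)) _).eq, ← mul_assoc, ← map_mul,
    e_mul_self]

end WordData

/-! ### The algebra of the cycle -/

section CycLam

open Classical

variable {k : Type*} [Field k] {V E E₁ : Type*} [Fintype V] {n : ℕ} [NeZero n]
  {D : WordData n V E} {Q₁ : ArrowQuiver V E₁} {c : ZMod n → E₁} {q : V → kˣ}

variable (D q) in
/-- The inverse of `q` on the cycle, and `1` off the cycle. -/
def invOnCycle (v : V) : kˣ := if ∃ i, D.cyc i = v then (q v)⁻¹ else 1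

/-- The action of the cycle on words in the algebra of the cycle. -/
def scalarCycSetup (h0 : 0 ∈ D.kinds) (inj : Function.Injective D.cyc) (q : V → kˣ) (bar : Bool) :
    D.CycSetup k where
  zero_mem := h0
  inj := inj
  δ := shiftOf k bar
  c i := (q (D.cyc i))⁻¹
  U := D.diagRho (invOnCycle D q)
  U_mem := (diagRho_isRho _).graded
  U_off v w hv hw := by
    change D.diag _ _ = _
    rw [diag_wd, invOnCycle, if_neg (by push Not; exact hv)]
    simp
  U_sub i w hw _ := by
    change D.diag _ _ - _ ∈ _
    rw [diag_wd, invOnCycle, if_pos ⟨i, rfl⟩, sub_self]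
    exact Submodule.zero_mem _

/-- The words formed by at most one atom of the cycle form a basis of the algebra of the cycle. -/
theorem cyc_bijective [Finite E₁] [LinearOrder (DArrow E₁)] (hK : D.kinds = {0})
    (h : IsCyc Q₁ D.cyc c) (hc : Function.Bijective c)
    (hlt : ∀ i j, (⟨c i, true⟩ : DArrow E₁) < ⟨c j, false⟩) {W : Set V}
    (hW : ∀ v, v ∉ W ↔ ∃ i, D.cyc i = v) (bar : Bool) {φ : LAlg k D.quiver →ₐ[k] PLam Q₁ q W}
    (hφ : ∀ v, φ (e k D.quiver v) = proj k (relBlack Q₁ q W) (e k Q₁ v))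
    {val : Atom n V E → PLam Q₁ q W}
    (hval : ∀ i m l, val (.cyc i m l) = proj k (relBlack Q₁ q W) (cycElt k Q₁ bar D.cyc c i m l)) :
    Function.Bijective (D.evalBy φ val) := by
  set π := proj k (relBlack Q₁ q W) with hπ
  have h0 : 0 ∈ D.kinds := by rw [hK]; rfl
  let C := scalarCycSetup h0 h.inj q bar
  have hrel : ∀ i ∉ W, π (e k Q₁ i * rho k Q₁) = (q i : k) • π (e k Q₁ i) :=
    (map_relBlack_eq_zero π W).1 proj_self
  have hker : (C.rep h hc).toHom (relBlack Q₁ q W) = 0 := by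
    rw [map_relBlack_eq_zero]
    intro v hv
    have h1 : (C.rep h hc).toHom (rho k Q₁ : LAlg k Q₁) = (↑C.U⁻¹ : D.Op k) := by
      have : Units.map ((C.rep h hc).toHom : LAlg k Q₁ →* D.Op k) (rho k Q₁) = C.U⁻¹ := by
        rw [h.rho_eq hc.surjective hlt, map_mul, map_inv, C.rep_x, C.rep_y, CycSetup.Y]
        group
      exact congrArg Units.val this
    have h2 : (C.rep h hc).toHom (e k Q₁ v) = D.vproj k v := QRep.toHom_e (C.rep h hc) v
    rw [map_mul, h1, h2]
    change D.vproj k v * D.diag _ = _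
    rw [vproj_mul_diag, invOnCycle, if_pos ((hW v).1 hv)]
    simp
  have hidem : CompleteOrthogonalIdempotents fun v => π (e k Q₁ v) := (e_idem k Q₁).map π.toRingHom
  have hU : Eqv (D.evalBy φ val) (C.U : D.Op k)
      (π (vertexMap k Q₁ fun v => (invOnCycle D q v : k))) := by
    apply Eqv.of_words
    intro v w _
    change D.evalBy φ val (D.diag _ _) = _
    rw [diag_wd, map_smul, ← e_mul_evalBy, hφ, ← mul_assoc, ← map_mul, vertexMap_mul_e, map_smul,
      smul_mul_assoc]
  have hy : π (cycY k Q₁ c) =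
      π (vertexMap k Q₁ fun v => (invOnCycle D q v : k)) * π (cycX k Q₁ c) := by
    apply eq_of_idem_mul hidem
    intro v
    rw [← map_mul, ← map_mul, ← map_mul, ← mul_assoc, e_mul_vertexMap, smul_mul_assoc, map_smul]
    by_cases hv : ∃ i, D.cyc i = v
    · rw [invOnCycle, if_pos hv]
      have h1 := hrel v ((hW v).2 hv)
      rw [h.rho_eq hc.surjective hlt] at h1
      have h2 := congrArg (· * π (cycY k Q₁ c)) h1
      simp only [← map_mul, smul_mul_assoc] at h2
      rw [Units.val_mul, ← mul_assoc, Units.inv_mul_cancel_right] at h2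
      rw [h2, smul_smul]
      simp
    · rw [invOnCycle, if_neg hv]
      push Not at hv
      rw [h.off_x hv, h.off_y hv]
      simp
  let cv : CycVals C φ val := CycVals.ofHom h π hφ hU hy rfl hval
  refine eval_bijective (r := C.rep h hc) rfl proj_surjective
    (σ := quotLift k (C.rep h hc).toHom hker) (quotLift_comp _ _) hφ ?_ ?_ ?_
  · exact CycSetup.eqv_rep cv h hc π hφ rfl rfl
  · rintro (⟨i, m, l⟩ | x | _) hx
    · exact cv.val_mul_e i m l
    all_goals exact absurd hx.1 (by simp [hK])
  · rintro v (⟨i, m, l⟩ | x | _) w hw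
    · rw [hval, quotLift_proj]
      exact C.rep_cycElt h hc rfl hw
    all_goals exact absurd hw.good.1 (by simp [hK])

end CycLam

/-! ### The algebras of the whole quiver -/

section Full

variable {k : Type*} [Field k] {V E : Type*} [Fintype V] {n : ℕ} [NeZero n]

theorem rho_sub_mem {D : WordData n V E} (S : D.LetterSetup k) {v : V} (hv : v ∈ S.W) {x : D.Space k}
    (hx : D.vproj k v x = x) :
    (S.rho : D.Op k) x - x ∈ D.wspan k fun _ w => ¬ StartsCyc w := by
  let G : Subgroup (D.Op k)ˣ :=
    { carrier := {T | Graded (T : D.Op k) ∧ ∀ x, D.vproj k v x = x →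
        (T : D.Op k) x - x ∈ D.wspan k fun _ w => ¬ StartsCyc w}
      one_mem' := ⟨Graded.one, fun x _ => by
        rw [Units.val_one, End.one_apply, sub_self]; exact Submodule.zero_mem _⟩
      mul_mem' := fun {a b} ha hb => ⟨ha.1.mul hb.1, fun x hx => by
        have h1 : D.vproj k v ((b : D.Op k) x) = b.val x := by
          rw [← End.mul_apply, (hb.1.vert v).eq, End.mul_apply, hx]
        have := Submodule.add_mem _ (ha.2 _ h1) (hb.2 x hx)
        rwa [sub_add_sub_cancel] at this⟩
      inv_mem' := fun {a} ha => ⟨ha.1.inv, fun x hx => by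
        have h1 : D.vproj k v ((↑a⁻¹ : D.Op k) x) = (↑a⁻¹ : D.Op k) x := by
          rw [← End.mul_apply, ((Graded.inv ha.1).vert v).eq, End.mul_apply, hx]
        have h2 := Submodule.neg_mem _ (ha.2 _ h1)
        rw [← End.mul_apply, Units.mul_inv, End.one_apply, neg_sub] at h2
        exact h2⟩ }
  have : S.rho ∈ G := by
    apply Subgroup.list_prod_mem
    intro t ht
    obtain ⟨d, _, rfl⟩ := List.mem_map.1 ht
    refine Subgroup.zpow_mem G (x := S.g d) ⟨(S.g_mem d).2, fun x hx => ?_⟩ _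
    by_cases hd : D.quiver.dtail d = v
    · exact S.g_sub_one_mem d (hd ▸ hv) x
    · have h2 := LinearMap.congr_fun ((S.g_mem d).1 v (Ne.symm hd)).2 x
      rw [End.mul_apply, hx] at h2
      rw [h2, sub_self]
      exact Submodule.zero_mem _
  exact this.2 x hx

/-- The action of the cycle on words in the whole quiver: `1 + a* a` is `ρ' ρ⁻¹ (1 + a a*)`. -/
def fullCycSetup {D : WordData n V E} {q : V → kˣ} (S : D.LetterSetup k) (hR : D.IsRho q S.R)
    (h0 : 0 ∈ D.kinds) (inj : Function.Injective D.cyc) (hW : ∀ v, v ∈ S.W ↔ ∃ i, D.cyc i = v)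
    (bar : Bool) : D.CycSetup k where
  zero_mem := h0
  inj := inj
  δ := shiftOf k bar
  c i := (q (D.cyc i))⁻¹
  U := S.rho * S.R⁻¹
  U_mem := (D.gradedUnits k).mul_mem S.rho_graded ((D.gradedUnits k).inv_mem hR.graded)
  U_off v w hv hw := by
    have hv' : v ∉ S.W := by rw [hW]; push Not; exact hv
    have h1 : D.vproj k v * (↑(S.rho * S.R⁻¹) : D.Op k) = D.vproj k v := by
      rw [Units.val_mul, ← mul_assoc, S.vproj_mul_rho hv', mul_assoc, Units.mul_inv, mul_one]
    have h2 : Graded (↑(S.rho * S.R⁻¹) : D.Op k) :=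
      (D.gradedUnits k).mul_mem S.rho_graded ((D.gradedUnits k).inv_mem hR.graded)
    rw [(h2.vert v).eq] at h1
    have h3 := LinearMap.congr_fun h1 (D.wd k v w)
    rwa [End.mul_apply, vproj_wd_self] at h3
  U_sub i w hw hs := by
    have hp : ¬ StartsPow w := by
      rcases w with _ | ⟨_ | _ | _, _⟩ <;> first | exact id | exact absurd hs id
    have h1 := hR.inv_sub (D.cyc i) w hw hp
    have h2 : D.vproj k (D.cyc i)
        ((↑S.R⁻¹ : D.Op k) (D.wd k (D.cyc i) w)) =
        (↑S.R⁻¹ : D.Op k) (D.wd k (D.cyc i) w) := by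
      rw [← End.mul_apply, ((Graded.inv hR.graded).vert _).eq, End.mul_apply, vproj_wd_self]
    have h3 := Submodule.add_mem _ (rho_sub_mem S ((hW _).2 ⟨i, rfl⟩) h2) h1
    rw [sub_add_sub_cancel] at h3
    simpa using h3

variable [Finite E] [LinearOrder (DArrow E)] {Q : ArrowQuiver V E} {q : V → kˣ} {z : Q.Cycle n}
  {F : Set (z.arrowsᶜ : Set E)} {K : Set (Fin 3)}

/-- The value in `L_Q` of an atom. -/
def atomVal (q : V → kˣ) (z : Q.Cycle n) (bar : Bool) : Atom n V (z.arrowsᶜ : Set E) → LAlg k Q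
  | .cyc i m l => cycElt k Q bar z.v z.c i m l
  | .letter x => (x.map Subtype.val).val Q
  | .pow i m => e k Q i * signedPow (rel Q q) (rel' Q q) m

theorem incl_val {A : Set E} (x : Letter A) :
    incl k Q A (x.val (Q.restrict A)) = (x.map Subtype.val).val Q := by
  rcases x with d | ⟨d, _ | _⟩
  · exact incl_ar A d
  · have := congrArg (fun u : (LAlg k Q)ˣ => (↑u⁻¹ : LAlg k Q))
      (incl_g (k := k) (Q := Q) A d)
    simp only [← map_inv] at this
    simp only [Letter.val, Letter.map, map_sub, map_one]
    exact congrArg (· - 1) this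
  · have := congrArg Units.val (incl_g (k := k) (Q := Q) A d)
    simp only [Letter.val, Letter.map, map_sub, map_one]
    exact congrArg (· - 1) this

end Full

section Full

variable {k : Type*} [Field k] {V E : Type*} [Fintype V] {n : ℕ} [NeZero n] [Finite E]
  [LinearOrder (DArrow E)] {Q : ArrowQuiver V E} {q : V → kˣ} {z : Q.Cycle n}
  {F : Set (z.arrowsᶜ : Set E)} {K : Set (Fin 3)}
  (hF : (Q.restrict z.arrowsᶜ).IsRootedForest z.verts F) (h0 : 0 ∈ K) (h1 : 1 ∈ K)
  {R : ((z.wordData F K).Op k)ˣ} (hR : (z.wordData F K).IsRho q R)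
  (ho : z.Oriented) (bar : Bool)

/-- The action of the letters on words in the whole quiver. -/
abbrev wholeLetters : (z.wordData F K).LetterSetup k := letterSetup (D := z.wordData F K) hF h1 hR

/-- The action of the cycle on words in the whole quiver. -/
abbrev wholeCycle : (z.wordData F K).CycSetup k :=
  fullCycSetup (wholeLetters hF h1 hR) hR h0 z.v_injective (fun _ => Iff.rfl) bar

/-- The representation of the whole quiver on normal words. -/
def wholeRep : QRep k Q ((z.wordData F K).Op k) :=
  ((wholeCycle hF h0 h1 hR bar).rep (ArrowQuiver.Cycle.isCyc ho) z.arrow_bijective).union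
    (wholeLetters hF h1 hR).rep rfl

theorem wholeRep_incl (a : LAlg k (Q.restrict z.arrows)) :
    (wholeRep hF h0 h1 hR ho bar).toHom (incl k Q z.arrows a) =
      ((wholeCycle hF h0 h1 hR bar).rep (ArrowQuiver.Cycle.isCyc ho) z.arrow_bijective).toHom a :=
  AlgHom.congr_fun (QRep.union_incl _ _ _) a

theorem wholeRep_incl_compl (a : LAlg k (Q.restrict z.arrowsᶜ)) :
    (wholeRep hF h0 h1 hR ho bar).toHom (incl k Q z.arrowsᶜ a) =
      (wholeLetters hF h1 hR).rep.toHom a :=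
  AlgHom.congr_fun (QRep.union_incl_compl _ _ _) a

theorem rho_cycle (ho : z.Oriented) (ha : z.Adapted) :
    rho k (Q.restrict z.arrows) =
      cycX k (Q.restrict z.arrows) z.arrow * (cycY k (Q.restrict z.arrows) z.arrow)⁻¹ :=
  (ArrowQuiver.Cycle.isCyc ho).rho_eq z.arrow_bijective.surjective fun i j => ha.1 i j

theorem wholeRep_rho (ha : z.Adapted) :
    Units.map ((wholeRep hF h0 h1 hR ho bar).toHom : LAlg k Q →* _) (rho k Q) = R := by
  have h2 : Units.map ((wholeRep hF h0 h1 hR ho bar).toHom : LAlg k Q →* _)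
      (Units.map (incl k Q z.arrows : LAlg k (Q.restrict z.arrows) →* LAlg k Q)
        (rho k (Q.restrict z.arrows))) = (wholeCycle hF h0 h1 hR bar).U⁻¹ := by
    have : Units.map (((wholeCycle hF h0 h1 hR bar).rep (ArrowQuiver.Cycle.isCyc ho)
        z.arrow_bijective).toHom : LAlg k (Q.restrict z.arrows) →* _)
        (rho k (Q.restrict z.arrows)) = (wholeCycle hF h0 h1 hR bar).U⁻¹ := by
      rw [rho_cycle ho ha, map_mul, map_inv, CycSetup.rep_x, CycSetup.rep_y, CycSetup.Y]
      group
    rw [← this]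
    ext1
    exact wholeRep_incl hF h0 h1 hR ho bar _
  have h3 : Units.map ((wholeRep hF h0 h1 hR ho bar).toHom : LAlg k Q →* _)
      (Units.map (incl k Q z.arrowsᶜ : LAlg k (Q.restrict z.arrowsᶜ) →* LAlg k Q)
        (rho k (Q.restrict z.arrowsᶜ))) = (wholeLetters hF h1 hR).rho := by
    rw [← (wholeLetters hF h1 hR).rep_rhoL]
    ext1
    exact wholeRep_incl_compl hF h0 h1 hR ho bar _
  rw [rho_eq_incl_mul_incl z.arrows ha.2, map_mul, h2, h3]
  change ((wholeLetters hF h1 hR).rho * (wholeLetters hF h1 hR).R⁻¹)⁻¹ *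
    (wholeLetters hF h1 hR).rho = R
  rw [mul_inv_rev, inv_inv, inv_mul_cancel_right]
  rfl

/-- The words form a basis of a quotient of `L_Q` which acts on them by operators compatible with
evaluation. -/
theorem whole_bijective (ha : z.Adapted) {B : Type*} [Ring B] [Algebra k B]
    {π : LAlg k Q →ₐ[k] B} (hπ : Function.Surjective π)
    {σ : B →ₐ[k] (z.wordData F K).Op k}
    (hσ : σ.comp π = (wholeRep hF h0 h1 hR ho bar).toHom)
    (hρ : Eqv ((z.wordData F K).evalBy (π.comp (incl k Q z.arrowsᶜ))
      fun x => π (atomVal q z bar x)) (R : End k _) (π (rho k Q)))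
    (hpow : ∀ v i m w, (z.wordData F K).IsWord v (.pow i m :: w) →
      (wholeRep hF h0 h1 hR ho bar).toHom (e k Q i * signedPow (rel Q q) (rel' Q q) m)
        ((z.wordData F K).wd k i w) = (z.wordData F K).wd k v (.pow i m :: w)) :
    Function.Bijective ((z.wordData F K).evalBy (π.comp (incl k Q z.arrowsᶜ))
      fun x => π (atomVal q z bar x)) := by
  have hc := ArrowQuiver.Cycle.isCyc ho
  have he : ∀ v, (π.comp (incl k Q z.arrowsᶜ)) (e k (Q.restrict z.arrowsᶜ) v) = π (e k Q v) :=
    fun v => congrArg π (incl_e _ v)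
  have he' : ∀ v, (π.comp (incl k Q z.arrowsᶜ)) (e k (Q.restrict z.arrowsᶜ) v) =
      (π.comp (incl k Q z.arrows)) (e k (Q.restrict z.arrows) v) :=
    fun v => (he v).trans (congrArg π (incl_e _ v)).symm
  have hval : ∀ x, π (atomVal q z bar (.letter x)) =
      (π.comp (incl k Q z.arrowsᶜ)) (x.val (Q.restrict z.arrowsᶜ)) :=
    fun x => congrArg π (incl_val x).symm
  have hcyc : ∀ i m l, π (atomVal q z bar (.cyc i m l)) =
      (π.comp (incl k Q z.arrows)) (cycElt k (Q.restrict z.arrows) bar z.v z.arrow i m l) :=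
    fun i m l => congrArg π (incl_cycElt z.arrows z.arrow bar i m l).symm
  let S := wholeLetters hF h1 hR
  let C := wholeCycle hF h0 h1 hR bar
  have hρ' := rho_eq_incl_mul_incl (k := k) (Q := Q) z.arrows ha.2
  have hS : ∀ i ∉ S.W, Eqv ((z.wordData F K).evalBy (π.comp (incl k Q z.arrowsᶜ))
      fun x => π (atomVal q z bar x)) ((z.wordData F K).vproj k i * S.R)
      ((π.comp (incl k Q z.arrowsᶜ)) (e k (Q.restrict z.arrowsᶜ) i *
        LetterSetup.rhoL k S.list (Q.restrict z.arrowsᶜ))) := by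
    intro i hi
    have h2 : (π.comp (incl k Q z.arrowsᶜ)) (e k (Q.restrict z.arrowsᶜ) i *
        (rho k (Q.restrict z.arrowsᶜ) : LAlg k (Q.restrict z.arrowsᶜ))) =
        (π.comp (incl k Q z.arrowsᶜ)) (e k (Q.restrict z.arrowsᶜ) i) * π (rho k Q) := by
      rw [map_mul, he, ← map_mul, hρ', Units.val_mul]
      have h3 := hc.e_mul_rho_off (k := k) z.arrow_bijective.surjective (u := i)
        (by rintro j rfl; exact hi ⟨j, rfl⟩)
      have h4 := congrArg (incl k Q z.arrows) h3
      rw [map_mul, incl_e] at h4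
      have h5 : e k Q i * ((Units.map (incl k Q z.arrows : LAlg k (Q.restrict z.arrows) →* LAlg k Q)
          (rho k (Q.restrict z.arrows)) : (LAlg k Q)ˣ) : LAlg k Q) = e k Q i := h4
      rw [← mul_assoc, h5, map_mul]
      rfl
    refine Eq.mpr ?_ ((eqv_vproj (D := z.wordData F K) i).mul hρ)
    exact congrArg (Eqv _ _) h2
  have hu := (S.eqv_rho hval hS).mul
    (Eqv.inv (b := Units.map (π : LAlg k Q →* B) (rho k Q)) hρ)
  let cv : CycVals C (π.comp (incl k Q z.arrowsᶜ)) (fun x => π (atomVal q z bar x)) := by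
    refine CycVals.ofHom hc (π.comp (incl k Q z.arrows)) he' hu ?_ rfl hcyc
    let f : (LAlg k (Q.restrict z.arrows))ˣ →* Bˣ :=
      Units.map ((π.comp (incl k Q z.arrows) : LAlg k (Q.restrict z.arrows) →ₐ[k] B) : _ →* B)
    let f' : (LAlg k (Q.restrict z.arrowsᶜ))ˣ →* Bˣ :=
      Units.map ((π.comp (incl k Q z.arrowsᶜ) : LAlg k (Q.restrict z.arrowsᶜ) →ₐ[k] B) : _ →* B)
    have h2 : Units.map (π : LAlg k Q →* B) (rho k Q) =
        f (rho k (Q.restrict z.arrows)) * f' (rho k (Q.restrict z.arrowsᶜ)) := by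
      rw [hρ', map_mul]
      rfl
    have h3 : f (cycY k (Q.restrict z.arrows) z.arrow) = f' (rho k (Q.restrict z.arrowsᶜ)) *
        (Units.map (π : LAlg k Q →* B) (rho k Q))⁻¹ * f (cycX k (Q.restrict z.arrows) z.arrow) := by
      rw [h2, rho_cycle ho ha, map_mul, map_inv]
      group
    exact congrArg Units.val h3
  refine eval_bijective (r := wholeRep hF h0 h1 hR ho bar) rfl hπ hσ he ?_ ?_ ?_
  · intro d
    rw [← QRep.toHom_ar (wholeRep hF h0 h1 hR ho bar)]
    by_cases hd : d.arrow ∈ z.arrows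
    · have h2 : incl k Q z.arrows (ar k _ ⟨⟨d.arrow, hd⟩, d.pos⟩) = ar k Q d := incl_ar _ _
      rw [← h2, wholeRep_incl, QRep.toHom_ar]
      exact CycSetup.eqv_rep cv hc z.arrow_bijective _ he' rfl rfl _
    · have h2 : incl k Q z.arrowsᶜ (ar k _ ⟨⟨d.arrow, hd⟩, d.pos⟩) = ar k Q d := incl_ar _ _
      rw [← h2, wholeRep_incl_compl, LetterSetup.rep, QRep.toHom_ar]
      exact S.eqv_ar hval hS _
  · rintro (⟨i, m, l⟩ | x | ⟨i, m⟩) _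
    · exact cv.val_mul_e i m l
    · rw [hval, ← map_mul]
      exact congrArg _ (val_mul_e x)
    · rw [he]
      change π (_ * _) * π (e k Q i) = π (_ * _)
      rw [← map_mul, e_mul_signedPow_rel, mul_assoc,
        ← (commute_laurentEval (k := k) (e_commute_rho i) _).eq, ← mul_assoc, e_mul_self]
  · have hσ' : ∀ a, σ (π a) = (wholeRep hF h0 h1 hR ho bar).toHom a := AlgHom.congr_fun hσ
    rintro v (⟨i, m, l⟩ | x | ⟨i, m⟩) w hw
    · rw [hcyc, AlgHom.comp_apply, hσ', wholeRep_incl]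
      exact C.rep_cycElt hc z.arrow_bijective rfl hw
    · rw [hval, AlgHom.comp_apply, hσ', wholeRep_incl_compl]
      exact (LinearMap.congr_fun (S.rep_val x) _).trans (S.op_wd hw)
    · rw [hσ']
      exact hpow v i m w hw

theorem map_rho_of_map_rel {B : Type*} [Ring B] [Algebra k B] {f : LAlg k Q →ₐ[k] B}
    (h : f (rel Q q) = 0) (i : V) : f (e k Q i) * f (rho k Q) = (q i : k) • f (e k Q i) := by
  have h1 := congrArg f (e_mul_rel (q := q) (Q := Q) i)
  rw [map_mul, h, mul_zero, map_sub, map_smul, map_mul] at h1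
  exact (sub_eq_zero.1 h1.symm)

/-- The words without powers of `r` and `r'` form a basis of `Λ^q(Q)`. -/
theorem lam_bijective (hF : (Q.restrict z.arrowsᶜ).IsRootedForest z.verts F) (ho : z.Oriented)
    (ha : z.Adapted) (bar : Bool) (q : V → kˣ) :
    Function.Bijective ((z.wordData F {0, 1}).evalBy
      ((proj k (rel Q q)).comp (incl k Q z.arrowsᶜ))
      fun x => proj k (rel Q q) (atomVal q z bar x)) := by
  have hR := diagRho_isRho (k := k) (D := z.wordData F {0, 1}) q
  have hker : (wholeRep hF (by simp) (by simp) hR ho bar).toHom (rel Q q) = 0 := by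
    have h1 : (wholeRep hF (by simp) (by simp) hR ho bar).toHom (rho k Q : LAlg k Q) = _ :=
      congrArg Units.val (wholeRep_rho hF (by simp) (by simp) hR ho bar ha)
    apply eq_of_idem_mul (vproj_idem (D := z.wordData F {0, 1}) (k := k))
    intro i
    have h2 : (wholeRep hF (by simp) (by simp) hR ho bar).toHom (e k Q i) =
      (z.wordData F {0, 1}).vproj k i := QRep.toHom_e _ i
    rw [← h2, ← map_mul, e_mul_rel, map_sub, map_mul, map_smul, h1, h2, mul_zero, sub_eq_zero]
    exact vproj_mul_diag _ i
  have hcomm : ∀ i, Commute (proj k (rel Q q) (e k Q i)) (proj k (rel Q q) (rho k Q)) := fun i => by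
    have := congrArg (proj k (rel Q q)) (e_commute_rho (k := k) (Q := Q) i).eq
    rwa [map_mul, map_mul] at this
  refine whole_bijective hF _ _ hR ho bar ha proj_surjective (σ := quotLift k _ hker)
    (quotLift_comp _ _) ?_ ?_
  · refine eqv_diagRho (D := z.wordData F {0, 1})
      (u := Units.map (proj k (rel Q q) : LAlg k Q →* Lam Q q) (rho k Q)) (fun i => ?_) fun i => ?_
    · rw [AlgHom.comp_apply, incl_e]
      exact map_rho_of_map_rel proj_self i
    · rw [AlgHom.comp_apply, incl_e]
      exact hcomm i
  · intro v i m w hw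
    have := hw.good.1
    simp at this

/-- All normal words form a basis of `L_Q`. -/
theorem lAlg_bijective (hF : (Q.restrict z.arrowsᶜ).IsRootedForest z.verts F) (ho : z.Oriented)
    (ha : z.Adapted) (bar : Bool) (q : V → kˣ) :
    Function.Bijective ((z.wordData F Set.univ).evalBy (incl k Q z.arrowsᶜ) (atomVal q z bar)) := by
  have hR := powRho_isRho (k := k) (D := z.wordData F Set.univ) (Set.mem_univ _) q
  refine whole_bijective hF (Set.mem_univ _) (Set.mem_univ _) hR ho bar ha (π := AlgHom.id k _)
    Function.surjective_id (AlgHom.comp_id _) ?_ ?_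
  · refine eqv_powRho (D := z.wordData F Set.univ) (Set.mem_univ _) (u := rho k Q) (fun i => ?_)
      fun i m => ?_
    · rw [AlgHom.comp_apply, incl_e]
      exact e_commute_rho i
    · rw [AlgHom.comp_apply, incl_e]
      exact e_mul_signedPow_rel i m
  · intro v i m w hw
    obtain rfl : i = v := hw.src
    have h2 : (wholeRep hF (Set.mem_univ _) (Set.mem_univ _) hR ho bar).toHom (e k Q i) =
      (z.wordData F Set.univ).vproj k i := QRep.toHom_e _ i
    rw [e_mul_signedPow_rel, map_mul, h2, map_laurentEval, wholeRep_rho hF _ _ hR ho bar ha,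
      powRho, ← map_laurentEval, laurentEval_laurentUnit, End.mul_apply,
      vproj_mul_powAct _ q hw, vproj_wd_self]

end Full

/-! ### Paths and their decomposition into blocks -/

/-- Conditions on a sequence of letters: the admissible letters, where a letter starts and ends,
and which pairs of letters may be adjacent. -/
structure PathData (V α : Type*) where
  P : α → Prop
  s : α → Option V
  t : α → Option V
  O : α → α → Prop

namespace PathData

variable {V α β κ : Type*} (D : PathData V α) (D' : PathData V β)

/-- The pairs of letters which may be adjacent. -/
def R (x y : α) : Prop := D.t x = D.s y ∧ D.O x y

/-- A vertex and an admissible, possibly empty, sequence of letters which starts there. -/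
def IsPath (p : V × List α) : Prop :=
  (∀ x ∈ p.2, D.P x) ∧ (∀ x ∈ p.2.head?, D.s x = some p.1) ∧ p.2.IsChain D.R

variable {D D'}

theorem isPath_nil (v : V) : D.IsPath (v, []) := ⟨by simp, by simp, List.isChain_nil⟩

theorem isPath_cons {v : V} {x : α} {l : List α} :
    D.IsPath (v, x :: l) ↔ D.P x ∧ D.s x = some v ∧ (∀ y ∈ l.head?, D.R x y) ∧
      (∀ y ∈ l, D.P y) ∧ l.IsChain D.R := by
  simp only [IsPath, List.forall_mem_cons, List.head?_cons, Option.mem_some_iff, forall_eq',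
    List.isChain_cons]
  tauto

theorem IsPath.tail {v u : V} {x : α} {l : List α} (h : D.IsPath (v, x :: l)) (ht : D.t x = some u) :
    D.IsPath (u, l) := by
  obtain ⟨_, _, h1, h2, h3⟩ := isPath_cons.1 h
  exact ⟨h2, fun y hy => (h1 y hy).1.symm.trans ht, h3⟩

/-- A path is empty, or else its starting vertex is redundant. -/
def splitEquiv {X : Type*} (j : X → List α) (v : X → V) (hj : ∀ x, j x ≠ [] ∧ D.IsPath (v x, j x))
    (inj : Function.Injective j) (surj : ∀ u w, w ≠ [] → D.IsPath (u, w) → ∃ x, j x = w) :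
    V ⊕ X ≃ {p // D.IsPath p} :=
  Equiv.ofBijective (Sum.elim (fun i => ⟨(i, []), isPath_nil i⟩) fun x => ⟨(v x, j x), (hj x).2⟩) <| by
    have hv : ∀ u w, w ≠ [] → D.IsPath (u, w) → ∀ x, j x = w → v x = u := by
      intro u w hw h x hx
      obtain ⟨y, w', rfl⟩ := List.exists_cons_of_ne_nil hw
      have h1 := (hj x).2
      rw [hx] at h1
      exact Option.some_injective _ ((isPath_cons.1 h1).2.1.symm.trans (isPath_cons.1 h).2.1)
    constructor
    · rintro (i | x) (i' | x') h
      · exact congrArg Sum.inl (congrArg (fun p => p.1.1) h)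
      · exact absurd (congrArg (fun p => p.1.2) h).symm (hj x').1
      · exact absurd (congrArg (fun p => p.1.2) h) (hj x).1
      · exact congrArg Sum.inr (inj (congrArg (fun p => p.1.2) h))
    · rintro ⟨⟨u, w⟩, h⟩
      by_cases hw : w = []
      · subst hw
        exact ⟨Sum.inl u, rfl⟩
      · obtain ⟨x, rfl⟩ := surj u w hw h
        exact ⟨Sum.inr x, Subtype.ext (Prod.ext (hv u _ hw h x rfl) rfl)⟩

/-- The letters of `D'` are the nonempty paths of one color in the letters of `D`, and adjacent
letters of a path in `D'` have different colors. -/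
structure Grouping (D : PathData V α) (D' : PathData V β) (c : α → κ) (c' : β → κ)
    (f : β → List α) : Prop where
  O_of_ne : ∀ x y, c x ≠ c y → D.O x y
  O_iff : ∀ b b', D'.P b → D'.P b' → (D'.O b b' ↔ c' b ≠ c' b')
  good : ∀ b, D'.P b → f b ≠ [] ∧ (∀ x ∈ f b, D.P x ∧ c x = c' b) ∧ (f b).IsChain D.R ∧
    D'.s b = (f b).head?.bind D.s ∧ D'.t b = (f b).getLast?.bind D.t
  inj : ∀ b b', D'.P b → D'.P b' → f b = f b' → b = b'
  surj : ∀ (i : κ) w, w ≠ [] → (∀ x ∈ w, D.P x ∧ c x = i) → w.IsChain D.R → ∃ b, D'.P b ∧ f b = w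

namespace Grouping

variable {c : α → κ} {c' : β → κ} {f : β → List α} (G : Grouping D D' c c' f)
include G

theorem head {b : β} {l : List β} (hb : D'.P b) :
    ∃ x, ((b :: l).flatMap f).head? = some x ∧ x ∈ f b ∧ D'.s b = D.s x ∧ c x = c' b := by
  obtain ⟨h1, h2, -, h3, -⟩ := G.good b hb
  obtain ⟨x, w, hx⟩ := List.exists_cons_of_ne_nil h1
  exact ⟨x, by simp [hx], by simp [hx], by simp [h3, hx], (h2 x (by simp [hx])).2⟩

theorem isChain {l : List β} (hP : ∀ b ∈ l, D'.P b) (hl : l.IsChain D'.R) :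
    (l.flatMap f).IsChain D.R := by
  induction l with
  | nil => exact List.isChain_nil
  | cons b l ih =>
    rw [List.forall_mem_cons] at hP
    rw [List.isChain_cons] at hl
    rw [List.flatMap_cons, List.isChain_append]
    obtain ⟨-, h2, h3, -, h4⟩ := G.good b hP.1
    refine ⟨h3, ih hP.2 hl.2, fun x hx y hy => ?_⟩
    obtain _ | ⟨b', l⟩ := l
    · simp at hy
    rw [List.forall_mem_cons] at hP
    have hb := hl.1 b' (by simp)
    obtain ⟨y', hy', -, h5, h6⟩ := G.head (l := l) hP.2.1
    obtain rfl : y' = y := Option.some_injective _ (hy'.symm.trans hy)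
    rw [Option.mem_def.1 hx] at h4
    refine ⟨h4.symm.trans (hb.1.trans h5), G.O_of_ne _ _ ?_⟩
    rw [(h2 x (List.mem_of_getLast? hx)).2, h6]
    exact (G.O_iff _ _ hP.1 hP.2.1).1 hb.2

theorem isPath {p : V × List β} (h : D'.IsPath p) : D.IsPath (p.1, p.2.flatMap f) := by
  refine ⟨fun x hx => ?_, fun x hx => ?_, G.isChain h.1 h.2.2⟩
  · obtain ⟨b, hb, hx⟩ := List.mem_flatMap.1 hx
    exact ((G.good b (h.1 b hb)).2.1 x hx).1
  · obtain ⟨v, _ | ⟨b, l⟩⟩ := p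
    · simp at hx
    · obtain ⟨hb, hs, -⟩ := isPath_cons.1 h
      obtain ⟨y, hy, -, h5, -⟩ := G.head (l := l) hb
      obtain rfl : y = x := Option.some_injective _ (hy.symm.trans hx)
      exact h5.symm.trans hs

open Classical in
theorem takeWhile {b : β} {l : List β} (hP : ∀ b' ∈ b :: l, D'.P b') (hl : (b :: l).IsChain D'.R) :
    ((b :: l).flatMap f).takeWhile (fun x => c x = c' b) = f b := by
  rw [List.forall_mem_cons] at hP
  rw [List.flatMap_cons, List.takeWhile_append_of_pos fun x hx => by
    simpa using ((G.good b hP.1).2.1 x hx).2]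
  suffices (l.flatMap f).takeWhile (fun x => c x = c' b) = [] by rw [this, List.append_nil]
  obtain _ | ⟨b', l⟩ := l
  · rfl
  · rw [List.forall_mem_cons] at hP
    obtain ⟨y, hy, -, -, h6⟩ := G.head (l := l) hP.2.1
    have hne := (G.O_iff _ _ hP.1 hP.2.1).1 (List.isChain_cons_cons.1 hl).1.2
    obtain ⟨w, hw⟩ := List.head?_eq_some_iff.1 hy
    rw [hw, List.takeWhile_cons_of_neg]
    simpa [h6] using hne.symm

theorem flatMap_injective {l l' : List β} (hP : ∀ b ∈ l, D'.P b) (hl : l.IsChain D'.R)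
    (hP' : ∀ b ∈ l', D'.P b) (hl' : l'.IsChain D'.R) (h : l.flatMap f = l'.flatMap f) : l = l' := by
  classical
  induction l generalizing l' with
  | nil =>
    obtain _ | ⟨b', l'⟩ := l'
    · rfl
    · obtain ⟨y, hy, -⟩ := G.head (l := l') (hP' b' (by simp))
      rw [← h] at hy
      simp at hy
  | cons b l ih =>
    obtain _ | ⟨b', l'⟩ := l'
    · obtain ⟨y, hy, -⟩ := G.head (l := l) (hP b (by simp))
      rw [h] at hy
      simp at hy
    · obtain ⟨y, hy, -, -, h6⟩ := G.head (l := l) (hP b (by simp))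
      obtain ⟨y', hy', -, -, h6'⟩ := G.head (l := l') (hP' b' (by simp))
      obtain rfl : y = y' := Option.some_injective _ (hy.symm.trans (h ▸ hy'))
      have h1 := G.takeWhile hP hl
      have h2 := G.takeWhile hP' hl'
      have hf : f b = f b' := by rw [← h1, ← h2, h, ← h6, ← h6']
      obtain rfl := G.inj b b' (hP b (by simp)) (hP' b' (by simp)) hf
      rw [List.flatMap_cons, List.flatMap_cons, List.append_cancel_left_eq] at h
      rw [ih (List.forall_mem_cons.1 hP).2 hl.tail (List.forall_mem_cons.1 hP').2 hl'.tail h]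

theorem exists_flatMap (w : List α) (hP : ∀ x ∈ w, D.P x) (hw : w.IsChain D.R) :
    ∃ l : List β, (∀ b ∈ l, D'.P b) ∧ l.IsChain D'.R ∧ l.flatMap f = w := by
  classical
  induction hn : w.length using Nat.strong_induction_on generalizing w with
  | _ n ih =>
  obtain _ | ⟨x, w⟩ := w
  · exact ⟨[], by simp, List.isChain_nil, rfl⟩
  set p : α → Bool := fun y => c y = c x with hp
  have happ := List.takeWhile_append_dropWhile (p := p) (l := x :: w)
  have hx : List.takeWhile p (x :: w) = x :: List.takeWhile p w :=
    List.takeWhile_cons_of_pos (by simp [hp])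
  have hc := hw
  rw [← happ, List.isChain_append] at hc
  obtain ⟨b, hb, hfb⟩ := G.surj (c x) (List.takeWhile p (x :: w)) (by rw [hx]; simp)
    (fun y hy => ⟨hP y ((List.takeWhile_prefix p).subset hy), by
      simpa [hp] using List.mem_takeWhile_imp hy⟩) hc.1
  have hlen : (List.dropWhile p (x :: w)).length < n := by
    have := congrArg List.length happ
    rw [List.length_append, hx, List.length_cons, hn] at this
    omega
  obtain ⟨l, h1, h2, h3⟩ := ih _ hlen _ (fun y hy => hP y ((List.dropWhile_suffix p).subset hy))
    hc.2.1 rfl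
  refine ⟨b :: l, List.forall_mem_cons.2 ⟨hb, h1⟩, List.isChain_cons.2 ⟨fun b' hb' => ?_, h2⟩, ?_⟩
  · obtain _ | ⟨b'', l⟩ := l
    · simp at hb'
    obtain rfl : b'' = b' := by simpa using hb'
    have hb'' := (List.forall_mem_cons.1 h1).1
    obtain ⟨y, hy, -, h5, h6⟩ := G.head (l := l) hb''
    rw [h3] at hy
    obtain ⟨hne, hall, -, -, ht⟩ := G.good b hb
    obtain ⟨u, hu⟩ := List.getLast?_isSome.2 hne |> Option.isSome_iff_exists.1
    have hR := hc.2.2 u (by rw [← hfb]; exact hu) y hy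
    rw [hu] at ht
    refine ⟨ht.trans (hR.1.trans h5.symm), (G.O_iff _ _ hb hb'').2 ?_⟩
    have h7 := List.head?_dropWhile_not p (x :: w)
    rw [hy] at h7
    have h8 : c x = c' b := (hall x (by rw [hfb, hx]; simp)).2
    rw [← h8, ← h6]
    exact fun h9 => by simp [hp, h9] at h7
  · rw [List.flatMap_cons, hfb, h3, happ]

/-- Decomposing a path into maximal subpaths of one color. -/
def equiv : {p // D'.IsPath p} ≃ {p // D.IsPath p} :=
  Equiv.ofBijective (fun p => ⟨(p.1.1, p.1.2.flatMap f), G.isPath p.2⟩) <| by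
    constructor
    · rintro ⟨⟨v, l⟩, h⟩ ⟨⟨v', l'⟩, h'⟩ heq
      have h1 : v = v' := congrArg (fun p => p.1.1) heq
      have h2 : l = l' := G.flatMap_injective h.1 h.2.2 h'.1 h'.2.2 (congrArg (fun p => p.1.2) heq)
      exact Subtype.ext (Prod.ext h1 h2)
    · rintro ⟨⟨v, w⟩, h⟩
      obtain ⟨l, h1, h2, rfl⟩ := G.exists_flatMap w h.1 h.2.2
      refine ⟨⟨(v, l), h1, fun b hb => ?_, h2⟩, rfl⟩
      obtain _ | ⟨b', l⟩ := l
      · simp at hb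
      obtain rfl : b' = b := by simpa using hb
      obtain ⟨y, hy, -, h5, -⟩ := G.head (l := l) (h1 b' (by simp))
      exact h5.trans (h.2.1 y hy)

end Grouping

end PathData

/-! ### Alternating words and free products -/

open Classical in
/-- The idempotent of a vertex in an algebra over the ring of functions on the vertices. -/
def vertexIdem {k V A : Type*} [Field k] [Ring A] [Algebra k A] (f : (V → k) →ₐ[k] A) (i : V) : A :=
  f (Pi.single i 1)

section Idem

variable {k V A : Type*} [Field k] [Fintype V] [Ring A] [Algebra k A] (f : (V → k) →ₐ[k] A)

theorem vertexIdem_idem : CompleteOrthogonalIdempotents (vertexIdem f) := by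
  classical
  convert (CompleteOrthogonalIdempotents.single (fun _ : V => k)).map f.toRingHom using 1
  ext i
  simp only [vertexIdem, Function.comp_apply]
  congr!

theorem map_eq_sum_vertexIdem (s : V → k) : f s = ∑ i, s i • vertexIdem f i := by
  classical
  have : s = ∑ i, s i • (Pi.single i 1 : V → k) := by
    ext j
    simp [Finset.sum_apply, Pi.single_apply]
  conv_lhs => rw [this]
  rw [map_sum]
  refine Finset.sum_congr rfl fun i _ => ?_
  rw [map_smul]
  simp only [vertexIdem]

theorem base_mul_vertexIdem (s : V → k) (i : V) :
    f s * vertexIdem f i = s i • vertexIdem f i := by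
  rw [map_eq_sum_vertexIdem f s, Finset.sum_mul, Finset.sum_eq_single i]
  · rw [smul_mul_assoc, (vertexIdem_idem f).idem]
  · intro j _ hj
    rw [smul_mul_assoc, (vertexIdem_idem f).ortho hj, smul_zero]
  · simp

end Idem

namespace PathData

variable {k V L κ : Type*} [Field k] [Fintype V] (D : PathData V L)

variable (k) in
/-- The vector space with basis the paths. -/
abbrev PathSpace := {p // D.IsPath p} →₀ k

open Classical in
variable (k) in
/-- The basis vector of a path in the vector space with basis the paths; it is `0` for sequences
which are not paths. -/
def vec (p : V × List L) : D.PathSpace k := if h : D.IsPath p then Finsupp.single ⟨p, h⟩ 1 else 0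

variable {D}

theorem vec_of {p : V × List L} (h : D.IsPath p) : D.vec k p = Finsupp.basisSingleOne ⟨p, h⟩ := by
  rw [vec, dif_pos h, Finsupp.coe_basisSingleOne]

theorem vec_of_not {p : V × List L} (h : ¬ D.IsPath p) : D.vec k p = 0 := dif_neg h

section

variable {N : Type*} [AddCommGroup N] [Module k N]

theorem hom_ext_vec {f g : D.PathSpace k →ₗ[k] N}
    (h : ∀ p, D.IsPath p → f (D.vec k p) = g (D.vec k p)) : f = g := by
  refine (Finsupp.basisSingleOne (R := k)).ext ?_
  rintro ⟨p, hp⟩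
  rw [← vec_of hp, h p hp]

variable (D k) in
/-- The linear map with given values on paths. -/
def pathLin (f : V × List L → N) : D.PathSpace k →ₗ[k] N :=
  (Finsupp.basisSingleOne (R := k)).constr k fun p => f p.1

theorem pathLin_vec (f : V × List L → N) {p : V × List L} (h : D.IsPath p) :
    D.pathLin k f (D.vec k p) = f p := by
  rw [vec_of h, pathLin, Basis.constr_basis]

end

variable (D) in
/-- The letters have colors, they have a start and an end, and adjacent letters of a path are of
different colors. -/
structure IsAlternating (col : L → κ) : Prop where
  O_iff : ∀ x y, D.O x y ↔ col x ≠ col y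
  s_some : ∀ x, D.P x → ∃ v, D.s x = some v
  t_some : ∀ x, D.P x → ∃ v, D.t x = some v

variable {A : Type*} [Ring A] [Algebra k A]

variable (D) in
/-- A basis of an algebra over the ring of functions on the vertices, formed by the idempotents of
the vertices and by homogeneous elements indexed by the letters of a color. -/
structure BasedAlg (col : L → κ) (c : κ) (f : (V → k) →ₐ[k] A) where
  basis : Basis (V ⊕ {x // D.P x ∧ col x = c}) k A
  inl : ∀ i, basis (Sum.inl i) = vertexIdem f i
  left : ∀ x v, D.s x.1 = some v → vertexIdem f v * basis (Sum.inr x) = basis (Sum.inr x)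
  right : ∀ x v, D.t x.1 = some v → basis (Sum.inr x) * vertexIdem f v = basis (Sum.inr x)

variable (D) in
/-- Letters have values in an algebra, compatible with their starts and ends. -/
structure Located {C : Type*} [Ring C] [Algebra k C] (f : (V → k) →ₐ[k] C) (val : L → C) : Prop where
  left : ∀ x v, D.P x → D.s x = some v → vertexIdem f v * val x = val x
  right : ∀ x v, D.P x → D.t x = some v → val x * vertexIdem f v = val x

/-- Does the word start with a letter of color `c`? -/
def Starts (col : L → κ) (c : κ) (l : List L) : Prop := ∃ x ∈ l.head?, col x = c

variable {col : L → κ} {c : κ} {f : (V → k) →ₐ[k] A}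

theorem Starts.exists_cons {p : V × List L} (hp : D.IsPath p) (h : Starts col c p.2) :
    ∃ v x l, p = (v, x :: l) ∧ D.P x ∧ col x = c := by
  obtain ⟨v, _ | ⟨x, l⟩⟩ := p
  · obtain ⟨x, hx, -⟩ := h
    simp at hx
  obtain ⟨y, hy, hc⟩ := h
  obtain rfl : x = y := by simpa using hy
  exact ⟨v, x, l, rfl, hp.1 x (by simp), hc⟩

theorem IsAlternating.isPath_cons (hD : D.IsAlternating col) {q : V × List L} (hq : D.IsPath q)
    (hs : ¬ Starts col c q.2) {x : L} (hx : D.P x) (hc : col x = c) {v : V} (hv : D.s x = some v)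
    (hu : D.t x = some q.1) : D.IsPath (v, x :: q.2) := by
  refine PathData.isPath_cons.2 ⟨hx, hv, fun y hy => ⟨?_, ?_⟩, hq.1, hq.2.2⟩
  · rw [hu, hq.2.1 y hy]
  · rw [hD.O_iff]
    exact fun hc' => hs ⟨y, hy, hc'.symm.trans hc⟩

namespace BasedAlg

variable (α : D.BasedAlg col c f)

open Classical in
/-- The linear map which multiplies basis elements of `A` by a fixed word. -/
def join (q : V × List L) : A →ₗ[k] D.PathSpace k :=
  α.basis.constr k <| Sum.elim (fun i => if i = q.1 then D.vec k q else 0) fun x =>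
    if D.t x.1 = some q.1 then D.vec k ((D.s x.1).getD q.1, x.1 :: q.2) else 0

open Classical in
theorem join_inl (q : V × List L) (i : V) :
    α.join q (vertexIdem f i) = if i = q.1 then D.vec k q else 0 := by
  rw [← α.inl, join, Basis.constr_basis]
  rfl

open Classical in
theorem join_inr (q : V × List L) (x : {x // D.P x ∧ col x = c}) :
    α.join q (α.basis (Sum.inr x)) =
      if D.t x.1 = some q.1 then D.vec k ((D.s x.1).getD q.1, x.1 :: q.2) else 0 := by
  rw [join, Basis.constr_basis]
  rfl

theorem join_one (q : V × List L) : α.join q 1 = D.vec k q := by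
  classical
  rw [← (vertexIdem_idem f).complete, map_sum, Finset.sum_eq_single q.1]
  · rw [join_inl, if_pos rfl]
  · intro i _ hi
    rw [join_inl, if_neg hi]
  · simp

theorem inr_mul_of_ne {x : {x // D.P x ∧ col x = c}} {u v : V} (hx : D.t x.1 = some u) (h : u ≠ v) :
    α.basis (Sum.inr x) * vertexIdem f v = 0 := by
  rw [← α.right x u hx, mul_assoc, (vertexIdem_idem f).ortho h, mul_zero]

open Classical in
theorem join_mul (hD : D.IsAlternating col) (q : V × List L) (i : V) (a : A) :
    α.join q (a * vertexIdem f i) = if i = q.1 then α.join q a else 0 := by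
  have : α.join q ∘ₗ LinearMap.mulRight k (vertexIdem f i) = if i = q.1 then α.join q else 0 := by
    apply α.basis.ext
    rintro (j | x)
    · rw [LinearMap.comp_apply, LinearMap.mulRight_apply, α.inl]
      by_cases hj : j = i
      · subst hj
        rw [(vertexIdem_idem f).idem, join_inl]
        split_ifs with h
        · rw [join_inl, if_pos h]
        · rfl
      · rw [(vertexIdem_idem f).ortho hj, map_zero]
        split_ifs with h
        · rw [join_inl, if_neg (h ▸ hj)]
        · rfl
    · obtain ⟨u, hu⟩ := hD.t_some x.1 x.2.1
      rw [LinearMap.comp_apply, LinearMap.mulRight_apply]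
      by_cases h : u = i
      · rw [α.right x i (h ▸ hu), join_inr]
        split_ifs with h1 h2 h2
        · rw [join_inr, if_pos h1]
        · exact absurd (Option.some_injective _ ((h ▸ hu).symm.trans h1)) h2
        · rw [join_inr, if_neg h1]
        · rfl
      · rw [α.inr_mul_of_ne hu h, map_zero]
        split_ifs with h1
        · rw [join_inr, if_neg]
          exact fun h2 => h (Option.some_injective _ (hu.symm.trans (h1 ▸ h2)))
        · rfl
  have := LinearMap.congr_fun this a
  rw [LinearMap.comp_apply, LinearMap.mulRight_apply] at this
  rw [this]
  split_ifs <;> rfl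

open Classical in
/-- A word without its first letter, if that has color `c`. -/
def stem (D : PathData V L) (col : L → κ) (c : κ) : V × List L → V × List L
  | (v, []) => (v, [])
  | (v, x :: l) => if D.P x ∧ col x = c then ((D.t x).getD v, l) else (v, x :: l)

open Classical in
/-- The first letter of a word, as an element of `A`, if that has color `c`. -/
def lead : V × List L → A
  | (_, []) => 1
  | (_, x :: _) => if h : D.P x ∧ col x = c then α.basis (Sum.inr ⟨x, h⟩) else 1

theorem stem_spec (hD : D.IsAlternating col) {p : V × List L} (h : D.IsPath p) :
    D.IsPath (stem D col c p) ∧ ¬ Starts col c (stem D col c p).2 := by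
  obtain ⟨v, _ | ⟨x, l⟩⟩ := p
  · exact ⟨h, by rintro ⟨x, hx, -⟩; simp [stem] at hx⟩
  · rw [stem]
    split_ifs with hx
    · obtain ⟨u, hu⟩ := hD.t_some x hx.1
      rw [hu, Option.getD_some]
      refine ⟨h.tail hu, ?_⟩
      rintro ⟨y, hy, hc⟩
      exact (hD.O_iff _ _).1 ((isPath_cons.1 h).2.2.1 y hy).2 (hx.2.trans hc.symm)
    · refine ⟨h, ?_⟩
      rintro ⟨y, hy, hc⟩
      obtain rfl : x = y := by simpa using hy
      exact hx ⟨h.1 x (by simp), hc⟩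

theorem stem_of_not {p : V × List L} (h : ¬ Starts col c p.2) : stem D col c p = p := by
  obtain ⟨v, _ | ⟨x, l⟩⟩ := p
  · rfl
  · rw [stem, if_neg]
    exact fun hx => h ⟨x, by simp, hx.2⟩

theorem lead_of_not {p : V × List L} (h : ¬ Starts col c p.2) : α.lead p = 1 := by
  obtain ⟨v, _ | ⟨x, l⟩⟩ := p
  · rfl
  · rw [lead, dif_neg]
    exact fun hx => h ⟨x, by simp, hx.2⟩

theorem join_stem (hD : D.IsAlternating col) {p : V × List L} (h : D.IsPath p) :
    α.join (stem D col c p) (α.lead p) = D.vec k p := by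
  classical
  by_cases hs : Starts col c p.2
  · obtain ⟨v, x, l, rfl, hx, hc⟩ := hs.exists_cons h
    obtain ⟨u, hu⟩ := hD.t_some x hx
    rw [stem, if_pos ⟨hx, hc⟩, lead, dif_pos ⟨hx, hc⟩, join_inr, if_pos (by rw [hu]; rfl),
      (isPath_cons.1 h).2.1]
    rfl
  · rw [stem_of_not hs, α.lead_of_not hs, join_one]

/-- The action of `A` on the space of words. -/
def actLin : A →ₗ[k] End k (D.PathSpace k) :=
  (D.pathLin k fun p => α.join (stem D col c p) ∘ₗ LinearMap.mulRight k (α.lead p)).flip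

theorem actLin_vec {p : V × List L} (h : D.IsPath p) (a : A) :
    α.actLin a (D.vec k p) = α.join (stem D col c p) (a * α.lead p) := by
  rw [actLin, LinearMap.flip_apply, pathLin_vec _ h]
  rfl

theorem actLin_join (hD : D.IsAlternating col) {q : V × List L} (hq : D.IsPath q)
    (hs : ¬ Starts col c q.2) (a b : A) : α.actLin a (α.join q b) = α.join q (a * b) := by
  classical
  have : α.actLin a ∘ₗ α.join q = α.join q ∘ₗ LinearMap.mulLeft k a := by
    apply α.basis.ext
    rintro (j | x)
    · rw [LinearMap.comp_apply, LinearMap.comp_apply, LinearMap.mulLeft_apply, α.inl, join_inl,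
        α.join_mul hD]
      split_ifs with h
      · rw [α.actLin_vec hq, stem_of_not hs, α.lead_of_not hs, mul_one]
      · exact map_zero _
    · obtain ⟨u, hu⟩ := hD.t_some x.1 x.2.1
      obtain ⟨v, hv⟩ := hD.s_some x.1 x.2.1
      rw [LinearMap.comp_apply, LinearMap.comp_apply, LinearMap.mulLeft_apply, join_inr,
        ← α.right x u hu, ← mul_assoc, α.join_mul hD, hu]
      by_cases h : u = q.1
      · rw [if_pos (congrArg some h), if_pos h, hv, Option.getD_some]
        have hp := hD.isPath_cons hq hs x.2.1 x.2.2 hv (hu.trans (congrArg some h))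
        rw [α.actLin_vec hp, stem, if_pos x.2, lead, dif_pos x.2, hu, Option.getD_some, h]
      · rw [if_neg fun h' => h (Option.some_injective _ h'), if_neg h, map_zero]
  exact LinearMap.congr_fun this b

/-- The action of `A` on the space of words, as a homomorphism of algebras. -/
def act (hD : D.IsAlternating col) : A →ₐ[k] End k (D.PathSpace k) := AlgHom.ofLinearMap α.actLin
    (hom_ext_vec fun p hp => by
      rw [α.actLin_vec hp, one_mul, α.join_stem hD hp]; rfl)
    (fun a b => hom_ext_vec fun p hp => by
      rw [End.mul_apply, α.actLin_vec hp, α.actLin_vec hp,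
        α.actLin_join hD (stem_spec hD hp).1 (stem_spec hD hp).2, mul_assoc])

theorem act_vec (hD : D.IsAlternating col) {p : V × List L} (h : D.IsPath p) (a : A) :
    α.act hD a (D.vec k p) = α.join (stem D col c p) (a * α.lead p) := α.actLin_vec h a

theorem act_base (hD : D.IsAlternating col) {p : V × List L} (h : D.IsPath p) (s : V → k) :
    α.act hD (f s) (D.vec k p) = s p.1 • D.vec k p := by
  rw [α.act_vec hD h]
  by_cases hs : Starts col c p.2
  · obtain ⟨v, x, l, rfl, hx⟩ := hs.exists_cons h
    have h1 := α.left ⟨x, hx⟩ v (isPath_cons.1 h).2.1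
    have h2 : f s * α.lead (v, x :: l) = s v • α.lead (v, x :: l) := by
      rw [lead, dif_pos hx, ← h1, ← mul_assoc, base_mul_vertexIdem, smul_mul_assoc]
    rw [h2, map_smul, α.join_stem hD h]
  · rw [stem_of_not hs, α.lead_of_not hs, mul_one, map_eq_sum_vertexIdem, map_sum,
      Finset.sum_eq_single p.1]
    · rw [map_smul, join_inl, if_pos rfl]
    · intro i _ hi
      rw [map_smul, join_inl, if_neg hi, smul_zero]
    · simp

variable {C : Type*} [Ring C] [Algebra k C] {ι : (V → k) →ₐ[k] C} {val : L → C}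

variable (D ι val) in
/-- The evaluation of words in an algebra. -/
def _root_.MPA.PathData.evalPath : D.PathSpace k →ₗ[k] C :=
  D.pathLin k fun p => vertexIdem ι p.1 * (p.2.map val).prod

theorem evalPath_join (hD : D.IsAlternating col) (hloc : D.Located ι val) {q : V × List L}
    (hq : D.IsPath q) (hs : ¬ Starts col c q.2) (γ : A →ₗ[k] C)
    (hi : ∀ i, γ (vertexIdem f i) = vertexIdem ι i)
    (hx : ∀ x, γ (α.basis (Sum.inr x)) = val x.1) (a : A) :
    D.evalPath ι val (α.join q a) = γ a * D.evalPath ι val (D.vec k q) := by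
  classical
  have hE := vertexIdem_idem ι
  have : D.evalPath ι val ∘ₗ α.join q = LinearMap.mulRight k (D.evalPath ι val (D.vec k q)) ∘ₗ γ := by
    apply α.basis.ext
    rintro (j | x)
    · rw [LinearMap.comp_apply, LinearMap.comp_apply, LinearMap.mulRight_apply, α.inl, join_inl, hi,
        evalPath, pathLin_vec _ hq, ← mul_assoc]
      split_ifs with h
      · rw [h, hE.idem, pathLin_vec _ hq]
      · rw [hE.ortho h, zero_mul, map_zero]
    · obtain ⟨u, hu⟩ := hD.t_some x.1 x.2.1
      obtain ⟨v, hv⟩ := hD.s_some x.1 x.2.1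
      rw [LinearMap.comp_apply, LinearMap.comp_apply, LinearMap.mulRight_apply, join_inr, hx,
        evalPath, pathLin_vec _ hq, hu, hv]
      by_cases h : u = q.1
      · rw [if_pos (congrArg some h), Option.getD_some]
        have hp := hD.isPath_cons hq hs x.2.1 x.2.2 hv (hu.trans (congrArg some h))
        rw [pathLin_vec _ hp, List.map_cons, List.prod_cons, ← mul_assoc, hloc.left _ _ x.2.1 hv,
          ← mul_assoc, hloc.right _ _ x.2.1 (h ▸ hu)]
      · rw [if_neg fun h' => h (Option.some_injective _ h'), map_zero,
          ← hloc.right _ _ x.2.1 hu, ← mul_assoc, mul_assoc (val _), hE.ortho h]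
        simp
  exact LinearMap.congr_fun this a

/-- Evaluation intertwines the action of `A` and left multiplication, if `A` maps to the algebra. -/
theorem evalPath_act (hD : D.IsAlternating col) (hloc : D.Located ι val) (γ : A →ₐ[k] C)
    (hi : ∀ i, γ (vertexIdem f i) = vertexIdem ι i)
    (hx : ∀ x, γ (α.basis (Sum.inr x)) = val x.1) (a : A) (w : D.PathSpace k) :
    D.evalPath ι val (α.act hD a w) = γ a * D.evalPath ι val w := by
  have : D.evalPath ι val ∘ₗ α.act hD a = LinearMap.mulLeft k (γ a) ∘ₗ D.evalPath ι val := by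
    apply hom_ext_vec
    intro p hp
    have h := stem_spec (c := c) hD hp
    have key := α.evalPath_join hD hloc h.1 h.2 γ.toLinearMap hi hx
    rw [LinearMap.comp_apply, LinearMap.comp_apply, LinearMap.mulLeft_apply, α.act_vec hD hp, key,
      ← α.join_stem hD hp, key, ← mul_assoc]
    congr 1
    exact map_mul γ _ _
  exact LinearMap.congr_fun this w

end BasedAlg

end PathData

section FreeProduct

variable {k V A B C : Type*} [Field k] [Ring A] [Algebra k A] [Ring B] [Algebra k B]
  [Ring C] [Algebra k C] (f : (V → k) →ₐ[k] A) (g : (V → k) →ₐ[k] B)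

theorem FreeProd.inl_base (s : V → k) : FreeProd.inl f g (f s) = FreeProd.inr f g (g s) :=
  RingQuot.mkAlgHom_rel k (AmalgRel.amalg s)

variable {f g}

/-- The universal property of the free product. -/
def FreeProd.lift (a : A →ₐ[k] C) (b : B →ₐ[k] C) (h : ∀ s, a (f s) = b (g s)) :
    FreeProd f g →ₐ[k] C :=
  RingQuot.liftAlgHom k ⟨FreeAlgebra.lift k (Sum.elim a b), by
    rintro _ _ (_ | _ | _ | _ | _ | _ | s) <;> simp [h]⟩

theorem FreeProd.lift_inl (a : A →ₐ[k] C) (b : B →ₐ[k] C) (h : ∀ s, a (f s) = b (g s)) (x : A) :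
    FreeProd.lift a b h (FreeProd.inl f g x) = a x := by
  change FreeProd.lift a b h (RingQuot.mkAlgHom k _ _) = _
  rw [lift, RingQuot.liftAlgHom_mkAlgHom_apply]
  simp

theorem FreeProd.lift_inr (a : A →ₐ[k] C) (b : B →ₐ[k] C) (h : ∀ s, a (f s) = b (g s)) (x : B) :
    FreeProd.lift a b h (FreeProd.inr f g x) = b x := by
  change FreeProd.lift a b h (RingQuot.mkAlgHom k _ _) = _
  rw [lift, RingQuot.liftAlgHom_mkAlgHom_apply]
  simp

theorem FreeProd.eq_top {S : Subalgebra k (FreeProd f g)} (hl : ∀ a, FreeProd.inl f g a ∈ S)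
    (hr : ∀ b, FreeProd.inr f g b ∈ S) : S = ⊤ := by
  rw [eq_top_iff]
  rintro x -
  obtain ⟨y, rfl⟩ := RingQuot.mkAlgHom_surjective k (AmalgRel f g) x
  have : (⊤ : Subalgebra k (FreeAlgebra k (A ⊕ B))) ≤
      S.comap (RingQuot.mkAlgHom k (AmalgRel f g)) := by
    rw [← FreeAlgebra.adjoin_range_ι, Algebra.adjoin_le_iff]
    rintro _ ⟨x | x, rfl⟩
    · exact hl x
    · exact hr x
  exact this (Algebra.mem_top (x := y))

variable (f g) in
/-- The structure map of the free product. -/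
def FreeProd.base : (V → k) →ₐ[k] FreeProd f g := (FreeProd.inl f g).comp f

theorem FreeProd.inl_vertexIdem (i : V) :
    FreeProd.inl f g (vertexIdem f i) = vertexIdem (FreeProd.base f g) i := rfl

theorem FreeProd.inr_vertexIdem (i : V) :
    FreeProd.inr f g (vertexIdem g i) = vertexIdem (FreeProd.base f g) i :=
  (FreeProd.inl_base f g _).symm

open PathData

variable {L κ : Type*} [Fintype V] {D : PathData V L} {col : L → κ} {c d : κ}

/-- The alternating words form a basis of the free product. -/
theorem freeProd_bijective (hD : D.IsAlternating col) (α : D.BasedAlg col c f)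
    (β : D.BasedAlg col d g) (hcd : ∀ x, D.P x → col x = c ∨ col x = d) {val : L → FreeProd f g}
    (hl : ∀ x, FreeProd.inl f g (α.basis (Sum.inr x)) = val x.1)
    (hr : ∀ x, FreeProd.inr f g (β.basis (Sum.inr x)) = val x.1) :
    D.Located (FreeProd.base f g) val ∧
      Function.Bijective (D.evalPath (FreeProd.base f g) val) := by
  classical
  have hloc : D.Located (FreeProd.base f g) val := by
    constructor
    all_goals
      intro x v hx hv
      rcases hcd x hx with h | h
    · rw [← hl ⟨x, hx, h⟩, ← FreeProd.inl_vertexIdem, ← map_mul, α.left _ v hv]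
    · rw [← hr ⟨x, hx, h⟩, ← FreeProd.inr_vertexIdem, ← map_mul, β.left _ v hv]
    · rw [← hl ⟨x, hx, h⟩, ← FreeProd.inl_vertexIdem, ← map_mul, α.right _ v hv]
    · rw [← hr ⟨x, hx, h⟩, ← FreeProd.inr_vertexIdem, ← map_mul, β.right _ v hv]
  refine ⟨hloc, ?_⟩
  have hact : ∀ s, α.act hD (f s) = β.act hD (g s) := fun s =>
    hom_ext_vec fun p hp => (α.act_base hD hp s).trans (β.act_base hD hp s).symm
  let σ : FreeProd f g →ₐ[k] End k (D.PathSpace k) :=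
    FreeProd.lift (C := End k (D.PathSpace k)) (α.act hD) (β.act hD) hact
  set u : D.PathSpace k := ∑ v, D.vec k (v, []) with hu
  have hone : D.evalPath (FreeProd.base f g) val u = 1 := by
    rw [hu, map_sum, ← (vertexIdem_idem (FreeProd.base f g)).complete]
    refine Finset.sum_congr rfl fun v _ => ?_
    rw [evalPath, pathLin_vec _ (isPath_nil v), List.map_nil, List.prod_nil, mul_one]
  have hσe : ∀ v p, D.IsPath p → σ (vertexIdem (FreeProd.base f g) v) (D.vec k p) =
      (Pi.single v 1 : V → k) p.1 • D.vec k p := fun v p hp => by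
    rw [← FreeProd.inl_vertexIdem]
    exact (LinearMap.congr_fun (FreeProd.lift_inl _ _ _ _) _).trans (by
      rw [vertexIdem, α.act_base hD hp])
  have hσx : ∀ v u' x l, D.IsPath (v, x :: l) → D.t x = some u' →
      σ (val x) (D.vec k (u', l)) = D.vec k (v, x :: l) := by
    intro v u' x l hp ht
    have hx := hp.1 x (by simp)
    have hs : ∀ e, col x = e → ¬ Starts col e l := by
      rintro e rfl ⟨y, hy, hc⟩
      exact (hD.O_iff _ _).1 ((isPath_cons.1 hp).2.2.1 y hy).2 hc.symm
    rcases hcd x hx with h | h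
    · rw [← hl ⟨x, hx, h⟩]
      refine (LinearMap.congr_fun (FreeProd.lift_inl _ _ _ _) _).trans ?_
      rw [α.act_vec hD (hp.tail ht), BasedAlg.stem_of_not (hs c h), α.lead_of_not (hs c h), mul_one,
        α.join_inr, if_pos ht, (isPath_cons.1 hp).2.1, Option.getD_some]
    · rw [← hr ⟨x, hx, h⟩]
      refine (LinearMap.congr_fun (FreeProd.lift_inr _ _ _ _) _).trans ?_
      rw [β.act_vec hD (hp.tail ht), BasedAlg.stem_of_not (hs d h), β.lead_of_not (hs d h), mul_one,
        β.join_inr, if_pos ht, (isPath_cons.1 hp).2.1, Option.getD_some]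
  have hinj : ∀ l v, D.IsPath (v, l) →
      σ (vertexIdem (FreeProd.base f g) v * (l.map val).prod) u = D.vec k (v, l) := by
    intro l
    induction l with
    | nil =>
      intro v _
      rw [List.map_nil, List.prod_nil, mul_one, hu, map_sum, Finset.sum_eq_single v]
      · rw [hσe _ _ (isPath_nil v), Pi.single_eq_same, one_smul]
      · intro i _ hi
        rw [hσe _ _ (isPath_nil i), Pi.single_eq_of_ne hi, zero_smul]
      · simp
    | cons x l ih =>
      intro v hp
      have hx := hp.1 x (by simp)
      obtain ⟨u', ht⟩ := hD.t_some x hx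
      rw [List.map_cons, List.prod_cons, ← mul_assoc, hloc.left x v hx (isPath_cons.1 hp).2.1,
        ← hloc.right x u' hx ht, mul_assoc, map_mul, End.mul_apply, ih u' (hp.tail ht),
        hσx v u' x l hp ht]
  constructor
  · refine Function.LeftInverse.injective (g := fun y => σ y u) fun x => ?_
    have : (LinearMap.applyₗ u ∘ₗ σ.toLinearMap) ∘ₗ D.evalPath (FreeProd.base f g) val =
        LinearMap.id := by
      apply hom_ext_vec
      rintro ⟨v, l⟩ hp
      rw [LinearMap.comp_apply, evalPath, pathLin_vec _ hp]
      exact hinj l v hp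
    exact LinearMap.congr_fun this x
  · intro y
    let S : Subalgebra k (FreeProd f g) :=
      { carrier := {y | ∀ w, D.evalPath (FreeProd.base f g) val (σ y w) =
          y * D.evalPath (FreeProd.base f g) val w}
        mul_mem' := fun {a b} ha hb w => by
          rw [map_mul, End.mul_apply, ha, hb, mul_assoc]
        add_mem' := fun {a b} ha hb w => by
          rw [map_add, LinearMap.add_apply, map_add, ha, hb, add_mul]
        algebraMap_mem' := fun r w => by
          rw [Algebra.algebraMap_eq_smul_one, map_smul, map_one, LinearMap.smul_apply, map_smul,
            smul_one_mul]
          rfl }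
    have hS : S = ⊤ := by
      apply FreeProd.eq_top
      · intro a w
        refine (congrArg _ (LinearMap.congr_fun (FreeProd.lift_inl _ _ _ a) w)).trans ?_
        exact α.evalPath_act hD hloc (FreeProd.inl f g) FreeProd.inl_vertexIdem hl a w
      · intro b w
        refine (congrArg _ (LinearMap.congr_fun (FreeProd.lift_inr _ _ _ b) w)).trans ?_
        exact β.evalPath_act hD hloc (FreeProd.inr f g) FreeProd.inr_vertexIdem hr b w
    have hy : y ∈ S := hS ▸ Algebra.mem_top
    exact ⟨σ y u, (hy u).trans (by rw [hone, mul_one])⟩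

end FreeProduct

namespace PathData

/-! ### Linear maps from a free product -/

variable {k V L κ A B C C' : Type*} [Field k] [Fintype V] [Ring A] [Algebra k A]
  [Ring B] [Algebra k B] [Ring C] [Algebra k C] [Ring C'] [Algebra k C'] {D : PathData V L}
  {f : (V → k) →ₐ[k] A} {g : (V → k) →ₐ[k] B} {ι : (V → k) →ₐ[k] C} {ι' : (V → k) →ₐ[k] C'}
  {val : L → C} {val' : L → C'} {col : L → κ} {c d : κ}

variable (D) in
/-- The vertex at which a path ends. -/
def pathEnd (p : V × List L) : V := (p.2.getLast?.bind D.t).getD p.1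

theorem vertexIdem_mul_base (ι : (V → k) →ₐ[k] C) (s : V → k) (i : V) :
    vertexIdem ι i * ι s = s i • vertexIdem ι i := by
  rw [← base_mul_vertexIdem, vertexIdem, ← map_mul, ← map_mul, mul_comm]

theorem evalPath_vec {p : V × List L} (hp : D.IsPath p) :
    D.evalPath ι val (D.vec k p) = vertexIdem ι p.1 * (p.2.map val).prod := pathLin_vec _ hp

theorem evalPath_sum : D.evalPath ι val (∑ v, D.vec k (v, [])) = 1 := by
  rw [map_sum, ← (vertexIdem_idem ι).complete]
  refine Finset.sum_congr rfl fun v _ => ?_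
  rw [evalPath_vec (isPath_nil v), List.map_nil, List.prod_nil, mul_one]

theorem base_mul_evalPath (s : V → k) {p : V × List L} (hp : D.IsPath p) :
    ι s * D.evalPath ι val (D.vec k p) = s p.1 • D.evalPath ι val (D.vec k p) := by
  rw [evalPath_vec hp, ← mul_assoc, base_mul_vertexIdem, smul_mul_assoc]

theorem evalPath_mul_base (hD : D.IsAlternating col) (h : D.Located ι val) (s : V → k)
    {p : V × List L} (hp : D.IsPath p) : D.evalPath ι val (D.vec k p) * ι s =
      s (D.pathEnd p) • D.evalPath ι val (D.vec k p) := by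
  obtain ⟨v, l⟩ := p
  rw [evalPath_vec hp]
  obtain rfl | ⟨l, x, rfl⟩ := l.eq_nil_or_concat
  · simp [pathEnd, vertexIdem_mul_base]
  · have hx := hp.1 x (by simp)
    obtain ⟨u, hu⟩ := hD.t_some x hx
    have he : D.pathEnd (v, l ++ [x]) = u := by simp [pathEnd, hu]
    rw [List.concat_eq_append, he, List.map_append, List.prod_append, List.map_singleton,
      List.prod_singleton, ← h.right x u hx hu]
    simp only [mul_assoc, vertexIdem_mul_base, mul_smul_comm]

/-- A linear map which replaces the values of letters by other values is a bimodule map. -/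
theorem bimodule_of_evalPath (hD : D.IsAlternating col) (h : D.Located ι val)
    (h' : D.Located ι' val') (hs : Function.Surjective (D.evalPath ι val)) {Ω : C →ₗ[k] C'}
    (hΩ : ∀ w, Ω (D.evalPath ι val w) = D.evalPath ι' val' w) (s : V → k) (z : C) :
    Ω (ι s * z) = ι' s * Ω z ∧ Ω (z * ι s) = Ω z * ι' s := by
  obtain ⟨w, rfl⟩ := hs z
  constructor
  · have : Ω ∘ₗ LinearMap.mulLeft k (ι s) ∘ₗ D.evalPath ι val =
        LinearMap.mulLeft k (ι' s) ∘ₗ Ω ∘ₗ D.evalPath ι val := hom_ext_vec fun p hp => by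
      simp only [LinearMap.comp_apply, LinearMap.mulLeft_apply]
      rw [base_mul_evalPath s hp, map_smul, hΩ, base_mul_evalPath s hp]
    exact LinearMap.congr_fun this w
  · have : Ω ∘ₗ LinearMap.mulRight k (ι s) ∘ₗ D.evalPath ι val =
        LinearMap.mulRight k (ι' s) ∘ₗ Ω ∘ₗ D.evalPath ι val := hom_ext_vec fun p hp => by
      simp only [LinearMap.comp_apply, LinearMap.mulRight_apply]
      rw [evalPath_mul_base hD h s hp, map_smul, hΩ, evalPath_mul_base hD h' s hp]
    exact LinearMap.congr_fun this w

variable (D k) in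
/-- The span of the words which do not start with a given color. -/
def notStart (col : L → κ) (c : κ) : Submodule k (D.PathSpace k) :=
  Submodule.span k {x | ∃ p, D.IsPath p ∧ ¬ Starts col c p.2 ∧ x = D.vec k p}

theorem sum_mem_notStart : ∑ v, D.vec k (v, []) ∈ D.notStart k col c :=
  Submodule.sum_mem _ fun v _ => Submodule.subset_span
    ⟨(v, []), isPath_nil v, by rintro ⟨x, hx, -⟩; simp at hx, rfl⟩

namespace BasedAlg

variable (α : D.BasedAlg col c f)

/-- The complement of the ring of functions on the vertices which is spanned by the letters. -/
def compl : Submodule k A := Submodule.span k (Set.range fun x => α.basis (Sum.inr x))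

theorem isCompl : IsCompl (LinearMap.range f.toLinearMap) α.compl := by
  have h1 : LinearMap.range f.toLinearMap = Submodule.span k (α.basis '' Set.range Sum.inl) := by
    apply le_antisymm
    · rintro _ ⟨s, rfl⟩
      change f s ∈ _
      rw [map_eq_sum_vertexIdem]
      exact Submodule.sum_mem _ fun i _ => Submodule.smul_mem _ _
        (Submodule.subset_span ⟨_, ⟨i, rfl⟩, α.inl i⟩)
    · rw [Submodule.span_le]
      rintro _ ⟨_, ⟨i, rfl⟩, rfl⟩
      rw [α.inl]
      exact ⟨_, rfl⟩
  have h2 : α.compl = Submodule.span k (α.basis '' Set.range Sum.inr) := by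
    rw [compl, ← Set.range_comp]
    rfl
  constructor
  · rw [h1, h2]
    exact α.basis.linearIndependent.disjoint_span_image
      (Set.isCompl_range_inl_range_inr.disjoint)
  · rw [codisjoint_iff, h1, h2, ← Submodule.span_union, ← Set.image_union,
      Set.range_inl_union_range_inr, Set.image_univ, α.basis.span_eq]

theorem mul_mem_compl (hD : D.IsAlternating col) (s : V → k) {m : A} (hm : m ∈ α.compl) :
    f s * m ∈ α.compl ∧ m * f s ∈ α.compl := by
  constructor
  · suffices α.compl ≤ α.compl.comap (LinearMap.mulLeft k (f s)) from this hm
    conv_lhs => rw [compl]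
    rw [Submodule.span_le]
    rintro _ ⟨x, rfl⟩
    obtain ⟨v, hv⟩ := hD.s_some x.1 x.2.1
    change f s * α.basis (Sum.inr x) ∈ α.compl
    rw [← α.left x v hv, ← mul_assoc, base_mul_vertexIdem, smul_mul_assoc, α.left x v hv]
    exact Submodule.smul_mem _ _ (Submodule.subset_span ⟨x, rfl⟩)
  · suffices α.compl ≤ α.compl.comap (LinearMap.mulRight k (f s)) from this hm
    conv_lhs => rw [compl]
    rw [Submodule.span_le]
    rintro _ ⟨x, rfl⟩
    obtain ⟨v, hv⟩ := hD.t_some x.1 x.2.1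
    change α.basis (Sum.inr x) * f s ∈ α.compl
    rw [← α.right x v hv, mul_assoc, vertexIdem_mul_base, mul_smul_comm, α.right x v hv]
    exact Submodule.smul_mem _ _ (Submodule.subset_span ⟨x, rfl⟩)

theorem evalPath_act_notStart (hD : D.IsAlternating col) (h : D.Located ι val) (γ : A →ₗ[k] C)
    (hi : ∀ i, γ (vertexIdem f i) = vertexIdem ι i)
    (hx : ∀ x, γ (α.basis (Sum.inr x)) = val x.1) (a : A) {w : D.PathSpace k}
    (hw : w ∈ D.notStart k col c) :
    D.evalPath ι val (α.act hD a w) = γ a * D.evalPath ι val w := by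
  suffices D.notStart k col c ≤ LinearMap.eqLocus (D.evalPath ι val ∘ₗ α.act hD a)
    (LinearMap.mulLeft k (γ a) ∘ₗ D.evalPath ι val) from this hw
  rw [notStart, Submodule.span_le]
  rintro _ ⟨p, hp, hs, rfl⟩
  change D.evalPath ι val (α.act hD a _) = γ a * _
  rw [α.act_vec hD hp, stem_of_not hs, α.lead_of_not hs, mul_one,
    α.evalPath_join hD h hp hs γ hi hx]

theorem join_mem_notStart (hcd : c ≠ d) {q : V × List L} {m : A} (hm : m ∈ α.compl) : α.join q m ∈ D.notStart k col d := by
  classical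
  suffices α.compl ≤ (D.notStart k col d).comap (α.join q) from this hm
  rw [compl, Submodule.span_le]
  rintro _ ⟨x, rfl⟩
  change α.join q _ ∈ D.notStart k col d
  rw [join_inr]
  split_ifs
  · by_cases hp : D.IsPath ((D.s x.1).getD q.1, x.1 :: q.2)
    · refine Submodule.subset_span ⟨_, hp, ?_, rfl⟩
      rintro ⟨y, hy, hc⟩
      obtain rfl : x.1 = y := by simpa using hy
      exact hcd (x.2.2.symm.trans hc)
    · rw [vec_of_not hp]
      exact Submodule.zero_mem _
  · exact Submodule.zero_mem _

theorem act_mem_notStart (hD : D.IsAlternating col) (hcd : c ≠ d) {T : Set A}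
    (hT : ∀ a ∈ T, a ∈ α.compl) (hmul : ∀ a ∈ T, ∀ b, a * b ∈ T) {a : A} (ha : a ∈ T)
    (w : D.PathSpace k) : α.act hD a w ∈ D.notStart k col d := by
  suffices (⊤ : Submodule k _) ≤ (D.notStart k col d).comap (α.act hD a) from this trivial
  rw [← (Finsupp.basisSingleOne (R := k)).span_eq, Submodule.span_le]
  rintro _ ⟨p, rfl⟩
  rw [← vec_of p.2]
  change α.act hD a _ ∈ D.notStart k col d
  rw [α.act_vec hD p.2]
  exact α.join_mem_notStart hcd (hT _ (hmul a ha _))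

theorem act_mem_notStart' (hD : D.IsAlternating col) (hcd : c ≠ d) {a : A} (ha : a ∈ α.compl)
    {w : D.PathSpace k} (hw : w ∈ D.notStart k col c) :
    α.act hD a w ∈ D.notStart k col d := by
  suffices D.notStart k col c ≤ (D.notStart k col d).comap (α.act hD a) from this hw
  conv_lhs => rw [notStart]
  rw [Submodule.span_le]
  rintro _ ⟨p, hp, hs, rfl⟩
  change α.act hD a _ ∈ D.notStart k col d
  rw [α.act_vec hD hp, stem_of_not hs, α.lead_of_not hs, mul_one]
  exact α.join_mem_notStart hcd ha

end BasedAlg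

section

variable (hD : D.IsAlternating col) (α : D.BasedAlg col c f)
    (β : D.BasedAlg col d g) (hcd : ∀ x, D.P x → col x = c ∨ col x = d) {valF : L → FreeProd f g}
    (hl : ∀ x, FreeProd.inl f g (α.basis (Sum.inr x)) = valF x.1)
    (hr : ∀ x, FreeProd.inr f g (β.basis (Sum.inr x)) = valF x.1)
    (hval : D.Located ι val) (hbij : Function.Bijective (D.evalPath ι val))

/-- The linear isomorphism from a free product to an algebra in which the alternating words form a
basis. -/
def freeEquiv : FreeProd f g ≃ₗ[k] C :=
  (LinearEquiv.ofBijective _ (freeProd_bijective hD α β hcd hl hr).2).symm.trans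
    (LinearEquiv.ofBijective _ hbij)

theorem freeEquiv_evalPath (w : D.PathSpace k) :
    freeEquiv hD α β hcd hl hr hbij (D.evalPath (FreeProd.base f g) valF w) = D.evalPath ι val w := by
  rw [freeEquiv, LinearEquiv.trans_apply]
  have : D.evalPath (FreeProd.base f g) valF w =
    LinearEquiv.ofBijective _ (freeProd_bijective hD α β hcd hl hr).2 w := rfl
  rw [this, LinearEquiv.symm_apply_apply]
  rfl

include hval in
theorem freeEquiv_bimodule (s : V → k) (z : FreeProd f g) :
    freeEquiv hD α β hcd hl hr hbij (FreeProd.inl f g (f s) * z) =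
        ι s * freeEquiv hD α β hcd hl hr hbij z ∧
      freeEquiv hD α β hcd hl hr hbij (z * FreeProd.inl f g (f s)) =
        freeEquiv hD α β hcd hl hr hbij z * ι s := by
  have h := freeProd_bijective hD α β hcd hl hr
  exact bimodule_of_evalPath hD h.1 hval h.2.surjective
    (Ω := (freeEquiv hD α β hcd hl hr hbij).toLinearMap)
    (freeEquiv_evalPath hD α β hcd hl hr hbij) s z

include hD α β hcd hl hr hval hbij in
theorem linearlyFreeProduct (hne : c ≠ d) : LinearlyFreeProduct f g ι := by
  have h := freeProd_bijective hD α β hcd hl hr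
  set Ψ := freeEquiv hD α β hcd hl hr hbij with hΨ
  have hΨe := freeEquiv_evalPath hD α β hcd hl hr hbij
  have hone : Ψ 1 = 1 := by
    rw [← evalPath_sum (D := D) (ι := FreeProd.base f g) (val := valF), hΨe, evalPath_sum]
  have hbi := freeEquiv_bimodule hD α β hcd hl hr hval hbij
  have hE : ∀ i, Ψ (vertexIdem (FreeProd.base f g) i) = vertexIdem ι i := fun i => by
    have := hΨe (D.vec k (i, []))
    rwa [evalPath_vec (isPath_nil i), evalPath_vec (isPath_nil i), List.map_nil, List.prod_nil,
      mul_one, List.map_nil, List.prod_nil, mul_one] at this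
  have hx : ∀ x, D.P x → Ψ (valF x) = val x := fun x hx => by
    obtain ⟨v, hv⟩ := hD.s_some x hx
    have hp : D.IsPath (v, [x]) := isPath_cons.2 ⟨hx, hv, by simp, by simp, List.isChain_nil⟩
    have := hΨe (D.vec k (v, [x]))
    rwa [evalPath_vec hp, evalPath_vec hp, List.map_singleton, List.prod_singleton,
      List.map_singleton, List.prod_singleton, h.1.left _ _ hx hv, hval.left _ _ hx hv] at this
  refine ⟨α.compl, β.compl, Ψ, α.isCompl, fun s m hm => α.mul_mem_compl hD s hm, β.isCompl,
    fun s m hm => β.mul_mem_compl hD s hm, hone, hbi, fun l hM hN hc => ?_⟩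
  suffices ∃ w, D.evalPath (FreeProd.base f g) valF w =
      (l.map (Sum.elim (FreeProd.inl f g) (FreeProd.inr f g))).prod ∧
      D.evalPath ι val w = (l.map (Sum.elim (fun a => Ψ (FreeProd.inl f g a))
          (fun b => Ψ (FreeProd.inr f g b)))).prod ∧
      ((∀ y ∈ l.head?, y.isLeft ≠ true) → w ∈ D.notStart k col c) ∧
      ((∀ y ∈ l.head?, y.isLeft ≠ false) → w ∈ D.notStart k col d) by
    obtain ⟨w, h1, h2, -⟩ := this
    rw [← h1, ← h2, hΨe]
  induction l with
  | nil =>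
    exact ⟨_, evalPath_sum, evalPath_sum, fun _ => sum_mem_notStart, fun _ => sum_mem_notStart⟩
  | cons y l ih =>
    rw [List.isChain_cons] at hc
    obtain ⟨w, h1, h2, h3, h4⟩ := ih (fun a ha => hM a (List.mem_cons_of_mem _ ha))
      (fun b hb => hN b (List.mem_cons_of_mem _ hb)) hc.2
    rcases y with a | b
    · have ha := hM a (by simp)
      have hw := h3 fun y hy => (hc.1 y hy).symm
      refine ⟨α.act hD a w, ?_, ?_, fun h => absurd rfl (h _ rfl), fun _ =>
        α.act_mem_notStart' hD hne ha hw⟩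
      · rw [α.evalPath_act hD h.1 (FreeProd.inl f g) FreeProd.inl_vertexIdem hl, h1]
        rfl
      · rw [α.evalPath_act_notStart hD hval (Ψ.toLinearMap ∘ₗ (FreeProd.inl f g).toLinearMap)
          (fun i => hE i) (fun x => (congrArg Ψ (hl x)).trans (hx x.1 x.2.1)) a hw, h2]
        rfl
    · have hb := hN b (by simp)
      have hw := h4 fun y hy => (hc.1 y hy).symm
      refine ⟨β.act hD b w, ?_, ?_, fun _ => β.act_mem_notStart' hD hne.symm hb hw,
        fun h => absurd rfl (h _ rfl)⟩
      · rw [β.evalPath_act hD h.1 (FreeProd.inr f g) FreeProd.inr_vertexIdem hr, h1]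
        rfl
      · rw [β.evalPath_act_notStart hD hval (Ψ.toLinearMap ∘ₗ (FreeProd.inr f g).toLinearMap)
          (fun i => (congrArg Ψ (FreeProd.inr_vertexIdem i)).trans (hE i))
          (fun x => (congrArg Ψ (hr x)).trans (hx x.1 x.2.1)) b hw, h2]
        rfl

/-- The linear isomorphism is multiplicative on products in which every second factor is in an
ideal `T` of `B` which avoids the ring of functions on the vertices. -/
theorem freeEquiv_prod (hne : c ≠ d) (γ : A →ₗ[k] C) (τ : B →ₐ[k] C)
    (hγi : ∀ i, γ (vertexIdem f i) = vertexIdem ι i)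
    (hγx : ∀ x, γ (α.basis (Sum.inr x)) = val x.1)
    (hτi : ∀ i, τ (vertexIdem g i) = vertexIdem ι i)
    (hτx : ∀ x, τ (β.basis (Sum.inr x)) = val x.1) {T : Set B} (hT : ∀ b ∈ T, b ∈ β.compl)
    (hmul : ∀ a ∈ T, ∀ b, a * b ∈ T) (hval : D.Located ι val) (a₀ : A) (l : List (B × A))
    (hlT : ∀ x ∈ l, x.1 ∈ T) :
    freeEquiv hD α β hcd hl hr hbij (FreeProd.inl f g a₀ *
      (l.map fun x => FreeProd.inr f g x.1 * FreeProd.inl f g x.2).prod) =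
      γ a₀ * (l.map fun x => τ x.1 * γ x.2).prod := by
  have h := freeProd_bijective hD α β hcd hl hr
  suffices ∃ w ∈ D.notStart k col c, D.evalPath (FreeProd.base f g) valF w =
      (l.map fun x => FreeProd.inr f g x.1 * FreeProd.inl f g x.2).prod ∧
      D.evalPath ι val w = (l.map fun x => τ x.1 * γ x.2).prod by
    obtain ⟨w, hw, h1, h2⟩ := this
    rw [← h1, ← h2, ← α.evalPath_act hD h.1 (FreeProd.inl f g) FreeProd.inl_vertexIdem hl, freeEquiv_evalPath,
      α.evalPath_act_notStart hD hval γ hγi hγx a₀ hw]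
  induction l with
  | nil => exact ⟨_, sum_mem_notStart, evalPath_sum, evalPath_sum⟩
  | cons y l ih =>
    obtain ⟨w, hw, h1, h2⟩ := ih fun x hx => hlT x (List.mem_cons_of_mem _ hx)
    refine ⟨β.act hD y.1 (α.act hD y.2 w),
      β.act_mem_notStart hD hne.symm hT hmul (hlT y (by simp)) _, ?_, ?_⟩
    · rw [β.evalPath_act hD h.1 (FreeProd.inr f g) FreeProd.inr_vertexIdem hr,
        α.evalPath_act hD h.1 (FreeProd.inl f g) FreeProd.inl_vertexIdem hl, h1, List.map_cons, List.prod_cons, mul_assoc]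
    · rw [β.evalPath_act hD hval τ hτi hτx, α.evalPath_act_notStart hD hval γ hγi hγx _ hw, h2,
        List.map_cons, List.prod_cons, mul_assoc]

end

end PathData

open PathData

/-! ### The localized polynomial ring -/

section LocPoly

variable {k V A : Type*} [Field k] [Fintype V] [Ring A] [Algebra k A]

/-- Evaluation of tuples of Laurent polynomials at a unit, by means of orthogonal idempotents. -/
def tupleEval (f : (V → k) →ₐ[k] A) (u : Aˣ) (hu : ∀ s, Commute (f s) (u : A)) :
    (V → k[T;T⁻¹]) →ₐ[k] A :=
  AlgHom.ofLinearMap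
    (∑ i, LinearMap.mulLeft k (vertexIdem f i) ∘ₗ (laurentEval k u).toLinearMap ∘ₗ LinearMap.proj i)
    (by
      rw [LinearMap.sum_apply, ← (vertexIdem_idem f).complete]
      exact Finset.sum_congr rfl fun i _ => by simp)
    (fun F G => by
      have hE := vertexIdem_idem f
      have hc : ∀ i p, Commute (vertexIdem f i) (laurentEval k u p) := fun i p =>
        commute_laurentEval (k := k) (hu _) p
      simp only [LinearMap.sum_apply, LinearMap.comp_apply, LinearMap.mulLeft_apply,
        AlgHom.toLinearMap_apply, LinearMap.proj_apply, Finset.sum_mul_sum, Pi.mul_apply, map_mul]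
      refine Finset.sum_congr rfl fun i _ => ?_
      rw [Finset.sum_eq_single i]
      · rw [mul_assoc, ← mul_assoc _ (vertexIdem f i), ← (hc i _).eq]
        simp only [← mul_assoc]
        rw [hE.idem]
      · intro j _ hj
        rw [mul_assoc, ← mul_assoc _ (vertexIdem f j), ← (hc j _).eq, mul_assoc, ← mul_assoc,
          hE.ortho hj.symm, zero_mul]
      · simp)

theorem tupleEval_apply (f : (V → k) →ₐ[k] A) (u : Aˣ) (hu : ∀ s, Commute (f s) (u : A))
    (F : V → k[T;T⁻¹]) :
    tupleEval f u hu F = ∑ i, vertexIdem f i * laurentEval k u (F i) := by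
  simp [tupleEval]

theorem tupleEval_const (f : (V → k) →ₐ[k] A) (u : Aˣ) (hu : ∀ s, Commute (f s) (u : A))
    (s : V → k) : tupleEval f u hu (fun i => algebraMap k _ (s i)) = f s := by
  rw [tupleEval_apply, map_eq_sum_vertexIdem f s]
  refine Finset.sum_congr rfl fun i _ => ?_
  rw [AlgHom.commutes, ← Algebra.commutes, ← Algebra.smul_def]

theorem tupleEval_T (f : (V → k) →ₐ[k] A) (u : Aˣ) (hu : ∀ s, Commute (f s) (u : A)) :
    tupleEval f u hu (fun _ => T 1) = u := by
  rw [tupleEval_apply, ← Finset.sum_mul, (vertexIdem_idem f).complete, one_mul, laurentEval_T,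
    zpow_one]

variable (q : V → kˣ)

/-- The image of `q + t` in the localization. -/
def locUnit : (LocPoly (locPt q))ˣ :=
  (IsLocalization.Away.algebraMap_isUnit (S := LocPoly (locPt q)) (locPt q)).unit

theorem locUnit_val : (locUnit q : LocPoly (locPt q)) =
    LocPoly.base k (locPt q) (fun i => (q i : k)) + LocPoly.t (locPt q) := by
  change algebraMap _ _ (locPt q) = _
  rw [locPt, map_add]
  rfl

variable (k V) in
/-- The constant tuples of Laurent polynomials. -/
def constTuple : (V → k) →ₐ[k] (V → k[T;T⁻¹]) :=
  AlgHom.pi fun i => (Algebra.ofId k k[T;T⁻¹]).comp (Pi.evalAlgHom k (fun _ : V => k) i)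

variable (k V) in
/-- The constant tuple `T`. -/
def tupleUnit : (V → k[T;T⁻¹])ˣ where
  val _ := T 1
  inv _ := T (-1)
  val_inv := by ext1 i; exact (laurentUnit k).val_inv
  inv_val := by ext1 i; exact (laurentUnit k).inv_val

/-- The homomorphism `t ↦ T - q` to tuples of Laurent polynomials. -/
def locToTuple : LocPoly (locPt q) →ₐ[k] (V → k[T;T⁻¹]) :=
  IsLocalization.liftAlgHom (M := Submonoid.powers (locPt q))
    (f := Polynomial.aevalTower (constTuple k V)
      ((tupleUnit k V : V → k[T;T⁻¹]) - constTuple k V fun i => (q i : k))) (by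
    rintro ⟨_, m, rfl⟩
    rw [map_pow]
    refine IsUnit.pow _ ⟨tupleUnit k V, ?_⟩
    rw [locPt, map_add, Polynomial.aevalTower_C, Polynomial.aevalTower_X, add_sub_cancel])

theorem locToTuple_base (s : V → k) :
    locToTuple q (LocPoly.base k (locPt q) s) = constTuple k V s := by
  change locToTuple q (algebraMap _ _ (Polynomial.C s)) = _
  rw [locToTuple, IsLocalization.liftAlgHom_apply, IsLocalization.lift_eq]
  exact Polynomial.aevalTower_C _ _ _

theorem locToTuple_t : locToTuple q (LocPoly.t (locPt q)) =
    (tupleUnit k V : V → k[T;T⁻¹]) - constTuple k V fun i => (q i : k) := by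
  rw [LocPoly.t, locToTuple, IsLocalization.liftAlgHom_apply, IsLocalization.lift_eq]
  exact Polynomial.aevalTower_X _ _

theorem locToTuple_unit :
    Units.map (locToTuple q : LocPoly (locPt q) →* (V → k[T;T⁻¹])) (locUnit q) = tupleUnit k V := by
  ext1
  change locToTuple q (locUnit q : LocPoly (locPt q)) = _
  rw [locUnit_val, map_add, locToTuple_base, locToTuple_t, add_sub_cancel]

theorem tuple_eval (p : k[T;T⁻¹]) (i : V) : laurentEval k (tupleUnit k V) p i = p := by
  have := map_laurentEval (Pi.evalAlgHom k (fun _ : V => k[T;T⁻¹]) i) (tupleUnit k V) p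
  change laurentEval k (tupleUnit k V) p i = _ at this
  rw [this]
  convert laurentEval_laurentUnit p
  ext1
  rfl

open Classical in
theorem vertexIdem_constTuple_mul (i : V) (F : V → k[T;T⁻¹]) :
    vertexIdem (constTuple k V) i * F = Pi.single i (F i) := by
  ext1 j
  have : vertexIdem (constTuple k V) i j = algebraMap k k[T;T⁻¹] ((Pi.single i 1 : V → k) j) := rfl
  rw [Pi.mul_apply, this]
  by_cases h : j = i
  · subst h; simp
  · simp [Pi.single_eq_of_ne h]

/-- The homomorphism `T ↦ q + t` on tuples of Laurent polynomials. -/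
def tupleToLoc : (V → k[T;T⁻¹]) →ₐ[k] LocPoly (locPt q) :=
  tupleEval (LocPoly.base k (locPt q)) (locUnit q) fun _ => Commute.all _ _

/-- The localized polynomial ring is the ring of tuples of Laurent polynomials. -/
def locEquiv : LocPoly (locPt q) ≃ₐ[k] (V → k[T;T⁻¹]) :=
  AlgEquiv.ofAlgHom (locToTuple q) (tupleToLoc q)
    (by
      classical
      ext1 F
      rw [AlgHom.comp_apply, tupleToLoc, tupleEval_apply, map_sum]
      have : ∀ i, locToTuple q (vertexIdem (LocPoly.base k (locPt q)) i *
          laurentEval k (locUnit q) (F i)) = Pi.single i (F i) := fun i => by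
        rw [map_mul, map_laurentEval, locToTuple_unit, vertexIdem, locToTuple_base]
        change vertexIdem (constTuple k V) i * _ = _
        rw [vertexIdem_constTuple_mul, tuple_eval]
      simp_rw [this]
      exact Finset.univ_sum_single F)
    (by
      let j := IsScalarTower.toAlgHom k (Polynomial (V → k)) (LocPoly (locPt q))
      have h : ((tupleToLoc q).comp (locToTuple q)).comp j = j := by
        apply Polynomial.algHom_ext'
        · ext1 s
          change tupleToLoc q (locToTuple q (LocPoly.base k (locPt q) s)) =
            LocPoly.base k (locPt q) s
          rw [locToTuple_base]
          exact tupleEval_const _ _ (fun _ => Commute.all _ _) s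
        · change tupleToLoc q (locToTuple q (LocPoly.t (locPt q))) = LocPoly.t (locPt q)
          rw [locToTuple_t, map_sub]
          refine (congrArg₂ _ (tupleEval_T _ _ fun _ => Commute.all _ _)
            (tupleEval_const _ _ (fun _ => Commute.all _ _) _)).trans ?_
          rw [locUnit_val]
          exact add_sub_cancel_left _ _
      apply AlgHom.coe_ringHom_injective
      apply IsLocalization.ringHom_ext (Submonoid.powers (locPt q))
      exact congrArg AlgHom.toRingHom h)

theorem locEquiv_symm_apply (F : V → k[T;T⁻¹]) : (locEquiv q).symm F =
    ∑ i, vertexIdem (LocPoly.base k (locPt q)) i * laurentEval k (locUnit q) (F i) :=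
  tupleEval_apply _ _ (fun _ => Commute.all _ _) _

open Classical in
/-- The basis of the localized polynomial ring formed by powers of `t` and `(q + t)⁻¹ - q⁻¹`. -/
def locBasis : Basis (Σ _ : V, ℤ) k (LocPoly (locPt q)) :=
  (Pi.basis fun i => shiftedBasis (q i : k) ((q i)⁻¹ : k)).map (locEquiv q).symm.toLinearEquiv

theorem locBasis_apply (i : V) (m : ℤ) : locBasis q ⟨i, m⟩ =
    vertexIdem (LocPoly.base k (locPt q)) i *
      laurentEval k (locUnit q) (shiftedBasis (q i : k) ((q i)⁻¹ : k) m) := by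
  classical
  rw [locBasis, Basis.map_apply, Pi.basis_apply]
  refine (locEquiv_symm_apply q _).trans ?_
  rw [Finset.sum_eq_single i]
  · rw [Pi.single_eq_same]
  · intro j _ hj
    rw [Pi.single_eq_of_ne hj, map_zero, mul_zero]
  · simp

theorem laurentEval_scalar (u : kˣ) (p : k[T;T⁻¹]) :
    (shiftedBasis (u : k) ((u)⁻¹ : k)).repr p 0 = laurentEval k u p := by
  have : (Finsupp.lapply (0 : ℤ)) ∘ₗ (shiftedBasis (u : k) ((u)⁻¹ : k)).repr.toLinearMap =
      (laurentEval k u).toLinearMap := by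
    apply (shiftedBasis (u : k) ((u)⁻¹ : k)).ext
    intro m
    change (shiftedBasis (u : k) ((u)⁻¹ : k)).repr (shiftedBasis (u : k) ((u)⁻¹ : k) m) 0 =
      laurentEval k u (shiftedBasis (u : k) ((u)⁻¹ : k) m)
    rw [Basis.repr_self, laurentEval_shiftedBasis]
    obtain ⟨m, rfl | rfl⟩ := m.eq_nat_or_neg <;> [rw [signedPow_nat]; rw [signedPow_neg]] <;>
      obtain rfl | hm := eq_or_ne m 0 <;> simp [*]
  exact LinearMap.congr_fun this p

theorem locBasis_repr_zero {x : LocPoly (locPt q)} (hx : x ∈ Ideal.span {LocPoly.t (locPt q)})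
    (i : V) : (locBasis q).repr x ⟨i, 0⟩ = 0 := by
  classical
  obtain ⟨y, rfl⟩ := Ideal.mem_span_singleton'.1 hx
  have h1 : ∀ x : LocPoly (locPt q), (locBasis q).repr x ⟨i, 0⟩ =
      (shiftedBasis (q i : k) ((q i)⁻¹ : k)).repr (locEquiv q x i) 0 := fun x => rfl
  have h2 : locEquiv q (LocPoly.t (locPt q)) i = T 1 - C (q i : k) := congrFun (locToTuple_t q) i
  rw [h1, map_mul, Pi.mul_apply, h2, laurentEval_scalar, map_mul, map_sub, laurentEval_T, zpow_one]
  have h3 : laurentEval k (q i) (C (q i : k)) = (q i : k) := (laurentEval k (q i)).commutes _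
  rw [h3, sub_self, mul_zero]

section Target

variable (f : (V → k) →ₐ[k] A) (u : Aˣ) (hu : ∀ s, Commute (f s) (u : A))

/-- The homomorphism to an algebra which maps `q + t` to a given unit. -/
def locHom : LocPoly (locPt q) →ₐ[k] A := (tupleEval f u hu).comp (locEquiv q)

theorem locHom_base (s : V → k) : locHom q f u hu (LocPoly.base k (locPt q) s) = f s :=
  (congrArg _ (locToTuple_base q s)).trans (tupleEval_const f u hu s)

theorem locHom_t : locHom q f u hu (LocPoly.t (locPt q)) = u - f fun i => (q i : k) := by
  refine (congrArg (tupleEval f u hu) (locToTuple_t q)).trans ((map_sub _ _ _).trans ?_)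
  exact congrArg₂ _ (tupleEval_T f u hu) (tupleEval_const f u hu _)

theorem locHom_basis (i : V) (m : ℤ) : locHom q f u hu (locBasis q ⟨i, m⟩) =
    vertexIdem f i * laurentEval k u (shiftedBasis (q i : k) ((q i)⁻¹ : k) m) := by
  have h : Units.map (locHom q f u hu : LocPoly (locPt q) →* A) (locUnit q) = u := by
    ext1
    change locHom q f u hu (locUnit q : LocPoly (locPt q)) = _
    rw [locUnit_val, map_add, locHom_base, locHom_t, add_sub_cancel]
  rw [locBasis_apply, map_mul, map_laurentEval, h, vertexIdem, locHom_base]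
  rfl

end Target

end LocPoly

/-! ### Normal words as alternating words -/

section Paths

variable {n : ℕ} {V E : Type*}

/-- Normal words as paths in the atoms. -/
def atomPath (D : WordData n V E) : PathData V (Atom n V E) :=
  ⟨D.Good, fun x => some (D.src x), fun x => some (D.tgt x), D.Ok⟩

theorem isPath_atomPath (D : WordData n V E) (v : V) (w : Atoms n V E) :
    (atomPath D).IsPath (v, w) ↔ D.IsWord v w := by
  induction w generalizing v with
  | nil => exact ⟨fun _ => trivial, fun _ => isPath_nil v⟩
  | cons x w ih =>
    rw [isPath_cons, IsWord, ← ih]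
    simp only [IsPath, atomPath, R, Option.some.injEq]
    constructor
    · rintro ⟨h1, h2, h3, h4, h5⟩
      exact ⟨h1, h2, fun y hy => (h3 y hy).2, h4, fun y hy => (h3 y hy).1.symm, h5⟩
    · rintro ⟨h1, h2, h3, h4, h5, h6⟩
      exact ⟨h1, h2, fun y hy => ⟨(h5 y hy).symm, h3 y hy⟩, h4, h6⟩

variable {Q : ArrowQuiver V E} {z : Q.Cycle n} (F : Set (z.arrowsᶜ : Set E))

variable (z) in
/-- Alternating words with given allowed kinds of blocks, as paths. -/
def blockPath (K : Set (Fin 3)) : PathData V (Block z) :=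
  ⟨fun b => b.Valid F ∧ b.kind ∈ K, Block.src, Block.tgt, fun b b' => b.kind ≠ b'.kind⟩

/-- The kind of an atom. -/
def Atom.kind : Atom n V E → Fin 3
  | .cyc _ _ _ => 0
  | .letter _ => 1
  | .pow _ _ => 2

/-- The atoms of a block. -/
def Block.atoms : Block z → List (Atom n V (z.arrowsᶜ : Set E))
  | .cyc i m l => [.cyc i m l]
  | .par w => w.map .letter
  | .pow i m => [.pow i m]

theorem exists_letters {w : Atoms n V E} (h : ∀ x ∈ w, Atom.kind x = 1) :
    ∃ w' : List (Letter E), w'.map Atom.letter = w := by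
  induction w with
  | nil => exact ⟨[], rfl⟩
  | cons x w ih =>
    rw [List.forall_mem_cons] at h
    obtain ⟨w', rfl⟩ := ih h.2
    obtain _ | x | _ := x
    · simp [Atom.kind] at h
    · exact ⟨x :: w', rfl⟩
    · simp [Atom.kind] at h

theorem letter_injective : Function.Injective (Atom.letter (n := n) (V := V) (E := E)) :=
  fun x y h => by injection h

theorem isForestWord_iff {K : Set (Fin 3)} (h1 : 1 ∈ K) {w : List (Letter (z.arrowsᶜ : Set E))} :
    IsForestWord (Q.restrict z.arrowsᶜ) F w ↔ w ≠ [] ∧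
      (∀ x ∈ w.map Atom.letter, (z.wordData F K).Good x) ∧
        (w.map Atom.letter).IsChain (atomPath (z.wordData F K)).R := by
  simp only [IsForestWord, List.isChain_map, List.forall_mem_map, Good, h1, true_and]
  refine and_congr_right fun _ => and_congr_right fun _ => ?_
  simp only [R, atomPath, Option.some.injEq]
  rfl

theorem grouping (K : Set (Fin 3)) :
    Grouping (atomPath (z.wordData F K)) (blockPath z F K) Atom.kind Block.kind Block.atoms where
  O_of_ne := by
    rintro (_ | _ | _) (_ | _ | _) h <;> first | exact trivial | exact absurd rfl h
  O_iff _ _ _ _ := Iff.rfl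
  good := by
    rintro (⟨i, m, l⟩ | w | ⟨i, m⟩) ⟨h, hK⟩
    · refine ⟨by simp [Block.atoms], ?_, List.isChain_singleton _, rfl, rfl⟩
      simp only [Block.atoms, List.mem_singleton, forall_eq]
      exact ⟨⟨hK, h⟩, rfl⟩
    · obtain ⟨h1, h2, h3⟩ := (isForestWord_iff F hK).1 h
      refine ⟨by simpa [Block.atoms] using h1, fun x hx => ⟨h2 x hx, ?_⟩, h3, ?_, ?_⟩
      · obtain ⟨y, _, rfl⟩ := List.mem_map.1 hx
        rfl
      · change w.head?.map _ = Option.bind (w.map _).head? _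
        rw [List.head?_map]
        cases w.head? <;> rfl
      · change w.getLast?.map _ = Option.bind (w.map _).getLast? _
        rw [List.getLast?_map]
        cases w.getLast? <;> rfl
    · refine ⟨by simp [Block.atoms], ?_, List.isChain_singleton _, rfl, rfl⟩
      simp only [Block.atoms, List.mem_singleton, forall_eq]
      exact ⟨⟨hK, h⟩, rfl⟩
  inj := by
    rintro (⟨i, m, l⟩ | w | ⟨i, m⟩) (⟨i', m', l'⟩ | w' | ⟨i', m'⟩) ⟨h, _⟩ ⟨h', _⟩ heq
    · simp only [Block.atoms, List.cons.injEq, Atom.cyc.injEq, and_true] at heq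
      rw [heq.1, heq.2.1, heq.2.2]
    · rcases w' with _ | ⟨x, _ | _⟩ <;> simp [Block.atoms] at heq
    · simp [Block.atoms] at heq
    · rcases w with _ | ⟨x, _ | _⟩ <;> simp [Block.atoms] at heq
    · rw [List.map_injective_iff.2 letter_injective heq]
    · rcases w with _ | ⟨x, _ | _⟩ <;> simp [Block.atoms] at heq
    · simp [Block.atoms] at heq
    · rcases w' with _ | ⟨x, _ | _⟩ <;> simp [Block.atoms] at heq
    · simp only [Block.atoms, List.cons.injEq, Atom.pow.injEq, and_true] at heq
      rw [heq.1, heq.2]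
  surj := by
    intro c w hw h hc
    obtain ⟨x, w, rfl⟩ := List.exists_cons_of_ne_nil hw
    have hx := h x (by simp)
    have hnil : ∀ y : Atom n V (z.arrowsᶜ : Set E), y.kind = x.kind →
        (z.wordData F K).Ok x y → x.kind = 1 := by
      rintro y hy ho
      rcases x with _ | _ | _ <;> rcases y with _ | _ | _ <;>
        first | rfl | exact absurd ho id | exact absurd hy (by simp [Atom.kind])
    have hw1 : w = [] ∨ x.kind = 1 := by
      obtain _ | ⟨y, w⟩ := w
      · exact Or.inl rfl
      · exact Or.inr (hnil y ((h y (by simp)).2.trans hx.2.symm) (List.isChain_cons_cons.1 hc).1.2)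
    obtain ⟨i, m, l⟩ | y | ⟨i, m⟩ := x
    · obtain rfl | h1 := hw1
      · exact ⟨.cyc i m l, ⟨hx.1.2, hx.1.1⟩, rfl⟩
      · simp [Atom.kind] at h1
    · obtain ⟨w', hw'⟩ := exists_letters (w := .letter y :: w) fun u hu => by
        rw [(h u hu).2, ← hx.2]; rfl
      refine ⟨.par w', ⟨?_, hx.1.1⟩, hw'⟩
      refine (isForestWord_iff F hx.1.1).2 ⟨?_, ?_, ?_⟩
      · rintro rfl
        simp at hw'
      · rw [hw']; exact fun u hu => (h u hu).1
      · rw [hw']; exact hc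
    · obtain rfl | h1 := hw1
      · exact ⟨.pow i m, ⟨hx.1.2, hx.1.1⟩, rfl⟩
      · simp [Atom.kind] at h1

theorem isAltWord_iff (p : V × List (Block z)) :
    IsAltWord z F p ↔ (blockPath z F Set.univ).IsPath p := by
  simp only [IsAltWord, IsPath, blockPath, Set.mem_univ, and_true]
  rfl

theorem isAltWord₀_iff (p : V × List (Block z)) :
    (IsAltWord z F p ∧ ∀ b ∈ p.2, b.kind ≠ 2) ↔ (blockPath z F {0, 1}).IsPath p := by
  have h : ∀ i : Fin 3, i ≠ 2 ↔ i ∈ ({0, 1} : Set (Fin 3)) := by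
    intro i
    fin_cases i <;> simp
  simp only [IsAltWord, IsPath, blockPath, h, forall_and]
  tauto

end Paths

/-! ### Homogeneity of the words -/

section Homogeneous

variable {k : Type*} [Field k] {V E : Type*} [Fintype V] {Q : ArrowQuiver V E}

theorem vertexIdem_vertexMap (i : V) : vertexIdem (vertexMap k Q) i = e k Q i := by
  classical
  rw [vertexIdem]
  convert vertexMap_single k Q i

theorem IsCyc.e_mul_cycElt {n : ℕ} [NeZero n] {v : ZMod n → V} {c : ZMod n → E}
    (bar : Bool) (i : ZMod n) (m l : ℤ) :
    e k Q (v i) * cycElt k Q bar v c i m l = cycElt k Q bar v c i m l := by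
  rw [cycElt, ← mul_assoc, ← mul_assoc, e_mul_self]

theorem IsCyc.cycElt_mul_e {n : ℕ} [NeZero n] {v : ZMod n → V} {c : ZMod n → E} (h : IsCyc Q v c)
    (bar : Bool) (i : ZMod n) (m l : ℤ) :
    cycElt k Q bar v c i m l * e k Q (v (i + l)) = cycElt k Q bar v c i m l := by
  rw [h.cycElt_eq, ((commute_laurentEval (k := k) (IsCyc.commute_x (v i)) _).eq), mul_assoc,
    mul_assoc, ← mul_assoc (e k Q (v i)), idem_mul_signedPow (E := fun i => e k Q (v i))
      h.e_mul_a_comm h.e_mul_a'_comm, mul_assoc, mul_assoc, e_mul_self,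
    idem_mul_signedPow (E := fun i => e k Q (v i)) h.e_mul_a_comm h.e_mul_a'_comm]

theorem e_mul_letters {w : List (Letter E)} {x : Letter E} (hx : x ∈ w.head?) :
    e k Q (x.src Q) * (w.map fun x => x.val Q).prod = ((w.map fun x => x.val Q).prod : LAlg k Q) := by
  obtain ⟨w', rfl⟩ := List.head?_eq_some_iff.1 hx
  rw [List.map_cons, List.prod_cons, ← mul_assoc, e_mul_val]

theorem letters_mul_e {w : List (Letter E)} {x : Letter E} (hx : x ∈ w.getLast?) :
    (w.map fun x => x.val Q).prod * e k Q (x.tgt Q) = ((w.map fun x => x.val Q).prod : LAlg k Q) := by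
  obtain ⟨w', rfl⟩ := List.getLast?_eq_some_iff.1 hx
  rw [List.map_append, List.prod_append, List.map_singleton, List.prod_singleton, mul_assoc,
    val_mul_e]

variable [Finite E] [LinearOrder (DArrow E)] {q : V → kˣ} {n : ℕ} [NeZero n] {z : Q.Cycle n}

theorem incl_letters {A : Set E} (w : List (Letter A)) :
    incl k Q A (w.map fun x => x.val (Q.restrict A)).prod =
      (w.map fun x => (x.map Subtype.val).val Q).prod := by
  rw [map_list_prod, List.map_map]
  congr 1
  exact List.map_congr_left fun x _ => incl_val x

theorem located_block (ho : z.Oriented) (bar : Bool) (F : Set (z.arrowsᶜ : Set E))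
    (K : Set (Fin 3)) :
    (blockPath z F K).Located (vertexMap k Q) (Block.val q bar) := by
  have hc : IsCyc Q z.v z.c := ⟨z.v_injective, fun i => (ho i).1, fun i => (ho i).2⟩
  constructor
  · rintro (⟨i, m, l⟩ | w | ⟨i, m⟩) v - hv <;> rw [vertexIdem_vertexMap]
    · obtain rfl : z.v i = v := Option.some_injective _ hv
      exact IsCyc.e_mul_cycElt bar i m l
    · obtain ⟨x, hx, rfl⟩ := Option.map_eq_some_iff.1 hv
      have := congrArg (incl k Q z.arrowsᶜ) (e_mul_letters (k := k) (Q := Q.restrict z.arrowsᶜ) hx)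
      rwa [map_mul, incl_e, incl_letters] at this
    · obtain rfl : i = v := Option.some_injective _ hv
      rw [Block.val, ← mul_assoc, e_mul_self]
  · rintro (⟨i, m, l⟩ | w | ⟨i, m⟩) v - hv <;> rw [vertexIdem_vertexMap]
    · obtain rfl : z.v (i + l) = v := Option.some_injective _ hv
      exact hc.cycElt_mul_e bar i m l
    · obtain ⟨x, hx, rfl⟩ := Option.map_eq_some_iff.1 hv
      have := congrArg (incl k Q z.arrowsᶜ) (letters_mul_e (k := k) (Q := Q.restrict z.arrowsᶜ) hx)
      rwa [map_mul, incl_e, incl_letters] at this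
    · obtain rfl : i = v := Option.some_injective _ hv
      rw [Block.val, e_mul_signedPow_rel, mul_assoc,
        ← (commute_laurentEval (k := k) (e_commute_rho i) _).eq, ← mul_assoc, e_mul_self]

theorem PathData.Located.map {L A B : Type*} [Ring A] [Algebra k A] [Ring B]
    [Algebra k B] {D : PathData V L} {ι : (V → k) →ₐ[k] A} {val : L → A} (h : D.Located ι val)
    (f : A →ₐ[k] B) : D.Located (f.comp ι) fun x => f (val x) :=
  ⟨fun x v hx hv => (map_mul f _ _).symm.trans (congrArg f (h.left x v hx hv)),
    fun x v hx hv => (map_mul f _ _).symm.trans (congrArg f (h.right x v hx hv))⟩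

theorem block_isAlternating (F : Set (z.arrowsᶜ : Set E)) (K : Set (Fin 3)) :
    (blockPath z F K).IsAlternating Block.kind where
  O_iff _ _ := Iff.rfl
  s_some := by
    rintro (⟨i, m, l⟩ | w | ⟨i, m⟩) ⟨h, -⟩
    · exact ⟨_, rfl⟩
    · obtain ⟨x, w', rfl⟩ := List.exists_cons_of_ne_nil (show w ≠ [] from h.1)
      exact ⟨_, rfl⟩
    · exact ⟨_, rfl⟩
  t_some := by
    rintro (⟨i, m, l⟩ | w | ⟨i, m⟩) ⟨h, -⟩
    · exact ⟨_, rfl⟩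
    · obtain ⟨x, hx⟩ := Option.isSome_iff_exists.1 (List.getLast?_isSome.2 (show w ≠ [] from h.1))
      exact ⟨_, congrArg (Option.map _) hx⟩
    · exact ⟨_, rfl⟩

end Homogeneous

/-! ### Bases of alternating words -/

section Bases

variable {k : Type*} [Field k] {V E : Type*} [Fintype V] {Q : ArrowQuiver V E}
  [Finite E] [LinearOrder (DArrow E)] {q : V → kˣ} {n : ℕ} [NeZero n] {z : Q.Cycle n}
  {F : Set (z.arrowsᶜ : Set E)} {bar : Bool}

/-- Words are paths of atoms. -/
def wordEquiv {n : ℕ} {V E : Type*} (D : WordData n V E) :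
    {p : V × Atoms n V E // D.IsWord p.1 p.2} ≃ {p // (atomPath D).IsPath p} :=
  Equiv.subtypeEquivRight fun p => (isPath_atomPath D p.1 p.2).symm

/-- A basis formed by normal words is a basis formed by alternating words. -/
theorem exists_basis_blocks {K : Set (Fin 3)} {B : Type*} [Ring B] [Algebra k B]
    (π : LAlg k Q →ₐ[k] B)
    (h : Function.Bijective ((z.wordData F K).evalBy (π.comp (incl k Q z.arrowsᶜ))
      fun x => π (atomVal q z bar x))) :
    ∃ b : Basis {p // (blockPath z F K).IsPath p} k B, ∀ p, b p = π (wordVal q bar p.1) := by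
  obtain ⟨b, hb⟩ := exists_basis_of_bijective h
  refine ⟨b.reindex ((wordEquiv _).trans (grouping F K).equiv.symm), fun p => ?_⟩
  rw [Basis.reindex_apply]
  refine (hb _).trans ?_
  have hval : ∀ b : Block z, (b.atoms.map fun x => atomVal q z bar x).prod = b.val q bar := by
    rintro (⟨i, m, l⟩ | w | ⟨i, m⟩)
    · exact List.prod_singleton
    · rw [Block.atoms, List.map_map]
      rfl
    · exact List.prod_singleton
  have hprod : ∀ l : List (Block z), ((l.flatMap Block.atoms).map fun x => atomVal q z bar x).prod =
      (l.map (Block.val q bar)).prod := fun l => by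
    induction l with
    | nil => rfl
    | cons b l ih =>
      rw [List.flatMap_cons, List.map_append, List.prod_append, ih, hval, List.map_cons,
        List.prod_cons]
  change π (incl k Q z.arrowsᶜ (e k _ p.1.1)) *
    ((p.1.2.flatMap Block.atoms).map fun x => π (atomVal q z bar x)).prod = _
  rw [incl_e, wordVal, map_mul, ← hprod, map_list_prod, List.map_map]
  rfl

theorem PathData.evalPath_bijective {L A : Type*} [Ring A] [Algebra k A]
    {D : PathData V L} {ι : (V → k) →ₐ[k] A} {val : L → A}
    (b : Basis {p // D.IsPath p} k A)
    (hb : ∀ p, b p = vertexIdem ι p.1.1 * (p.1.2.map val).prod) :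
    Function.Bijective (D.evalPath ι val) := by
  have : D.evalPath ι val = b.repr.symm.toLinearMap := hom_ext_vec fun p hp => by
    rw [evalPath_vec hp, vec_of hp, Finsupp.coe_basisSingleOne, LinearEquiv.coe_coe,
      Basis.repr_symm_single_one, hb]
  rw [this]
  exact b.repr.symm.bijective

/-- The basis of the algebra of the cycle. -/
theorem exists_basis_cycLam (ho : z.Oriented) (ha : z.Adapted) (bar : Bool) :
    ∃ b : Basis (V ⊕ {p : ZMod n × ℤ × ℤ // p.2.1 ≠ 0 ∨ p.2.2 ≠ 0}) k (CycLam q z),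
      (∀ i, b (Sum.inl i) = proj k _ (e k (Q.restrict z.arrows) i)) ∧
      ∀ p, b (Sum.inr p) = proj k _
        (cycElt k (Q.restrict z.arrows) bar z.v z.arrow p.1.1 p.1.2.1 p.1.2.2) := by
  let r : QRep k z.cycData.quiver (CycLam q z) :=
    { vert := fun i => proj k _ (e k (Q.restrict z.arrows) i)
      arr := fun d => d.arrow.elim
      unit := fun d => d.arrow.elim
      idem := (e_idem k (Q.restrict z.arrows)).map (proj k _).toRingHom
      tail := fun d => d.arrow.elim
      head := fun d => d.arrow.elim
      unit_eq := fun d => d.arrow.elim }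
  let val : Atom n V Empty → CycLam q z
    | .cyc i m l => proj k _ (cycElt k (Q.restrict z.arrows) bar z.v z.arrow i m l)
    | _ => 0
  obtain ⟨b, hb⟩ := exists_basis_of_bijective (cyc_bijective (D := z.cycData) (q := q)
    (W := z.vertsᶜ) rfl (ArrowQuiver.Cycle.isCyc ho) z.arrow_bijective (fun i j => ha.1 i j)
    (fun v => by simp [ArrowQuiver.Cycle.mem_verts]) bar (φ := r.toHom) (val := val)
    (QRep.toHom_e r) fun i m l => rfl)
  let j : {p : ZMod n × ℤ × ℤ // p.2.1 ≠ 0 ∨ p.2.2 ≠ 0} → List (Atom n V Empty) :=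
    fun p => [.cyc p.1.1 p.1.2.1 p.1.2.2]
  let eqv := splitEquiv (D := atomPath z.cycData) j (fun p => z.v p.1.1)
    (fun p => ⟨by simp [j], isPath_cons.2 ⟨⟨rfl, p.2⟩, rfl, by simp, by simp, List.isChain_nil⟩⟩)
    (fun p p' h => by
      simp only [j, List.cons.injEq, Atom.cyc.injEq, and_true] at h
      exact Subtype.ext (Prod.ext h.1 (Prod.ext h.2.1 h.2.2)))
    (by
      rintro u w hw h
      obtain ⟨x, w, rfl⟩ := List.exists_cons_of_ne_nil hw
      rw [isPath_atomPath] at h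
      obtain ⟨i, m, l⟩ | x | ⟨i, m⟩ := x
      · obtain _ | ⟨_ | x | _, w⟩ := w
        · exact ⟨⟨(i, m, l), h.good.2⟩, rfl⟩
        · exact absurd (h.2.2.1 _ rfl) id
        · exact absurd h.tail.good.1 (by simp)
        · exact absurd h.tail.good.1 (by simp)
      · exact absurd h.good.1 (by simp)
      · exact absurd h.good.1 (by simp))
  refine ⟨b.reindex ((wordEquiv _).trans eqv.symm), fun i => ?_, fun p => ?_⟩
  · rw [Basis.reindex_apply]
    refine (hb _).trans ?_
    change r.toHom (e k _ i) * 1 = _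
    rw [mul_one, QRep.toHom_e]
  · rw [Basis.reindex_apply]
    refine (hb _).trans ?_
    change r.toHom (e k _ (z.v p.1.1)) * (val (.cyc p.1.1 p.1.2.1 p.1.2.2) * 1) = _
    rw [mul_one, QRep.toHom_e]
    change proj k _ _ * proj k _ _ = _
    rw [← map_mul, IsCyc.e_mul_cycElt]

/-- The basis of the algebra of the complement of the cycle. -/
theorem exists_basis_complLam (hF : (Q.restrict z.arrowsᶜ).IsRootedForest z.verts F) :
    ∃ b : Basis (V ⊕ {w // IsForestWord (Q.restrict z.arrowsᶜ) F w}) k (ComplLam q z),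
      (∀ i, b (Sum.inl i) = proj k _ (e k (Q.restrict z.arrowsᶜ) i)) ∧
      ∀ w, b (Sum.inr w) = proj k _
        ((w.1.map fun x => x.val (Q.restrict z.arrowsᶜ)).prod : LAlg k _) := by
  obtain ⟨b, hb⟩ := exists_basis_of_bijective (letter_bijective (D := z.wordData F {1}) (q := q)
    hF rfl)
  let eqv := splitEquiv (D := atomPath (z.wordData F {1}))
    (fun w : {w // IsForestWord (Q.restrict z.arrowsᶜ) F w} => w.1.map Atom.letter)
    (fun w => (w.1.head w.2.1).src (Q.restrict z.arrowsᶜ))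
    (fun w => by
      obtain ⟨h1, h2, h3⟩ := (isForestWord_iff F (K := {1}) rfl).1 w.2
      refine ⟨by simpa using h1, h2, fun x hx => ?_, h3⟩
      rw [List.head?_map, List.head?_eq_some_head h1] at hx
      obtain rfl := Option.some_injective _ hx
      rfl)
    (fun w w' h => Subtype.ext (List.map_injective_iff.2 letter_injective h))
    (by
      rintro u w hw h
      obtain ⟨w', rfl⟩ := exists_letters (w := w) fun x hx => by
        have : (z.wordData F {1}).Good x := h.1 x hx
        rcases x with _ | _ | _
        · exact absurd this.1 (by simp)
        · rfl
        · exact absurd this.1 (by simp)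
      exact ⟨⟨w', (isForestWord_iff F (K := {1}) rfl).2 ⟨by simpa using hw, h.1, h.2.2⟩⟩, rfl⟩)
  refine ⟨b.reindex ((wordEquiv _).trans eqv.symm), fun i => ?_, fun w => ?_⟩
  · rw [Basis.reindex_apply]
    refine (hb _).trans ?_
    change proj k _ (e k (Q.restrict z.arrowsᶜ) i) * 1 = _
    rw [mul_one]
  · rw [Basis.reindex_apply]
    refine (hb _).trans ?_
    change proj k _ (e k (Q.restrict z.arrowsᶜ) ((w.1.head w.2.1).src _)) *
      ((w.1.map Atom.letter).map _).prod = _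
    rw [← e_mul_letters (List.head?_eq_some_head w.2.1), map_mul, map_list_prod, List.map_map,
      List.map_map]
    rfl

end Bases

/-! ### The free product decomposition in the adapted case -/

section Adapted

variable {k : Type*} [Field k] {V E : Type*} [Fintype V] {Q : ArrowQuiver V E}
  [Finite E] [LinearOrder (DArrow E)] {q : V → kˣ} {n : ℕ} [NeZero n] {z : Q.Cycle n}
  {F : Set (z.arrowsᶜ : Set E)} {bar : Bool}

variable (F) in
/-- The blocks of the first kind. -/
def cycBlock : {p : ZMod n × ℤ × ℤ // p.2.1 ≠ 0 ∨ p.2.2 ≠ 0} ≃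
    {x // (blockPath z F {0, 1}).P x ∧ x.kind = 0} where
  toFun p := ⟨.cyc p.1.1 p.1.2.1 p.1.2.2, ⟨p.2, Or.inl rfl⟩, rfl⟩
  invFun
    | ⟨.cyc i m l, h⟩ => ⟨(i, m, l), h.1.1⟩
    | ⟨.par _, h⟩ => absurd h.2 (by decide : (1 : Fin 3) ≠ 0)
    | ⟨.pow _ _, h⟩ => absurd h.2 (by decide : (2 : Fin 3) ≠ 0)
  left_inv _ := rfl
  right_inv
    | ⟨.cyc i m l, h⟩ => rfl
    | ⟨.par _, h⟩ => absurd h.2 (by decide : (1 : Fin 3) ≠ 0)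
    | ⟨.pow _ _, h⟩ => absurd h.2 (by decide : (2 : Fin 3) ≠ 0)

variable (F) in
/-- The blocks of the second kind. -/
def parBlock : {w // IsForestWord (Q.restrict z.arrowsᶜ) F w} ≃
    {x // (blockPath z F {0, 1}).P x ∧ x.kind = 1} where
  toFun w := ⟨.par w.1, ⟨w.2, Or.inr rfl⟩, rfl⟩
  invFun
    | ⟨.par w, h⟩ => ⟨w, h.1.1⟩
    | ⟨.cyc _ _ _, h⟩ => absurd h.2 (by decide : (0 : Fin 3) ≠ 1)
    | ⟨.pow _ _, h⟩ => absurd h.2 (by decide : (2 : Fin 3) ≠ 1)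
  left_inv _ := rfl
  right_inv
    | ⟨.par w, h⟩ => rfl
    | ⟨.cyc _ _ _, h⟩ => absurd h.2 (by decide : (0 : Fin 3) ≠ 1)
    | ⟨.pow _ _, h⟩ => absurd h.2 (by decide : (2 : Fin 3) ≠ 1)

/-- A basis indexed by the vertices and by the letters of one color, up to an equivalence. -/
theorem exists_basedAlg_of_equiv {L κ X A : Type*} [Ring A] [Algebra k A] {D : PathData V L}
    {col : L → κ} {c : κ} {f : (V → k) →ₐ[k] A} (eqv : X ≃ {x // D.P x ∧ col x = c})
    (b : Basis (V ⊕ X) k A) (hi : ∀ i, b (Sum.inl i) = vertexIdem f i)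
    (hl : ∀ x v, D.s (eqv x).1 = some v → vertexIdem f v * b (Sum.inr x) = b (Sum.inr x))
    (hr : ∀ x v, D.t (eqv x).1 = some v → b (Sum.inr x) * vertexIdem f v = b (Sum.inr x)) :
    ∃ α : D.BasedAlg col c f, ∀ x, α.basis (Sum.inr (eqv x)) = b (Sum.inr x) := by
  have hx : ∀ x, b.reindex (Equiv.sumCongr (Equiv.refl V) eqv) (Sum.inr (eqv x)) =
      b (Sum.inr x) := fun x => by simp
  refine ⟨⟨b.reindex (Equiv.sumCongr (Equiv.refl V) eqv), fun i => (b.reindex_apply _ _).trans (hi i),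
    fun x v hv => ?_, fun x v hv => ?_⟩, hx⟩ <;> obtain ⟨x, rfl⟩ := eqv.surjective x <;> rw [hx]
  · exact hl x v hv
  · exact hr x v hv

theorem exists_basedAlg_cycLam (F : Set (z.arrowsᶜ : Set E)) (ho : z.Oriented) (ha : z.Adapted)
    (q : V → kˣ) (bar : Bool) :
    ∃ α : (blockPath z F {0, 1}).BasedAlg Block.kind 0 (CycLam.base q z),
      ∀ x, FreeProd.inl _ (ComplLam.base q z) (α.basis (Sum.inr x)) = x.1.freeVal q bar := by
  obtain ⟨b, hi, hb⟩ := exists_basis_cycLam (q := q) ho ha bar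
  have hE : ∀ i, vertexIdem (CycLam.base q z) i = proj k _ (e k (Q.restrict z.arrows) i) := fun i =>
    congrArg (proj k _) (vertexIdem_vertexMap i)
  obtain ⟨α, hα⟩ := exists_basedAlg_of_equiv (cycBlock F) b (fun i => (hi i).trans (hE i).symm)
    (fun p v hv => by
      obtain rfl : z.v p.1.1 = v := Option.some_injective _ hv
      rw [hb, hE, ← map_mul, IsCyc.e_mul_cycElt])
    (fun p v hv => by
      obtain rfl : z.v (p.1.1 + p.1.2.2) = v := Option.some_injective _ hv
      rw [hb, hE, ← map_mul, (ArrowQuiver.Cycle.isCyc ho).cycElt_mul_e])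
  refine ⟨α, fun x => ?_⟩
  obtain ⟨p, rfl⟩ := (cycBlock F).surjective x
  rw [hα, hb]
  rfl

theorem exists_basedAlg_complLam (hF : (Q.restrict z.arrowsᶜ).IsRootedForest z.verts F)
    (q : V → kˣ) (bar : Bool) :
    ∃ β : (blockPath z F {0, 1}).BasedAlg Block.kind 1 (ComplLam.base q z),
      ∀ x, FreeProd.inr (CycLam.base q z) _ (β.basis (Sum.inr x)) = x.1.freeVal q bar := by
  obtain ⟨b, hi, hb⟩ := exists_basis_complLam (q := q) hF
  have hE : ∀ i, vertexIdem (ComplLam.base q z) i = proj k _ (e k (Q.restrict z.arrowsᶜ) i) :=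
    fun i => congrArg (proj k _) (vertexIdem_vertexMap i)
  obtain ⟨β, hβ⟩ := exists_basedAlg_of_equiv (parBlock F) b (fun i => (hi i).trans (hE i).symm)
    (fun w v hv => by
      obtain ⟨y, hy, rfl⟩ := Option.map_eq_some_iff.1 hv
      rw [hb, hE, ← map_mul, e_mul_letters hy])
    (fun w v hv => by
      obtain ⟨y, hy, rfl⟩ := Option.map_eq_some_iff.1 hv
      rw [hb, hE, ← map_mul, letters_mul_e hy])
  refine ⟨β, fun x => ?_⟩
  obtain ⟨w, rfl⟩ := (parBlock F).surjective x
  rw [hβ, hb]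
  rfl

theorem located_block_lam (ho : z.Oriented) (bar : Bool) (F : Set (z.arrowsᶜ : Set E))
    (q : V → kˣ) (K : Set (Fin 3)) : (blockPath z F K).Located (Lam.base Q q)
      fun x => proj k (rel Q q) (x.val q bar) :=
  (located_block ho bar F K).map _

theorem proj_wordVal (q : V → kˣ) (bar : Bool) (p : V × List (Block z)) : proj k (rel Q q) (wordVal q bar p) =
    vertexIdem (Lam.base Q q) p.1 * (p.2.map fun x => proj k (rel Q q) (x.val q bar)).prod := by
  rw [wordVal, map_mul, map_list_prod, List.map_map, ← vertexIdem_vertexMap]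
  rfl

variable (hF : (Q.restrict z.arrowsᶜ).IsRootedForest z.verts F) (ho : z.Oriented) (ha : z.Adapted)
  (bar) (q)
include hF ho ha

/-- The basis of `L_Q` formed by the alternating words. -/
theorem exists_basis_lAlg :
    ∃ b : Basis {p // (blockPath z F Set.univ).IsPath p} k (LAlg k Q),
      ∀ p, b p = wordVal q bar p.1 :=
  exists_basis_blocks (AlgHom.id k _) (lAlg_bijective hF ho ha bar q)

/-- The basis of `Λ^q(Q)` formed by the alternating words without powers of `r` and `r'`. -/
theorem exists_basis_lam :
    ∃ b : Basis {p // (blockPath z F {0, 1}).IsPath p} k (Lam Q q),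
      ∀ p, b p = proj k _ (wordVal q bar p.1) :=
  exists_basis_blocks _ (lam_bijective hF ho ha bar q)

theorem bijective_evalPath_lAlg :
    Function.Bijective ((blockPath z F Set.univ).evalPath (vertexMap k Q) (Block.val q bar)) := by
  obtain ⟨b, hb⟩ := exists_basis_lAlg q bar hF ho ha
  exact evalPath_bijective b fun p => by rw [hb, wordVal, vertexIdem_vertexMap]

theorem bijective_evalPath_lam :
    Function.Bijective ((blockPath z F {0, 1}).evalPath (Lam.base Q q)
      fun x => proj k (rel Q q) (x.val q bar)) := by
  obtain ⟨b, hb⟩ := exists_basis_lam q bar hF ho ha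
  exact evalPath_bijective b fun p => by rw [hb, proj_wordVal]

theorem linearlyFreeProduct_of_adapted :
    LinearlyFreeProduct (CycLam.base q z) (ComplLam.base q z) (Lam.base Q q) := by
  obtain ⟨α, hα⟩ := exists_basedAlg_cycLam F ho ha q false
  obtain ⟨β, hβ⟩ := exists_basedAlg_complLam hF q false
  exact linearlyFreeProduct (block_isAlternating F _) α β (fun x hx => hx.2) hα hβ
    (located_block_lam ho false F q _) (bijective_evalPath_lam q false hF ho ha) (by decide)

theorem exists_freeEquiv_words :
    ∃ Ψ : FreeProd (CycLam.base q z) (ComplLam.base q z) ≃ₗ[k] Lam Q q,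
      (∀ s x, Ψ (FreeProd.inl _ _ (CycLam.base q z s) * x) = Lam.base Q q s * Ψ x ∧
        Ψ (x * FreeProd.inl _ _ (CycLam.base q z s)) = Ψ x * Lam.base Q q s) ∧
      ∀ p : AltWord₀ z F, Ψ (wordFreeVal q bar p.1) = proj k _ (wordVal q bar p.1) := by
  obtain ⟨α, hα⟩ := exists_basedAlg_cycLam F ho ha q bar
  obtain ⟨β, hβ⟩ := exists_basedAlg_complLam hF q bar
  have hD := block_isAlternating F {0, 1}
  have hbij := bijective_evalPath_lam q bar hF ho ha
  refine ⟨freeEquiv hD α β (fun x hx => hx.2) hα hβ hbij, freeEquiv_bimodule hD α β _ hα hβ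
    (located_block_lam ho bar F q _) hbij, fun p => ?_⟩
  have hp := (isAltWord₀_iff F p.1).1 p.2
  have h := freeEquiv_evalPath hD α β (fun x hx => hx.2) hα hβ hbij
    ((blockPath z F {0, 1}).vec k p.1)
  rw [evalPath_vec hp, evalPath_vec hp, ← proj_wordVal] at h
  rw [← h, wordFreeVal, ← vertexIdem_vertexMap]
  rfl

end Adapted

/-! ### Runs of letters of the same color -/

namespace PathData

section Runs

variable {V L κ : Type*} (D : PathData V L) (c : L → κ)

/-- The paths of `D`, cut into runs of letters of the same color. -/
def runs : PathData V (List L) where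
  P w := w ≠ [] ∧ (∀ x ∈ w, D.P x) ∧ (∀ x ∈ w, some (c x) = w.head?.map c) ∧ w.IsChain D.R
  s w := w.head?.bind D.s
  t w := w.getLast?.bind D.t
  O w w' := w.head?.map c ≠ w'.head?.map c

variable {D c}

theorem runs_grouping (hO : ∀ x y, c x ≠ c y → D.O x y) :
    Grouping D (D.runs c) (fun x => some (c x)) (fun w => w.head?.map c) id where
  O_of_ne x y h := hO x y fun h' => h (congrArg some h')
  O_iff _ _ _ _ := Iff.rfl
  good := fun w ⟨h1, h2, h3, h4⟩ => ⟨h1, fun x hx => ⟨h2 x hx, h3 x hx⟩, h4, rfl, rfl⟩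
  inj _ _ _ _ h := h
  surj i w hw h hc := by
    obtain ⟨x, w, rfl⟩ := List.exists_cons_of_ne_nil hw
    exact ⟨x :: w, ⟨hw, fun y hy => (h y hy).1,
      fun y hy => (h y hy).2.trans (h x (by simp)).2.symm, hc⟩, rfl⟩

theorem runs_isAlternating (hs : ∀ x, D.P x → ∃ v, D.s x = some v)
    (ht : ∀ x, D.P x → ∃ v, D.t x = some v) :
    (D.runs c).IsAlternating fun w => w.head?.map c where
  O_iff _ _ := Iff.rfl
  s_some w hw := by
    obtain ⟨x, w, rfl⟩ := List.exists_cons_of_ne_nil hw.1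
    exact hs x (hw.2.1 x (by simp))
  t_some w hw := by
    obtain ⟨w, x, rfl⟩ := w.eq_nil_or_concat.resolve_left hw.1
    obtain ⟨v, hv⟩ := ht x (hw.2.1 x (by simp))
    exact ⟨v, by simp [runs, hv]⟩

variable {k A B C : Type*} [Field k] [Fintype V] [Ring A] [Algebra k A] [Ring B] [Algebra k B]
  [Ring C] [Algebra k C] {f : (V → k) →ₐ[k] A} {g : (V → k) →ₐ[k] B}
  {ι : (V → k) →ₐ[k] C} {val : L → C}

theorem Located.runs (h : D.Located ι val) :
    (D.runs c).Located ι fun w => (w.map val).prod where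
  left w v hw hv := by
    obtain ⟨x, w, rfl⟩ := List.exists_cons_of_ne_nil hw.1
    rw [List.map_cons, List.prod_cons, ← mul_assoc, h.left x v (hw.2.1 x (by simp)) hv]
  right w v hw hv := by
    obtain ⟨w, x, rfl⟩ := w.eq_nil_or_concat.resolve_left hw.1
    rw [List.concat_eq_append, List.map_append, List.prod_append, List.map_singleton,
      List.prod_singleton, mul_assoc, h.right x v (hw.2.1 x (by simp)) (by simpa [PathData.runs] using hv)]

theorem evalPath_runs_bijective (hO : ∀ x y, c x ≠ c y → D.O x y)
    (h : Function.Bijective (D.evalPath ι val)) :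
    Function.Bijective ((D.runs c).evalPath ι fun w => (w.map val).prod) := by
  have : (D.runs c).evalPath ι (fun w => (w.map val).prod) = D.evalPath ι val ∘ₗ
      (Finsupp.domLCongr (runs_grouping hO).equiv).toLinearMap := by
    refine (Finsupp.basisSingleOne (R := k)).ext ?_
    rintro ⟨p, hp⟩
    have hp' := (runs_grouping hO).isPath hp
    rw [← vec_of hp, evalPath_vec hp, vec_of hp, Finsupp.coe_basisSingleOne, LinearMap.comp_apply,
      LinearEquiv.coe_coe, Finsupp.domLCongr_single]
    have h2 := evalPath_vec (ι := ι) (val := val) hp'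
    rw [vec_of hp', Finsupp.coe_basisSingleOne] at h2
    refine Eq.trans ?_ h2.symm
    congr 1
    simp only [List.flatMap_id, List.map_flatten, List.prod_flatten, List.map_map]
    rfl
  rw [this]
  exact h.comp (LinearEquiv.bijective _)

theorem BasedAlg.mem_compl {col : L → κ} {d : κ} (α : D.BasedAlg col d f) {a : A}
    (h : ∀ i, α.basis.repr a (Sum.inl i) = 0) : a ∈ α.compl := by
  rw [BasedAlg.compl, Set.range_comp' α.basis Sum.inr, Basis.mem_span_image]
  rintro (i | x) hx
  · exact absurd (h i) (Finsupp.mem_support_iff.1 hx)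
  · exact ⟨x, rfl⟩

theorem exists_freeVal {col : L → κ} {d d' : κ} (α : D.BasedAlg col d f) (β : D.BasedAlg col d' g)
    (hne : d ≠ d') : ∃ valF : L → FreeProd f g,
      (∀ x, FreeProd.inl f g (α.basis (Sum.inr x)) = valF x.1) ∧
      ∀ x, FreeProd.inr f g (β.basis (Sum.inr x)) = valF x.1 := by
  classical
  refine ⟨fun x => if h : D.P x ∧ col x = d then FreeProd.inl f g (α.basis (Sum.inr ⟨x, h⟩)) else
    if h : D.P x ∧ col x = d' then FreeProd.inr f g (β.basis (Sum.inr ⟨x, h⟩)) else 0,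
    fun x => ?_, fun x => ?_⟩
  · dsimp only
    rw [dif_pos x.2]
  dsimp only
  rw [dif_neg fun h => hne (h.2.symm.trans x.2.2), dif_pos x.2]

end Runs

end PathData

/-! ### The strong free product property in the adapted case -/

section Adapted

variable {k : Type*} [Field k] {V E : Type*} [Fintype V] {Q : ArrowQuiver V E}
  {n : ℕ} {z : Q.Cycle n} {F : Set (z.arrowsᶜ : Set E)}

/-- Is the block a power of `r` or `r'`? -/
def Block.isPow (b : Block z) : Bool := b.kind = 2

variable (z F) in
/-- The alternating words, with consecutive blocks of the first two kinds merged. -/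
abbrev runPath : PathData V (List (Block z)) := (blockPath z F Set.univ).runs Block.isPow

variable (z) in
/-- Is the run a power of `r` or `r'`? -/
abbrev runColor (w : List (Block z)) : Option Bool := w.head?.map Block.isPow

theorem runPath_false {w : List (Block z)} :
    (runPath z F).P w ∧ runColor z w = some false ↔ w ≠ [] ∧
      (∀ b ∈ w, (blockPath z F {0, 1}).P b) ∧ w.IsChain (blockPath z F {0, 1}).R := by
  have h2 : ∀ i : Fin 3, i ∈ ({0, 1} : Set (Fin 3)) ↔ ¬ i = 2 := by
    intro i
    fin_cases i <;> simp
  constructor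
  · rintro ⟨⟨h1, h2', h3, h4⟩, h5⟩
    refine ⟨h1, fun b hb => ⟨(h2' b hb).1, (h2 _).2 ?_⟩, h4⟩
    exact of_decide_eq_false (Option.some_injective _ ((h3 b hb).trans h5))
  · rintro ⟨h1, h3, h4⟩
    have h : ∀ b ∈ w, b.isPow = false := fun b hb => decide_eq_false ((h2 _).1 (h3 b hb).2)
    obtain ⟨x, w, rfl⟩ := List.exists_cons_of_ne_nil h1
    exact ⟨⟨h1, fun b hb => ⟨(h3 b hb).1, trivial⟩, fun b hb => by
      rw [h b hb, List.head?_cons, Option.map_some, h x (by simp)], h4⟩,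
      congrArg some (h x (by simp))⟩

theorem runPath_true {w : List (Block z)} (h : (runPath z F).P w) (hc : runColor z w = some true) :
    ∃ i m, m ≠ 0 ∧ w = [.pow i m] := by
  obtain ⟨h1, h2, h3, h4⟩ := h
  have h : ∀ b ∈ w, b.kind = 2 := fun b hb =>
    of_decide_eq_true (Option.some_injective _ ((h3 b hb).trans hc))
  obtain _ | ⟨b, _ | ⟨b', w⟩⟩ := w
  · exact absurd rfl h1
  · obtain ⟨i, m, l⟩ | w | ⟨i, m⟩ := b
    · exact absurd (h _ List.mem_cons_self) (by decide : (0 : Fin 3) ≠ 2)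
    · exact absurd (h _ List.mem_cons_self) (by decide : (1 : Fin 3) ≠ 2)
    · exact ⟨i, m, (h2 _ List.mem_cons_self).1, rfl⟩
  · exact absurd ((h b (by simp)).trans (h b' (by simp)).symm) (List.isChain_cons_cons.1 h4).1.2

variable (z F) in
/-- The index of a basis element of the localized polynomial ring: an idempotent, or the word formed
by a power of `r` or `r'`. -/
def powRunFun (p : Σ _ : V, ℤ) : V ⊕ {w // (runPath z F).P w ∧ runColor z w = some true} :=
  if h : p.2 = 0 then Sum.inl p.1 else
    Sum.inr ⟨[.pow p.1 p.2], ⟨by simp, by simpa using ⟨h, trivial⟩, by simp,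
      List.isChain_singleton _⟩, rfl⟩

theorem powRunFun_bijective : Function.Bijective (powRunFun z F) := by
  constructor
  · rintro ⟨i, m⟩ ⟨i', m'⟩ h
    unfold powRunFun at h
    split_ifs at h with h1 h2 h2
    · obtain rfl : m = 0 := h1
      obtain rfl : m' = 0 := h2
      obtain rfl : i = i' := Sum.inl_injective h
      rfl
    · have := congrArg Subtype.val (Sum.inr_injective h)
      simp only [List.cons.injEq, Block.pow.injEq, and_true] at this
      rw [this.1, this.2]
  · rintro (i | ⟨w, hP, hc⟩)
    · exact ⟨⟨i, 0⟩, dif_pos rfl⟩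
    · obtain ⟨i, m, hm, rfl⟩ := runPath_true hP hc
      exact ⟨⟨i, m⟩, dif_neg hm⟩

variable (z F) in
/-- The indexing of the basis of the localized polynomial ring by idempotents and words. -/
def powRun : (Σ _ : V, ℤ) ≃ V ⊕ {w // (runPath z F).P w ∧ runColor z w = some true} :=
  Equiv.ofBijective _ powRunFun_bijective

theorem powRun_zero (i : V) : powRun z F ⟨i, 0⟩ = Sum.inl i :=
  show powRunFun z F ⟨i, 0⟩ = _ from dif_pos rfl

theorem powRun_of_ne (i : V) {m : ℤ} (hm : m ≠ 0) :
    ∃ h, powRun z F ⟨i, m⟩ = Sum.inr ⟨[.pow i m], h⟩ := ⟨_, dif_neg hm⟩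

theorem exists_basedAlg_loc (q : V → kˣ) :
    ∃ β : (runPath z F).BasedAlg (runColor z) (some true) (LocPoly.base k (locPt q)),
      (∀ (x : {w // (runPath z F).P w ∧ runColor z w = some true}) i m, x.1 = [.pow i m] →
        β.basis (Sum.inr x) = locBasis q ⟨i, m⟩) ∧
      ∀ b ∈ Ideal.span {LocPoly.t (locPt q)}, b ∈ β.compl := by
  have hi : ∀ i, (locBasis q).reindex (powRun z F) (Sum.inl i) = locBasis q ⟨i, 0⟩ := fun i => by
    rw [Basis.reindex_apply, ← powRun_zero, Equiv.symm_apply_apply]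
  have hx : ∀ (x : {w // (runPath z F).P w ∧ runColor z w = some true}) i m, x.1 = [.pow i m] →
      (locBasis q).reindex (powRun z F) (Sum.inr x) = locBasis q ⟨i, m⟩ := by
    rintro ⟨w, hw⟩ i m (rfl : w = _)
    obtain ⟨h, h'⟩ := powRun_of_ne (z := z) (F := F) i (m := m) (hw.1.2.1 _ List.mem_cons_self).1
    rw [Basis.reindex_apply, ← h', Equiv.symm_apply_apply]
  refine ⟨⟨(locBasis q).reindex (powRun z F), fun i => ?_, ?_, ?_⟩, hx, fun b hb =>
    BasedAlg.mem_compl _ fun i => ?_⟩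
  · rw [hi, locBasis_apply, shiftedBasis_apply]
    simp [signedPow]
  · rintro ⟨w, hw⟩ v hv
    obtain ⟨i, m, hm, rfl⟩ := runPath_true hw.1 hw.2
    obtain rfl : i = v := Option.some_injective _ hv
    rw [hx _ _ _ rfl, locBasis_apply, ← mul_assoc, (vertexIdem_idem _).idem]
  · rintro ⟨w, hw⟩ v hv
    obtain ⟨i, m, hm, rfl⟩ := runPath_true hw.1 hw.2
    obtain rfl : i = v := Option.some_injective _ hv
    rw [hx _ _ _ rfl, mul_comm, locBasis_apply, ← mul_assoc, (vertexIdem_idem _).idem]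
  · change ((locBasis q).reindex (powRun z F)).repr b (Sum.inl i) = 0
    rw [Basis.repr_reindex_apply, ← powRun_zero, Equiv.symm_apply_apply]
    exact locBasis_repr_zero q hb i

theorem vertexMap_commute_rho [Finite E] [LinearOrder (DArrow E)] (s : V → k) :
    Commute (vertexMap k Q s) (rho k Q : LAlg k Q) := by
  rw [map_eq_sum_vertexIdem]
  refine Commute.sum_left _ _ _ fun i _ => Commute.smul_left ?_ _
  rw [vertexIdem_vertexMap]
  exact e_commute_rho i

variable [Finite E] [LinearOrder (DArrow E)] [NeZero n]
  (q : V → kˣ) (bar : Bool) (hF : (Q.restrict z.arrowsᶜ).IsRootedForest z.verts F)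
  (ho : z.Oriented) (ha : z.Adapted)
include hF ho ha

/-- The section sends each word to the same word. -/
theorem exists_section_words : ∃ σ : Lam Q q →ₗ[k] LAlg k Q,
    StrongFreeProduct (vertexMap k Q) (rel Q q) σ (locPt q) ∧
    ∀ p : AltWord₀ z F, σ (proj k _ (wordVal q bar p.1)) = wordVal q bar p.1 := by
  obtain ⟨b, hb⟩ := exists_basis_lam q bar hF ho ha
  let σ : Lam Q q →ₗ[k] LAlg k Q := b.constr k fun p => wordVal q bar p.1
  have hσ : ∀ p, σ (b p) = wordVal q bar p.1 := fun p => b.constr_basis k _ p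
  have hloc := located_block (k := k) (q := q) ho bar F
  have hval : ∀ p : V × List (Block z), wordVal q bar p =
      vertexIdem (vertexMap k Q) p.1 * (p.2.map (Block.val q bar)).prod := fun p => by
    rw [vertexIdem_vertexMap, wordVal]
  have hσi : ∀ i, σ (vertexIdem (Lam.base Q q) i) = vertexIdem (vertexMap k Q) i := fun i => by
    have h1 := hσ ⟨(i, []), isPath_nil i⟩
    rw [hb, proj_wordVal, hval] at h1
    simpa using h1
  have hσΩ : ∀ w, σ ((blockPath z F {0, 1}).evalPath (Lam.base Q q)
      (fun x => proj k (rel Q q) (x.val q bar)) w) =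
      (blockPath z F {0, 1}).evalPath (vertexMap k Q) (Block.val q bar) w := by
    refine LinearMap.congr_fun (f := σ ∘ₗ _) (hom_ext_vec fun p hp => ?_)
    rw [LinearMap.comp_apply, evalPath_vec hp, evalPath_vec hp, ← proj_wordVal, ← hval]
    exact (congrArg σ (hb ⟨p, hp⟩)).symm.trans (hσ ⟨p, hp⟩)
  have hbi := bimodule_of_evalPath (block_isAlternating F {0, 1}) (located_block_lam ho bar F q _)
    (hloc {0, 1}) (bijective_evalPath_lam q bar hF ho ha).surjective hσΩ
  -- the two based algebras
  have halt : (runPath z F).IsAlternating (runColor z) :=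
    runs_isAlternating (block_isAlternating F Set.univ).s_some (block_isAlternating F Set.univ).t_some
  have hv : ∀ x : {w // (runPath z F).P w ∧ runColor z w = some false},
    ∃ v, (runPath z F).s x.1 = some v := fun x => halt.s_some x.1 x.2.1
  choose v hv using hv
  have hpath : ∀ x, (blockPath z F {0, 1}).IsPath (v x, x.1) := fun x => by
    obtain ⟨h1, h2, h3⟩ := runPath_false.1 x.2
    exact ⟨h2, fun y hy => by
      have h := hv x
      change x.1.head?.bind Block.src = some (v x) at h
      rwa [Option.mem_def.1 hy] at h, h3⟩
  let eqv := splitEquiv (D := blockPath z F {0, 1}) Subtype.val v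
    (fun x => ⟨(runPath_false.1 x.2).1, hpath x⟩) Subtype.val_injective
    fun u w hw h => ⟨⟨w, runPath_false.2 ⟨hw, h.1, h.2.2⟩⟩, rfl⟩
  have hbi' : ∀ i, b.reindex eqv.symm (Sum.inl i) = vertexIdem (Lam.base Q q) i := fun i => by
    rw [Basis.reindex_apply]
    refine (hb _).trans ((proj_wordVal q bar _).trans ?_)
    exact mul_one _
  have hbx : ∀ x, b.reindex eqv.symm (Sum.inr x) = b ⟨(v x, x.1), hpath x⟩ := fun x =>
    Basis.reindex_apply _ _ _
  have hlocr := (hloc Set.univ).runs (c := Block.isPow)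
  have hlocl : (runPath z F).Located (Lam.base Q q) _ :=
    ((located_block_lam ho bar F q Set.univ).runs (c := Block.isPow))
  have hwl : ∀ x, b ⟨(v x, x.1), hpath x⟩ =
      (x.1.map fun x => proj k (rel Q q) (x.val q bar)).prod := fun x => by
    rw [hb, proj_wordVal]
    exact hlocl.left _ _ x.2.1 (hv x)
  let α : (runPath z F).BasedAlg (runColor z) (some false) (Lam.base Q q) :=
    ⟨b.reindex eqv.symm, hbi', fun x u hu => by
      rw [hbx, hwl]; exact hlocl.left _ _ x.2.1 hu, fun x u hu => by
      rw [hbx, hwl]; exact hlocl.right _ _ x.2.1 hu⟩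
  have hαx : ∀ x, σ (α.basis (Sum.inr x)) = (x.1.map (Block.val q bar)).prod := fun x => by
    refine (congrArg σ (hbx x)).trans ((hσ _).trans ((hval _).trans ?_))
    exact hlocr.left _ _ x.2.1 (hv x)
  obtain ⟨β, hβ, hT⟩ := exists_basedAlg_loc (z := z) (F := F) q
  have hne : (some false : Option Bool) ≠ some true := by decide
  obtain ⟨valF, hl, hr⟩ := exists_freeVal α β hne
  have hbij := evalPath_runs_bijective (c := Block.isPow)
    (fun x y (h : x.isPow ≠ y.isPow) h' => h (by rw [Block.isPow, Block.isPow, h']))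
    (bijective_evalPath_lAlg q bar hF ho ha)
  let τ := locHom q (vertexMap k Q) (rho k Q) vertexMap_commute_rho
  have hτx : ∀ x, τ (β.basis (Sum.inr x)) = (x.1.map (Block.val q bar)).prod := fun x => by
    obtain ⟨i, m, hm, hx⟩ := runPath_true x.2.1 x.2.2
    rw [hβ x i m hx, hx]
    refine (locHom_basis q _ _ _ i m).trans ?_
    rw [vertexIdem_vertexMap, ← e_mul_signedPow_rel]
    exact (mul_one _).symm
  have hcd : ∀ w, (runPath z F).P w → runColor z w = some false ∨ runColor z w = some true := by
    intro w hw
    obtain ⟨x, w, rfl⟩ := List.exists_cons_of_ne_nil hw.1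
    rcases h : x.isPow
    · exact Or.inl (congrArg some h)
    · exact Or.inr (congrArg some h)
  refine ⟨σ, ⟨⟨fun x => ?_, ?_, fun s x => (hbi s x).1, fun s x => (hbi s x).2⟩, τ,
    locHom_base q _ _ _, locHom_t q _ _ _, freeEquiv halt α β hcd hl hr hbij, ?_⟩, fun p => ?_⟩
  · have : (proj k (rel Q q)).toLinearMap ∘ₗ σ = LinearMap.id := b.ext fun p => by
      rw [LinearMap.comp_apply, hσ, LinearMap.id_apply, hb]
      rfl
    exact LinearMap.congr_fun this x
  · rw [← (vertexIdem_idem (Lam.base Q q)).complete, map_sum,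
      ← (vertexIdem_idem (vertexMap k Q)).complete]
    exact Finset.sum_congr rfl fun i _ => hσi i
  · exact freeEquiv_prod halt α β hcd hl hr hbij hne σ τ hσi hαx
      (fun i => locHom_base q _ _ _ _) hτx (T := (Ideal.span {LocPoly.t (locPt q)} : Set _)) hT
      (fun a ha b => Ideal.mul_mem_right b _ ha) hlocr
  · have hp := (isAltWord₀_iff F p.1).1 p.2
    exact (congrArg σ (hb ⟨p.1, hp⟩)).symm.trans (hσ ⟨p.1, hp⟩)

end Adapted

open WordData.LetterSetup

/-! ### Independence of the orientation and of the order -/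

section Reorient

variable {k : Type*} [Field k] {V E : Type*} [Fintype V] {Q Q' Q'' : ArrowQuiver V E}

/-- The quivers have the same arrows up to the orientation of the arrows in `X`. -/
def IsFlip (X : Set E) (Q Q' : ArrowQuiver V E) : Prop :=
  ∀ a, (a ∈ X → Q'.tail a = Q.head a ∧ Q'.head a = Q.tail a) ∧
    (a ∉ X → Q'.tail a = Q.tail a ∧ Q'.head a = Q.head a)

open Classical in
/-- The exchange of `a` and `a*` for `a ∈ X`. -/
def flipArrow (X : Set E) (a : DArrow E) : DArrow E := if a.arrow ∈ X then a.star else a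

theorem IsFlip.symm {X : Set E} (h : IsFlip X Q Q') : IsFlip X Q' Q := fun a =>
  ⟨fun ha => ⟨((h a).1 ha).2.symm, ((h a).1 ha).1.symm⟩,
    fun ha => ⟨((h a).2 ha).1.symm, ((h a).2 ha).2.symm⟩⟩

theorem IsFlip.dtail {X : Set E} (h : IsFlip X Q Q') (a : DArrow E) :
    Q.dtail a = Q'.dtail (flipArrow X a) := by
  obtain ⟨a, p⟩ := a
  by_cases ha : a ∈ X
  · rw [flipArrow, if_pos ha]
    cases p <;> simp [ArrowQuiver.dtail, DArrow.star, ((h a).1 ha).1, ((h a).1 ha).2]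
  · rw [flipArrow, if_neg ha]
    cases p <;> simp [ArrowQuiver.dtail, ((h a).2 ha).1, ((h a).2 ha).2]

theorem flipArrow_star (X : Set E) (a : DArrow E) : flipArrow X a.star = (flipArrow X a).star := by
  by_cases ha : a.arrow ∈ X
  · rw [flipArrow, flipArrow, if_pos ha, if_pos (show a.star.arrow ∈ X from ha)]
  · rw [flipArrow, flipArrow, if_neg ha, if_neg (show a.star.arrow ∉ X from ha)]

theorem flipArrow_flipArrow (X : Set E) (a : DArrow E) : flipArrow X (flipArrow X a) = a := by
  by_cases ha : a.arrow ∈ X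
  · rw [flipArrow, flipArrow, if_pos ha, if_pos (show a.star.arrow ∈ X from ha), DArrow.star_star]
  · rw [flipArrow, flipArrow, if_neg ha, if_neg ha]

theorem IsFlip.dhead {X : Set E} (h : IsFlip X Q Q') (a : DArrow E) :
    Q.dhead a = Q'.dhead (flipArrow X a) := by
  rw [← Q.dtail_star, h.dtail, flipArrow_star, Q'.dtail_star]

theorem sign_star (a : DArrow E) : a.star.sign = -a.sign := by
  obtain ⟨a, _ | _⟩ := a <;> rfl

variable (k Q) in
theorem g_inv_val (a : DArrow E) : (↑(g k Q a)⁻¹ : LAlg k Q) =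
    1 + (↑(-(g k Q a)⁻¹) : LAlg k Q) * (ar k Q a * ar k Q a.star) := by
  have h := (g k Q a).inv_mul
  rw [g_val, mul_add, mul_one] at h
  rw [Units.val_neg, neg_mul]
  exact eq_add_neg_of_add_eq h

open Classical in
/-- For `a ∈ X`, one of the arrows `a`, `a*` is mapped to the other one, and the images of `1 + a a*`
and `1 + a* a` are inverse to the corresponding elements of the target. -/
def flipRep {X : Set E} (h : IsFlip X Q Q') (p : Bool) : QRep k Q (LAlg k Q') where
  vert := e k Q'
  arr a := if a.arrow ∈ X ∧ a.pos ≠ p then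
      (↑(-(g k Q' (flipArrow X a))⁻¹) : LAlg k Q') * ar k Q' (flipArrow X a)
    else ar k Q' (flipArrow X a)
  unit a := if a.arrow ∈ X then (g k Q' (flipArrow X a))⁻¹ else g k Q' (flipArrow X a)
  idem := e_idem k Q'
  tail a := by
    rw [h.dtail]
    split_ifs
    · rw [Units.val_neg, neg_mul, mul_neg, ← mul_assoc,
        ((commute_of_mem_locAt (e_idem k Q') (g_mem_locAt _) _).units_inv_right).eq, mul_assoc,
        e_mul_ar]
    · exact e_mul_ar _ _ _
  head a := by
    rw [h.dhead]
    split_ifs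
    · rw [mul_assoc, ar_mul_e]
    · exact ar_mul_e _ _ _
  unit_eq a := by
    rw [flipArrow_star]
    by_cases ha : a.arrow ∈ X
    · have ha' : a.star.arrow ∈ X := ha
      by_cases hp : a.pos = p
      · have hp' : a.star.pos ≠ p := by simp [DArrow.star, hp]
        have := ar_mul_g_inv k Q' (flipArrow X a)
        rw [if_pos ha, if_neg (fun h => h.2 hp), if_pos ⟨ha', hp'⟩]
        refine (g_inv_val k Q' _).trans ?_
        rw [← mul_assoc, ← mul_assoc, Units.val_neg, Units.val_neg, mul_neg, this, neg_mul]
      · have hp' : ¬ a.star.pos ≠ p := by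
          rw [not_not]
          simp only [DArrow.star]
          cases h1 : a.pos <;> cases p <;> simp_all
        rw [if_pos ha, if_pos ⟨ha, hp⟩, if_neg (fun h => hp' h.2), mul_assoc]
        exact g_inv_val k Q' _
    · rw [if_neg ha, if_neg (fun h => ha h.1), if_neg (fun h => ha h.1), g_val]

theorem flipRep_g {X : Set E} (h : IsFlip X Q Q') (p : Bool) (a : DArrow E) :
    Units.map ((flipRep (k := k) h p).toHom : LAlg k Q →* LAlg k Q') (g k Q a ^ a.sign) =
      g k Q' (flipArrow X a) ^ (flipArrow X a).sign := by
  classical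
  rw [map_zpow, QRep.map_g, flipRep]
  by_cases ha : a.arrow ∈ X
  · simp only [if_pos ha]
    rw [inv_zpow', ← sign_star, flipArrow, if_pos ha]
  · simp only [if_neg ha]
    rw [flipArrow, if_neg ha]

theorem flipRep_comp {X : Set E} (h : IsFlip X Q Q') (p : Bool) :
    (flipRep (k := k) h.symm !p).toHom.comp (flipRep h p).toHom = AlgHom.id k (LAlg k Q) := by
  classical
  refine LAlg.hom_ext (fun i => ?_) fun a => ?_
  · rw [AlgHom.comp_apply, QRep.toHom_e]
    exact QRep.toHom_e _ i
  have hf := flipArrow_flipArrow X a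
  have hg := QRep.toHom_g_inv (flipRep (k := k) h.symm !p) (flipArrow X a)
  have har := QRep.toHom_ar (flipRep (k := k) h.symm !p) (flipArrow X a)
  rw [AlgHom.comp_apply, QRep.toHom_ar]
  by_cases ha : a.arrow ∈ X
  · have hfa : flipArrow X a = a.star := if_pos ha
    have ha' : (flipArrow X a).arrow ∈ X := by rw [hfa]; exact ha
    by_cases hp : a.pos = p
    · have hp' : ¬ (flipArrow X a).pos ≠ !p := by simp [hfa, DArrow.star, hp]
      simp only [flipRep, if_neg (fun h : a.arrow ∈ X ∧ a.pos ≠ p => h.2 hp)]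
      simp only [flipRep, if_neg (fun h : (flipArrow X a).arrow ∈ X ∧ _ => hp' h.2), hf] at har
      exact har
    · have hp' : (flipArrow X a).pos ≠ !p := by simpa [hfa, DArrow.star] using hp
      simp only [flipRep, if_pos (And.intro ha hp)]
      simp only [flipRep, if_pos (And.intro ha' hp'), hf] at har
      simp only [flipRep, if_pos ha', hf, inv_inv] at hg
      rw [map_mul, Units.val_neg, map_neg]
      refine (congrArg₂ (· * ·) (neg_inj.2 hg) har).trans ?_
      rw [Units.val_neg, neg_mul, neg_mul, mul_neg, neg_neg, Units.mul_inv_cancel_left]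
      rfl
  · simp only [flipRep, if_neg (fun h : a.arrow ∈ X ∧ _ => ha h.1)]
    have ha' : ¬ (flipArrow X a).arrow ∈ X := by rwa [flipArrow, if_neg ha]
    simp only [flipRep, if_neg (fun h : (flipArrow X a).arrow ∈ X ∧ _ => ha' h.1), hf] at har
    exact har

variable (k) in
/-- There is an isomorphism between the algebras `L_Q` over the ring of functions on the vertices
which maps the product over the first list to the product over the second one. -/
def RhoEquiv (Q Q' : ArrowQuiver V E) (l l' : List (DArrow E)) : Prop :=
  ∃ θ : LAlg k Q ≃ₐ[k] LAlg k Q', (∀ i, θ (e k Q i) = e k Q' i) ∧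
    θ (rhoL k l Q : LAlg k Q) = rhoL k l' Q'

theorem RhoEquiv.refl (l : List (DArrow E)) : RhoEquiv k Q Q l l :=
  ⟨AlgEquiv.refl, fun _ => rfl, rfl⟩

theorem RhoEquiv.trans {l l' l'' : List (DArrow E)} :
    RhoEquiv k Q Q' l l' → RhoEquiv k Q' Q'' l' l'' → RhoEquiv k Q Q'' l l'' :=
  fun ⟨θ, h1, h2⟩ ⟨θ', h3, h4⟩ => ⟨θ.trans θ', fun i => (congrArg θ' (h1 i)).trans (h3 i),
    (congrArg θ' h2).trans h4⟩

theorem map_rhoL {B : Type*} [Ring B] [Algebra k B] (θ : LAlg k Q →ₐ[k] B) (l : List (DArrow E)) :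
    θ (rhoL k l Q : LAlg k Q) =
      (((l.map fun a => Units.map (θ : LAlg k Q →* B) (g k Q a ^ a.sign)).prod : Bˣ) : B) := by
  change ((Units.map (θ : LAlg k Q →* B) (rhoL k l Q) : Bˣ) : B) = _
  rw [rhoL, map_list_prod, List.map_map]
  rfl

theorem rhoEquiv_flip {X : Set E} (h : IsFlip X Q Q') (l : List (DArrow E)) :
    RhoEquiv k Q Q' l (l.map (flipArrow X)) := by
  refine ⟨AlgEquiv.ofAlgHom (flipRep h true).toHom (flipRep h.symm false).toHom
    (flipRep_comp h.symm false) (flipRep_comp h true), fun i => QRep.toHom_e _ i, ?_⟩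
  refine (map_rhoL (flipRep h true).toHom l).trans ?_
  simp only [flipRep_g]
  rw [rhoL, List.map_map]
  rfl

open Classical in
/-- The arrow `b` is conjugated by a power of `1 + a a*`, where `a` has the same tail. -/
def twistRep (Q : ArrowQuiver V E) {a b : DArrow E} (h : Q.dtail a = Q.dtail b) (m : ℤ) :
    QRep k Q (LAlg k Q) where
  vert := e k Q
  arr c := if c = b then (↑(g k Q a ^ (-m)) : LAlg k Q) * ar k Q b else
    if c = b.star then ar k Q b.star * (↑(g k Q a ^ m) : LAlg k Q) else ar k Q c
  unit c := if c = b then g k Q a ^ (-m) * g k Q b * g k Q a ^ m else g k Q c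
  idem := e_idem k Q
  tail c := by
    split_ifs with h1 h2
    · subst h1
      rw [← h, ← mul_assoc, (commute_of_mem_locAt (e_idem k Q)
        (Subgroup.zpow_mem _ (g_mem_locAt a) (-m)) (Q.dtail a)).eq, mul_assoc, h, e_mul_ar]
    · subst h2
      rw [← mul_assoc, e_mul_ar]
    · exact e_mul_ar _ _ _
  head c := by
    split_ifs with h1 h2
    · subst h1
      rw [mul_assoc, ar_mul_e]
    · subst h2
      have hc := (commute_of_mem_locAt (e_idem k Q)
        (Subgroup.zpow_mem _ (g_mem_locAt a) m) (Q.dtail a)).eq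
      have har := ar_mul_e k Q b.star
      rw [Q.dhead_star, ← h] at har ⊢
      rw [mul_assoc, ← hc, ← mul_assoc, har]
    · exact ar_mul_e _ _ _
  unit_eq c := by
    by_cases h1 : c = b
    · subst h1
      rw [if_pos rfl, if_pos rfl, if_neg c.star_ne, if_pos rfl, Units.val_mul, Units.val_mul, g_val,
        mul_add, add_mul, mul_one, ← Units.val_mul, zpow_neg, inv_mul_cancel, Units.val_one]
      simp only [mul_assoc]
    · by_cases h2 : c = b.star
      · subst h2
        rw [if_neg h1, if_neg h1, if_pos rfl, DArrow.star_star, if_pos rfl, mul_assoc,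
          ← mul_assoc _ _ (ar k Q b), zpow_neg, Units.mul_inv, one_mul, g_val, DArrow.star_star]
      · rw [if_neg h1, if_neg h1, if_neg h2, if_neg, if_neg, g_val]
        · exact fun h3 => h1 (by rw [← c.star_star, h3, DArrow.star_star])
        · exact fun h3 => h2 (by rw [← h3, DArrow.star_star])

theorem twistRep_g_of_ne {a b : DArrow E} (h : Q.dtail a = Q.dtail b) (m : ℤ) {c : DArrow E}
    (hc : c ≠ b) : Units.map ((twistRep (k := k) Q h m).toHom : LAlg k Q →* LAlg k Q) (g k Q c) =
      g k Q c := by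
  rw [QRep.map_g]
  exact if_neg hc

theorem twistRep_comp {a b : DArrow E} (h : Q.dtail a = Q.dtail b) (hab : a ≠ b) (m m' : ℤ)
    (hm : m' = -m) : (twistRep (k := k) Q h m').toHom.comp (twistRep Q h m).toHom =
      AlgHom.id k (LAlg k Q) := by
  subst hm
  have hg : ∀ j : ℤ, (twistRep (k := k) Q h (-m)).toHom (↑(g k Q a ^ j) : LAlg k Q) =
      (↑(g k Q a ^ j) : LAlg k Q) := fun j => by
    have := twistRep_g_of_ne (k := k) h (-m) hab
    have h2 := congrArg (fun u : (LAlg k Q)ˣ => (↑(u ^ j) : LAlg k Q)) this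
    rwa [← map_zpow] at h2
  refine LAlg.hom_ext (fun i => ?_) fun c => ?_
  · rw [AlgHom.comp_apply, QRep.toHom_e]
    exact QRep.toHom_e _ i
  · rw [AlgHom.comp_apply, QRep.toHom_ar]
    have har := QRep.toHom_ar (twistRep (k := k) Q h (-m)) c
    by_cases h1 : c = b
    · subst h1
      simp only [twistRep, if_pos] at har ⊢
      refine (map_mul _ _ _).trans ((congrArg₂ _ (hg _) har).trans ?_)
      rw [zpow_neg, zpow_neg, zpow_neg, inv_inv, Units.inv_mul_cancel_left]
      rfl
    · by_cases h2 : c = b.star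
      · subst h2
        simp only [twistRep, if_neg h1, if_pos] at har ⊢
        refine (map_mul _ _ _).trans ((congrArg₂ _ har (hg _)).trans ?_)
        rw [zpow_neg, mul_assoc, Units.inv_mul, mul_one]
        rfl
      · simp only [twistRep, if_neg h1, if_neg h2] at har ⊢
        exact har

theorem map_rhoL_eq (θ : LAlg k Q →ₐ[k] LAlg k Q) (l : List (DArrow E))
    (h : ∀ c ∈ l, Units.map (θ : LAlg k Q →* LAlg k Q) (g k Q c) = g k Q c) :
    θ (rhoL k l Q : LAlg k Q) = rhoL k l Q := by
  rw [map_rhoL, rhoL]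
  congr 2
  exact List.map_congr_left fun c hc => by rw [map_zpow, h c hc]

/-- An exchange of neighbours: of commuting factors, of `a` and `a*`, or of `a` and `b` with the same
tail, where `1 + b b*` is conjugated by `(1 + a a*)^{±1}`. -/
theorem rhoEquiv_swap (l₁ l₂ : List (DArrow E)) {a b : DArrow E} (hn : (l₁ ++ a :: b :: l₂).Nodup) :
    RhoEquiv k Q Q (l₁ ++ a :: b :: l₂) (l₁ ++ b :: a :: l₂) := by
  have hrho : ∀ a b : DArrow E, (rhoL k (l₁ ++ a :: b :: l₂) Q : LAlg k Q) =
      rhoL k l₁ Q * ((↑(g k Q a ^ a.sign * g k Q b ^ b.sign) : LAlg k Q) *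
        rhoL k l₂ Q) := fun a b => by
    rw [← Units.val_mul, ← Units.val_mul]
    congr 1
    simp only [rhoL, List.map_append, List.prod_append, List.map_cons, List.prod_cons, mul_assoc]
  replace hn := (List.perm_middle.trans (List.perm_middle.cons a)).nodup_iff.1 hn
  simp only [List.nodup_cons, List.mem_cons, not_or] at hn
  obtain ⟨⟨hab, ha⟩, hb, -⟩ := hn
  have hne : ∀ c ∈ l₁ ++ l₂, c ≠ a ∧ c ≠ b := fun c hc => ⟨fun h => ha (h ▸ hc), fun h => hb (h ▸ hc)⟩
  by_cases ht : Q.dtail a = Q.dtail b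
  · by_cases hs : b = a.star
    · -- an exchange of `a` and `a*` for a loop `a` is undone by the reversal of `a`
      have hf : IsFlip {a.arrow} Q Q := by
        have hl : Q.tail a.arrow = Q.head a.arrow := by
          rw [hs, Q.dtail_star] at ht
          obtain ⟨a, _ | _⟩ := a
          · exact ht.symm
          · exact ht
        intro c
        refine ⟨?_, fun _ => ⟨rfl, rfl⟩⟩
        rintro rfl
        exact ⟨hl, hl.symm⟩
      have hfa : flipArrow {a.arrow} a = b := by rw [hs, flipArrow, if_pos (Set.mem_singleton _)]
      have hfb : flipArrow {a.arrow} b = a := by rw [← hfa, flipArrow_flipArrow]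
      have hfc : ∀ c ∈ l₁ ++ l₂, flipArrow {a.arrow} c = c := fun c hc => by
        rw [flipArrow, if_neg]
        intro h
        have h' : c.arrow = a.arrow := h
        rcases hp : decide (c.pos = a.pos) with _ | _
        · exact (hne c hc).2 (hs ▸ DArrow.ext h' (by
            have := of_decide_eq_false hp
            simp only [DArrow.star]
            cases h1 : c.pos <;> cases h2 : a.pos <;> simp_all))
        · exact (hne c hc).1 (DArrow.ext h' (of_decide_eq_true hp))
      have h := rhoEquiv_flip (k := k) hf (l₁ ++ a :: b :: l₂)
      rwa [List.map_append, List.map_cons, List.map_cons, hfa, hfb,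
        List.map_congr_left fun c hc => hfc c (List.mem_append_left _ hc),
        List.map_congr_left fun c hc => hfc c (List.mem_append_right _ hc), List.map_id',
        List.map_id'] at h
    · refine ⟨AlgEquiv.ofAlgHom (twistRep Q ht a.sign).toHom (twistRep Q ht (-a.sign)).toHom
        (twistRep_comp ht hab _ _ (neg_neg _).symm) (twistRep_comp ht hab _ _ rfl),
        fun i => QRep.toHom_e _ i, ?_⟩
      change (twistRep Q ht a.sign).toHom _ = _
      rw [hrho, hrho, map_mul, map_mul, map_rhoL_eq _ _ fun c hc =>
        twistRep_g_of_ne ht _ (hne c (List.mem_append_left _ hc)).2, map_rhoL_eq _ _ fun c hc =>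
        twistRep_g_of_ne ht _ (hne c (List.mem_append_right _ hc)).2]
      have h1 : Units.map ((twistRep (k := k) Q ht a.sign).toHom : LAlg k Q →* LAlg k Q)
          (g k Q a ^ a.sign * g k Q b ^ b.sign) = g k Q b ^ b.sign * g k Q a ^ a.sign := by
        have h2 : Units.map ((twistRep (k := k) Q ht a.sign).toHom : LAlg k Q →* LAlg k Q)
            (g k Q b) = (g k Q a ^ a.sign)⁻¹ * g k Q b * g k Q a ^ a.sign := by
          rw [QRep.map_g, ← zpow_neg]
          exact if_pos rfl
        have h3 := conj_zpow (i := b.sign) (a := (g k Q a ^ a.sign)⁻¹) (b := g k Q b)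
        rw [inv_inv] at h3
        rw [map_mul, map_zpow, map_zpow, twistRep_g_of_ne ht _ hab, h2, h3]
        group
      rw [← congrArg Units.val h1]
      rfl
  · have hc : Commute (g k Q a ^ a.sign) (g k Q b ^ b.sign) := by
      refine Commute.zpow_zpow ?_ _ _
      ext
      apply eq_of_idem_mul (e_idem k Q)
      intro i
      have ha := commute_of_mem_locAt (e_idem k Q) (g_mem_locAt (k := k) (Q := Q) a) i
      have hb := commute_of_mem_locAt (e_idem k Q) (g_mem_locAt (k := k) (Q := Q) b) i
      rw [Units.val_mul, Units.val_mul]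
      by_cases hi : i = Q.dtail a
      · have h1 := g_mem_locAt (k := k) (Q := Q) b i (by rw [hi]; exact ht)
        rw [← mul_assoc, ha.eq, mul_assoc, h1.1, ← ha.eq, ← mul_assoc, h1.1]
      · have h1 := g_mem_locAt (k := k) (Q := Q) a i hi
        rw [← mul_assoc, h1.1, ← mul_assoc, hb.eq, mul_assoc, h1.1]
    refine ⟨AlgEquiv.refl, fun _ => rfl, ?_⟩
    rw [hrho, hrho, hc.eq]
    rfl

theorem rhoEquiv_perm {l l' : List (DArrow E)} (h : l.Perm l') (l₁ : List (DArrow E))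
    (hn : (l₁ ++ l).Nodup) : RhoEquiv k Q Q (l₁ ++ l) (l₁ ++ l') := by
  induction h generalizing l₁ with
  | nil => exact RhoEquiv.refl _
  | cons x _ ih =>
    have := ih (l₁ ++ [x]) (by simpa using hn)
    simpa using this
  | swap x y l => exact rhoEquiv_swap _ _ hn
  | trans h₁ _ ih₁ ih₂ =>
    exact (ih₁ l₁ hn).trans (ih₂ l₁ ((h₁.append_left l₁).nodup_iff.1 hn))

/-- The isomorphism between the algebras of two orientations of a quiver, for any orders. -/
theorem rhoEquiv_of_isFlip {X : Set E} (h : IsFlip X Q Q') {l l' : List (DArrow E)}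
    (hl : l.Nodup) (hl' : l'.Nodup) (hm : ∀ a, a ∈ l) (hm' : ∀ a, a ∈ l') :
    RhoEquiv k Q Q' l l' := by
  have hi : Function.Injective (flipArrow X) :=
    (show Function.Involutive _ from flipArrow_flipArrow X).injective
  refine (rhoEquiv_flip h l).trans (rhoEquiv_perm (l₁ := []) ?_ (hl.map hi))
  refine (List.perm_ext_iff_of_nodup (hl.map hi) hl').2 fun a => ⟨fun _ => hm' a, fun _ => ?_⟩
  exact List.mem_map.2 ⟨_, hm _, flipArrow_flipArrow X a⟩

end Reorient

/-! ### Transport along isomorphisms -/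

section Transport

variable {k V A B C A' B' C' : Type*} [Field k] [Ring A] [Algebra k A] [Ring B] [Algebra k B]
  [Ring C] [Algebra k C] [Ring A'] [Algebra k A'] [Ring B'] [Algebra k B'] [Ring C'] [Algebra k C']
  {f : (V → k) →ₐ[k] A} {g : (V → k) →ₐ[k] B} {ι : (V → k) →ₐ[k] C}
  {f' : (V → k) →ₐ[k] A'} {g' : (V → k) →ₐ[k] B'} {ι' : (V → k) →ₐ[k] C'}

/-- The homomorphism of quotients induced by a homomorphism. -/
def quotMap (θ : A →ₐ[k] A') {r : A} {r' : A'} (h : θ r = r') : Quot1 r →ₐ[k] Quot1 r' :=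
  quotLift k ((proj k r').comp θ) (by rw [AlgHom.comp_apply, h]; exact proj_self)

theorem quotMap_proj (θ : A →ₐ[k] A') {r : A} {r' : A'} (h : θ r = r') (x : A) :
    quotMap θ h (proj k r x) = proj k r' (θ x) := quotLift_proj _ _ _

theorem quotMap_comp (θ : A →ₐ[k] A') (θ' : A' →ₐ[k] A) {r : A} {r' : A'} (h : θ r = r')
    (h' : θ' r' = r) (hθ : ∀ x, θ' (θ x) = x) :
    (quotMap θ' h').comp (quotMap θ h) = AlgHom.id k _ := by
  refine AlgHom.ext fun x => ?_
  obtain ⟨x, rfl⟩ := proj_surjective (k := k) x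
  exact (congrArg _ (quotMap_proj θ h x)).trans
    ((quotMap_proj θ' h' _).trans (congrArg (proj k r) (hθ x)))

/-- The isomorphism of quotients induced by an isomorphism. -/
def quotCongr (θ : A ≃ₐ[k] A') {r : A} {r' : A'} (h : θ r = r') : Quot1 r ≃ₐ[k] Quot1 r' :=
  AlgEquiv.ofAlgHom (quotMap (θ : A →ₐ[k] A') h)
    (quotMap (θ.symm : A' →ₐ[k] A) (θ.symm_apply_eq.2 h.symm))
    (quotMap_comp _ _ _ _ θ.apply_symm_apply) (quotMap_comp _ _ _ _ θ.symm_apply_apply)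

theorem quotCongr_proj (θ : A ≃ₐ[k] A') {r : A} {r' : A'} (h : θ r = r') (x : A) :
    quotCongr θ h (proj k r x) = proj k r' (θ x) := quotMap_proj _ _ _

/-- The homomorphism of free products induced by homomorphisms of the factors. -/
def freeProdMap (α : A →ₐ[k] A') (β : B →ₐ[k] B') (hf : ∀ s, α (f s) = f' s)
    (hg : ∀ s, β (g s) = g' s) : FreeProd f g →ₐ[k] FreeProd f' g' :=
  FreeProd.lift ((FreeProd.inl f' g').comp α) ((FreeProd.inr f' g').comp β) fun s => by
    rw [AlgHom.comp_apply, AlgHom.comp_apply, hf, hg]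
    exact FreeProd.inl_base f' g' s

theorem freeProd_hom_ext {φ ψ : FreeProd f g →ₐ[k] C}
    (hl : ∀ a, φ (FreeProd.inl f g a) = ψ (FreeProd.inl f g a))
    (hr : ∀ b, φ (FreeProd.inr f g b) = ψ (FreeProd.inr f g b)) : φ = ψ := by
  have h := FreeProd.eq_top (S := AlgHom.equalizer φ ψ) hl hr
  refine AlgHom.ext fun x => ?_
  have hx : x ∈ AlgHom.equalizer φ ψ := h ▸ Algebra.mem_top
  exact hx

theorem freeProdMap_comp (α : A →ₐ[k] A') (β : B →ₐ[k] B') (hf : ∀ s, α (f s) = f' s)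
    (hg : ∀ s, β (g s) = g' s) (α' : A' →ₐ[k] A) (β' : B' →ₐ[k] B) (hf' : ∀ s, α' (f' s) = f s)
    (hg' : ∀ s, β' (g' s) = g s) (hα : ∀ a, α' (α a) = a) (hβ : ∀ b, β' (β b) = b) :
    (freeProdMap α' β' hf' hg').comp (freeProdMap α β hf hg) = AlgHom.id k _ :=
  freeProd_hom_ext
    (fun a => (congrArg _ (FreeProd.lift_inl _ _ _ a)).trans
      ((FreeProd.lift_inl _ _ _ _).trans (congrArg (FreeProd.inl f g) (hα a))))
    fun b => (congrArg _ (FreeProd.lift_inr _ _ _ b)).trans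
      ((FreeProd.lift_inr _ _ _ _).trans (congrArg (FreeProd.inr f g) (hβ b)))

/-- The isomorphism of free products induced by isomorphisms of the factors. -/
def freeProdCongr (α : A ≃ₐ[k] A') (β : B ≃ₐ[k] B') (hf : ∀ s, α (f s) = f' s)
    (hg : ∀ s, β (g s) = g' s) : FreeProd f g ≃ₐ[k] FreeProd f' g' :=
  AlgEquiv.ofAlgHom (freeProdMap (α : A →ₐ[k] A') (β : B →ₐ[k] B') hf hg)
    (freeProdMap (α.symm : A' →ₐ[k] A) (β.symm : B' →ₐ[k] B)
      (fun s => α.symm_apply_eq.2 (hf s).symm) fun s => β.symm_apply_eq.2 (hg s).symm)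
    (freeProdMap_comp _ _ _ _ _ _ _ _ α.apply_symm_apply β.apply_symm_apply)
    (freeProdMap_comp _ _ _ _ _ _ _ _ α.symm_apply_apply β.symm_apply_apply)

section

variable (α : A ≃ₐ[k] A') (β : B ≃ₐ[k] B') (hf : ∀ s, α (f s) = f' s) (hg : ∀ s, β (g s) = g' s)

theorem freeProdCongr_inl (a : A) :
    freeProdCongr α β hf hg (FreeProd.inl f g a) = FreeProd.inl f' g' (α a) :=
  FreeProd.lift_inl _ _ _ a

theorem freeProdCongr_inr (b : B) :
    freeProdCongr α β hf hg (FreeProd.inr f g b) = FreeProd.inr f' g' (β b) :=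
  FreeProd.lift_inr _ _ _ b

end

theorem StrongFreeProduct.congr (θ : A ≃ₐ[k] A') (hθ : ∀ s, θ (f s) = f' s) {r : A} {r' : A'}
    (hr : θ r = r') {p : Polynomial (V → k)} {σ' : Quot1 r' →ₗ[k] A'}
    (h : StrongFreeProduct f' r' σ' p) :
    StrongFreeProduct f r (θ.symm.toLinearMap ∘ₗ σ' ∘ₗ (quotCongr θ hr).toLinearMap) p := by
  obtain ⟨⟨h1, h2, h3, h4⟩, τ, h5, h6, Ω, h7⟩ := h
  have hs : ∀ s, θ.symm (f' s) = f s := fun s => θ.symm_apply_eq.2 (hθ s).symm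
  have hb : ∀ s, quotCongr θ hr (((proj k r).comp f) s) = ((proj k r').comp f') s := fun s =>
    (quotCongr_proj θ hr _).trans (congrArg (proj k r') (hθ s))
  let Φ := freeProdCongr (f' := (proj k r').comp f') (g := LocPoly.base k p)
    (g' := LocPoly.base k p) (quotCongr θ hr)
    (AlgEquiv.refl : LocPoly p ≃ₐ[k] LocPoly p) hb fun s => rfl
  refine ⟨⟨fun x => ?_, ?_, fun s x => ?_, fun s x => ?_⟩, (θ.symm : A' →ₐ[k] A).comp τ,
    fun s => (congrArg θ.symm (h5 s)).trans (hs s),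
    (congrArg θ.symm h6).trans (θ.symm_apply_eq.2 hr.symm),
    Φ.toLinearEquiv.trans (Ω.trans θ.symm.toLinearEquiv), fun a₀ l hl => ?_⟩
  · apply (quotCongr θ hr).injective
    rw [quotCongr_proj]
    exact (congrArg (proj k r') (θ.apply_symm_apply _)).trans (h1 _)
  · change θ.symm (σ' (quotCongr θ hr 1)) = 1
    rw [map_one, h2, map_one]
  · change θ.symm (σ' (quotCongr θ hr _)) = _ * θ.symm (σ' (quotCongr θ hr _))
    rw [map_mul, quotCongr_proj, hθ, h3, map_mul, hs]
  · change θ.symm (σ' (quotCongr θ hr _)) = θ.symm (σ' (quotCongr θ hr _)) * _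
    rw [map_mul, quotCongr_proj, hθ, h4, map_mul, hs]
  · change θ.symm (Ω (Φ _)) = θ.symm (σ' (quotCongr θ hr _)) * _
    have h8 := h7 (quotCongr θ hr a₀) (l.map fun x => (x.1, quotCongr θ hr x.2)) fun x hx => by
      obtain ⟨y, hy, rfl⟩ := List.mem_map.1 hx
      exact hl y hy
    have h9 : Φ (FreeProd.inl _ _ a₀ *
        (l.map fun x => FreeProd.inr _ _ x.1 * FreeProd.inl _ _ x.2).prod) =
        FreeProd.inl _ _ (quotCongr θ hr a₀) * ((l.map fun x => (x.1, quotCongr θ hr x.2)).map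
          fun x => FreeProd.inr _ _ x.1 * FreeProd.inl _ _ x.2).prod := by
      rw [map_mul, map_list_prod, List.map_map, List.map_map]
      congr 2
      · exact freeProdCongr_inl _ _ _ _ a₀
      · refine List.map_congr_left fun x _ => ?_
        rw [Function.comp_apply, map_mul]
        exact congrArg₂ _ (freeProdCongr_inr _ _ _ _ x.1) (freeProdCongr_inl _ _ _ _ x.2)
    rw [h9, h8, map_mul, map_list_prod, List.map_map, List.map_map]
    congr 2
    refine List.map_congr_left fun x _ => ?_
    exact map_mul θ.symm _ _

theorem isCompl_comap (α : A ≃ₐ[k] A') (hf : ∀ s, α (f s) = f' s) {M : Submodule k A'}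
    (hM : IsCompl (LinearMap.range f'.toLinearMap) M) :
    IsCompl (LinearMap.range f.toLinearMap) (M.comap α.toLinearMap) := by
  have h : LinearMap.range f.toLinearMap =
      (LinearMap.range f'.toLinearMap).comap α.toLinearMap := by
    ext x
    constructor
    · rintro ⟨s, rfl⟩
      exact ⟨s, (hf s).symm⟩
    · rintro ⟨s, hs⟩
      exact ⟨s, α.injective ((hf s).trans hs)⟩
  rw [h]
  exact (Submodule.orderIsoMapComap α.toLinearEquiv).symm.isCompl hM

theorem LinearlyFreeProduct.congr (α : A ≃ₐ[k] A') (β : B ≃ₐ[k] B') (γ : C ≃ₐ[k] C')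
    (hf : ∀ s, α (f s) = f' s) (hg : ∀ s, β (g s) = g' s) (hι : ∀ s, γ (ι s) = ι' s)
    (h : LinearlyFreeProduct f' g' ι') : LinearlyFreeProduct f g ι := by
  obtain ⟨M, N, Ψ, h1, h2, h3, h4, h5, h6, h7⟩ := h
  let Φ := freeProdCongr α β hf hg
  have hs : ∀ s, γ.symm (ι' s) = ι s := fun s => γ.symm_apply_eq.2 (hι s).symm
  refine ⟨M.comap α.toLinearMap, N.comap β.toLinearMap,
    Φ.toLinearEquiv.trans (Ψ.trans γ.symm.toLinearEquiv), isCompl_comap α hf h1, fun s m hm => ?_,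
    isCompl_comap β hg h3, fun s m hm => ?_, ?_, fun s x => ?_, fun l hM hN hc => ?_⟩
  · have := h2 s _ hm
    exact ⟨by simpa [hf] using this.1, by simpa [hf] using this.2⟩
  · have := h4 s _ hm
    exact ⟨by simpa [hg] using this.1, by simpa [hg] using this.2⟩
  · change γ.symm (Ψ (Φ 1)) = 1
    rw [map_one, h5, map_one]
  · have h8 : Φ (FreeProd.inl f g (f s)) = FreeProd.inl f' g' (f' s) :=
      (freeProdCongr_inl α β hf hg _).trans (congrArg _ (hf s))
    change γ.symm (Ψ (Φ _)) = _ * γ.symm (Ψ (Φ _)) ∧ γ.symm (Ψ (Φ _)) = γ.symm (Ψ (Φ _)) * _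
    rw [map_mul Φ, map_mul Φ, h8, (h6 s _).1, (h6 s _).2, map_mul, map_mul, hs]
    exact ⟨rfl, rfl⟩
  · change γ.symm (Ψ (Φ _)) = (l.map (Sum.elim (fun a => γ.symm (Ψ (Φ _)))
      fun b => γ.symm (Ψ (Φ _)))).prod
    have h8 := h7 (l.map (Sum.map α β))
      (fun a ha => by
        obtain ⟨x | x, hx, h⟩ := List.mem_map.1 ha
        · obtain rfl : α x = a := Sum.inl_injective h
          exact hM x hx
        · cases h)
      (fun b hb => by
        obtain ⟨x | x, hx, h⟩ := List.mem_map.1 hb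
        · cases h
        · obtain rfl : β x = b := Sum.inr_injective h
          exact hN x hx)
      (by
        rw [List.isChain_map]
        exact hc.imp fun x y h => by simpa using h)
    have hl : ∀ a, Φ (FreeProd.inl f g a) = FreeProd.inl f' g' (α a) := freeProdCongr_inl α β hf hg
    have hr : ∀ b, Φ (FreeProd.inr f g b) = FreeProd.inr f' g' (β b) := freeProdCongr_inr α β hf hg
    have h9 : Φ (l.map (Sum.elim (FreeProd.inl f g) (FreeProd.inr f g))).prod =
        ((l.map (Sum.map α β)).map (Sum.elim (FreeProd.inl f' g') (FreeProd.inr f' g'))).prod := by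
      rw [map_list_prod, List.map_map, List.map_map]
      congr 1
      refine List.map_congr_left ?_
      rintro (x | x) _
      · exact hl x
      · exact hr x
    rw [h9, h8, map_list_prod, List.map_map, List.map_map]
    congr 1
    refine List.map_congr_left ?_
    rintro (x | x) _
    · exact congrArg (fun y => γ.symm (Ψ y)) (hl x).symm
    · exact congrArg (fun y => γ.symm (Ψ y)) (hr x).symm

end Transport

/-! ### Freeness over the ring of functions on the vertices -/

section Free

variable {k V A J : Type*} [Field k] [Fintype V] [Ring A] [Algebra k A]

/-- The algebra is free if its parts at all vertices have the same dimension. -/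
theorem free_of_basis (f : (V → k) →ₐ[k] A) (b : Basis (V × J) k A)
    (h : ∀ i j, vertexIdem f i * b (i, j) = b (i, j)) :
    letI : Module (V → k) A := Module.compHom A f.toRingHom
    Module.Free (V → k) A := by
  classical
  let _ : Module (V → k) A := Module.compHom A f.toRingHom
  have hs : ∀ (s : V → k) i j, f s * b (i, j) = s i • b (i, j) := fun s i j => by
    rw [← h, ← mul_assoc, base_mul_vertexIdem, smul_mul_assoc]
  have hsm : ∀ (s : V → k) (x : A), s • x = f s * x := fun _ _ => rfl
  refine Module.Free.of_basis (ι := J) (Basis.mk (v := fun j => ∑ i, b (i, j)) ?_ ?_)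
  · rw [linearIndependent_iff']
    intro t c hc j hj
    ext i
    have hb := linearIndependent_iff'.1 b.linearIndependent (Finset.univ ×ˢ t) (fun p => c p.2 p.1)
      (by
        rw [Finset.sum_product_right, ← hc]
        refine Finset.sum_congr rfl fun j _ => ?_
        rw [hsm, Finset.mul_sum]
        exact Finset.sum_congr rfl fun i _ => (hs _ _ _).symm)
    exact hb (i, j) (by simpa using hj)
  · rintro x -
    have hx := b.mem_span x
    induction hx using Submodule.span_induction with
    | mem x hx =>
      obtain ⟨⟨i, j⟩, rfl⟩ := hx
      have h1 : b (i, j) = (Pi.single i 1 : V → k) • ∑ i, b (i, j) := by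
        rw [hsm, Finset.mul_sum, Finset.sum_eq_single i]
        · rw [hs, Pi.single_eq_same, one_smul]
        · intro i' _ hi'
          rw [hs, Pi.single_eq_of_ne hi', zero_smul]
        · simp
      rw [h1]
      exact Submodule.smul_mem _ _ (Submodule.subset_span ⟨j, rfl⟩)
    | zero => exact Submodule.zero_mem _
    | add x y _ _ hx hy => exact Submodule.add_mem _ hx hy
    | smul c x _ hx =>
      have h1 : c • x = (algebraMap k (V → k) c) • x := by
        rw [hsm, AlgHom.commutes, Algebra.smul_def]
      rw [h1]
      exact Submodule.smul_mem _ _ hx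

theorem LeftFree.congr {E E' : Type*} {Q : ArrowQuiver V E} {Q' : ArrowQuiver V E'}
    (θ : LAlg k Q ≃ₐ[k] LAlg k Q') (hθ : ∀ s, θ (vertexMap k Q s) = vertexMap k Q' s)
    (h : LeftFree k Q') : LeftFree k Q := by
  let _ : Module (V → k) (LAlg k Q) := Module.compHom _ (vertexMap k Q).toRingHom
  let _ : Module (V → k) (LAlg k Q') := Module.compHom _ (vertexMap k Q').toRingHom
  have : Module.Free (V → k) (LAlg k Q') := h
  let θ' : LAlg k Q ≃ₗ[V → k] LAlg k Q' := { θ.toAddEquiv with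
    map_smul' := fun s x => (map_mul θ _ _).trans (congrArg (· * θ x) (hθ s)) }
  exact Module.Free.of_equiv θ'.symm

end Free

section Free

variable {k : Type*} [Field k] {V E : Type*} [Fintype V] {Q : ArrowQuiver V E}
  [Finite E] {n : ℕ} [NeZero n] {z : Q.Cycle n}

instance : Countable (Letter E) :=
  Function.Injective.countable (f := fun x : Letter E => show DArrow E × Option Bool from match x with
    | .arr a => (a, none)
    | .bar a s => (a, some s)) <| by
  rintro (a | ⟨a, s⟩) (a' | ⟨a', s'⟩) h <;> simp_all

instance : Countable (Block z) := by
  have : Finite (ZMod n) := Finite.of_equiv _ (ZMod.finEquiv n).toEquiv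
  refine Function.Injective.countable (f := fun x : Block z =>
    show (ZMod n × ℤ × ℤ) ⊕ List (Letter (z.arrowsᶜ : Set E)) ⊕ (V × ℤ) from match x with
    | .cyc i m l => Sum.inl (i, m, l)
    | .par w => Sum.inr (Sum.inl w)
    | .pow i m => Sum.inr (Sum.inr (i, m))) ?_
  rintro (⟨i, m, l⟩ | w | ⟨i, m⟩) (⟨i', m', l'⟩ | w' | ⟨i', m'⟩) h <;> simp_all

/-- At every vertex there is a countable infinity of words, so the parts of the algebra at the
vertices have the same dimension. -/
theorem leftFree_of_adapted [LinearOrder (DArrow E)] (q : V → kˣ) {F : Set (z.arrowsᶜ : Set E)}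
    (hF : (Q.restrict z.arrowsᶜ).IsRootedForest z.verts F) (ho : z.Oriented) (ha : z.Adapted) :
    LeftFree k Q := by
  obtain ⟨b, hb⟩ := exists_basis_lAlg q false hF ho ha
  have hd : ∀ i : V, Nonempty ({p : {p // (blockPath z F Set.univ).IsPath p} // p.1.1 = i} ≃ ℕ) := by
    intro i
    have : Infinite {p : {p // (blockPath z F Set.univ).IsPath p} // p.1.1 = i} :=
      Infinite.of_injective (fun m : ℕ => ⟨⟨(i, [.pow i (m + 1 : ℤ)]), isPath_cons.2
        ⟨⟨by change (m + 1 : ℤ) ≠ 0; omega, trivial⟩, rfl, by simp, by simp, List.isChain_nil⟩⟩,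
          rfl⟩) fun m m' h => by
        have h2 := congrArg (fun p => p.1.1.2) h
        simp only [List.cons.injEq, Block.pow.injEq, and_true] at h2
        omega
    exact ⟨(nonempty_denumerable _).some.eqv⟩
  let w := fun i => (hd i).some
  let eqv : {p // (blockPath z F Set.univ).IsPath p} ≃ V × ℕ :=
    (Equiv.sigmaFiberEquiv fun p : {p // (blockPath z F Set.univ).IsPath p} => p.1.1).symm.trans
      ((Equiv.sigmaCongrRight w).trans (Equiv.sigmaEquivProd V ℕ))
  refine free_of_basis (vertexMap k Q) (b.reindex eqv) fun i j => ?_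
  rw [Basis.reindex_apply, hb, vertexIdem_vertexMap]
  have : (eqv.symm (i, j)).1.1 = i := ((w i).symm j).2
  rw [wordVal, this, ← mul_assoc, e_mul_self]

end Free

/-! ### Orientations and orders adapted to the cycle -/

section Choice

variable {V E : Type*} {Q : ArrowQuiver V E} {n : ℕ}

/-- A distance function to `v`: every other vertex has a neighbour of smaller distance. -/
theorem exists_parent (hQ : Q.Connected) (v : V) : ∃ d : V → ℕ, ∀ i ≠ v, ∃ a j,
    d j < d i ∧ (Q.tail a = i ∧ Q.head a = j ∨ Q.tail a = j ∧ Q.head a = i) := by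
  set G := SimpleGraph.fromRel fun i j => ∃ a, Q.tail a = i ∧ Q.head a = j with hG
  refine ⟨fun i => G.dist i v, fun i hi => ?_⟩
  obtain ⟨p, hp⟩ := ((show G.Connected from hQ).preconnected i v).exists_walk_length_eq_dist
  cases p with
  | nil => exact absurd rfl hi
  | @cons _ j _ h p =>
    have hd : G.dist j v < G.dist i v := by
      rw [← hp, SimpleGraph.Walk.length_cons]
      exact Nat.lt_succ_of_le (SimpleGraph.dist_le p)
    obtain ⟨-, ⟨a, h1, h2⟩ | ⟨a, h1, h2⟩⟩ := (SimpleGraph.fromRel_adj _ _ _).1 h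
    · exact ⟨a, j, hd, Or.inl ⟨h1, h2⟩⟩
    · exact ⟨a, j, hd, Or.inr ⟨h1, h2⟩⟩

/-- The arrows of the cycle are oriented along it, and an arrow from each other vertex to a
neighbour nearer to the cycle is oriented towards it. -/
theorem exists_orientation (hQ : Q.Connected) (z : Q.Cycle n) :
    ∃ (X : Set E) (Q' : ArrowQuiver V E) (z' : Q'.Cycle n) (F : Set (z'.arrowsᶜ : Set E)),
      IsFlip X Q Q' ∧ z'.v = z.v ∧ z'.c = z.c ∧ z'.Oriented ∧
        (Q'.restrict z'.arrowsᶜ).IsRootedForest z'.verts F := by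
  classical
  obtain ⟨d, hd⟩ := exists_parent hQ (z.v 0)
  have hW : ∀ i, i ∉ z.verts → i ≠ z.v 0 := fun i hi h => hi ⟨0, h.symm⟩
  have : Nonempty E := ⟨z.c 0⟩
  have : Nonempty V := ⟨z.v 0⟩
  choose! a nb hlt hjoin using fun i (hi : i ∉ z.verts) => hd i (hW i hi)
  have hoff : ∀ i ∉ z.verts, ∀ m, a i ≠ z.c m := by
    rintro i hi m h
    rcases hjoin i hi with h1 | h1 <;> rcases z.joins m with h2 | h2 <;> rw [h] at h1 <;>
      first | exact hi ⟨_, h2.1.symm.trans h1.1⟩ | exact hi ⟨_, h2.2.symm.trans h1.2⟩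
  have hinj : ∀ i ∉ z.verts, ∀ j ∉ z.verts, a i = a j → i = j := by
    intro i hi j hj h
    by_contra hne
    have h1 := hlt i hi
    have h2 := hlt j hj
    have h3 : nb i = j ∧ nb j = i := by
      rcases hjoin i hi with h1 | h1 <;> rcases hjoin j hj with h2 | h2 <;> rw [h] at h1
      · exact absurd (h1.1.symm.trans h2.1) hne
      · exact ⟨h1.2.symm.trans h2.2, h2.1.symm.trans h1.1⟩
      · exact ⟨h1.1.symm.trans h2.1, h2.2.symm.trans h1.2⟩
      · exact absurd (h1.2.symm.trans h2.2) hne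
    rw [h3.1] at h1
    rw [h3.2] at h2
    omega
  let X : Set E := {b | (∃ m, b = z.c m ∧ ¬(Q.tail b = z.v m ∧ Q.head b = z.v (m + 1))) ∨
    ∃ i ∉ z.verts, b = a i ∧ Q.tail b ≠ i}
  let Q' : ArrowQuiver V E := ⟨fun b => if b ∈ X then Q.head b else Q.tail b,
    fun b => if b ∈ X then Q.tail b else Q.head b⟩
  have hf : IsFlip X Q Q' := fun b =>
    ⟨fun hb => ⟨if_pos hb, if_pos hb⟩, fun hb => ⟨if_neg hb, if_neg hb⟩⟩
  have hc : ∀ m, Q'.tail (z.c m) = z.v m ∧ Q'.head (z.c m) = z.v (m + 1) := by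
    intro m
    by_cases hm : z.c m ∈ X
    · rw [((hf _).1 hm).1, ((hf _).1 hm).2]
      obtain ⟨m', hm', h⟩ | ⟨i, hi, h, -⟩ := hm
      · obtain rfl := z.c_injective hm'
        exact ((z.joins m).resolve_left h).symm
      · exact absurd h.symm (hoff i hi m)
    · rw [((hf _).2 hm).1, ((hf _).2 hm).2]
      by_contra h
      exact hm (Or.inl ⟨m, rfl, h⟩)
  have ha : ∀ i ∉ z.verts, Q'.tail (a i) = i ∧ Q'.head (a i) = nb i := by
    intro i hi
    by_cases hm : a i ∈ X
    · rw [((hf _).1 hm).1, ((hf _).1 hm).2]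
      obtain ⟨m, h, -⟩ | ⟨j, hj, h, ht⟩ := hm
      · exact absurd h (hoff i hi m)
      · obtain rfl := hinj i hi j hj h
        exact ((hjoin i hi).resolve_left fun h => ht h.1).symm
    · rw [((hf _).2 hm).1, ((hf _).2 hm).2]
      have ht : Q.tail (a i) = i := by
        by_contra h
        exact hm (Or.inr ⟨i, hi, rfl, h⟩)
      refine (hjoin i hi).resolve_right fun h => ?_
      have := hlt i hi
      rw [← h.1, ht] at this
      exact lt_irrefl _ this
  refine ⟨X, Q', ⟨z.v, z.c, z.v_injective, z.c_injective, fun i => Or.inl (hc i)⟩,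
    {b | ∃ i ∉ z.verts, b.1 = a i}, hf, rfl, rfl, hc, ?_, ?_, ?_⟩
  · rintro b ⟨i, hi, hb⟩ hW
    apply hi
    change Q'.tail b.1 ∈ z.verts at hW
    rwa [hb, (ha i hi).1] at hW
  · intro i hi
    refine ⟨⟨a i, ?_⟩, ⟨⟨i, hi, rfl⟩, (ha i hi).1⟩, ?_⟩
    · rintro ⟨m, hm⟩
      exact hoff i hi m hm.symm
    · rintro b ⟨⟨j, hj, hb⟩, ht⟩
      change Q'.tail b.1 = i at ht
      rw [hb, (ha j hj).1] at ht
      subst ht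
      exact Subtype.ext hb
  · intro i
    induction hn : d i using Nat.strong_induction_on generalizing i with
    | _ n ih =>
    by_cases hi : i ∈ z.verts
    · exact ⟨i, hi, Relation.ReflTransGen.refl⟩
    · obtain ⟨w, hw, h⟩ := ih (d (nb i)) (hn ▸ hlt i hi) (nb i) rfl
      refine ⟨w, hw, Relation.ReflTransGen.head ⟨⟨a i, ?_⟩, ⟨i, hi, rfl⟩, (ha i hi).1,
        (ha i hi).2⟩ h⟩
      rintro ⟨m, hm⟩
      exact hoff i hi m hm.symm

theorem exists_adapted [LinearOrder (DArrow E)] (z : Q.Cycle n) :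
    ∃ o : LinearOrder (DArrow E), letI := o; z.Adapted := by
  classical
  let cls : DArrow E → ℕ := fun a => if a.arrow ∈ z.arrows then (if a.pos then 0 else 1) else 2
  refine ⟨LinearOrder.lift' (fun a => toLex (cls a, a)) fun a b h => congrArg (fun p => (ofLex p).2) h,
    fun i j => ?_, fun a b ha hb => ?_⟩
  · refine Prod.Lex.toLex_lt_toLex.2 (Or.inl ?_)
    have h : ∀ i, z.c i ∈ z.arrows := fun i => ⟨i, rfl⟩
    simp [cls, h]
  · refine Prod.Lex.toLex_lt_toLex.2 (Or.inl ?_)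
    simp only [cls, if_pos ha, if_neg hb]
    split_ifs <;> omega

end Choice

/-! ### The general case -/

section Transport

variable {k : Type*} [Field k] {V E : Type*} [Fintype V] [Finite E] {Q Q' : ArrowQuiver V E}
  {X : Set E} (h : IsFlip X Q Q') (o o' : LinearOrder (DArrow E)) (q : V → kˣ)
include h

/-- An isomorphism over the ring of functions on the vertices which respects `r`. -/
theorem exists_relIso : ∃ θ : LAlg k Q ≃ₐ[k] LAlg k Q',
    (∀ s, θ (vertexMap k Q s) = vertexMap k Q' s) ∧
      θ (letI := o; rel Q q) = (letI := o'; rel Q' q) := by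
  obtain ⟨θ, h1, h2⟩ := rhoEquiv_of_isFlip (k := k) h
    (letI := o; sorted_nodup) (letI := o'; sorted_nodup) (letI := o; mem_sorted)
    (letI := o'; mem_sorted)
  have h3 : ∀ s, θ (vertexMap k Q s) = vertexMap k Q' s := fun s => by
    rw [vertexMap_apply, vertexMap_apply, map_sum]
    exact Finset.sum_congr rfl fun i _ => by rw [map_smul, h1]
  exact ⟨θ, h3, (map_sub θ _ _).trans (congrArg₂ _ h2 (h3 _))⟩

theorem strongFreeProduct_of_isFlip
    (hs : letI := o'; ∃ σ, StrongFreeProduct (vertexMap k Q') (rel Q' q) σ (locPt q)) :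
    letI := o; ∃ σ, StrongFreeProduct (vertexMap k Q) (rel Q q) σ (locPt q) := by
  obtain ⟨σ, hσ⟩ := hs
  obtain ⟨θ, h1, h2⟩ := exists_relIso h o o' q
  exact ⟨_, hσ.congr θ h1 h2⟩

omit [Finite E] in
theorem IsFlip.restrict (A : Set E) :
    IsFlip (Subtype.val ⁻¹' X) (Q.restrict A) (Q'.restrict A) := fun a => h a.1

theorem exists_pLamIso (A : Set E) (W : Set V) :
    ∃ θ : (letI := o; PLam (Q.restrict A) q W) ≃ₐ[k] (letI := o'; PLam (Q'.restrict A) q W),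
      ∀ s, θ (letI := o; PLam.base (Q.restrict A) q W s) =
        (letI := o'; PLam.base (Q'.restrict A) q W s) := by
  obtain ⟨θ, h1, h2⟩ := exists_relIso (h.restrict A) (letI := o; inferInstance)
    (letI := o'; inferInstance) q
  refine ⟨quotCongr θ ?_, fun s => (quotCongr_proj θ _ _).trans (congrArg _ (h1 s))⟩
  rw [relBlack, map_mul, map_mul, h1, h2, relBlack]

theorem linearlyFreeProduct_of_isFlip (A A' : Set E) (W W' : Set V)
    (hs : letI := o'; LinearlyFreeProduct (PLam.base (Q'.restrict A) q W)
      (PLam.base (Q'.restrict A') q W') (Lam.base Q' q)) :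
    letI := o; LinearlyFreeProduct (PLam.base (Q.restrict A) q W)
      (PLam.base (Q.restrict A') q W') (Lam.base Q q) := by
  obtain ⟨α, hα⟩ := exists_pLamIso h o o' q A W
  obtain ⟨β, hβ⟩ := exists_pLamIso h o o' q A' W'
  obtain ⟨θ, h1, h2⟩ := exists_relIso h o o' q
  exact hs.congr α β (quotCongr θ h2) hα hβ fun s =>
    (quotCongr_proj θ _ _).trans (congrArg _ (h1 s))

end Transport

/-- The assertions which do not refer to an adapted order, for all orders and orientations. -/
theorem freeProducts_of_connected {k : Type*} [Field k] {V E : Type*} [Fintype V] [Finite E]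
    [o : LinearOrder (DArrow E)] {Q : ArrowQuiver V E} (q : V → kˣ) (hQ : Q.Connected)
    {n : ℕ} [NeZero n] (z : Q.Cycle n) :
    (∃ σ : Lam Q q →ₗ[k] LAlg k Q, StrongFreeProduct (vertexMap k Q) (rel Q q) σ (locPt q)) ∧
      LinearlyFreeProduct (CycLam.base q z) (ComplLam.base q z) (Lam.base Q q) ∧ LeftFree k Q := by
  obtain ⟨X, Q', z', F, hf, hv, hc, ho, hF⟩ := exists_orientation hQ z
  have hA : z'.arrows = z.arrows := congrArg Set.range hc
  have hW : z'.verts = z.verts := congrArg Set.range hv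
  have hL : ∀ A W, z'.arrows = A → z'.verts = W → LinearlyFreeProduct
      (PLam.base (Q.restrict A) q Wᶜ) (PLam.base (Q.restrict Aᶜ) q W) (Lam.base Q q) := by
    rintro A W rfl rfl
    obtain ⟨o', ha⟩ := exists_adapted z'
    exact linearlyFreeProduct_of_isFlip hf o o' q _ _ _ _
      (linearlyFreeProduct_of_adapted q hF ho ha)
  refine ⟨?_, hL _ _ hA hW, ?_⟩
  · obtain ⟨o', ha⟩ := exists_adapted z'
    obtain ⟨σ, hσ, -⟩ := exists_section_words q false hF ho ha
    exact strongFreeProduct_of_isFlip hf o o' q ⟨σ, hσ⟩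
  · obtain ⟨o', ha⟩ := exists_adapted z'
    obtain ⟨θ, hθ, -⟩ := exists_relIso (k := k) hf o o' q
    exact (leftFree_of_adapted q hF ho ha).congr θ hθ

end MPA

end

open MPA in
theorem theorem3p2 {k : Type*} [Field k] {V E : Type*} [Fintype V] [Finite E]
    [LinearOrder (DArrow E)] (Q : ArrowQuiver V E) (q : V → kˣ) (hQ : Q.Connected)
    {n : ℕ} [NeZero n] (z : Q.Cycle n) :
    (∃ σ : Lam Q q →ₗ[k] LAlg k Q,
      StrongFreeProduct (vertexMap k Q) (rel Q q) σ (locPt q)) ∧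
    LinearlyFreeProduct (CycLam.base q z) (ComplLam.base q z) (Lam.base Q q) ∧
    LeftFree k Q ∧
    ∀ F : Set (z.arrowsᶜ : Set E), z.Oriented → z.Adapted →
      (Q.restrict z.arrowsᶜ).IsRootedForest z.verts F → ∀ bar : Bool,
      (∃ b : Module.Basis (V ⊕ {p : ZMod n × ℤ × ℤ // p.2.1 ≠ 0 ∨ p.2.2 ≠ 0}) k (CycLam q z),
        (∀ i, b (Sum.inl i) = proj k _ (e k (Q.restrict z.arrows) i)) ∧
        ∀ p, b (Sum.inr p) = proj k _
          (cycElt k (Q.restrict z.arrows) bar z.v z.arrow p.1.1 p.1.2.1 p.1.2.2)) ∧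
      (∃ b : Module.Basis (V ⊕ {w // IsForestWord (Q.restrict z.arrowsᶜ) F w}) k (ComplLam q z),
        (∀ i, b (Sum.inl i) = proj k _ (e k (Q.restrict z.arrowsᶜ) i)) ∧
        ∀ w, b (Sum.inr w) = proj k _
          ((w.1.map fun x => x.val (Q.restrict z.arrowsᶜ)).prod : LAlg k _)) ∧
      (∃ b : Module.Basis (AltWord z F) k (LAlg k Q), ∀ p, b p = wordVal q bar p.1) ∧
      (∃ b : Module.Basis (AltWord₀ z F) k (Lam Q q),
        ∀ p, b p = proj k _ (wordVal q bar p.1)) ∧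
      (∃ σ : Lam Q q →ₗ[k] LAlg k Q,
        StrongFreeProduct (vertexMap k Q) (rel Q q) σ (locPt q) ∧
        ∀ p : AltWord₀ z F, σ (proj k _ (wordVal q bar p.1)) = wordVal q bar p.1) ∧
      ∃ Ψ : FreeProd (CycLam.base q z) (ComplLam.base q z) ≃ₗ[k] Lam Q q,
        (∀ s x, Ψ (FreeProd.inl _ _ (CycLam.base q z s) * x) = Lam.base Q q s * Ψ x ∧
          Ψ (x * FreeProd.inl _ _ (CycLam.base q z s)) = Ψ x * Lam.base Q q s) ∧
        ∀ p : AltWord₀ z F, Ψ (wordFreeVal q bar p.1) = proj k _ (wordVal q bar p.1) := by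
  obtain ⟨h1, h2, h3⟩ := freeProducts_of_connected q hQ z
  refine ⟨h1, h2, h3, fun F ho ha hF bar => ⟨exists_basis_cycLam ho ha bar,
    exists_basis_complLam hF, ?_, ?_, exists_section_words q bar hF ho ha,
    exists_freeEquiv_words q bar hF ho ha⟩⟩
  · obtain ⟨b, hb⟩ := exists_basis_lAlg q bar hF ho ha
    exact ⟨b.reindex (Equiv.subtypeEquivRight fun p => (isAltWord_iff F p).symm), fun p => by
      rw [Module.Basis.reindex_apply, hb]
      rfl⟩
  · obtain ⟨b, hb⟩ := exists_basis_lam q bar hF ho ha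
    exact ⟨b.reindex (Equiv.subtypeEquivRight fun p => (isAltWord₀_iff F p).symm), fun p => by
      rw [Module.Basis.reindex_apply, hb]
      rfl⟩
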